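/- Let $n\ge 1$, $x,y>0$, $\alpha\in\mathbb R\setminus\{0,\pm1\}$, $I=\mathrm{diag}(\mathbf 1_n,-\mathbf 1_n)$, $G=SL(2n,\mathbb C)$, $K=SU(n,n)=\{g\in G: g^\dagger I g=I\}$, $K_+=K\cap SU(2n)=S(U(n)\times U(n))$, $B\subset G$ the upper triangular matrices with positive diagonal, $\langle X,Y\rangle=\mathrm{Im}\,\mathrm{tr}\,XY$. $G$ carries the Heisenberg double bracket $\{F,H\}=\langle D^lF,R(D^lH)\rangle+\langle D^rF,R(D^rH)\rangle$, where $R=P_{\mathfrak k}-P_{\mathfrak b}$ for $\mathfrak{sl}(2n,\mathbb C)=\mathfrak k+\mathfrak b$ and $D^{l},D^{r}$ are the left and right derivatives. The set of $g=k_Lb_R=b_Lk_R$ ($k_{L,R}\in K$, $b_{L,R}\in B$) carries the two-form $[Symp]=\langle db_Lb_L^{-1}\overset{\wedge},dk_Lk_L^{-1}\rangle+\langle b_R^{-1}db_R\overset{\wedge},k_R^{-1}dk_R\rangle$. Let $$\Phi_\nu(g)=-\tfrac1{2\nu}\,\mathrm{tr}\,(gIg^\dagger I)^\nu,\qquad \nu=1,2,\dots$$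 Let $\sigma$ be upper triangular with positive diagonal, $\det\sigma=1$ and $\sigma\sigma^\dagger=\alpha^2\mathbf 1-\mathrm{sgn}(\log\alpha^2)\,\hat v\hat v^\dagger$ for some $\hat v\in\mathbb C^n$. Let $C$ be the set of $g=k_Lb_R=b_Lk_R$ as above with $$b_R=\begin{pmatrix}x\mathbf 1&\omega\\0&x^{-1}\mathbf 1\end{pmatrix},\qquad b_L=\begin{pmatrix}y^{-1}\sigma&y^{-1}\nu\\0&y\mathbf 1\end{pmatrix}$$ ($\omega,\nu$ arbitrary). Say that $g\in C$ has coordinates $(\Delta,p)\in\mathbb R^n\times\mathbb R^n$ if $k_L=\begin{pmatrix}\rho&0\\0&\tau\end{pmatrix}\begin{pmatrix}\cosh\Delta&\sinh\Delta\\\sinh\Delta&\cosh\Delta\end{pmatrix}\begin{pmatrix}k&0\\0&l\end{pmatrix}$ with $\rho,\tau,k,l\in U(n)$ and $\Delta$ read as a diagonal matrix, and $\tau^\dagger g_{22}l^\dagger=(y^2+x^2\sinh^2\Delta)^{1/2}\,T$ with $T_{ii}=|T_{ii}|e^{ip_i}$ for all $i$ ($g_{22}$ is the lower right block of $g$). Put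 $\Sigma_i=\sinh\Delta_i$, and $\Sigma_i=e^{q_i}$ where $\Sigma_i>0$. Let $D_\alpha=\{q: q_i-q_j>|\log|\alpha||\ \text{for } i<j\}$, and let $\hat D_\alpha$ be the set of $\Sigma\in(\mathbb R\setminus\{0\})^n$ with $|\log|\Sigma_i|-\log|\Sigma_j||>|\log|\alpha||$ for $i\ne j$. The reduced space is the quotient of $\{g\in C: g \text{ has coordinates with } q\in D_\alpha\}$ by the maps $g\mapsto agb$ with $a,b\in K_+$, where the upper left block $a_{11}$ of $a$ satisfies $a_{11}\sigma\sigma^\dagger a_{11}^\dagger=\sigma\sigma^\dagger$. Then: (1) The functions $\Phi_\nu$ are real, invariant under left and right multiplication by $K_+$, and satisfy $\{\Phi_\nu,\Phi_\mu\}=0$ on $G$. (2) $(q,p)$ define a bijection of the reduced space onto $D_\alpha\times(\mathbb R/2\pi\mathbb Z)^n$, and there is a smooth map from $D_\alpha\times\mathbb R^n$ to $C$ which sends each $(q,p)$ to a point with these coordinates. The coordinates are canonical: along smooth curves in $C$ having smooth coordinates $(\Delta,p)$ with $\Sigma\in\hat D_\alpha$, $[Symp]$ equals $2\sum_i dp_i\wedge\Sigma_i^{-1}d\Sigma_i$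 (which is $2\sum_i dp_i\wedge dq_i$). (3) The $\Phi_\nu$ descend to smooth functions on the reduced space, which commute with one another for the Poisson bracket of $2\sum_i dp_i\wedge dq_i$. In the coordinates $(q,p)$, with $q\in D_\alpha$, $$\Phi_1=\tfrac12(x^{-2}+y^2)\sum_i e^{-2q_i}-\sum_i\cos p_i\Bigl[1+\bigl(1+\tfrac{y^2}{x^2}\bigr)e^{-2q_i}+\tfrac{y^2}{x^2}e^{-4q_i}\Bigr]^{1/2}\prod_{k\ne i}\Bigl[1-\tfrac{(\alpha-\alpha^{-1})^2}{4\sinh^2(q_i-q_k)}\Bigr]^{1/2}.$$ More generally, at each $g\in C$ with coordinates $(\Delta,p)$ such that all $\Delta_i\neq0$ and the $|\Delta_i|$ are distinct, $$\Phi_1=\tfrac12(x^{-2}+y^2)\sum_i\Sigma_i^{-2}-x^{-1}\sum_i\cos p_i\sqrt{1+\Sigma_i^{-2}}\sqrt{x^2+y^2\Sigma_i^{-2}}\prod_{k\neq i}\Bigl[\tfrac{(\alpha^{-1}\Sigma_k^2-\alpha\Sigma_i^2)(\alpha\Sigma_k^2-\alpha^{-1}\Sigma_i^2)}{(\Sigma_k^2-\Sigma_i^2)^2}\Bigr]^{1/2}.$$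 (4) The Weyl group of type $BC_n$ acts by sign changes $(\Sigma_i,p_i)\mapsto(-\Sigma_i,p_i)$ and by simultaneous permutations of the pairs $(\Sigma_i,p_i)$. This action is the lift of the same action on $\Delta$; if $g$ has coordinates $(\Delta,p)$ then it also has the transformed coordinates. The action preserves $\hat D_\alpha$, the form $2\sum_i dp_i\wedge\Sigma_i^{-1}d\Sigma_i$, and the function $\Phi_1(\Sigma,p)$ in (3). (5) For $n\ge2$ the Hamiltonian depends on three independent parameters: for two triples $(\alpha,x,y)$ and $(\alpha',x',y')$ of admissible parameters the functions $\Phi_1(q,p)$ in (3) coincide on $(D_\alpha\cap D_{\alpha'})\times\mathbb R^n$ if and only if $\alpha'^2\in\{\alpha^2,\alpha^{-2}\}$ and $(x',y')\in\{(x,y),(y^{-1},x^{-1})\}$. -/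

import Mathlib

open scoped ContDiff Matrix

noncomputable section

namespace HeisenbergDouble

/-! ## The group `SL(2n, ℂ)` and its subgroups -/

/-- Complex `2n × 2n` matrices, written in `n × n` blocks. -/
abbrev BlockMat (n : ℕ) := Matrix (Fin n ⊕ Fin n) (Fin n ⊕ Fin n) ℂ

/-- Complex `n × n` matrices. -/
abbrev Mat (n : ℕ) := Matrix (Fin n) (Fin n) ℂ

/-- Real `n`-vectors. -/
abbrev RVec (n : ℕ) := Fin n → ℝ

/-- The matrix `diag(1, …, 1, -1, …, -1)`. -/
def Inn (n : ℕ) : BlockMat n := Matrix.fromBlocks 1 0 0 (-1)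

/-- `G = SL(2n, ℂ)`. -/
def groupG (n : ℕ) : Set (BlockMat n) := {g | g.det = 1}

/-- `K = SU(n, n)`. -/
def groupK (n : ℕ) : Set (BlockMat n) := {g | g.det = 1 ∧ gᴴ * Inn n * g = Inn n}

/-- `K₊ = S(U(n) × U(n))`, the maximal compact subgroup of `K`. -/
def groupKplus (n : ℕ) : Set (BlockMat n) :=
  {g | ∃ p ∈ Matrix.unitaryGroup (Fin n) ℂ, ∃ q ∈ Matrix.unitaryGroup (Fin n) ℂ,
    g = Matrix.fromBlocks p 0 0 q ∧ g.det = 1}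

/-- `B_n`: upper triangular matrices in `GL(n, ℂ)` with real positive diagonal entries. -/
def groupBn (n : ℕ) : Set (Mat n) :=
  {b | b.BlockTriangular id ∧ ∀ i, 0 < (b i i).re ∧ (b i i).im = 0}

/-! ## The Poisson bracket of the Heisenberg double -/

/-- The invariant inner product `⟨X, Y⟩ = Im tr (X Y)`. -/
def pairing {n : ℕ} (X Y : BlockMat n) : ℝ := (X * Y).trace.im

/-- The Lie algebra of `G`. -/
def lieG (n : ℕ) : Set (BlockMat n) := {X | X.trace = 0}

/-- The Lie algebra `su(n, n)` of `K`. -/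
def lieK (n : ℕ) : Set (BlockMat n) := {X | X.trace = 0 ∧ Xᴴ * Inn n + Inn n * X = 0}

/-- The Lie algebra of the group `B` of upper triangular matrices in `SL(2n, ℂ)` with real
positive diagonal: upper triangular, real diagonal, trace zero. -/
def lieB (n : ℕ) : Set (BlockMat n) :=
  {X | X.trace = 0 ∧ X.BlockTriangular toLex ∧ ∀ i, (X i i).im = 0}

/-- `Y = R X`, where `R = P_K - P_B` comes from the decomposition `Lie G = Lie K + Lie B`. -/
def IsRImage {n : ℕ} (X Y : BlockMat n) : Prop :=
  ∃ κ ∈ lieK n, ∃ β ∈ lieB n, X = κ + β ∧ Y = κ - β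

/-- `D = D^l F (g)`. Only the values of `F` on `G` matter when `g ∈ G`. -/
def IsLeftDerivative {n : ℕ} (F : BlockMat n → ℝ) (g D : BlockMat n) : Prop :=
  D ∈ lieG n ∧ ∀ X ∈ lieG n,
    HasDerivAt (fun t : ℝ => F (NormedSpace.exp (t • X) * g)) (pairing D X) 0

/-- `D = D^r F (g)`. -/
def IsRightDerivative {n : ℕ} (F : BlockMat n → ℝ) (g D : BlockMat n) : Prop :=
  D ∈ lieG n ∧ ∀ X ∈ lieG n,
    HasDerivAt (fun t : ℝ => F (g * NormedSpace.exp (t • X))) (pairing D X) 0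

/-- `{F, H}(g) = c`, for `{F, H} = ⟨D^l F, R (D^l H)⟩ + ⟨D^r F, R (D^r H)⟩`. -/
def HasPoissonBracket {n : ℕ} (F H : BlockMat n → ℝ) (g : BlockMat n) (c : ℝ) : Prop :=
  ∃ Fl Fr Hl Hr RHl RHr : BlockMat n,
    IsLeftDerivative F g Fl ∧ IsRightDerivative F g Fr ∧
    IsLeftDerivative H g Hl ∧ IsRightDerivative H g Hr ∧
    IsRImage Hl RHl ∧ IsRImage Hr RHr ∧ c = pairing Fl RHl + pairing Fr RHr

/-- The complex number `-(1 / 2ν) tr (g I g† I)^ν`. -/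
def PhiC {n : ℕ} (ν : ℕ) (g : BlockMat n) : ℂ :=
  -(1 / (2 * (ν : ℂ))) * ((g * Inn n * gᴴ * Inn n) ^ ν).trace

/-- The Hamiltonian `Φ_ν` as a real function (`PhiC` takes real values). -/
def Phi {n : ℕ} (ν : ℕ) (g : BlockMat n) : ℝ := (PhiC ν g).re

/-! ## The constraint surface -/

/-- The KKS condition on `σ`: `σ ∈ B_n`, `det σ = 1` and
`σ σ† = α² + ε v v†`, with `ε = -sgn (log α²)`. -/
def IsKKS {n : ℕ} (α : ℝ) (v : Fin n → ℂ) (σ : Mat n) : Prop :=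
  σ ∈ groupBn n ∧ σ.det = 1 ∧
    σ * σᴴ = ((α ^ 2 : ℝ) : ℂ) • (1 : Mat n)
      + ((-Real.sign (Real.log (α ^ 2)) : ℝ) : ℂ) • Matrix.vecMulVec v (star v)

/-- The constrained form of `b_R`. -/
def constrainedBR {n : ℕ} (x : ℝ) (om : Mat n) : BlockMat n :=
  Matrix.fromBlocks ((x : ℂ) • 1) om 0 ((x : ℂ)⁻¹ • 1)

/-- The constrained form of `b_L`. -/
def constrainedBL {n : ℕ} (y : ℝ) (σ ν : Mat n) : BlockMat n :=
  Matrix.fromBlocks ((y : ℂ)⁻¹ • σ) ((y : ℂ)⁻¹ • ν) 0 ((y : ℂ) • 1)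

/-- `b_L k_R = k_L b_R` is a point of the leaf `M(1, 1)` satisfying the constraints. -/
structure IsConstrained {n : ℕ} (σ : Mat n) (x y : ℝ) (bL kL bR kR : BlockMat n) : Prop where
  kL_mem : kL ∈ groupK n
  kR_mem : kR ∈ groupK n
  bL_form : ∃ ν : Mat n, bL = constrainedBL y σ ν
  bR_form : ∃ om : Mat n, bR = constrainedBR x om
  eq : bL * kR = kL * bR

/-- The set of all `g` in the leaf `M(1, 1)` which satisfy the constraints. -/
def constraintSurface {n : ℕ} (σ : Mat n) (x y : ℝ) : Set (BlockMat n) :=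
  {g | ∃ bL kL bR kR, IsConstrained σ x y bL kL bR kR ∧ g = kL * bR}

/-! ## Coordinates -/

/-- The matrix with blocks `Γ = cosh Δ` and `Σ = sinh Δ`, for the diagonal matrix `Δ`. -/
def cartan {n : ℕ} (Δ : RVec n) : BlockMat n :=
  Matrix.fromBlocks
    (Matrix.diagonal fun i => (Real.cosh (Δ i) : ℂ)) (Matrix.diagonal fun i => (Real.sinh (Δ i) : ℂ))
    (Matrix.diagonal fun i => (Real.sinh (Δ i) : ℂ)) (Matrix.diagonal fun i => (Real.cosh (Δ i) : ℂ))

/-- `(Δ, p)` are coordinates of `g`: one has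
`g = diag(ρ, τ) (cosh Δ, sinh Δ; sinh Δ, cosh Δ) diag(k, l) b_R`; gauging away `τ`, `k`, `l` turns
the lower right block of `g` into `Ω = τ† g₂₂ l† = Λ T` with
`Λ = (y² + x² sinh² Δ)^(1/2)`, and `exp (i p)` is the diagonal matrix of phases for which
`exp (-i p) T` has nonnegative diagonal. -/
def HasCoordinates {n : ℕ} (x y : ℝ) (g : BlockMat n) (Δ p : RVec n) : Prop :=
  ∃ ρ ∈ Matrix.unitaryGroup (Fin n) ℂ, ∃ τ ∈ Matrix.unitaryGroup (Fin n) ℂ,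
  ∃ k ∈ Matrix.unitaryGroup (Fin n) ℂ, ∃ l ∈ Matrix.unitaryGroup (Fin n) ℂ,
  ∃ om T : Mat n,
    g = Matrix.fromBlocks ρ 0 0 τ * cartan Δ * Matrix.fromBlocks k 0 0 l * constrainedBR x om ∧
    τᴴ * g.toBlocks₂₂ * lᴴ =
      (Matrix.diagonal fun i => (Real.sqrt (y ^ 2 + x ^ 2 * Real.sinh (Δ i) ^ 2) : ℂ)) * T ∧
    ∀ i, T i i = (‖T i i‖ : ℂ) * Complex.exp (Complex.I * (p i : ℂ))

/-- The vector `Δ` with `sinh Δ_i = exp q_i`. -/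
def deltaOf {n : ℕ} (q : RVec n) : RVec n := fun i => Real.arsinh (Real.exp (q i))

/-- The domain of the variables `q`: `q_i - q_j > |log |α||` for `i < j`. It is the region of the
Weyl chamber in which all the factors `1 - (α - α⁻¹)² / (4 sinh² (q_i - q_j))` are positive. -/
def chamber (n : ℕ) (α : ℝ) : Set (RVec n) :=
  {q | ∀ i j, i < j → |Real.log α| < q i - q j}

/-- The union of the images of `chamber` (in the variables `S_i = ± exp q_i`) in all the Weyl
chambers (`Real.log` of a negative number is the logarithm of its absolute value). -/
def allChambers (n : ℕ) (α : ℝ) : Set (RVec n) :=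
  {S | (∀ i, S i ≠ 0) ∧ ∀ i j, i ≠ j → |Real.log α| < |Real.log (S i) - Real.log (S j)|}

/-! ## The reduced space -/

/-- The regular part of the constraint surface. -/
def regularSurface {n : ℕ} (σ : Mat n) (α x y : ℝ) : Set (BlockMat n) :=
  {g | g ∈ constraintSurface σ x y ∧
    ∃ q ∈ chamber n α, ∃ p : RVec n, HasCoordinates x y g (deltaOf q) p}

/-- The isotropy subgroup, in `K₊` acting from the left, of the constraint on `b_L`. -/
def leftGauge {n : ℕ} (σ : Mat n) : Set (BlockMat n) :=
  {a | ∃ p ∈ Matrix.unitaryGroup (Fin n) ℂ, ∃ q ∈ Matrix.unitaryGroup (Fin n) ℂ,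
    a = Matrix.fromBlocks p 0 0 q ∧ a.det = 1 ∧ p * (σ * σᴴ) * pᴴ = σ * σᴴ}

lemma one_mem_leftGauge {n : ℕ} (σ : Mat n) : (1 : BlockMat n) ∈ leftGauge σ :=
  ⟨1, one_mem _, 1, one_mem _, by simp, by simp, by simp⟩

lemma mul_mem_leftGauge {n : ℕ} {σ : Mat n} {a b : BlockMat n} (ha : a ∈ leftGauge σ)
    (hb : b ∈ leftGauge σ) : a * b ∈ leftGauge σ := by
  obtain ⟨p, hp, q, hq, rfl, hd, hs⟩ := ha
  obtain ⟨p', hp', q', hq', rfl, hd', hs'⟩ := hb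
  refine ⟨p * p', mul_mem hp hp', q * q', mul_mem hq hq', by simp [Matrix.fromBlocks_multiply],
    by rw [Matrix.det_mul, hd, hd', one_mul], ?_⟩
  rw [Matrix.conjTranspose_mul]
  calc p * p' * (σ * σᴴ) * (p'ᴴ * pᴴ) = p * (p' * (σ * σᴴ) * p'ᴴ) * pᴴ := by
        simp only [Matrix.mul_assoc]
    _ = σ * σᴴ := by rw [hs', hs]

lemma exists_inv_leftGauge {n : ℕ} {σ : Mat n} {a : BlockMat n} (ha : a ∈ leftGauge σ) :
    ∃ b ∈ leftGauge σ, b * a = 1 ∧ a * b = 1 := by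
  obtain ⟨p, hp, q, hq, rfl, hd, hs⟩ := ha
  have hp1 : pᴴ * p = 1 := Matrix.mem_unitaryGroup_iff'.1 hp
  have hq1 : qᴴ * q = 1 := Matrix.mem_unitaryGroup_iff'.1 hq
  have hp2 : p * pᴴ = 1 := Matrix.mem_unitaryGroup_iff.1 hp
  have hq2 : q * qᴴ = 1 := Matrix.mem_unitaryGroup_iff.1 hq
  have hba : Matrix.fromBlocks pᴴ 0 0 qᴴ * Matrix.fromBlocks p 0 0 q = (1 : BlockMat n) := by
    simp [Matrix.fromBlocks_multiply, hp1, hq1]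
  refine ⟨Matrix.fromBlocks pᴴ 0 0 qᴴ,
    ⟨pᴴ, Unitary.star_mem hp, qᴴ, Unitary.star_mem hq, rfl, ?_, ?_⟩, hba, ?_⟩
  · have := congrArg Matrix.det hba
    rwa [Matrix.det_mul, hd, mul_one, Matrix.det_one] at this
  · rw [Matrix.conjTranspose_conjTranspose]
    nth_rewrite 1 [← hs]
    calc pᴴ * (p * (σ * σᴴ) * pᴴ) * p = (pᴴ * p) * (σ * σᴴ) * (pᴴ * p) := by
          simp only [Matrix.mul_assoc]
      _ = σ * σᴴ := by rw [hp1, Matrix.one_mul, Matrix.mul_one]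
  · simp [Matrix.fromBlocks_multiply, hp2, hq2]

lemma groupKplus_eq_leftGauge_one (n : ℕ) : groupKplus n = leftGauge (1 : Mat n) := by
  ext a
  constructor
  · rintro ⟨p, hp, q, hq, h, hd⟩
    have hp2 : p * pᴴ = 1 := Matrix.mem_unitaryGroup_iff.1 hp
    exact ⟨p, hp, q, hq, h, hd, by simp [hp2]⟩
  · rintro ⟨p, hp, q, hq, h, hd, -⟩
    exact ⟨p, hp, q, hq, h, hd⟩

/-- Gauge equivalence on the regular part of the constraint surface. -/
def gaugeSetoid {n : ℕ} (σ : Mat n) (α x y : ℝ) : Setoid (regularSurface σ α x y) where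
  r g h := ∃ a ∈ leftGauge σ, ∃ b ∈ groupKplus n, (h : BlockMat n) = a * g * b
  iseqv := by
    rw [groupKplus_eq_leftGauge_one]
    refine ⟨fun g => ⟨1, one_mem_leftGauge σ, 1, one_mem_leftGauge 1, by simp⟩, ?_, ?_⟩
    · rintro g h ⟨a, ha, b, hb, e⟩
      obtain ⟨a', ha', h1, -⟩ := exists_inv_leftGauge ha
      obtain ⟨b', hb', -, h2⟩ := exists_inv_leftGauge hb
      refine ⟨a', ha', b', hb', ?_⟩
      rw [e]
      calc (g : BlockMat n) = (a' * a) * g * (b * b') := by rw [h1, h2]; simp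
        _ = _ := by simp only [Matrix.mul_assoc]
    · rintro g h k ⟨a, ha, b, hb, e⟩ ⟨a', ha', b', hb', e'⟩
      exact ⟨a' * a, mul_mem_leftGauge ha' ha, b * b', mul_mem_leftGauge hb hb', by
        rw [e', e]; simp only [Matrix.mul_assoc]⟩

/-- The reduced space: the quotient of the regular part of the constraint surface by the gauge
group. -/
def ReducedSpace {n : ℕ} (σ : Mat n) (α x y : ℝ) : Type := Quotient (gaugeSetoid σ α x y)

/-- The projection to the reduced space. -/
def toReduced {n : ℕ} {σ : Mat n} {α x y : ℝ} (g : regularSurface σ α x y) :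
    ReducedSpace σ α x y := Quotient.mk (gaugeSetoid σ α x y) g

open Classical in
/-- A function on the reduced space, written in coordinates `(q, p)`. -/
def inCoordinates {n : ℕ} {σ : Mat n} {α x y : ℝ}
    (e : ReducedSpace σ α x y ≃ chamber n α × (Fin n → Real.Angle))
    (f : ReducedSpace σ α x y → ℝ) (z : RVec n × RVec n) : ℝ :=
  if h : z.1 ∈ chamber n α then f (e.symm (⟨z.1, h⟩, fun i => (z.2 i : Real.Angle))) else 0

/-! ## The symplectic structure -/

/-- A family of matrices has smooth entries. -/
def SmoothMatOn {n : ℕ} {E : Type*} [NormedAddCommGroup E] [NormedSpace ℝ E]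
    (M : E → BlockMat n) (s : Set E) : Prop :=
  ∀ i j, ContDiffOn ℝ ∞ (fun t => M t i j) s

/-- A smooth curve in the constraint surface, `g(t) = b_L(t) k_R(t) = k_L(t) b_R(t)`. -/
structure ConstraintCurve {n : ℕ} (σ : Mat n) (x y : ℝ) where
  bL : ℝ → BlockMat n
  kL : ℝ → BlockMat n
  bR : ℝ → BlockMat n
  kR : ℝ → BlockMat n
  bL_smooth : SmoothMatOn bL Set.univ
  kL_smooth : SmoothMatOn kL Set.univ
  bR_smooth : SmoothMatOn bR Set.univ
  kR_smooth : SmoothMatOn kR Set.univ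
  constrained : ∀ t, IsConstrained σ x y (bL t) (kL t) (bR t) (kR t)

/-- The point `g(t)` of the curve. -/
def ConstraintCurve.point {n : ℕ} {σ : Mat n} {x y : ℝ} (c : ConstraintCurve σ x y) (t : ℝ) :
    BlockMat n := c.kL t * c.bR t

/-- The derivative at `0` of a curve of matrices. -/
def velocity {n : ℕ} (M : ℝ → BlockMat n) : BlockMat n :=
  Matrix.of fun i j => deriv (fun t => M t i j) 0

/-- `M' M⁻¹` at `t = 0`. -/
def velR {n : ℕ} (M : ℝ → BlockMat n) : BlockMat n := velocity M * (M 0)⁻¹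

/-- `M⁻¹ M'` at `t = 0`. -/
def velL {n : ℕ} (M : ℝ → BlockMat n) : BlockMat n := (M 0)⁻¹ * velocity M

/-- The symplectic form
`⟨db_L b_L⁻¹ ∧ dk_L k_L⁻¹⟩ + ⟨b_R⁻¹ db_R ∧ k_R⁻¹ dk_R⟩` of the leaf `M(1, 1)`, evaluated on the
velocities at `t = 0` of two curves through the same point. -/
def leafForm {n : ℕ} {σ : Mat n} {x y : ℝ} (c d : ConstraintCurve σ x y) : ℝ :=
  (pairing (velR c.bL) (velR d.kL) - pairing (velR d.bL) (velR c.kL))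
    + (pairing (velL c.bR) (velL d.kR) - pairing (velL d.bR) (velL c.kR))

/-- The two-form `2 ∑ dp_i ∧ S_i⁻¹ dS_i` at a point with coordinates `(S, p)`, on two tangent
vectors `(δS, δp)`. For `S_i = exp q_i` it is `2 ∑ dp_i ∧ dq_i`. -/
def reducedForm {n : ℕ} (S : RVec n) (u w : RVec n × RVec n) : ℝ :=
  2 * ∑ i, (u.2 i * ((S i)⁻¹ * w.1 i) - w.2 i * ((S i)⁻¹ * u.1 i))

/-- The velocity at `t = 0` of the curve `(sinh Δ(t), p(t))`. -/
def coordVelocity {n : ℕ} (Δ p : ℝ → RVec n) : RVec n × RVec n :=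
  (fun i => deriv (fun t => Real.sinh (Δ t i)) 0, fun i => deriv (fun t => p t i) 0)

/-- The Poisson bracket of the symplectic form `2 ∑ dp_i ∧ dq_i`, for functions of `(q, p)`. -/
def reducedBracket {n : ℕ} (f h : RVec n × RVec n → ℝ) (z : RVec n × RVec n) : ℝ :=
  (1 / 2) * ∑ i,
    (fderiv ℝ f z (Pi.single i 1, 0) * fderiv ℝ h z (0, Pi.single i 1)
      - fderiv ℝ f z (0, Pi.single i 1) * fderiv ℝ h z (Pi.single i 1, 0))

/-! ## The reduced Hamiltonian -/

/-- The reduced Hamiltonian in the variables `(S, p)`, where `S = sinh Δ`. -/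
def hamS {n : ℕ} (α x y : ℝ) (S p : RVec n) : ℝ :=
  (1 / 2) * ((x ^ 2)⁻¹ + y ^ 2) * ∑ i, (S i ^ 2)⁻¹
    - x⁻¹ * ∑ i, Real.cos (p i) * Real.sqrt (1 + (S i ^ 2)⁻¹)
        * Real.sqrt (x ^ 2 + y ^ 2 * (S i ^ 2)⁻¹)
        * ∏ k ∈ Finset.univ.erase i,
            Real.sqrt ((α⁻¹ * S k ^ 2 - α * S i ^ 2) * (α * S k ^ 2 - α⁻¹ * S i ^ 2)
              / (S k ^ 2 - S i ^ 2) ^ 2)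

/-- The reduced Hamiltonian in the canonical variables `(q, p)`. -/
def hamQ {n : ℕ} (α x y : ℝ) (q p : RVec n) : ℝ :=
  (1 / 2) * ((x ^ 2)⁻¹ + y ^ 2) * ∑ i, Real.exp (-2 * q i)
    - ∑ i, Real.cos (p i)
        * Real.sqrt (1 + (1 + y ^ 2 / x ^ 2) * Real.exp (-2 * q i)
            + y ^ 2 / x ^ 2 * Real.exp (-4 * q i))
        * ∏ k ∈ Finset.univ.erase i,
            Real.sqrt (1 - (α - α⁻¹) ^ 2 / (4 * Real.sinh (q i - q k) ^ 2))

/-- The action on the position variables of the element of the Weyl group of type `BC_n` given by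
the signs `s` and the permutation `π`. The momenta are only permuted. -/
def weylAct {n : ℕ} (s : Fin n → ℤˣ) (π : Equiv.Perm (Fin n)) (S : RVec n) : RVec n :=
  fun i => ((s i : ℤ) : ℝ) * S (π i)

end HeisenbergDouble

end

open HeisenbergDouble

/-! Write k_L = diag(ρ, τ)(Γ, S; S, Γ)diag(k, l). The constraints make the lower left block of k_R
equal to x/y times that of k_L, so k_R has a Cartan decomposition with the same τ and k and with new
outer factors r, m (`exists_isFrame`). The remaining blocks of b_L k_R = k_L b_R give ω and ν
explicitly and leave the single relation σ†ρSl = rSm. Eliminating r, the unitary matrix T = m l†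
satisfies T†S²T = α²S² + ε w w† with w = Sρ†v (`IsFrame.rank_one`).

This rank one perturbation problem is solved in closed form. The characteristic polynomials,
evaluated at the eigenvalues, give |w_i|² and |(Tw)_i|² as functions of S; the entries T_ki (S_k² -
α²S_i²) = ε (Tw)_k conj(w_i) then determine T. In the gauge w > 0 one gets T = exp(ip) R with a real
Cauchy-type matrix R (`eq_phase_mul_cauchyT`). Conversely, Lagrange interpolation shows that R is
orthogonal and solves the problem, so every (q, p) occurs, smoothly (`exists_section`). Two points
with equal coordinates have the same T, hence differ by their unitary factors; the coordinates are
recovered from the spectrum of the block product k₁₁k₁₁† of k_L and from the cyclic vector v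
(`IsNormal.rho_mul`, `exists_coordinates`).

The functions Φ_ν are invariant under K on both sides, so Φ_1 depends only on tr ωω†. Since ω is
linear in T, only the real parts cos(p_i)|T_ii| of the diagonal of T appear, and |T_ii| is a product
over the other particles (`IsFrame.phi_one`).

For the two-form, write all velocities of unitary factors through skew-Hermitian matrices. Most
traces then have a symmetric real weight and zero imaginary part, and the traces symmetric in the
two tangent vectors cancel. The rest is transported by the real orthogonal matrix R, and only the
velocities Y of the phases, paired with D = S'/S, survive (`leafHalf_canonical`).

On G, the derivatives of Φ_ν are the traceless parts of -iL^ν. They lie in su(n, n), so R acts on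
them as the identity, and their pairings vanish because traces of powers of L are real. On the
reduced space the commutation is obtained directly: the velocity κk_L, with κ the derivative of Φ_a,
is tangent to the constraint surface and keeps b_L and b_R constant. Contracting the form with it
gives dΦ_a, while two such vectors have zero pairing since the form always contains a velocity of
b_L or b_R.

The parameters enter the Hamiltonian only through (α - α⁻¹)², x⁻² + y² and y²/x². These three
numbers can be read off from special momenta and from translations of q, which gives the last claim.
-/

namespace HeisenbergDouble

/-! ### Traces of skew-Hermitian matrices with real weights. -/

section FormAlgebra

/-- The complex diagonal matrix with the given real entries. -/
abbrev dg {n : ℕ} (f : RVec n) : Mat n := Matrix.diagonal fun i => (f i : ℂ)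

lemma dg_mul_dg {n : ℕ} (f g : RVec n) : dg f * dg g = dg (fun i => f i * g i) := by
  simp [dg, Matrix.diagonal_mul_diagonal]

lemma dg_conjTranspose {n : ℕ} (f : RVec n) : (dg f)ᴴ = dg f := by
  simp [dg, Matrix.diagonal_conjTranspose, Pi.star_def]

/-- A weighted trace of a product. -/
def wtr {n : ℕ} (m : Fin n → Fin n → ℝ) (X Y : Mat n) : ℂ :=
  ∑ i, ∑ j, (m i j : ℂ) * (X i j * Y j i)

lemma skew_apply {n : ℕ} {X : Mat n} (hX : Xᴴ = -X) (i j : Fin n) :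
    X j i = -star (X i j) := by
  have := congrFun (congrFun hX j) i
  simp only [Matrix.conjTranspose_apply, Matrix.neg_apply] at this
  rw [this, neg_neg]

/-- For skew-Hermitian X and Y the conjugate of X_ij Y_ji is X_ji Y_ij. Conjugation therefore only
exchanges the summation indices, which a symmetric weight does not notice. -/
lemma wtr_symm_im {n : ℕ} {m : Fin n → Fin n → ℝ} {X Y : Mat n} (hX : Xᴴ = -X) (hY : Yᴴ = -Y)
    (hm : ∀ i j, m i j = m j i) : (wtr m X Y).im = 0 := by
  have h : star (wtr m X Y) = wtr m X Y := by
    unfold wtr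
    rw [star_sum, Finset.sum_comm]
    simp only [star_sum]
    rw [Finset.sum_comm]
    conv_rhs => rw [Finset.sum_comm]
    refine Finset.sum_congr rfl fun i _ => Finset.sum_congr rfl fun j _ => ?_
    rw [skew_apply hX i j, skew_apply hY j i, hm i j]
    simp
  exact Complex.conj_eq_iff_im.1 h

lemma trace_dg_mul_dg {n : ℕ} (f g : RVec n) :
    (dg f * dg g).trace = ∑ i, ((f i * g i : ℝ) : ℂ) := by
  simp [Matrix.trace]

lemma trace_dg_sandwich {n : ℕ} (f g h k : RVec n) (X Y : Mat n) :
    (dg f * X * dg g * (dg h * Y * dg k)).trace = wtr (fun i j => k i * f i * (g j * h j)) X Y := by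
  simp only [Matrix.trace, Matrix.diag_apply, Matrix.mul_apply (M := _ * _) (N := _ * _ * _), wtr,
    Matrix.diagonal_mul, Matrix.mul_diagonal]
  refine Finset.sum_congr rfl fun i _ => Finset.sum_congr rfl fun j _ => ?_
  push_cast; ring

lemma wtr_add {n : ℕ} (m m' : Fin n → Fin n → ℝ) (X Y : Mat n) :
    wtr m X Y + wtr m' X Y = wtr (fun i j => m i j + m' i j) X Y := by
  simp only [wtr, ← Finset.sum_add_distrib]
  refine Finset.sum_congr rfl fun i _ => Finset.sum_congr rfl fun j _ => ?_
  push_cast; ring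

lemma wtr_congr {n : ℕ} {m m' : Fin n → Fin n → ℝ} (X Y : Mat n) (h : ∀ i j, m i j = m' i j) :
    wtr m X Y = wtr m' X Y := by
  rw [funext fun i => funext (h i)]

lemma dg_one {n : ℕ} : dg (fun _ => 1 : RVec n) = 1 := by simp [dg]

/-- The first factor has the shape of a variation of c/s, the second that of a lower left block of
k'k⁻¹. The hyperbolic identity enters only as c²/s = 1/s + s, in the terms X·V and Y·U: it splits
their weights into a quotient s_i/s_j or s_j/s_i and a symmetric part. All symmetric weights are
collected in the last bracket. -/
lemma trace_shape {n : ℕ} {c s D D' : RVec n} (hc : ∀ i, c i ≠ 0) (hs : ∀ i, s i ≠ 0)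
    (hcs : ∀ i, c i ^ 2 = 1 + s i ^ 2) (X Y U V : Mat n) :
    ((X * dg (fun i => c i / s i) - dg (fun i => D i / (c i * s i))
      - dg (fun i => c i / s i) * Y) *
      (dg (fun i => s i * D' i / c i) + dg s * U * dg c - dg c * V * dg s)).trace =
      (-(dg D * (U - V)).trace + (dg D' * (X - Y)).trace
      - (dg s * X * dg (fun i => (s i)⁻¹) * V).trace
      - (dg (fun i => (s i)⁻¹) * Y * dg s * U).trace)
      + (wtr (fun i j => c i * c j) X U - wtr (fun i j => s i * s j) X V
        - wtr (fun i j => s i * s j) Y U + wtr (fun i j => c i * c j) Y V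
        - ∑ i, ((D i * D' i / c i ^ 2 : ℝ) : ℂ)) := by
  have one (X : Mat n) (f : RVec n) : X * dg f = dg (fun _ => 1) * X * dg f := by
    rw [dg_one, Matrix.one_mul]
  have one' (X : Mat n) (f : RVec n) : dg f * X = dg f * X * dg (fun _ => 1) := by
    rw [dg_one, Matrix.mul_one]
  have oneV (V : Mat n) : V = dg (fun _ => 1) * V * dg (fun _ => 1) := by
    rw [dg_one, Matrix.mul_one, Matrix.one_mul]
  have r1 : (dg s * X * dg (fun i => (s i)⁻¹) * V).trace
      = wtr (fun i j => s i * (s j)⁻¹) X V := by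
    rw [oneV V, trace_dg_sandwich, ← oneV]; exact wtr_congr _ _ fun i j => by ring
  have r2 : (dg (fun i => (s i)⁻¹) * Y * dg s * U).trace
      = wtr (fun i j => (s i)⁻¹ * s j) Y U := by
    rw [oneV U, trace_dg_sandwich, ← oneV]; exact wtr_congr _ _ fun i j => by ring
  have r3 : (X * dg (fun i => c i / s i) * (dg s * U * dg c)).trace
      = wtr (fun i j => c i * c j) X U := by
    rw [one X, trace_dg_sandwich]; exact wtr_congr _ _ fun i j => by field_simp [hs j]
  have r4 : (X * dg (fun i => c i / s i) * (dg c * V * dg s)).trace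
      = wtr (fun i j => s i * (s j)⁻¹) X V + wtr (fun i j => s i * s j) X V := by
    rw [one X, trace_dg_sandwich, wtr_add]
    exact wtr_congr _ _ fun i j => by
      have := hs j
      field_simp; rw [hcs j]
  have r5 : (dg (fun i => c i / s i) * Y * (dg s * U * dg c)).trace
      = wtr (fun i j => (s i)⁻¹ * s j) Y U + wtr (fun i j => s i * s j) Y U := by
    rw [one' Y, trace_dg_sandwich, wtr_add]
    exact wtr_congr _ _ fun i j => by
      have := hs i
      field_simp; rw [hcs i]; ring
  have r6 : (dg (fun i => c i / s i) * Y * (dg c * V * dg s)).trace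
      = wtr (fun i j => c i * c j) Y V := by
    rw [one' Y, trace_dg_sandwich]; exact wtr_congr _ _ fun i j => by field_simp [hs i]
  have r7 : (X * dg (fun i => c i / s i) * dg (fun i => s i * D' i / c i)).trace
      = (dg D' * X).trace := by
    rw [Matrix.mul_assoc, dg_mul_dg, Matrix.trace_mul_comm]
    congr 3; funext i; field_simp [hs i, hc i]
  have r8 : (dg (fun i => c i / s i) * Y * dg (fun i => s i * D' i / c i)).trace
      = (dg D' * Y).trace := by
    rw [Matrix.trace_mul_comm, ← Matrix.mul_assoc, dg_mul_dg]
    congr 3; funext i; field_simp [hs i, hc i]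
  have r9 (f : RVec n) (U : Mat n) (g : RVec n) : (dg (fun i => D i / (c i * s i)) * (dg f * U * dg g)).trace
      = (dg (fun i => D i / (c i * s i) * (f i * g i)) * U).trace := by
    rw [← Matrix.mul_assoc, Matrix.trace_mul_comm, ← Matrix.mul_assoc, ← Matrix.mul_assoc,
      dg_mul_dg, dg_mul_dg]
    congr 3; funext i; ring
  have r10 : (fun i => D i / (c i * s i) * (s i * c i)) = D := by
    funext i; field_simp [hs i, hc i]
  have r11 : (fun i => D i / (c i * s i) * (c i * s i)) = D := by
    funext i; field_simp [hs i, hc i]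
  have r12 : (dg (fun i => D i / (c i * s i)) * dg (fun i => s i * D' i / c i)).trace
      = ∑ i, ((D i * D' i / c i ^ 2 : ℝ) : ℂ) := by
    rw [trace_dg_mul_dg]
    refine Finset.sum_congr rfl fun i _ => ?_
    congr 1; have := hs i; have := hc i; field_simp
  simp only [Matrix.sub_mul, Matrix.mul_sub, Matrix.mul_add, Matrix.trace_add,
      Matrix.trace_sub, r1, r2, r3, r4, r5, r6, r7, r8, r9, r10, r11, r12]
  ring

/-- The last bracket of `trace_shape` is real: its weights are symmetric and its remaining sum has
real terms. -/
lemma shape_im {n : ℕ} {c s D D' : RVec n} (hc : ∀ i, c i ≠ 0) (hs : ∀ i, s i ≠ 0)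
    (hcs : ∀ i, c i ^ 2 = 1 + s i ^ 2) {X Y U V : Mat n} (hX : Xᴴ = -X) (hY : Yᴴ = -Y)
    (hU : Uᴴ = -U) (hV : Vᴴ = -V) :
    ((X * dg (fun i => c i / s i) - dg (fun i => D i / (c i * s i)) - dg (fun i => c i / s i) * Y) *
      (dg (fun i => s i * D' i / c i) + dg s * U * dg c - dg c * V * dg s)).trace.im =
    (-(dg D * (U - V)).trace + (dg D' * (X - Y)).trace
      - (dg s * X * dg (fun i => (s i)⁻¹) * V).trace
      - (dg (fun i => (s i)⁻¹) * Y * dg s * U).trace).im := by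
  rw [trace_shape hc hs hcs, Complex.add_im]
  simp only [Complex.sub_im, Complex.add_im]
  rw [wtr_symm_im hX hU (fun i j => mul_comm _ _), wtr_symm_im hX hV (fun i j => mul_comm _ _),
    wtr_symm_im hY hU (fun i j => mul_comm _ _), wtr_symm_im hY hV (fun i j => mul_comm _ _)]
  simp only [Complex.im_sum, Complex.ofReal_im]
  simp

end FormAlgebra

/-! ### The reduced two-form for real orthogonal T. -/

section RealForm
abbrev RMat (n : ℕ) := Matrix (Fin n) (Fin n) ℝ

/-- The real and imaginary parts of a reduced infinitesimal variation. -/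
structure RealVel {n : ℕ} (S : RVec n) (T A B P Q ER EI FR FI : RMat n) (D Y : RVec n) : Prop where
  A_skew : Aᵀ = -A
  B_symm : Bᵀ = B
  P_skew : Pᵀ = -P
  Q_symm : Qᵀ = Q
  ER_skew : ERᵀ = -ER
  FR_skew : FRᵀ = -FR
  FI_symm : FIᵀ = FI
  re_eq : T * (Matrix.diagonal S * A * Matrix.diagonal S⁻¹ - Matrix.diagonal D + FR) * Tᵀ =
    Matrix.diagonal S * P * Matrix.diagonal S⁻¹ - Matrix.diagonal D + ER
  im_eq : T * (Matrix.diagonal S * B * Matrix.diagonal S⁻¹ + FI) * Tᵀ =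
    Matrix.diagonal S * Q * Matrix.diagonal S⁻¹ + EI
  Y_eq : EI = T * FI * Tᵀ + Matrix.diagonal Y

lemma trace_skew_mul_symm {n : ℕ} {X Y : RMat n} (hX : Xᵀ = -X) (hY : Yᵀ = Y) :
    (X * Y).trace = 0 := by
  have h : (X * Y).trace = -(X * Y).trace := by
    conv_lhs => rw [← Matrix.trace_transpose, Matrix.transpose_mul, hX, hY, Matrix.mul_neg,
      Matrix.trace_neg, Matrix.trace_mul_comm]
  linarith

lemma trace_diag_conj {n : ℕ} {S : RVec n} (hS : ∀ i, S i ≠ 0) (X Y : RMat n) :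
    (Matrix.diagonal S * X * Matrix.diagonal S⁻¹ * (Matrix.diagonal S * Y * Matrix.diagonal S⁻¹)).trace
      = (X * Y).trace := by
  have h1 : Matrix.diagonal S⁻¹ * Matrix.diagonal S = (1 : RMat n) := by
    rw [Matrix.diagonal_mul_diagonal, ← Matrix.diagonal_one]
    congr 1; funext i; simp [hS i]
  calc _ = (Matrix.diagonal S * (X * (Matrix.diagonal S⁻¹ * Matrix.diagonal S) * Y) *
        Matrix.diagonal S⁻¹).trace := by simp only [Matrix.mul_assoc]
    _ = _ := by rw [h1, Matrix.mul_one, Matrix.trace_mul_comm, ← Matrix.mul_assoc, h1, Matrix.one_mul]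

lemma trace_diagonal_conj_left {n : ℕ} {S : RVec n} (hS : ∀ i, S i ≠ 0) (D : RVec n) (X : RMat n) :
    (Matrix.diagonal D * (Matrix.diagonal S * X * Matrix.diagonal S⁻¹)).trace
      = (Matrix.diagonal D * X).trace := by
  simp only [Matrix.trace, Matrix.diag_apply, Matrix.diagonal_mul, Matrix.mul_diagonal]
  refine Finset.sum_congr rfl fun i _ => ?_
  have := hS i
  simp only [Pi.inv_apply]; field_simp

lemma skew_diag {n : ℕ} {X : RMat n} (hX : Xᵀ = -X) (i : Fin n) : X i i = 0 := by
  have := congrFun (congrFun hX i) i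
  simp at this; linarith

lemma trace_diagonal_skew {n : ℕ} (D : RVec n) {X : RMat n} (hX : Xᵀ = -X) :
    (Matrix.diagonal D * X).trace = 0 := by
  simp [Matrix.trace, Matrix.diagonal_mul, skew_diag hX]

/-- One of the two halves of the reduced two-form. -/
noncomputable def halfForm {n : ℕ} (S : RVec n) (A B Q ER EI FI : RMat n) (D' : RVec n)
    (FR' FI' P' Q' : RMat n) : ℝ :=
  (Matrix.diagonal D' * (B - Q + EI - FI)).trace
    - (Matrix.diagonal S * A * Matrix.diagonal S⁻¹ * FI').trace
    - (Matrix.diagonal S * B * Matrix.diagonal S⁻¹ * FR').trace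
    - (ER * (Matrix.diagonal S * Q' * Matrix.diagonal S⁻¹)).trace
    - (EI * (Matrix.diagonal S * P' * Matrix.diagonal S⁻¹)).trace

/-- The relations of `RealVel` express p', q' and ER, EI by conjugation with T, so that all of them
can be eliminated. Products of a skew and a symmetric matrix have trace zero. What is left, apart
from the sum of the Y_i D'_i, is visibly symmetric under exchange of the two velocities and
disappears from the difference in `halfForm_sub_halfForm`. -/
lemma halfForm_eq {n : ℕ} {S : RVec n} (hS : ∀ i, S i ≠ 0) {T : RMat n} (hT : Tᵀ * T = 1)
    {A B P Q ER EI FR FI A' B' P' Q' ER' EI' FR' FI' : RMat n} {D Y D' Y' : RVec n}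
    (h : RealVel S T A B P Q ER EI FR FI D Y) (h' : RealVel S T A' B' P' Q' ER' EI' FR' FI' D' Y') :
    halfForm S A B Q ER EI FI D' FR' FI' P' Q' =
      2 * ∑ i, Y i * D' i
      + ((Matrix.diagonal D' * B).trace + (Matrix.diagonal D * B').trace)
      - ((Matrix.diagonal D' * (T * (Matrix.diagonal S * B * Matrix.diagonal S⁻¹) * Tᵀ)).trace +
        (Matrix.diagonal D * (T * (Matrix.diagonal S * B' * Matrix.diagonal S⁻¹) * Tᵀ)).trace)
      - ((Matrix.diagonal S * A * Matrix.diagonal S⁻¹ * FI').trace +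
        (Matrix.diagonal S * A' * Matrix.diagonal S⁻¹ * FI).trace)
      - ((Matrix.diagonal S * B * Matrix.diagonal S⁻¹ * FR').trace +
        (Matrix.diagonal S * B' * Matrix.diagonal S⁻¹ * FR).trace) := by
  have cyc (X Z : RMat n) : (T * X * Tᵀ * (T * Z * Tᵀ)).trace = (X * Z).trace := by
    calc _ = (T * (X * (Tᵀ * T) * Z) * Tᵀ).trace := by simp only [Matrix.mul_assoc]
      _ = _ := by rw [hT, Matrix.mul_one, Matrix.trace_mul_comm, ← Matrix.mul_assoc, hT,
                    Matrix.one_mul]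
  have trs (X : RMat n) : (T * X * Tᵀ)ᵀ = T * Xᵀ * Tᵀ := by
    simp only [Matrix.transpose_mul, Matrix.transpose_transpose, Matrix.mul_assoc]
  have ds (v : RVec n) : (Matrix.diagonal v)ᵀ = Matrix.diagonal v := Matrix.diagonal_transpose v
  set a := Matrix.diagonal S * A * Matrix.diagonal S⁻¹ with ha
  set b := Matrix.diagonal S * B * Matrix.diagonal S⁻¹ with hb
  set a' := Matrix.diagonal S * A' * Matrix.diagonal S⁻¹ with ha'
  set b' := Matrix.diagonal S * B' * Matrix.diagonal S⁻¹ with hb'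
  set p := Matrix.diagonal S * P * Matrix.diagonal S⁻¹ with hp
  set q := Matrix.diagonal S * Q * Matrix.diagonal S⁻¹ with hq
  set p' := Matrix.diagonal S * P' * Matrix.diagonal S⁻¹ with hp'
  set q' := Matrix.diagonal S * Q' * Matrix.diagonal S⁻¹ with hq'
  set θ := ER - T * FR * Tᵀ with hθ
  have θs : θᵀ = -θ := by rw [hθ, Matrix.transpose_sub, trs, h.ER_skew, h.FR_skew, Matrix.mul_neg, Matrix.neg_mul]; abel
  have eER : ER = θ + T * FR * Tᵀ := by rw [hθ]; abel
  have eEI := h.Y_eq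
  -- the relations solved for `q'`, `p'` and `p`
  have eq' : q' = T * b' * Tᵀ - Matrix.diagonal Y' := by
    have := h'.im_eq
    rw [h'.Y_eq, Matrix.mul_add, Matrix.add_mul, ← hb', ← hq'] at this
    linear_combination (norm := abel) -this
  have eq : q = T * b * Tᵀ - Matrix.diagonal Y := by
    have := h.im_eq
    rw [h.Y_eq, Matrix.mul_add, Matrix.add_mul, ← hb, ← hq] at this
    linear_combination (norm := abel) -this
  set θ' := ER' - T * FR' * Tᵀ with hθ'
  have θs' : θ'ᵀ = -θ' := by rw [hθ', Matrix.transpose_sub, trs, h'.ER_skew, h'.FR_skew, Matrix.mul_neg, Matrix.neg_mul]; abel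
  have ep' : p' = T * (a' - Matrix.diagonal D') * Tᵀ + Matrix.diagonal D' - θ' := by
    have := h'.re_eq
    rw [Matrix.mul_add, Matrix.add_mul, ← ha', ← hp'] at this
    rw [hθ']; linear_combination (norm := abel) -this
  have ep : p = T * (a - Matrix.diagonal D) * Tᵀ + Matrix.diagonal D - θ := by
    have := h.re_eq
    rw [Matrix.mul_add, Matrix.add_mul, ← ha, ← hp] at this
    rw [hθ]; linear_combination (norm := abel) -this
  -- traces which vanish
  have z1 : (a * b').trace = 0 := by
    rw [ha, hb', trace_diag_conj hS, trace_skew_mul_symm h.A_skew h'.B_symm]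
  have z2 : (p * q').trace = 0 := by
    rw [hp, hq', trace_diag_conj hS, trace_skew_mul_symm h.P_skew h'.Q_symm]
  have z3 : (Matrix.diagonal Y * p').trace = 0 := by
    rw [hp', trace_diagonal_conj_left hS, trace_diagonal_skew _ h'.P_skew]
  have z4 : (T * FR * Tᵀ * Matrix.diagonal Y').trace = 0 :=
    trace_skew_mul_symm (by rw [trs, h.FR_skew]; simp) (ds Y')
  have z5 : (T * FI * Tᵀ * θ').trace = 0 := by
    rw [Matrix.trace_mul_comm]
    exact trace_skew_mul_symm θs' (by rw [trs, h.FI_symm])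
  have z6 : (Matrix.diagonal Y' * p).trace = 0 := by
    rw [hp, trace_diagonal_conj_left hS, trace_diagonal_skew _ h.P_skew]
  have z7 : (Matrix.diagonal Y' * θ).trace = 0 := trace_diagonal_skew _ θs
  -- the last two terms
  have t1 : (ER * q').trace = (θ * q').trace + (FR * b').trace := by
    rw [eER, Matrix.add_mul, Matrix.trace_add, eq', Matrix.mul_sub (T * FR * Tᵀ), Matrix.trace_sub,
      cyc, z4, sub_zero]
  have t2 : (EI * p').trace = (FI * a').trace - (FI * Matrix.diagonal D').trace
      + (T * FI * Tᵀ * Matrix.diagonal D').trace := by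
    rw [eEI, Matrix.add_mul, Matrix.trace_add, z3, ep', Matrix.mul_sub, Matrix.mul_add,
      Matrix.trace_sub, Matrix.trace_add, z5, cyc, Matrix.mul_sub, Matrix.trace_sub]
    ring
  -- θ is eliminated by its expression through a, D and p. The term p q' drops out as skew times
  -- symmetric up to a similarity; the diagonal part Y' of q' drops out because θ + p, the
  -- complementary combination, has zero trace against it.
  have t3 : (θ * q').trace = - (Matrix.diagonal D * b').trace
      + (Matrix.diagonal D * (T * b' * Tᵀ)).trace := by
    have e : θ = T * a * Tᵀ - T * Matrix.diagonal D * Tᵀ + Matrix.diagonal D - p := by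
      rw [ep, Matrix.mul_sub, Matrix.sub_mul]; abel
    have e3 : (Matrix.diagonal Y' * (T * a * Tᵀ - T * Matrix.diagonal D * Tᵀ
        + Matrix.diagonal D)).trace = 0 := by
      have : T * a * Tᵀ - T * Matrix.diagonal D * Tᵀ + Matrix.diagonal D = θ + p := by
        rw [ep, Matrix.mul_sub, Matrix.sub_mul]; abel
      rw [this, Matrix.mul_add, Matrix.trace_add, z6, z7, add_zero]
    have : (θ * q').trace = ((T * a * Tᵀ - T * Matrix.diagonal D * Tᵀ + Matrix.diagonal D) * q').trace := by
      conv_lhs => rw [e, Matrix.sub_mul, Matrix.trace_sub, z2, sub_zero]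
    rw [this, eq', Matrix.mul_sub, Matrix.trace_sub,
      Matrix.trace_mul_comm _ (Matrix.diagonal Y'), e3, sub_zero, Matrix.add_mul, Matrix.sub_mul,
      Matrix.trace_add, Matrix.trace_sub, cyc, cyc, z1]
    ring
  have t4 : (Matrix.diagonal D' * Q).trace = (Matrix.diagonal D' * (T * b * Tᵀ)).trace
      - ∑ i, Y i * D' i := by
    rw [← trace_diagonal_conj_left hS, ← hq, eq, Matrix.mul_sub, Matrix.trace_sub]
    congr 1
    simp [Matrix.trace, mul_comm]
  have t5 : (Matrix.diagonal D' * EI).trace = (T * FI * Tᵀ * Matrix.diagonal D').trace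
      + ∑ i, Y i * D' i := by
    rw [eEI, Matrix.mul_add, Matrix.trace_add, Matrix.trace_mul_comm]
    congr 1
    simp [Matrix.trace, mul_comm]
  have t6 : (FI * Matrix.diagonal D').trace = (Matrix.diagonal D' * FI).trace :=
    Matrix.trace_mul_comm _ _
  have t7 : (Matrix.diagonal D * b').trace = (Matrix.diagonal D * B').trace := by
    rw [hb', trace_diagonal_conj_left hS]
  have t8 : (FI * a').trace = (a' * FI).trace := Matrix.trace_mul_comm _ _
  have t9 : (FR * b').trace = (b' * FR).trace := Matrix.trace_mul_comm _ _
  unfold halfForm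
  rw [← ha, ← hb, ← hq', ← hp', t1, t2, t3, Matrix.mul_sub, Matrix.mul_add, Matrix.mul_sub,
    Matrix.trace_sub, Matrix.trace_add, Matrix.trace_sub, t4, t5, t6, t7, t8, t9]
  ring

lemma halfForm_sub_halfForm {n : ℕ} {S : RVec n} (hS : ∀ i, S i ≠ 0) {T : RMat n} (hT : Tᵀ * T = 1)
    {A B P Q ER EI FR FI A' B' P' Q' ER' EI' FR' FI' : RMat n} {D Y D' Y' : RVec n}
    (h : RealVel S T A B P Q ER EI FR FI D Y) (h' : RealVel S T A' B' P' Q' ER' EI' FR' FI' D' Y') :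
    halfForm S A B Q ER EI FI D' FR' FI' P' Q' - halfForm S A' B' Q' ER' EI' FI' D FR FI P Q =
      2 * ∑ i, (Y i * D' i - Y' i * D i) := by
  rw [halfForm_eq hS hT h h', halfForm_eq hS hT h' h, Finset.sum_sub_distrib]
  ring
end RealForm
end HeisenbergDouble

namespace HeisenbergDouble
-- The Cartan decomposition at the level of tangent vectors.
section InfinitesimalCartan

/-- Off the diagonal, the entry (i, j) and the conjugate of the entry (j, i) form a 2 × 2 linear
system for ξ_ij and η_ij whose determinant is S_i² - S_j² up to sign. On the diagonal the real part
goes to D; the imaginary part, which could be shared, is put entirely into η. -/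
lemma exists_skew_decomposition {n : ℕ} {S : RVec n} (hS : ∀ i, S i ≠ 0)
    (hd : ∀ i j, i ≠ j → S i ^ 2 ≠ S j ^ 2) (Z : Mat n) :
    ∃ (ξ η : Mat n) (D : RVec n), ξᴴ = -ξ ∧ ηᴴ = -η ∧
      Z = ξ * dg S + dg (fun i => S i * D i) + dg S * η := by
  have hd' : ∀ i j, i ≠ j → ((S i : ℂ) ^ 2 - (S j : ℂ) ^ 2) ≠ 0 := fun i j h => by
    rw [sub_ne_zero]; exact_mod_cast hd i j h
  refine ⟨Matrix.of fun i j => if i = j then 0 else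
      (S j * Z i j + S i * star (Z j i)) / ((S j : ℂ) ^ 2 - (S i : ℂ) ^ 2),
    Matrix.of fun i j => if i = j then Complex.I * ((Z i i).im / S i : ℝ) else
      (S i * Z i j + S j * star (Z j i)) / ((S i : ℂ) ^ 2 - (S j : ℂ) ^ 2),
    fun i => (Z i i).re / S i, ?_, ?_, ?_⟩
  · ext i j
    by_cases h : i = j
    · subst h; simp
    · have := hd' i j h
      have := hd' j i (Ne.symm h)
      simp [h, Ne.symm h]
      field_simp
      ring
  · ext i j
    by_cases h : i = j
    · subst h; simp
    · have := hd' i j h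
      have := hd' j i (Ne.symm h)
      simp [h, Ne.symm h]
      field_simp
      ring
  · ext i j
    have hi : (S i : ℂ) ≠ 0 := by exact_mod_cast hS i
    by_cases h : i = j
    · subst h
      simp [Matrix.diagonal_mul, Matrix.mul_diagonal]
      field_simp
      rw [mul_comm Complex.I]; exact (Complex.re_add_im _).symm
    · have h1 := hd' i j h
      have h2 := hd' j i (Ne.symm h)
      simp [Matrix.diagonal_mul, Matrix.mul_diagonal, h]
      field_simp
      ring

/-- The Cartan decomposition `diag(ρ, τ) (c, s; s, c) diag(k, l)`. -/
noncomputable def kak {n : ℕ} (ρ τ k l : Mat n) (c s : RVec n) : BlockMat n :=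
  Matrix.fromBlocks (ρ * dg c * k) (ρ * dg s * l) (τ * dg s * k) (τ * dg c * l)

/-- The velocity of a Cartan decomposition, for `s' = s D`. -/
noncomputable def kakVel {n : ℕ} (ρ τ k l : Mat n) (c s D : RVec n) (ξ χ η θ : Mat n) :
    BlockMat n :=
  Matrix.fromBlocks
    (ρ * (ξ * dg c + dg (fun i => s i ^ 2 * D i / c i) + dg c * η) * k)
    (ρ * (ξ * dg s + dg (fun i => s i * D i) + dg s * θ) * l)
    (τ * (χ * dg s + dg (fun i => s i * D i) + dg s * η) * k)
    (τ * (χ * dg c + dg (fun i => s i ^ 2 * D i / c i) + dg c * θ) * l)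

/-- The formulas for the blocks 11 and 22 serve as definitions of ξ and θ. The tangency conditions
e11 and e22 then say that ξ and θ are skew-Hermitian, and e12 gives the block 12. Thus the lower
left block with its decomposition determines the whole tangent vector. -/
lemma exists_skew_of_tangent {n : ℕ} {c s D : RVec n} (hc : ∀ i, c i ≠ 0)
    (hcs : ∀ i, c i ^ 2 = 1 + s i ^ 2) {χ η Z₁₁ Z₁₂ Z₂₁ Z₂₂ : Mat n} (hχ : χᴴ = -χ) (hη : ηᴴ = -η)
    (h21 : Z₂₁ = χ * dg s + dg (fun i => s i * D i) + dg s * η)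
    (e11 : Z₁₁ᴴ * dg c + dg c * Z₁₁ = Z₂₁ᴴ * dg s + dg s * Z₂₁)
    (e12 : Z₁₁ᴴ * dg s + dg c * Z₁₂ = Z₂₁ᴴ * dg c + dg s * Z₂₂)
    (e22 : Z₂₁ * dg s + dg s * Z₂₁ᴴ = Z₂₂ * dg c + dg c * Z₂₂ᴴ) :
    ∃ ξ θ : Mat n, ξᴴ = -ξ ∧ θᴴ = -θ ∧
      Z₁₁ = ξ * dg c + dg (fun i => s i ^ 2 * D i / c i) + dg c * η ∧
      Z₁₂ = ξ * dg s + dg (fun i => s i * D i) + dg s * θ ∧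
      Z₂₂ = χ * dg c + dg (fun i => s i ^ 2 * D i / c i) + dg c * θ := by
  have hc' : ∀ i, (c i : ℂ) ≠ 0 := fun i => by exact_mod_cast hc i
  have hcs' : ∀ i, (c i : ℂ) ^ 2 = 1 + (s i : ℂ) ^ 2 := fun i => by exact_mod_cast hcs i
  have E11 := fun i j => congrFun (congrFun e11 i) j
  have E12 := fun i j => congrFun (congrFun e12 i) j
  have E22 := fun i j => congrFun (congrFun e22 i) j
  have E21 := fun i j => congrFun (congrFun h21 i) j
  have Kχ := skew_apply hχ
  have Kη := skew_apply hη
  simp only [Matrix.add_apply, Matrix.mul_diagonal, Matrix.diagonal_mul,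
    Matrix.conjTranspose_apply] at E11 E12 E22 E21
  have sD (i j : Fin n) : (dg (fun i => s i * D i) : Mat n) i j = s i * (dg D : Mat n) i j := by
    by_cases h : i = j
    · subst h; simp
    · simp [h]
  have cD (i j : Fin n) : (dg (fun i => s i ^ 2 * D i / c i) : Mat n) i j
      = s i ^ 2 / c i * (dg D : Mat n) i j := by
    by_cases h : i = j
    · subst h; simp; ring
    · simp [h]
  have Dst (i j : Fin n) : star ((dg D : Mat n) j i) = (dg D : Mat n) i j := by
    by_cases h : i = j
    · subst h; simp
    · simp [h, Ne.symm h]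
  have D0 (i j : Fin n) (h : i ≠ j) : (dg D : Mat n) i j = 0 := by simp [h]
  have S21 (i j : Fin n) : star (Z₂₁ j i) = - s i * χ i j + s j * (dg D : Mat n) i j - η i j * s j := by
    rw [E21 j i, sD]
    simp only [star_add, star_mul', Dst]
    rw [Kχ i j, Kη i j]
    simp; ring
  have B21 (i j : Fin n) : Z₂₁ i j = χ i j * s j + s i * (dg D : Mat n) i j + s i * η i j := by
    rw [E21 i j, sD]
  have A11 (i j : Fin n) : star (Z₁₁ j i) =
      ((- s i * χ i j + s j * (dg D : Mat n) i j - η i j * s j) * s j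
        + s i * (χ i j * s j + s i * (dg D : Mat n) i j + s i * η i j) - c i * Z₁₁ i j) / c j := by
    rw [eq_div_iff (hc' j), ← S21, ← B21, ← E11 i j]; ring
  have A22 (i j : Fin n) : star (Z₂₂ j i) =
      ((χ i j * s j + s i * (dg D : Mat n) i j + s i * η i j) * s j
        + s i * (- s i * χ i j + s j * (dg D : Mat n) i j - η i j * s j) - Z₂₂ i j * c j) / c i := by
    rw [eq_div_iff (hc' i), mul_comm, ← S21, ← B21, E22 i j]; ring
  refine ⟨Matrix.of fun i j => (Z₁₁ i j - s i ^ 2 / c i * (dg D : Mat n) i j - c i * η i j) / c j,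
    Matrix.of fun i j => (Z₂₂ i j - s i ^ 2 / c i * (dg D : Mat n) i j - χ i j * c j) / c i,
    ?_, ?_, ?_, ?_, ?_⟩
  · ext i j
    simp only [Matrix.conjTranspose_apply, Matrix.of_apply, Matrix.neg_apply]
    simp only [star_div₀, star_sub, star_mul', A11, Dst, Kη i j]
    by_cases h : i = j
    · subst h
      have := hc' i
      have e := hcs' i
      simp
      field_simp
      rw [e]; ring
    · rw [D0 i j h]
      have := hc' i
      have := hc' j
      have e := hcs' i
      have e' := hcs' j
      simp
      field_simp
      linear_combination (η i j) * e' - (η i j) * e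
  · ext i j
    simp only [Matrix.conjTranspose_apply, Matrix.of_apply, Matrix.neg_apply]
    simp only [star_div₀, star_sub, star_mul', A22, Dst, Kχ i j]
    by_cases h : i = j
    · subst h
      have := hc' i
      have e := hcs' i
      simp
      field_simp
      rw [e]; ring
    · rw [D0 i j h]
      have := hc' i
      have := hc' j
      have e := hcs' i
      have e' := hcs' j
      simp
      field_simp
      linear_combination (χ i j) * e - (χ i j) * e'
  · ext i j
    simp only [Matrix.add_apply, Matrix.mul_diagonal, Matrix.diagonal_mul, cD, Matrix.of_apply]
    have := hc' j
    field_simp; ring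
  · ext i j
    simp only [Matrix.add_apply, Matrix.mul_diagonal, Matrix.diagonal_mul, sD, Matrix.of_apply]
    have e12 := E12 i j
    rw [A11, S21] at e12
    have e12' := eq_sub_of_add_eq' e12
    have := hc' j
    have := hc' i
    have e := hcs' i
    have e' := hcs' j
    rw [← mul_right_inj' (hc' i)]
    by_cases h : i = j
    · subst h
      rw [e12']
      field_simp
      ring
    · rw [e12', D0 i j h]
      field_simp
      linear_combination (c i * s j * η i j) * (e - e')
  · ext i j
    simp only [Matrix.add_apply, Matrix.mul_diagonal, Matrix.diagonal_mul, cD, Matrix.of_apply]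
    have := hc' i
    field_simp; ring
end InfinitesimalCartan
end HeisenbergDouble

namespace HeisenbergDouble
-- Frames of the constraint surface and the velocities of ω and ν.
section LeafForm

/-- A point of the constraint surface: the two Cartan decompositions
`k_L = diag(ρ, τ) (Γ, S; S, Γ) diag(k, l)` and `k_R = diag(r, τ) (C, s; s, C) diag(k, m)` with
`s = (x / y) S`, and the off-diagonal blocks `om`, `ν` of `b_R`, `b_L`. -/
structure IsFrame {n : ℕ} (σ : Mat n) (x y : ℝ) (S Γ C : RVec n) (ρ τ k l r m om ν : Mat n) :
    Prop where
  x_pos : 0 < x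
  y_pos : 0 < y
  S_ne : ∀ i, S i ≠ 0
  Γ_pos : ∀ i, 0 < Γ i
  Γ_sq : ∀ i, Γ i ^ 2 = 1 + S i ^ 2
  C_pos : ∀ i, 0 < C i
  C_sq : ∀ i, C i ^ 2 = 1 + (x / y * S i) ^ 2
  ρ_u : ρᴴ * ρ = 1
  τ_u : τᴴ * τ = 1
  k_u : kᴴ * k = 1
  l_u : lᴴ * l = 1
  r_u : rᴴ * r = 1
  m_u : mᴴ * m = 1
  rel : σᴴ * ρ * dg S * l = r * dg S * m
  om_eq : dg S * k * om = (y : ℂ) • (dg C * m) - ((x : ℂ)⁻¹) • (dg Γ * l)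
  ν_eq : ν * τ * dg (fun i => x / y * S i) = ((x * y : ℝ) : ℂ) • (ρ * dg Γ) - σ * r * dg C

/-- The velocity of a curve of such points, with `S' = S D`. -/
structure IsFrameVel {n : ℕ} (σ : Mat n) (x y : ℝ) (S Γ C : RVec n) (ρ τ k l r m om ν : Mat n)
    (D : RVec n) (ξ χ η θ ζ μ vom vν : Mat n) : Prop where
  ξ_skew : ξᴴ = -ξ
  χ_skew : χᴴ = -χ
  η_skew : ηᴴ = -η
  θ_skew : θᴴ = -θ
  ζ_skew : ζᴴ = -ζ
  μ_skew : μᴴ = -μ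
  rel : σᴴ * ρ * (ξ * dg S + dg (fun i => S i * D i) + dg S * θ) * l =
    r * (ζ * dg S + dg (fun i => S i * D i) + dg S * μ) * m
  om_eq : dg S * k * vom =
    (y : ℂ) • ((χ * dg C + dg (fun i => (x / y * S i) ^ 2 * D i / C i) + dg C * μ) * m)
    - ((x : ℂ)⁻¹) • ((χ * dg Γ + dg (fun i => S i ^ 2 * D i / Γ i) + dg Γ * θ) * l)
    - (χ * dg S + dg (fun i => S i * D i) + dg S * η) * k * om
  ν_eq : vν * τ * dg (fun i => x / y * S i) =
    ((x * y : ℝ) : ℂ) • (ρ * (ξ * dg Γ + dg (fun i => S i ^ 2 * D i / Γ i) + dg Γ * η))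
    - σ * r * (ζ * dg C + dg (fun i => (x / y * S i) ^ 2 * D i / C i) + dg C * η)
    - ν * τ * (χ * dg (fun i => x / y * S i) + dg (fun i => x / y * S i * D i)
        + dg (fun i => x / y * S i) * η)

/-- The lower left block of `k_L' k_L⁻¹`, up to gauge. -/
noncomputable def velκ {n : ℕ} (S Γ D : RVec n) (η θ : Mat n) : Mat n :=
  dg (fun i => S i * D i / Γ i) + dg S * η * dg Γ - dg Γ * θ * dg S

lemma dg_inv_mul {n : ℕ} {S : RVec n} (hS : ∀ i, S i ≠ 0) :
    dg (fun i => (S i)⁻¹) * dg S = 1 := by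
  rw [dg_mul_dg, ← dg_one]; congr 1; funext i; exact_mod_cast inv_mul_cancel₀ (hS i)

lemma dg_mul_inv {n : ℕ} {S : RVec n} (hS : ∀ i, S i ≠ 0) :
    dg S * dg (fun i => (S i)⁻¹) = 1 := by
  rw [dg_mul_dg, ← dg_one]; congr 1; funext i; exact_mod_cast mul_inv_cancel₀ (hS i)

/-- This is the derivative of k₁₁k₂₁⁻¹ = ρ(c/s)τ†, with the outer unitary factors removed: (c/s)' =
-D/(cs), and η drops out because k cancels in the quotient. -/
lemma vel_N_eq {n : ℕ} {c s D : RVec n} (hc : ∀ i, c i ≠ 0) (hs : ∀ i, s i ≠ 0)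
    (hcs : ∀ i, c i ^ 2 = 1 + s i ^ 2) (ξ χ η : Mat n) :
    ((ξ * dg c + dg (fun i => s i ^ 2 * D i / c i) + dg c * η) - dg c * dg (fun i => (s i)⁻¹) *
      (χ * dg s + dg (fun i => s i * D i) + dg s * η)) * dg (fun i => (s i)⁻¹) =
    ξ * dg (fun i => c i / s i) - dg (fun i => D i / (c i * s i)) - dg (fun i => c i / s i) * χ := by
  ext i j
  have h1 : (s i : ℂ) ≠ 0 := by exact_mod_cast hs i
  have h2 : (s j : ℂ) ≠ 0 := by exact_mod_cast hs j
  have h3 : (c i : ℂ) ≠ 0 := by exact_mod_cast hc i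
  have h4 : (c i : ℂ) ^ 2 = 1 + (s i : ℂ) ^ 2 := by exact_mod_cast hcs i
  rw [dg_mul_dg]
  by_cases h : i = j
  · subst h
    simp [Matrix.mul_diagonal, Matrix.diagonal_mul]
    field_simp
    linear_combination (- (D i : ℂ)) * h4
  · simp [Matrix.mul_diagonal, Matrix.diagonal_mul, h]
    field_simp
    ring

/-- The analogue of `vel_N_eq` for k₂₁⁻¹k₂₂ = k†(c/s)l, in which τ and hence χ cancel. The signs of
η and θ come from k† on the left and l on the right. -/
lemma vel_W_eq {n : ℕ} {c s D : RVec n} (hc : ∀ i, c i ≠ 0) (hs : ∀ i, s i ≠ 0)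
    (hcs : ∀ i, c i ^ 2 = 1 + s i ^ 2) (χ η θ : Mat n) :
    dg (fun i => (s i)⁻¹) * ((χ * dg c + dg (fun i => s i ^ 2 * D i / c i) + dg c * θ) -
      (χ * dg s + dg (fun i => s i * D i) + dg s * η) * dg (fun i => (s i)⁻¹) * dg c) =
    (-η) * dg (fun i => c i / s i) - dg (fun i => D i / (c i * s i))
      - dg (fun i => c i / s i) * (-θ) := by
  ext i j
  have h1 : (s i : ℂ) ≠ 0 := by exact_mod_cast hs i
  have h2 : (s j : ℂ) ≠ 0 := by exact_mod_cast hs j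
  have h3 : (c i : ℂ) ≠ 0 := by exact_mod_cast hc i
  have h4 : (c i : ℂ) ^ 2 = 1 + (s i : ℂ) ^ 2 := by exact_mod_cast hcs i
  by_cases h : i = j
  · subst h
    simp [Matrix.mul_diagonal, Matrix.diagonal_mul]
    field_simp
    linear_combination (- (D i : ℂ)) * h4
  · simp [Matrix.mul_diagonal, Matrix.diagonal_mul, h]
    field_simp
    ring

/-- The variation of c/s and the lower left block `velκ` are the same object up to multiplication by
powers of s. This is what makes the mixed terms of the form symmetric in the two tangent vectors. -/
lemma velκ_conj_left {n : ℕ} {c s D : RVec n} (hc : ∀ i, c i ≠ 0) (hs : ∀ i, s i ≠ 0)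
    (ζ χ : Mat n) :
    dg s * (ζ * dg (fun i => c i / s i) - dg (fun i => D i / (c i * s i))
      - dg (fun i => c i / s i) * χ) =
    - (velκ s c D (-ζ) (-χ) * dg (fun i => (s i)⁻¹)) := by
  ext i j
  have h1 : (s i : ℂ) ≠ 0 := by exact_mod_cast hs i
  have h2 : (s j : ℂ) ≠ 0 := by exact_mod_cast hs j
  have h3 : (c i : ℂ) ≠ 0 := by exact_mod_cast hc i
  unfold velκ
  by_cases h : i = j
  · subst h
    simp [Matrix.mul_diagonal, Matrix.diagonal_mul]
    field_simp
    ring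
  · simp [Matrix.mul_diagonal, Matrix.diagonal_mul, h]
    field_simp
    ring

lemma velκ_conj_right {n : ℕ} {c s D : RVec n} (hc : ∀ i, c i ≠ 0) (hs : ∀ i, s i ≠ 0)
    (η θ : Mat n) :
    (-η) * dg (fun i => c i / s i) - dg (fun i => D i / (c i * s i))
      - dg (fun i => c i / s i) * (-θ) =
    - (dg (fun i => (s i)⁻¹) * velκ s c D η θ * dg (fun i => (s i)⁻¹)) := by
  ext i j
  have h1 : (s i : ℂ) ≠ 0 := by exact_mod_cast hs i
  have h2 : (s j : ℂ) ≠ 0 := by exact_mod_cast hs j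
  have h3 : (c i : ℂ) ≠ 0 := by exact_mod_cast hc i
  unfold velκ
  by_cases h : i = j
  · subst h
    simp [Matrix.mul_diagonal, Matrix.diagonal_mul]
    field_simp
    ring
  · simp [Matrix.mul_diagonal, Matrix.diagonal_mul, h]
    field_simp
    ring

variable {n : ℕ} {σ : Mat n} {x y : ℝ} {S Γ C : RVec n} {ρ τ k l r m om ν : Mat n}

lemma IsFrame.s_ne (F : IsFrame σ x y S Γ C ρ τ k l r m om ν) (i : Fin n) : x / y * S i ≠ 0 :=
  mul_ne_zero (div_ne_zero F.x_pos.ne' F.y_pos.ne') (F.S_ne i)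

/-- The adjoint of the relation for σ†ρ, solved for σr, which is the combination that occurs in ν.
-/
lemma IsFrame.rel' (F : IsFrame σ x y S Γ C ρ τ k l r m om ν) :
    ρᴴ * σ * r = dg (fun i => (S i)⁻¹) * (l * mᴴ) * dg S := by
  have h : σᴴ * ρ * dg S = r * dg S * (m * lᴴ) := by
    rw [← Matrix.mul_assoc, ← F.rel, Matrix.mul_assoc _ l, mul_eq_one_comm.1 F.l_u, Matrix.mul_one]
  have h' : dg S * (ρᴴ * σ) = l * mᴴ * (dg S * rᴴ) := by
    have := congrArg Matrix.conjTranspose h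
    simpa only [Matrix.conjTranspose_mul, Matrix.conjTranspose_conjTranspose, dg_conjTranspose]
      using this
  calc ρᴴ * σ * r = dg (fun i => (S i)⁻¹) * dg S * (ρᴴ * σ * r) := by
        rw [dg_inv_mul F.S_ne, Matrix.one_mul]
    _ = dg (fun i => (S i)⁻¹) * (dg S * (ρᴴ * σ)) * r := by simp only [Matrix.mul_assoc]
    _ = dg (fun i => (S i)⁻¹) * (l * mᴴ) * dg S * (rᴴ * r) := by
        rw [h']; simp only [Matrix.mul_assoc]
    _ = _ := by rw [F.r_u, Matrix.mul_one]

variable {D : RVec n} {ξ χ η θ ζ μ vom vν : Mat n}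

/-- With s = (x/y)S one has ν = y²ρ(Γ/S)τ† - σr(C/s)τ†. Its derivative consists of two variations of
the form `vel_N_eq`; in the second, σr is replaced by means of `IsFrame.rel'`. -/
lemma IsFrameVel.ν_half (F : IsFrame σ x y S Γ C ρ τ k l r m om ν)
    (V : IsFrameVel σ x y S Γ C ρ τ k l r m om ν D ξ χ η θ ζ μ vom vν) :
    (((y ^ 2 : ℝ) : ℂ)⁻¹) • (ρᴴ * vν * τ) =
      (ξ * dg (fun i => Γ i / S i) - dg (fun i => D i / (Γ i * S i)) - dg (fun i => Γ i / S i) * χ)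
      + (((x ^ 2 : ℝ) : ℂ)⁻¹) • (dg (fun i => (S i)⁻¹) * (l * mᴴ) *
        (velκ (fun i => x / y * S i) C D (-ζ) (-χ)) * dg (fun i => (S i)⁻¹)) := by
  set s : RVec n := fun i => x / y * S i with hs
  have hxy : x / y ≠ 0 := div_ne_zero F.x_pos.ne' F.y_pos.ne'
  have si : dg s * dg (fun i => (s i)⁻¹) = 1 := dg_mul_inv F.s_ne
  have e1 : ρᴴ * vν * τ = ρᴴ * (vν * τ * dg s) * dg (fun i => (s i)⁻¹) := by
    calc ρᴴ * vν * τ = ρᴴ * (vν * τ) * (dg s * dg (fun i => (s i)⁻¹)) := by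
          rw [si, Matrix.mul_one, Matrix.mul_assoc]
      _ = _ := by simp only [Matrix.mul_assoc]
  have e2 : ν * τ = (((x * y : ℝ) : ℂ) • (ρ * dg Γ) - σ * r * dg C) * dg (fun i => (s i)⁻¹) := by
    rw [← F.ν_eq, Matrix.mul_assoc _ (dg _), si, Matrix.mul_one]
  set N₁ := ξ * dg Γ + dg (fun i => S i ^ 2 * D i / Γ i) + dg Γ * η with hN₁
  set N₂ := ζ * dg C + dg (fun i => s i ^ 2 * D i / C i) + dg C * η with hN₂
  set M := χ * dg s + dg (fun i => s i * D i) + dg s * η with hM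
  have hv := V.ν_eq
  change vν * τ * dg s = ((x * y : ℝ) : ℂ) • (ρ * N₁) - σ * r * N₂ - ν * τ * M at hv
  have e3 : ρᴴ * vν * τ = ((x * y : ℝ) : ℂ) •
        ((N₁ - dg Γ * dg (fun i => (s i)⁻¹) * M) * dg (fun i => (s i)⁻¹))
      - ρᴴ * σ * r * ((N₂ - dg C * dg (fun i => (s i)⁻¹) * M) * dg (fun i => (s i)⁻¹)) := by
    have c1 (X : Mat n) : ρᴴ * (ρ * X) = X := by rw [← Matrix.mul_assoc, F.ρ_u, Matrix.one_mul]
    rw [e1, hv, e2]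
    simp only [Matrix.mul_sub, Matrix.sub_mul, Matrix.mul_smul, Matrix.smul_mul, smul_sub,
      Matrix.mul_assoc, c1]
    abel
  have hM' : dg Γ * dg (fun i => (s i)⁻¹) * M = dg Γ * dg (fun i => (S i)⁻¹) *
      (χ * dg S + dg (fun i => S i * D i) + dg S * η) := by
    ext i j
    have h1 : (S i : ℂ) ≠ 0 := by exact_mod_cast F.S_ne i
    have h2 : (x : ℂ) ≠ 0 := by exact_mod_cast F.x_pos.ne'
    have h3 : (y : ℂ) ≠ 0 := by exact_mod_cast F.y_pos.ne'
    rw [hM, dg_mul_dg, dg_mul_dg]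
    by_cases h : i = j
    · subst h
      simp [Matrix.mul_diagonal, Matrix.diagonal_mul, hs]
      field_simp
    · simp [Matrix.mul_diagonal, Matrix.diagonal_mul, h, hs]
      field_simp
  have hsi : dg (fun i => (s i)⁻¹) = ((y / x : ℝ) : ℂ) • dg (fun i => (S i)⁻¹) := by
    rw [dg, dg, ← Matrix.diagonal_smul]
    congr 1; funext i
    have := F.x_pos.ne'; have := F.y_pos.ne'; have := F.S_ne i
    simp [hs]
    rw [mul_comm]
  have hSs : dg S = ((y / x : ℝ) : ℂ) • dg s := by
    rw [dg, dg, ← Matrix.diagonal_smul]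
    congr 1; funext i
    have := F.x_pos.ne'; have := F.y_pos.ne'
    simp only [hs, Pi.smul_apply, smul_eq_mul, ← Complex.ofReal_mul]
    congr 1; field_simp
  have hSv : dg S * (ζ * dg (fun i => C i / s i) - dg (fun i => D i / (C i * s i))
      - dg (fun i => C i / s i) * χ) = ((y / x : ℝ) : ℂ) •
      (- (velκ s C D (-ζ) (-χ) * dg (fun i => (s i)⁻¹))) := by
    rw [hSs, Matrix.smul_mul, velκ_conj_left (fun i => (F.C_pos i).ne') F.s_ne]
  rw [e3, vel_N_eq (fun i => (F.C_pos i).ne') F.s_ne F.C_sq, hM', F.rel', Matrix.mul_assoc _ (dg S),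
    hSv, hsi, Matrix.mul_smul, vel_N_eq (fun i => (F.Γ_pos i).ne') F.S_ne F.Γ_sq]
  have hx : (x : ℂ) ≠ 0 := by exact_mod_cast F.x_pos.ne'
  have hy : (y : ℂ) ≠ 0 := by exact_mod_cast F.y_pos.ne'
  simp only [Matrix.mul_smul, Matrix.mul_neg, smul_neg, sub_neg_eq_add, smul_add, smul_smul,
    ← Matrix.mul_assoc]
  congr 1
  · convert one_smul ℂ _ using 2
    push_cast; field_simp
  · congr 1
    push_cast; field_simp

/-- With s = (x/y)S one has x⁻¹ω = k†(C/s)m - x⁻²k†(Γ/S)l, and both terms are differentiated by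
`vel_W_eq`. -/
lemma IsFrameVel.om_half (F : IsFrame σ x y S Γ C ρ τ k l r m om ν)
    (V : IsFrameVel σ x y S Γ C ρ τ k l r m om ν D ξ χ η θ ζ μ vom vν) :
    ((x : ℂ)⁻¹) • (k * vom * mᴴ) =
      ((-η) * dg (fun i => C i / (x / y * S i)) - dg (fun i => D i / (C i * (x / y * S i)))
        - dg (fun i => C i / (x / y * S i)) * (-μ))
      + (((x ^ 2 : ℝ) : ℂ)⁻¹) • (dg (fun i => (S i)⁻¹) * velκ S Γ D η θ *
        dg (fun i => (S i)⁻¹) * (l * mᴴ)) := by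
  set s : RVec n := fun i => x / y * S i with hs
  have si : dg (fun i => (S i)⁻¹) * dg S = 1 := dg_inv_mul F.S_ne
  have hx : (x : ℂ) ≠ 0 := by exact_mod_cast F.x_pos.ne'
  have hy : (y : ℂ) ≠ 0 := by exact_mod_cast F.y_pos.ne'
  have mm : m * mᴴ = 1 := mul_eq_one_comm.1 F.m_u
  have e1 : k * vom * mᴴ = dg (fun i => (S i)⁻¹) * (dg S * k * vom) * mᴴ := by
    rw [← Matrix.mul_assoc, ← Matrix.mul_assoc (dg _) (dg S), si, Matrix.one_mul]
  have e2 : k * om = dg (fun i => (S i)⁻¹) *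
      ((y : ℂ) • (dg C * m) - ((x : ℂ)⁻¹) • (dg Γ * l)) := by
    rw [← F.om_eq, ← Matrix.mul_assoc, ← Matrix.mul_assoc, si, Matrix.one_mul]
  set W₁ := χ * dg Γ + dg (fun i => S i ^ 2 * D i / Γ i) + dg Γ * θ with hW₁
  set W₂ := χ * dg C + dg (fun i => s i ^ 2 * D i / C i) + dg C * μ with hW₂
  set M := χ * dg S + dg (fun i => S i * D i) + dg S * η with hM
  have hv := V.om_eq
  change dg S * k * vom = (y : ℂ) • (W₂ * m) - ((x : ℂ)⁻¹) • (W₁ * l) - M * k * om at hv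
  have e3 : k * vom * mᴴ =
      (y : ℂ) • (dg (fun i => (S i)⁻¹) * (W₂ - M * dg (fun i => (S i)⁻¹) * dg C))
      - ((x : ℂ)⁻¹) • (dg (fun i => (S i)⁻¹) * (W₁ - M * dg (fun i => (S i)⁻¹) * dg Γ) * (l * mᴴ)) := by
    rw [e1, hv, Matrix.mul_assoc M, e2]
    simp only [Matrix.mul_sub, Matrix.sub_mul, Matrix.mul_smul, Matrix.smul_mul, smul_sub,
      Matrix.mul_assoc, mm, Matrix.mul_one]
    abel
  have hM' : dg (fun i => (S i)⁻¹) * (W₂ - M * dg (fun i => (S i)⁻¹) * dg C) =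
      ((x / y : ℝ) : ℂ) • (dg (fun i => (s i)⁻¹) * (W₂ -
      (χ * dg s + dg (fun i => s i * D i) + dg s * η) * dg (fun i => (s i)⁻¹) * dg C)) := by
    ext i j
    have h1 : (S i : ℂ) ≠ 0 := by exact_mod_cast F.S_ne i
    have h1' : (S j : ℂ) ≠ 0 := by exact_mod_cast F.S_ne j
    rw [hM]
    by_cases h : i = j
    · subst h
      simp [Matrix.mul_diagonal, Matrix.diagonal_mul, hs]
      field_simp
    · simp [Matrix.mul_diagonal, Matrix.diagonal_mul, h, hs]
      field_simp
  rw [e3, hM', vel_W_eq (fun i => (F.C_pos i).ne') F.s_ne F.C_sq,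
    vel_W_eq (fun i => (F.Γ_pos i).ne') F.S_ne F.Γ_sq,
    velκ_conj_right (fun i => (F.Γ_pos i).ne') F.S_ne]
  simp only [Matrix.neg_mul (_ * _ * _), smul_neg, sub_neg_eq_add, smul_add, smul_smul]
  congr 1
  · convert one_smul ℂ _ using 2
    push_cast; field_simp
  · congr 1
    push_cast; field_simp

end LeafForm
end HeisenbergDouble

namespace HeisenbergDouble
-- From the leaf form to the canonical form.
section LeafFormReal

variable {n : ℕ} {σ : Mat n} {x y : ℝ} {S Γ C : RVec n} {ρ τ k l r m om ν : Mat n}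
  {D D' : RVec n} {ξ χ η θ ζ μ vom vν ξ' χ' η' θ' ζ' μ' vom' vν' : Mat n}

/-- One half of the form on the leaf, in terms of Cartan decompositions. -/
noncomputable def leafHalf (x y : ℝ) (S Γ C : RVec n) (ρ τ k m vom vν : Mat n) (D' : RVec n)
    (χ' η' θ' ζ' : Mat n) : ℂ :=
  (((y ^ 2 : ℝ) : ℂ)⁻¹) * (vν * (τ * velκ S Γ D' η' θ' * ρᴴ)).trace
    + (x : ℂ)⁻¹ * (vom * (mᴴ * velκ (fun i => x / y * S i) C D' (-ζ') (-χ') * k)).trace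

/-- One half of the reduced form. -/
noncomputable def redHalf (S : RVec n) (ξ θ ζ μ : Mat n) (D' : RVec n) (θ' ζ' : Mat n) : ℂ :=
  (dg D' * (ξ - ζ + μ - θ)).trace - (dg S * ξ * dg (fun i => (S i)⁻¹) * θ').trace
    - (dg (fun i => (S i)⁻¹) * μ * dg S * ζ').trace

lemma dg_scale_conj {a : ℝ} (ha : a ≠ 0) (S : RVec n) (X : Mat n) :
    dg (fun i => a * S i) * X * dg (fun i => (a * S i)⁻¹) = dg S * X * dg (fun i => (S i)⁻¹) := by
  ext i j
  have : (a : ℂ) ≠ 0 := by exact_mod_cast ha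
  simp [Matrix.mul_diagonal, Matrix.diagonal_mul]
  field_simp

lemma dg_scale_conj' {a : ℝ} (ha : a ≠ 0) (S : RVec n) (X : Mat n) :
    dg (fun i => (a * S i)⁻¹) * X * dg (fun i => a * S i) = dg (fun i => (S i)⁻¹) * X * dg S := by
  ext i j
  have : (a : ℂ) ≠ 0 := by exact_mod_cast ha
  simp [Matrix.mul_diagonal, Matrix.diagonal_mul]
  field_simp

/-- The two traces with the factor x⁻² come from the second parts of ν' and ω'. They are exchanged
when the two tangent vectors are exchanged, so they do not contribute to the antisymmetric form. -/
lemma leafHalf_eq (F : IsFrame σ x y S Γ C ρ τ k l r m om ν)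
    (V : IsFrameVel σ x y S Γ C ρ τ k l r m om ν D ξ χ η θ ζ μ vom vν) :
    leafHalf x y S Γ C ρ τ k m vom vν D' χ' η' θ' ζ' =
    ((ξ * dg (fun i => Γ i / S i) - dg (fun i => D i / (Γ i * S i)) - dg (fun i => Γ i / S i) * χ)
      * velκ S Γ D' η' θ').trace
    + (((-η) * dg (fun i => C i / (x / y * S i)) - dg (fun i => D i / (C i * (x / y * S i)))
        - dg (fun i => C i / (x / y * S i)) * (-μ)) *
          velκ (fun i => x / y * S i) C D' (-ζ') (-χ')).trace
    + (((x ^ 2 : ℝ) : ℂ)⁻¹) *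
      (((l * mᴴ) * velκ (fun i => x / y * S i) C D (-ζ) (-χ) * dg (fun i => (S i)⁻¹) *
        velκ S Γ D' η' θ' * dg (fun i => (S i)⁻¹)).trace
      + ((l * mᴴ) * velκ (fun i => x / y * S i) C D' (-ζ') (-χ') * dg (fun i => (S i)⁻¹) *
        velκ S Γ D η θ * dg (fun i => (S i)⁻¹)).trace) := by
  have e1 : (((y ^ 2 : ℝ) : ℂ)⁻¹) * (vν * (τ * velκ S Γ D' η' θ' * ρᴴ)).trace =
      (((((y ^ 2 : ℝ) : ℂ)⁻¹) • (ρᴴ * vν * τ)) * velκ S Γ D' η' θ').trace := by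
    rw [Matrix.smul_mul, Matrix.trace_smul, smul_eq_mul, ← Matrix.mul_assoc,
      Matrix.trace_mul_comm _ ρᴴ]
    simp only [Matrix.mul_assoc]
  have e2 : (x : ℂ)⁻¹ * (vom * (mᴴ * velκ (fun i => x / y * S i) C D' (-ζ') (-χ') * k)).trace =
      (((x : ℂ)⁻¹ • (k * vom * mᴴ)) * velκ (fun i => x / y * S i) C D' (-ζ') (-χ')).trace := by
    rw [Matrix.smul_mul, Matrix.trace_smul, smul_eq_mul, ← Matrix.mul_assoc,
      Matrix.trace_mul_comm _ k]
    simp only [Matrix.mul_assoc]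
  rw [leafHalf, e1, e2, V.ν_half F, V.om_half F]
  simp only [Matrix.add_mul, Matrix.trace_add, Matrix.smul_mul, Matrix.trace_smul, smul_eq_mul]
  have e3 (a b : Mat n) : (dg (fun i => (S i)⁻¹) * (l * mᴴ) * a * dg (fun i => (S i)⁻¹) * b).trace
      = (l * mᴴ * a * dg (fun i => (S i)⁻¹) * b * dg (fun i => (S i)⁻¹)).trace := by
    rw [Matrix.trace_mul_comm _ (dg _)]
    simp only [Matrix.mul_assoc]
  have e4 (a b : Mat n) : (dg (fun i => (S i)⁻¹) * a * dg (fun i => (S i)⁻¹) * (l * mᴴ) * b).trace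
      = (l * mᴴ * b * dg (fun i => (S i)⁻¹) * a * dg (fun i => (S i)⁻¹)).trace := by
    rw [Matrix.mul_assoc (_ * _ * _) (l * mᴴ), Matrix.trace_mul_comm]
    simp only [Matrix.mul_assoc]
  rw [e3, e4]
  ring

/-- `shape_im` is applied once with (Γ, S) for k_L and once with (C, s) for k_R. In the sum, the
terms with χ and η, which belong to the common factors τ and k, are symmetric in the two tangent
vectors and cancel. -/
lemma leafHalf_sub_leafHalf (F : IsFrame σ x y S Γ C ρ τ k l r m om ν)
    (V : IsFrameVel σ x y S Γ C ρ τ k l r m om ν D ξ χ η θ ζ μ vom vν)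
    (V' : IsFrameVel σ x y S Γ C ρ τ k l r m om ν D' ξ' χ' η' θ' ζ' μ' vom' vν') :
    (leafHalf x y S Γ C ρ τ k m vom vν D' χ' η' θ' ζ').im
      - (leafHalf x y S Γ C ρ τ k m vom' vν' D χ η θ ζ).im =
    (redHalf S ξ θ ζ μ D' θ' ζ').im - (redHalf S ξ' θ' ζ' μ' D θ ζ).im := by
  have hxy : x / y ≠ 0 := div_ne_zero F.x_pos.ne' F.y_pos.ne'
  have ns {X : Mat n} (h : Xᴴ = -X) : (-X)ᴴ = -(-X) := by rw [Matrix.conjTranspose_neg, h]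
  rw [leafHalf_eq F V, leafHalf_eq F V']
  simp only [Complex.add_im]
  have s1 := shape_im (D := D) (D' := D') (fun i => (F.Γ_pos i).ne') F.S_ne F.Γ_sq V.ξ_skew
    V.χ_skew V'.η_skew V'.θ_skew
  have s2 := shape_im (D := D) (D' := D') (fun i => (F.C_pos i).ne') F.s_ne F.C_sq (ns V.η_skew)
    (ns V.μ_skew) (ns V'.ζ_skew) (ns V'.χ_skew)
  have s1' := shape_im (D := D') (D' := D) (fun i => (F.Γ_pos i).ne') F.S_ne F.Γ_sq V'.ξ_skew
    V'.χ_skew V.η_skew V.θ_skew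
  have s2' := shape_im (D := D') (D' := D) (fun i => (F.C_pos i).ne') F.s_ne F.C_sq (ns V'.η_skew)
    (ns V'.μ_skew) (ns V.ζ_skew) (ns V.χ_skew)
  have e1 (a b : Mat n) : (dg (fun i => (S i)⁻¹) * a * dg S * b).trace =
      (dg S * b * dg (fun i => (S i)⁻¹) * a).trace := by
    rw [Matrix.mul_assoc (_ * a), Matrix.trace_mul_comm, ← Matrix.mul_assoc]
  rw [dg_scale_conj hxy, dg_scale_conj' hxy] at s2 s2'
  simp only [Matrix.mul_neg, Matrix.neg_mul, neg_neg, sub_neg_eq_add, e1 χ, e1 χ'] at s1 s2 s1' s2'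
  simp only [velκ, Matrix.mul_neg, Matrix.neg_mul, sub_neg_eq_add]
  rw [s1, s2, s1', s2']
  simp only [redHalf, Matrix.mul_sub, Matrix.trace_add, Matrix.trace_sub,
    Complex.add_im, Complex.sub_im, Complex.neg_im, Matrix.mul_neg, Matrix.trace_neg,
    Complex.mul_im, mul_add]
  ring

/-- The real part of a matrix. -/
def reM (M : Mat n) : RMat n := M.map Complex.re

/-- The imaginary part of a matrix. -/
def imM (M : Mat n) : RMat n := M.map Complex.im

/-- A real matrix as a complex one. -/
def ofRealM (M : RMat n) : Mat n := M.map Complex.ofReal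

lemma reM_mul (M N : Mat n) : reM (M * N) = reM M * reM N - imM M * imM N := by
  ext i j
  simp [reM, imM, Matrix.mul_apply, Complex.re_sum, Complex.mul_re, Finset.sum_sub_distrib]

lemma imM_mul (M N : Mat n) : imM (M * N) = reM M * imM N + imM M * reM N := by
  ext i j
  simp [reM, imM, Matrix.mul_apply, Complex.im_sum, Complex.mul_im, Finset.sum_add_distrib]

@[simp] lemma reM_dg (f : RVec n) : reM (dg f) = Matrix.diagonal f := by
  ext i j
  by_cases h : i = j
  · subst h; simp [reM]
  · simp [reM, h]

@[simp] lemma imM_dg (f : RVec n) : imM (dg f) = 0 := by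
  ext i j
  by_cases h : i = j
  · subst h; simp [imM]
  · simp [imM, h]

@[simp] lemma reM_ofRealM (M : RMat n) : reM (ofRealM M) = M := by ext i j; simp [reM, ofRealM]

@[simp] lemma imM_ofRealM (M : RMat n) : imM (ofRealM M) = 0 := by ext i j; simp [imM, ofRealM]

lemma reM_add (M N : Mat n) : reM (M + N) = reM M + reM N := by ext i j; simp [reM]
lemma imM_add (M N : Mat n) : imM (M + N) = imM M + imM N := by ext i j; simp [imM]
lemma reM_sub (M N : Mat n) : reM (M - N) = reM M - reM N := by ext i j; simp [reM]
lemma imM_sub (M N : Mat n) : imM (M - N) = imM M - imM N := by ext i j; simp [imM]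

lemma reM_skew {X : Mat n} (h : Xᴴ = -X) : (reM X)ᵀ = -reM X := by
  ext i j
  simp [reM, skew_apply h i j]

lemma imM_skew {X : Mat n} (h : Xᴴ = -X) : (imM X)ᵀ = imM X := by
  ext i j
  simp [imM, skew_apply h i j]

lemma trace_im (M : Mat n) : M.trace.im = (imM M).trace := by
  simp [Matrix.trace, imM, Complex.im_sum]

lemma redHalf_im (S : RVec n) (ξ θ ζ μ : Mat n) (D' : RVec n) (θ' ζ' : Mat n) :
    (redHalf S ξ θ ζ μ D' θ' ζ').im =
    halfForm S (reM ξ) (imM ξ) (imM ζ) (reM μ) (imM μ) (imM θ) D' (reM θ') (imM θ') (reM ζ')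
      (imM ζ') := by
  have hS : (fun i => (S i)⁻¹) = S⁻¹ := rfl
  have c1 (a b : RMat n) : (Matrix.diagonal S⁻¹ * a * Matrix.diagonal S * b).trace =
      (a * (Matrix.diagonal S * b * Matrix.diagonal S⁻¹)).trace := by
    rw [Matrix.mul_assoc, Matrix.mul_assoc, Matrix.trace_mul_comm]
    simp only [Matrix.mul_assoc]
  simp only [redHalf, halfForm, Complex.sub_im, trace_im, imM_mul, reM_mul, reM_dg, imM_dg, hS,
    Matrix.zero_mul, Matrix.mul_zero, add_zero, zero_add, sub_zero, imM_add, imM_sub,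
    Matrix.trace_add, c1]
  ring

/-- The diagonal matrix of phases. -/
noncomputable def phase (p : RVec n) : Mat n :=
  Matrix.diagonal fun i => Complex.exp (Complex.I * (p i : ℂ))

lemma phase_conjTranspose_mul (p : RVec n) : (phase p)ᴴ * phase p = 1 := by
  rw [phase, Matrix.diagonal_conjTranspose, Matrix.diagonal_mul_diagonal, ← Matrix.diagonal_one]
  congr 1; funext i
  simp [← Complex.exp_conj, ← Complex.exp_add]

lemma phase_mul_conjTranspose (p : RVec n) : phase p * (phase p)ᴴ = 1 :=
  mul_eq_one_comm.1 (phase_conjTranspose_mul p)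

lemma phase_comm_dg (p f : RVec n) : phase p * dg f = dg f * phase p := by
  simp [phase, Matrix.diagonal_mul_diagonal, mul_comm]

lemma phase_star_comm_dg (p f : RVec n) : (phase p)ᴴ * dg f = dg f * (phase p)ᴴ := by
  simp [phase, Matrix.diagonal_mul_diagonal, mul_comm, Matrix.diagonal_conjTranspose]

/-- Conjugation by phases. -/
noncomputable def unphase (p : RVec n) (X : Mat n) : Mat n := (phase p)ᴴ * X * phase p

lemma unphase_skew (p : RVec n) {X : Mat n} (h : Xᴴ = -X) : (unphase p X)ᴴ = -unphase p X := by
  simp only [unphase, Matrix.conjTranspose_mul, Matrix.conjTranspose_conjTranspose, h,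
    Matrix.mul_neg, Matrix.neg_mul, Matrix.mul_assoc]

/-- Diagonal phases commute with S and D and cancel inside the traces. This permits passing from T
to the real matrix exp(-ip)T. -/
lemma redHalf_unphase (p : RVec n) (S : RVec n) (ξ θ ζ μ : Mat n) (D' : RVec n) (θ' ζ' : Mat n) :
    redHalf S ξ θ (unphase p ζ) (unphase p μ) D' θ' (unphase p ζ') = redHalf S ξ θ ζ μ D' θ' ζ' := by
  have h1 (f : RVec n) (X : Mat n) : (dg f * unphase p X).trace = (dg f * X).trace := by
    rw [unphase, ← Matrix.mul_assoc, ← Matrix.mul_assoc, ← phase_star_comm_dg,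
      Matrix.trace_mul_comm, ← Matrix.mul_assoc, ← Matrix.mul_assoc, phase_mul_conjTranspose,
      Matrix.one_mul]
  have h2 : (dg (fun i => (S i)⁻¹) * unphase p μ * dg S * unphase p ζ').trace =
      (dg (fun i => (S i)⁻¹) * μ * dg S * ζ').trace := by
    have : dg (fun i => (S i)⁻¹) * unphase p μ * dg S * unphase p ζ' =
        (phase p)ᴴ * (dg (fun i => (S i)⁻¹) * μ * dg S * ζ' * phase p) := by
      calc _ = (dg (fun i => (S i)⁻¹) * (phase p)ᴴ) * μ * (phase p * dg S) * (phase p)ᴴ * ζ' * phase p := by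
            simp only [unphase, Matrix.mul_assoc]
        _ = (phase p)ᴴ * (dg (fun i => (S i)⁻¹) * μ * dg S * (phase p * (phase p)ᴴ) * ζ' * phase p) := by
            rw [← phase_star_comm_dg, phase_comm_dg]; simp only [Matrix.mul_assoc]
        _ = _ := by rw [phase_mul_conjTranspose, Matrix.mul_one]
    rw [this, Matrix.trace_mul_comm, Matrix.mul_assoc, phase_mul_conjTranspose, Matrix.mul_one]
  simp only [redHalf, Matrix.mul_add, Matrix.mul_sub, Matrix.trace_add, Matrix.trace_sub, h1, h2]

/-- The derivative, at constant σ, of the relation between σ†ρ, r and T = m l†. -/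
lemma IsFrameVel.rel' (F : IsFrame σ x y S Γ C ρ τ k l r m om ν)
    (V : IsFrameVel σ x y S Γ C ρ τ k l r m om ν D ξ χ η θ ζ μ vom vν) :
    (m * lᴴ) * (dg S * ξ * dg (fun i => (S i)⁻¹) - dg D + θ) =
      (dg S * ζ * dg (fun i => (S i)⁻¹) - dg D + μ) * (m * lᴴ) := by
  have SS := dg_inv_mul F.S_ne
  have SS' := dg_mul_inv F.S_ne
  have ll : l * lᴴ = 1 := mul_eq_one_comm.1 F.l_u
  have mm : m * mᴴ = 1 := mul_eq_one_comm.1 F.m_u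
  have h0 : σᴴ * ρ = r * (dg S * (m * lᴴ) * dg (fun i => (S i)⁻¹)) := by
    have : σᴴ * ρ * dg S = r * dg S * (m * lᴴ) := by
      rw [← Matrix.mul_assoc, ← F.rel, Matrix.mul_assoc _ l, ll, Matrix.mul_one]
    calc σᴴ * ρ = σᴴ * ρ * dg S * dg (fun i => (S i)⁻¹) := by
          rw [Matrix.mul_assoc _ (dg S), SS', Matrix.mul_one]
      _ = _ := by rw [this]; simp only [Matrix.mul_assoc]
  have dS : dg (fun i => S i * D i) = dg S * dg D := (dg_mul_dg _ _).symm
  have e1 : (m * lᴴ) * (dg (fun i => (S i)⁻¹) * ξ * dg S + dg D + θ) =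
      (dg (fun i => (S i)⁻¹) * ζ * dg S + dg D + μ) * (m * lᴴ) := by
    have h1 := V.rel
    rw [h0, dS] at h1
    have h2 := congrArg (fun M => dg (fun i => (S i)⁻¹) * (rᴴ * M) * lᴴ) h1
    beta_reduce at h2
    have a1 : dg (fun i => (S i)⁻¹) * (rᴴ * (r * (dg S * (m * lᴴ) * dg (fun i => (S i)⁻¹)) *
        (ξ * dg S + dg S * dg D + dg S * θ) * l)) * lᴴ =
        (dg (fun i => (S i)⁻¹) * ((rᴴ * r) * dg S)) * ((m * lᴴ) * (dg (fun i => (S i)⁻¹) * ξ * dg S +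
          (dg (fun i => (S i)⁻¹) * dg S) * dg D + (dg (fun i => (S i)⁻¹) * dg S) * θ)) * (l * lᴴ) := by
      simp only [Matrix.mul_assoc, Matrix.mul_add, Matrix.add_mul]
    have a2 : dg (fun i => (S i)⁻¹) * (rᴴ * (r * (ζ * dg S + dg S * dg D + dg S * μ) * m)) * lᴴ =
        dg (fun i => (S i)⁻¹) * (rᴴ * r) * (ζ * dg S + dg S * dg D + dg S * μ) * (m * lᴴ) := by
      simp only [Matrix.mul_assoc]
    rw [a1, a2, F.r_u, Matrix.one_mul, SS, Matrix.mul_one, Matrix.one_mul, ll, Matrix.mul_one,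
      Matrix.one_mul, Matrix.one_mul] at h2
    rw [h2, Matrix.mul_add, Matrix.mul_add, ← Matrix.mul_assoc _ (dg S) μ,
      ← Matrix.mul_assoc _ (dg S) (dg D), SS, Matrix.one_mul, Matrix.one_mul, ← Matrix.mul_assoc _ ζ]
  -- Taking adjoints turns S⁻¹ξS into -SξS⁻¹ and leaves D unchanged; this is why D carries a minus
  -- sign in the conclusion.
  have e2 := congrArg (fun M => (m * lᴴ) * Mᴴ * (m * lᴴ)) e1
  simp only [Matrix.conjTranspose_mul, Matrix.conjTranspose_add, dg_conjTranspose,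
    Matrix.conjTranspose_conjTranspose, V.ξ_skew, V.θ_skew, V.ζ_skew, V.μ_skew] at e2
  have tt : m * lᴴ * (l * mᴴ) = 1 := by
    rw [Matrix.mul_assoc, ← Matrix.mul_assoc lᴴ, F.l_u, Matrix.one_mul, mm]
  have tt' : l * mᴴ * (m * lᴴ) = 1 := by
    rw [Matrix.mul_assoc, ← Matrix.mul_assoc mᴴ, F.m_u, Matrix.one_mul, ll]
  rw [Matrix.mul_assoc, Matrix.mul_assoc _ (l * mᴴ) (m * lᴴ), tt', Matrix.mul_one,
    ← Matrix.mul_assoc (m * lᴴ) (l * mᴴ), tt, Matrix.one_mul] at e2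
  simp only [Matrix.neg_mul, Matrix.mul_neg, ← Matrix.mul_assoc (dg _) (_)] at e2
  have n1 (a θ : Mat n) : a - dg D + θ = -(-a + dg D + -θ) := by abel
  rw [n1, n1 (_ * _ * _) μ, Matrix.mul_neg, Matrix.neg_mul, e2]

variable {p : RVec n} {T : RMat n}

lemma IsFrameVel.rel_real (F : IsFrame σ x y S Γ C ρ τ k l r m om ν)
    (V : IsFrameVel σ x y S Γ C ρ τ k l r m om ν D ξ χ η θ ζ μ vom vν)
    (hT : Tᵀ * T = 1) (hml : m * lᴴ = phase p * ofRealM T) :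
    ofRealM T * (dg S * ξ * dg (fun i => (S i)⁻¹) - dg D + θ) * ofRealM Tᵀ =
      dg S * unphase p ζ * dg (fun i => (S i)⁻¹) - dg D + unphase p μ := by
  have h := V.rel' F
  rw [hml] at h
  have hTc : ofRealM T * ofRealM Tᵀ = 1 := by
    have : ofRealM T * ofRealM Tᵀ = ofRealM (T * Tᵀ) := by
      ext i j; simp [ofRealM, Matrix.mul_apply]
    rw [this, mul_eq_one_comm.1 hT]; ext i j; simp [ofRealM, Matrix.one_apply, apply_ite]
  have h2 := congrArg (fun M => (phase p)ᴴ * M * ofRealM Tᵀ) h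
  beta_reduce at h2
  have a1 (X : Mat n) : (phase p)ᴴ * (phase p * ofRealM T * X) * ofRealM Tᵀ =
      ofRealM T * X * ofRealM Tᵀ := by
    rw [← Matrix.mul_assoc, ← Matrix.mul_assoc, phase_conjTranspose_mul, Matrix.one_mul]
  have a2 (X : Mat n) : (phase p)ᴴ * (X * (phase p * ofRealM T)) * ofRealM Tᵀ = unphase p X := by
    rw [Matrix.mul_assoc, Matrix.mul_assoc, Matrix.mul_assoc, hTc, Matrix.mul_one, unphase,
      Matrix.mul_assoc]
  rw [a1, a2] at h2
  rw [h2]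
  have b1 : unphase p (dg S * ζ * dg (fun i => (S i)⁻¹)) =
      dg S * unphase p ζ * dg (fun i => (S i)⁻¹) := by
    calc _ = ((phase p)ᴴ * dg S) * ζ * (dg (fun i => (S i)⁻¹) * phase p) := by
          simp only [unphase, Matrix.mul_assoc]
      _ = _ := by rw [phase_star_comm_dg, ← phase_comm_dg]; simp only [unphase, Matrix.mul_assoc]
  have b2 : unphase p (dg D) = dg D := by
    rw [unphase, phase_star_comm_dg, Matrix.mul_assoc, phase_conjTranspose_mul, Matrix.mul_one]
  rw [← b1]
  conv_rhs => rw [← b2]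
  simp only [unphase, Matrix.mul_add, Matrix.add_mul, Matrix.mul_sub, Matrix.sub_mul]

/-- The imaginary part of the variation of `T = exp(ip) T₀` is that of the phases. -/
def HasPhaseVel (p : RVec n) (T : RMat n) (θ μ : Mat n) (Y : RVec n) : Prop :=
  imM (unphase p μ) = T * imM θ * Tᵀ + Matrix.diagonal Y

lemma IsFrameVel.realVel (F : IsFrame σ x y S Γ C ρ τ k l r m om ν)
    (V : IsFrameVel σ x y S Γ C ρ τ k l r m om ν D ξ χ η θ ζ μ vom vν)
    (hT : Tᵀ * T = 1) (hml : m * lᴴ = phase p * ofRealM T) {Y : RVec n}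
    (hY : HasPhaseVel p T θ μ Y) :
    RealVel S T (reM ξ) (imM ξ) (reM (unphase p ζ)) (imM (unphase p ζ)) (reM (unphase p μ))
      (imM (unphase p μ)) (reM θ) (imM θ) D Y where
  A_skew := reM_skew V.ξ_skew
  B_symm := imM_skew V.ξ_skew
  P_skew := reM_skew (unphase_skew p V.ζ_skew)
  Q_symm := imM_skew (unphase_skew p V.ζ_skew)
  ER_skew := reM_skew (unphase_skew p V.μ_skew)
  FR_skew := reM_skew V.θ_skew
  FI_symm := imM_skew V.θ_skew
  re_eq := by
    have h := congrArg reM (V.rel_real F hT hml)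
    simp only [reM_mul, imM_mul, reM_ofRealM, imM_ofRealM, Matrix.zero_mul, Matrix.mul_zero,
      sub_zero, reM_add, reM_sub, imM_dg, reM_dg] at h
    exact h
  im_eq := by
    have h := congrArg imM (V.rel_real F hT hml)
    simp only [reM_mul, imM_mul, reM_ofRealM, imM_ofRealM, Matrix.zero_mul, Matrix.mul_zero,
      sub_zero, add_zero, zero_add, imM_add, imM_sub, imM_dg, reM_dg] at h
    exact h
  Y_eq := hY

/-- The symplectic form on the leaf in terms of the coordinates. -/
theorem leafHalf_canonical (F : IsFrame σ x y S Γ C ρ τ k l r m om ν)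
    (V : IsFrameVel σ x y S Γ C ρ τ k l r m om ν D ξ χ η θ ζ μ vom vν)
    (V' : IsFrameVel σ x y S Γ C ρ τ k l r m om ν D' ξ' χ' η' θ' ζ' μ' vom' vν')
    (hT : Tᵀ * T = 1) (hml : m * lᴴ = phase p * ofRealM T) {Y Y' : RVec n}
    (hY : HasPhaseVel p T θ μ Y) (hY' : HasPhaseVel p T θ' μ' Y') :
    (leafHalf x y S Γ C ρ τ k m vom vν D' χ' η' θ' ζ').im
      - (leafHalf x y S Γ C ρ τ k m vom' vν' D χ η θ ζ).im =
    2 * ∑ i, (Y i * D' i - Y' i * D i) := by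
  rw [leafHalf_sub_leafHalf F V V', ← redHalf_unphase p S ξ, ← redHalf_unphase p S ξ', redHalf_im,
    redHalf_im]
  exact halfForm_sub_halfForm F.S_ne hT (V.realVel F hT hml hY) (V'.realVel F hT hml hY')

/-- In the gauge in which `ρ† v` stays real, the matrix `exp(-ip) T` stays real up to phases. -/
lemma IsFrameVel.exists_phaseVel (F : IsFrame σ x y S Γ C ρ τ k l r m om ν)
    (V : IsFrameVel σ x y S Γ C ρ τ k l r m om ν D ξ χ η θ ζ μ vom vν)
    (hT : Tᵀ * T = 1) (hml : m * lᴴ = phase p * ofRealM T)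
    (hd : ∀ i j, i ≠ j → S i ^ 2 ≠ S j ^ 2) {a ε : ℝ} {vh : RVec n}
    (hrank : Tᵀ * Matrix.diagonal (fun i => S i ^ 2) * T = Matrix.diagonal S *
      (a • (1 : RMat n) + ε • Matrix.vecMulVec vh vh) * Matrix.diagonal S)
    (hξ : imM ξ *ᵥ vh = 0) : ∃ Y, HasPhaseVel p T θ μ Y := by
  have hT' : T * Tᵀ = 1 := mul_eq_one_comm.1 hT
  set B := imM ξ with hB
  set Q := imM (unphase p ζ) with hQ
  set E := imM (unphase p μ) with hE
  have Bs : Bᵀ = B := imM_skew V.ξ_skew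
  have Qs : Qᵀ = Q := imM_skew (unphase_skew p V.ζ_skew)
  have Es : Eᵀ = E := imM_skew (unphase_skew p V.μ_skew)
  have Fs : (imM θ)ᵀ = imM θ := imM_skew V.θ_skew
  have him : T * (Matrix.diagonal S * B * Matrix.diagonal S⁻¹ + imM θ) * Tᵀ =
      Matrix.diagonal S * Q * Matrix.diagonal S⁻¹ + E := by
    have h := congrArg imM (V.rel_real F hT hml)
    simp only [reM_mul, imM_mul, reM_ofRealM, imM_ofRealM, Matrix.zero_mul, Matrix.mul_zero,
      sub_zero, add_zero, zero_add, imM_add, imM_sub, imM_dg, reM_dg] at h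
    exact h
  set Y := E - T * imM θ * Tᵀ with hYd
  have Ys : Yᵀ = Y := by
    rw [hYd, Matrix.transpose_sub, Es, Matrix.transpose_mul, Matrix.transpose_mul,
      Matrix.transpose_transpose, Fs, Matrix.mul_assoc]
  have e1 : Y = T * (Matrix.diagonal S * B * Matrix.diagonal S⁻¹) * Tᵀ
      - Matrix.diagonal S * Q * Matrix.diagonal S⁻¹ := by
    rw [Matrix.mul_add, Matrix.add_mul] at him
    rw [hYd]; linear_combination (norm := abel) -him
  have d2 : Matrix.diagonal S⁻¹ * Matrix.diagonal (fun i => S i ^ 2) = Matrix.diagonal S := by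
    rw [Matrix.diagonal_mul_diagonal]; congr 1; funext i
    have := F.S_ne i
    simp only [Pi.inv_apply]; field_simp
  have d3 : Matrix.diagonal S⁻¹ * Matrix.diagonal S = (1 : RMat n) := by
    rw [Matrix.diagonal_mul_diagonal, ← Matrix.diagonal_one]
    congr 1; funext i; simp [F.S_ne i]
  have Bv : B * Matrix.vecMulVec vh vh = 0 := by
    rw [Matrix.mul_vecMulVec, hξ, Matrix.zero_vecMulVec]
  -- Multiplying by S² allows the rank one relation to be inserted. The rank one term is annihilated
  -- by B, so only the multiple of the identity survives.
  have e2 : Y * Matrix.diagonal (fun i => S i ^ 2) =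
      a • (T * (Matrix.diagonal S * B * Matrix.diagonal S) * Tᵀ)
        - Matrix.diagonal S * Q * Matrix.diagonal S := by
    have : Tᵀ * Matrix.diagonal (fun i => S i ^ 2) =
        Matrix.diagonal S * (a • (1 : RMat n) + ε • Matrix.vecMulVec vh vh) * Matrix.diagonal S * Tᵀ := by
      rw [← hrank, Matrix.mul_assoc _ T, hT', Matrix.mul_one]
    rw [e1, Matrix.sub_mul, Matrix.mul_assoc (Matrix.diagonal S * Q), d2,
      Matrix.mul_assoc _ Tᵀ, this]
    congr 1
    calc _ = T * (Matrix.diagonal S * (B * ((Matrix.diagonal S⁻¹ * Matrix.diagonal S) *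
            (a • (1 : RMat n) + ε • Matrix.vecMulVec vh vh))) * Matrix.diagonal S) * Tᵀ := by
          simp only [Matrix.mul_assoc]
      _ = _ := by
        rw [d3, Matrix.one_mul, Matrix.mul_add, Matrix.mul_smul, Matrix.mul_smul, Bv, smul_zero,
          add_zero, Matrix.mul_one]
        simp only [Matrix.mul_smul, Matrix.smul_mul]
  -- Both Y and Y S² are symmetric, hence Y commutes with S². The S_i² are distinct, so Y is
  -- diagonal.
  have e3 : (Y * Matrix.diagonal (fun i => S i ^ 2))ᵀ = Y * Matrix.diagonal (fun i => S i ^ 2) := by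
    rw [e2]
    simp only [Matrix.transpose_sub, Matrix.transpose_smul, Matrix.transpose_mul, Bs, Qs,
      Matrix.diagonal_transpose, Matrix.transpose_transpose, Matrix.mul_assoc]
  refine ⟨fun i => Y i i, ?_⟩
  have e4 : Y = Matrix.diagonal fun i => Y i i := by
    ext i j
    by_cases h : i = j
    · subst h; simp
    · rw [Matrix.diagonal_apply_ne _ h]
      have h1 := congrFun (congrFun e3 i) j
      rw [Matrix.transpose_mul, Matrix.diagonal_transpose, Ys, Matrix.diagonal_mul,
        Matrix.mul_diagonal] at h1
      have h2 : (S i ^ 2 - S j ^ 2) * Y i j = 0 := by rw [sub_mul, h1]; ring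
      exact (mul_eq_zero.1 h2).resolve_left (sub_ne_zero.2 (hd i j h))
  unfold HasPhaseVel
  rw [← e4, hYd]; abel

end LeafFormReal
end HeisenbergDouble

namespace HeisenbergDouble
-- Block identities in U(n, n) and its tangent spaces.
section BlockRelations

variable {n : ℕ}

lemma Inn_mul_Inn : Inn n * Inn n = 1 := by
  simp [Inn, Matrix.fromBlocks_multiply]

lemma Inn_conjTranspose : (Inn n)ᴴ = Inn n := by
  simp [Inn, Matrix.fromBlocks_conjTranspose]

lemma mul_Inn_of_preserves {k : BlockMat n} (h : kᴴ * Inn n * k = Inn n) :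
    k * Inn n * kᴴ = Inn n := by
  have h1 : (Inn n * kᴴ * Inn n) * k = 1 := by
    rw [Matrix.mul_assoc (Inn n), Matrix.mul_assoc (Inn n), h, Inn_mul_Inn]
  have h2 : k * (Inn n * kᴴ * Inn n) = 1 := mul_eq_one_comm.1 h1
  calc k * Inn n * kᴴ = k * (Inn n * kᴴ * Inn n) * Inn n := by
        simp only [Matrix.mul_assoc, Inn_mul_Inn, Matrix.mul_one]
    _ = Inn n := by rw [h2, Matrix.one_mul]

/-- The inverse of an element of `U(n, n)`. -/
lemma inv_of_preserves {k : BlockMat n} (h : kᴴ * Inn n * k = Inn n) :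
    k⁻¹ = Inn n * kᴴ * Inn n := by
  refine Matrix.inv_eq_left_inv ?_
  rw [Matrix.mul_assoc (Inn n), Matrix.mul_assoc (Inn n), h, Inn_mul_Inn]

lemma preserves_blocks {a b c d : Mat n}
    (h : (Matrix.fromBlocks a b c d)ᴴ * Inn n * Matrix.fromBlocks a b c d = Inn n) :
    aᴴ * a - cᴴ * c = 1 ∧ aᴴ * b = cᴴ * d ∧ dᴴ * d - bᴴ * b = 1 := by
  simp only [Inn, Matrix.fromBlocks_conjTranspose, Matrix.fromBlocks_multiply,
    Matrix.fromBlocks_inj, Matrix.mul_one, Matrix.mul_zero, Matrix.mul_neg, add_zero, zero_add,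
    Matrix.neg_mul] at h
  obtain ⟨h1, h2, -, h4⟩ := h
  refine ⟨by rw [← h1]; abel, ?_, ?_⟩
  · rw [← sub_eq_zero, ← h2]; abel
  · rw [← neg_inj, ← h4]; abel

lemma preserves_blocks' {a b c d : Mat n}
    (h : (Matrix.fromBlocks a b c d)ᴴ * Inn n * Matrix.fromBlocks a b c d = Inn n) :
    a * aᴴ - b * bᴴ = 1 ∧ a * cᴴ = b * dᴴ ∧ d * dᴴ - c * cᴴ = 1 := by
  have h := mul_Inn_of_preserves h
  simp only [Inn, Matrix.fromBlocks_conjTranspose, Matrix.fromBlocks_multiply,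
    Matrix.fromBlocks_inj, Matrix.mul_one, Matrix.mul_zero, Matrix.mul_neg, add_zero, zero_add,
    Matrix.neg_mul] at h
  obtain ⟨h1, h2, -, h4⟩ := h
  refine ⟨by rw [← h1]; abel, ?_, ?_⟩
  · rw [← sub_eq_zero, ← h2]; abel
  · rw [← neg_inj, ← h4]; abel

lemma tangent_right {k v : BlockMat n} (h : kᴴ * Inn n * k = Inn n)
    (hv : vᴴ * Inn n * k + kᴴ * Inn n * v = 0) : v * Inn n * kᴴ + k * Inn n * vᴴ = 0 := by
  have h1 : k * (Inn n * kᴴ * Inn n) = 1 := by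
    rw [← Matrix.mul_assoc, ← Matrix.mul_assoc, mul_Inn_of_preserves h, Inn_mul_Inn]
  have h2 : k * Inn n * (vᴴ * Inn n * k + kᴴ * Inn n * v) * (Inn n * kᴴ) =
      k * Inn n * vᴴ * Inn n * (k * Inn n * kᴴ) + k * (Inn n * kᴴ * Inn n) * v * Inn n * kᴴ := by
    simp only [Matrix.mul_add, Matrix.add_mul, Matrix.mul_assoc]
  rw [hv, h1, mul_Inn_of_preserves h, Matrix.mul_zero, Matrix.zero_mul, Matrix.one_mul,
    Matrix.mul_assoc _ (Inn n) (Inn n), Inn_mul_Inn, Matrix.mul_one] at h2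
  rw [add_comm, ← h2]

lemma tangent_blocks {a b c d va vb vc vd : Mat n}
    (h : (Matrix.fromBlocks va vb vc vd)ᴴ * Inn n * Matrix.fromBlocks a b c d
      + (Matrix.fromBlocks a b c d)ᴴ * Inn n * Matrix.fromBlocks va vb vc vd = 0) :
    vaᴴ * a + aᴴ * va = vcᴴ * c + cᴴ * vc ∧ vaᴴ * b + aᴴ * vb = vcᴴ * d + cᴴ * vd := by
  simp only [Inn, Matrix.fromBlocks_conjTranspose, Matrix.fromBlocks_multiply,
    Matrix.fromBlocks_add, Matrix.mul_one, Matrix.mul_zero, Matrix.mul_neg, add_zero, zero_add,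
    Matrix.neg_mul, ← Matrix.fromBlocks_zero, Matrix.fromBlocks_inj] at h
  obtain ⟨h1, h2, -, h4⟩ := h
  constructor
  · rw [← sub_eq_zero, ← h1]; abel
  · rw [← sub_eq_zero, ← h2]; abel

lemma tangent_blocks' {a b c d va vb vc vd : Mat n}
    (h : (Matrix.fromBlocks va vb vc vd) * Inn n * (Matrix.fromBlocks a b c d)ᴴ
      + (Matrix.fromBlocks a b c d) * Inn n * (Matrix.fromBlocks va vb vc vd)ᴴ = 0) :
    vc * cᴴ + c * vcᴴ = vd * dᴴ + d * vdᴴ := by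
  simp only [Inn, Matrix.fromBlocks_conjTranspose, Matrix.fromBlocks_multiply,
    Matrix.fromBlocks_add, Matrix.mul_one, Matrix.mul_zero, Matrix.mul_neg, add_zero, zero_add,
    Matrix.neg_mul, ← Matrix.fromBlocks_zero, Matrix.fromBlocks_inj] at h
  obtain ⟨-, -, -, h4⟩ := h
  rw [← sub_eq_zero, ← h4]; abel

lemma unitary_cancel {u : Mat n} (hu : uᴴ * u = 1) (X : Mat n) : uᴴ * (u * X) = X := by
  rw [← Matrix.mul_assoc, hu, Matrix.one_mul]

lemma unitary_cancel' {u : Mat n} (hu : uᴴ * u = 1) (X : Mat n) : u * (uᴴ * X) = X := by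
  rw [← Matrix.mul_assoc, mul_eq_one_comm.1 hu, Matrix.one_mul]

lemma left_injective_of_unitary {u X Y : Mat n} (hu : uᴴ * u = 1) (h : u * X = u * Y) : X = Y := by
  rw [← unitary_cancel hu X, h, unitary_cancel hu]

lemma right_injective_of_unitary {u X Y : Mat n} (hu : uᴴ * u = 1) (h : X * u = Y * u) : X = Y := by
  have := congrArg (· * uᴴ) h
  simpa only [Matrix.mul_assoc, mul_eq_one_comm.1 hu, Matrix.mul_one] using this

lemma dg_left_injective {f : RVec n} (hf : ∀ i, f i ≠ 0) {X Y : Mat n} (h : dg f * X = dg f * Y) :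
    X = Y := by
  have := congrArg (dg (fun i => (f i)⁻¹) * ·) h
  simpa only [← Matrix.mul_assoc, dg_inv_mul hf, Matrix.one_mul] using this

lemma dg_right_injective {f : RVec n} (hf : ∀ i, f i ≠ 0) {X Y : Mat n} (h : X * dg f = Y * dg f) :
    X = Y := by
  have := congrArg (· * dg (fun i => (f i)⁻¹)) h
  simpa only [Matrix.mul_assoc, dg_mul_inv hf, Matrix.mul_one] using this

/-- An element of `U(n, n)` is determined up to unitary factors by its lower left block. -/
lemma exists_kak_of_lower {a b c d τ k : Mat n} {C s : RVec n}
    (h : (Matrix.fromBlocks a b c d)ᴴ * Inn n * Matrix.fromBlocks a b c d = Inn n)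
    (hC : ∀ i, 0 < C i) (hCs : ∀ i, C i ^ 2 = 1 + s i ^ 2) (hτ : τᴴ * τ = 1) (hk : kᴴ * k = 1)
    (hc : c = τ * dg s * k) :
    ∃ r m : Mat n, rᴴ * r = 1 ∧ mᴴ * m = 1 ∧ Matrix.fromBlocks a b c d = kak r τ k m C s := by
  have hC' : ∀ i, C i ≠ 0 := fun i => (hC i).ne'
  obtain ⟨h1, h2, -⟩ := preserves_blocks h
  obtain ⟨-, -, h3⟩ := preserves_blocks' h
  have CC : (1 : Mat n) + dg s * dg s = dg C * dg C := by
    rw [dg_mul_dg, dg_mul_dg, ← dg_one]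
    ext i j
    by_cases hij : i = j
    · subst hij
      have := hCs i
      simp [-Complex.ofReal_mul]
      norm_cast
      nlinarith
    · simp [hij]
  have kk : k * kᴴ = 1 := mul_eq_one_comm.1 hk
  have ττ : τ * τᴴ = 1 := mul_eq_one_comm.1 hτ
  have aa : aᴴ * a = kᴴ * (dg C * dg C) * k := by
    rw [sub_eq_iff_eq_add.1 h1, hc, ← CC]
    simp only [Matrix.conjTranspose_mul, dg_conjTranspose, Matrix.mul_add, Matrix.add_mul,
      Matrix.mul_one, hk, Matrix.mul_assoc, unitary_cancel hτ]
  have dd : d * dᴴ = τ * (dg C * dg C) * τᴴ := by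
    rw [sub_eq_iff_eq_add.1 h3, hc, ← CC]
    simp only [Matrix.conjTranspose_mul, dg_conjTranspose, Matrix.mul_add, Matrix.add_mul,
      Matrix.mul_one, ττ, Matrix.mul_assoc, unitary_cancel' hk]
  have ea : a = a * kᴴ * dg (fun i => (C i)⁻¹) * dg C * k := by
    rw [Matrix.mul_assoc _ (dg _) (dg C), dg_inv_mul hC', Matrix.mul_one, Matrix.mul_assoc, hk,
      Matrix.mul_one]
  have ed : d = τ * dg C * (dg (fun i => (C i)⁻¹) * τᴴ * d) := by
    rw [Matrix.mul_assoc, ← Matrix.mul_assoc (dg C), ← Matrix.mul_assoc (dg C), dg_mul_inv hC',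
      Matrix.one_mul, unitary_cancel' hτ]
  -- The diagonal blocks satisfy a†a = k†C²k and dd† = τC²τ†, so r and m are their unitary polar
  -- parts relative to the prescribed k and τ.
  set r := a * kᴴ * dg (fun i => (C i)⁻¹) with hr
  set m := dg (fun i => (C i)⁻¹) * τᴴ * d with hm
  have ru : rᴴ * r = 1 := by
    rw [hr]
    simp only [Matrix.conjTranspose_mul, dg_conjTranspose, Matrix.conjTranspose_conjTranspose,
      Matrix.mul_assoc]
    rw [← Matrix.mul_assoc aᴴ, aa]
    simp only [Matrix.mul_assoc, unitary_cancel' hk, dg_mul_inv hC', Matrix.mul_one, dg_inv_mul hC']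
  have mu : m * mᴴ = 1 := by
    rw [hm]
    simp only [Matrix.conjTranspose_mul, dg_conjTranspose, Matrix.conjTranspose_conjTranspose,
      Matrix.mul_assoc]
    rw [← Matrix.mul_assoc d, dd]
    simp only [Matrix.mul_assoc, unitary_cancel hτ, dg_mul_inv hC', Matrix.mul_one, dg_inv_mul hC']
  refine ⟨r, m, ru, mul_eq_one_comm.1 mu, ?_⟩
  clear_value r m
  have eb : b = r * dg s * m := by
    have h4 : kᴴ * (dg C * (rᴴ * b)) = kᴴ * (dg C * (dg s * m)) := by
      have : aᴴ * b = kᴴ * (dg C * (rᴴ * b)) := by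
        conv_lhs => rw [ea]
        simp only [Matrix.conjTranspose_mul, dg_conjTranspose, Matrix.mul_assoc]
      rw [← this, h2, hc]
      conv_lhs => rw [ed]
      simp only [Matrix.conjTranspose_mul, dg_conjTranspose, Matrix.mul_assoc, unitary_cancel hτ]
      congr 1
      rw [← Matrix.mul_assoc, ← Matrix.mul_assoc, dg_mul_dg, dg_mul_dg]
      congr 3; funext i; ring
    have h5 : rᴴ * b = dg s * m := dg_left_injective hC'
      (left_injective_of_unitary (u := kᴴ) (by rw [Matrix.conjTranspose_conjTranspose]; exact kk) h4)
    rw [Matrix.mul_assoc, ← h5, unitary_cancel' ru]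
  rw [kak, ← ea, ← ed, ← eb, ← hc]

end BlockRelations
end HeisenbergDouble

namespace HeisenbergDouble
-- The constraint equation and its linearization, block by block.
section ConstraintRelations

variable {n : ℕ} {σ om ν : Mat n} {x y : ℝ}

lemma constraint_blocks {a b c d a' b' c' d' : Mat n}
    (h : constrainedBL y σ ν * Matrix.fromBlocks a' b' c' d' =
      Matrix.fromBlocks a b c d * constrainedBR x om) :
    (y : ℂ) • c' = (x : ℂ) • c ∧ (y : ℂ) • d' = c * om + (x : ℂ)⁻¹ • d ∧
      (y : ℂ)⁻¹ • (σ * a' + ν * c') = (x : ℂ) • a ∧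
      (y : ℂ)⁻¹ • (σ * b' + ν * d') = a * om + (x : ℂ)⁻¹ • b := by
  simp only [constrainedBL, constrainedBR, Matrix.fromBlocks_multiply, Matrix.fromBlocks_inj,
    Matrix.zero_mul, Matrix.mul_zero, add_zero, zero_add, Matrix.smul_mul, Matrix.mul_smul,
    Matrix.one_mul, Matrix.mul_one] at h
  obtain ⟨h1, h2, h3, h4⟩ := h
  exact ⟨h3, h4, by rw [← h1, smul_add], by rw [← h2, smul_add]⟩

lemma Inn_conj_fromBlocks (a b c d : Mat n) :
    Inn n * (Matrix.fromBlocks a b c d)ᴴ * Inn n = Matrix.fromBlocks aᴴ (-cᴴ) (-bᴴ) dᴴ := by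
  simp [Inn, Matrix.fromBlocks_multiply, Matrix.fromBlocks_conjTranspose]

/-- For elements of U(n, n) the inverse is Ik†I. In this form the lower left block of the equation
involves only the upper right blocks of k_L and k_R, without ω and ν. -/
lemma constraint_inverse {kL kR bL bR : BlockMat n} (hL : kLᴴ * Inn n * kL = Inn n)
    (hR : kRᴴ * Inn n * kR = Inn n) (h : bL * kR = kL * bR) :
    (Inn n * kLᴴ * Inn n) * bL = bR * (Inn n * kRᴴ * Inn n) := by
  have h1 : (Inn n * kLᴴ * Inn n) * kL = 1 := by
    rw [Matrix.mul_assoc (Inn n), Matrix.mul_assoc (Inn n), hL, Inn_mul_Inn]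
  have h2 : kR * (Inn n * kRᴴ * Inn n) = 1 := by
    rw [← Matrix.mul_assoc, ← Matrix.mul_assoc, mul_Inn_of_preserves hR, Inn_mul_Inn]
  set L := Inn n * kLᴴ * Inn n
  set R := Inn n * kRᴴ * Inn n
  calc L * bL = L * (bL * kR) * R := by
        rw [Matrix.mul_assoc L, Matrix.mul_assoc bL, h2, Matrix.mul_one]
    _ = bR * R := by rw [h, ← Matrix.mul_assoc L, h1, Matrix.one_mul]

/-- The upper right blocks of `k_L` and `k_R` are proportional up to `σ†`. -/
lemma constraint_upper_right (hx : x ≠ 0) (hy : y ≠ 0) {a b c d a' b' c' d' : Mat n}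
    (hL : (Matrix.fromBlocks a b c d)ᴴ * Inn n * Matrix.fromBlocks a b c d = Inn n)
    (hR : (Matrix.fromBlocks a' b' c' d')ᴴ * Inn n * Matrix.fromBlocks a' b' c' d' = Inn n)
    (h : constrainedBL y σ ν * Matrix.fromBlocks a' b' c' d' =
      Matrix.fromBlocks a b c d * constrainedBR x om) :
    (x : ℂ) • (σᴴ * b) = (y : ℂ) • b' := by
  have h := constraint_inverse hL hR h
  rw [Inn_conj_fromBlocks, Inn_conj_fromBlocks] at h
  simp only [constrainedBL, constrainedBR, Matrix.fromBlocks_multiply, Matrix.fromBlocks_inj,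
    Matrix.zero_mul, Matrix.mul_zero, add_zero, zero_add, Matrix.smul_mul, Matrix.mul_smul,
    Matrix.one_mul, Matrix.mul_one, Matrix.neg_mul, smul_neg, neg_inj] at h
  have h3 := congrArg Matrix.conjTranspose h.2.2.1
  simp only [Matrix.conjTranspose_smul, Matrix.conjTranspose_mul,
    Matrix.conjTranspose_conjTranspose, star_inv₀, Complex.star_def, Complex.conj_ofReal] at h3
  have hx' : (x : ℂ) ≠ 0 := by exact_mod_cast hx
  have hy' : (y : ℂ) ≠ 0 := by exact_mod_cast hy
  have h4 := congrArg (((x * y : ℝ) : ℂ) • ·) h3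
  simp only [smul_smul] at h4
  rw [show ((x * y : ℝ) : ℂ) * (y : ℂ)⁻¹ = x by push_cast; field_simp,
    show ((x * y : ℝ) : ℂ) * (x : ℂ)⁻¹ = y by push_cast; field_simp] at h4
  exact h4

/-- The infinitesimal version of the constraints, for constant `σ`, `x`, `y`. -/
structure IsTangent (σ : Mat n) (x y : ℝ) (kL kR : BlockMat n) (om ν : Mat n)
    (vkL vkR : BlockMat n) (vom vν : Mat n) : Prop where
  tL : vkLᴴ * Inn n * kL + kLᴴ * Inn n * vkL = 0
  tR : vkRᴴ * Inn n * kR + kRᴴ * Inn n * vkR = 0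
  main : Matrix.fromBlocks 0 ((y : ℂ)⁻¹ • vν) 0 0 * kR + constrainedBL y σ ν * vkR =
    vkL * constrainedBR x om + kL * Matrix.fromBlocks 0 vom 0 0

lemma tangent_main_blocks {a b c d a' b' c' d' va vb vc vd va' vb' vc' vd' vom vν : Mat n}
    (h : Matrix.fromBlocks 0 ((y : ℂ)⁻¹ • vν) 0 0 * Matrix.fromBlocks a' b' c' d'
      + constrainedBL y σ ν * Matrix.fromBlocks va' vb' vc' vd' =
      Matrix.fromBlocks va vb vc vd * constrainedBR x om
      + Matrix.fromBlocks a b c d * Matrix.fromBlocks 0 vom 0 0) :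
    (y : ℂ) • vc' = (x : ℂ) • vc ∧ (y : ℂ) • vd' = vc * om + (x : ℂ)⁻¹ • vd + c * vom ∧
      (y : ℂ)⁻¹ • (vν * c' + σ * va' + ν * vc') = (x : ℂ) • va := by
  simp only [constrainedBL, constrainedBR, Matrix.fromBlocks_multiply, Matrix.fromBlocks_inj,
    Matrix.zero_mul, Matrix.mul_zero, add_zero, zero_add, Matrix.smul_mul, Matrix.mul_smul,
    Matrix.one_mul, Matrix.mul_one, Matrix.fromBlocks_add] at h
  obtain ⟨h1, h2, h3, h4⟩ := h
  exact ⟨h3, h4, by rw [← h1, smul_add, smul_add, add_assoc]⟩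

lemma tangent_inverse {k v : BlockMat n} (h : kᴴ * Inn n * k = Inn n)
    (hv : vᴴ * Inn n * k + kᴴ * Inn n * v = 0) :
    Inn n * vᴴ * Inn n = - ((Inn n * kᴴ * Inn n) * v * (Inn n * kᴴ * Inn n)) := by
  have h2 : k * (Inn n * kᴴ * Inn n) = 1 := by
    rw [← Matrix.mul_assoc, ← Matrix.mul_assoc, mul_Inn_of_preserves h, Inn_mul_Inn]
  have h3 : Inn n * (vᴴ * Inn n * k + kᴴ * Inn n * v) * (Inn n * kᴴ * Inn n) =
      Inn n * vᴴ * Inn n * (k * (Inn n * kᴴ * Inn n)) + (Inn n * kᴴ * Inn n) * v * (Inn n * kᴴ * Inn n) := by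
    simp only [Matrix.mul_add, Matrix.add_mul, Matrix.mul_assoc]
  rw [hv, Matrix.mul_zero, Matrix.zero_mul, h2, Matrix.mul_one] at h3
  exact eq_neg_of_add_eq_zero_left h3.symm

/-- The linearization of `constraint_inverse`. The velocities of ω and ν sit in upper right blocks,
so after one-sided multiplication they do not reach the lower left block, which is the one read off.
-/
lemma tangent_upper_right (hx : x ≠ 0) (hy : y ≠ 0)
    {a b c d a' b' c' d' va vb vc vd va' vb' vc' vd' vom vν : Mat n}
    (hL : (Matrix.fromBlocks a b c d)ᴴ * Inn n * Matrix.fromBlocks a b c d = Inn n)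
    (hR : (Matrix.fromBlocks a' b' c' d')ᴴ * Inn n * Matrix.fromBlocks a' b' c' d' = Inn n)
    (h : constrainedBL y σ ν * Matrix.fromBlocks a' b' c' d' =
      Matrix.fromBlocks a b c d * constrainedBR x om)
    (t : IsTangent σ x y (Matrix.fromBlocks a b c d) (Matrix.fromBlocks a' b' c' d') om ν
      (Matrix.fromBlocks va vb vc vd) (Matrix.fromBlocks va' vb' vc' vd') vom vν) :
    (x : ℂ) • (σᴴ * vb) = (y : ℂ) • vb' := by
  have hi := constraint_inverse hL hR h
  have iL := tangent_inverse hL t.tL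
  have iR := tangent_inverse hR t.tR
  have hm := t.main
  have wb := Inn_conj_fromBlocks va vb vc vd
  have wb' := Inn_conj_fromBlocks va' vb' vc' vd'
  have lb := Inn_conj_fromBlocks a b c d
  have rb := Inn_conj_fromBlocks a' b' c' d'
  set kL := Matrix.fromBlocks a b c d
  set kR := Matrix.fromBlocks a' b' c' d'
  set vL := Matrix.fromBlocks va vb vc vd
  set vR := Matrix.fromBlocks va' vb' vc' vd'
  set L := Inn n * kLᴴ * Inn n
  set R := Inn n * kRᴴ * Inn n
  have h1 : L * kL = 1 := by
    simp only [L]; rw [Matrix.mul_assoc (Inn n), Matrix.mul_assoc (Inn n), hL, Inn_mul_Inn]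
  have h2 : kR * R = 1 := by
    simp only [R]
    rw [← Matrix.mul_assoc, ← Matrix.mul_assoc, mul_Inn_of_preserves hR, Inn_mul_Inn]
  set Eν : BlockMat n := Matrix.fromBlocks 0 ((y : ℂ)⁻¹ • vν) 0 0 with hEν
  set Eω : BlockMat n := Matrix.fromBlocks 0 vom 0 0 with hEω
  set bL := constrainedBL y σ ν with hbL
  set bR := constrainedBR x om with hbR
  have key : (Inn n * vLᴴ * Inn n) * bL + L * Eν = bR * (Inn n * vRᴴ * Inn n) + Eω * R := by
    have e : L * (Eν * kR + bL * vR) * R = L * (vL * bR + kL * Eω) * R := by rw [hm]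
    have e1 : L * (Eν * kR + bL * vR) * R = L * Eν + bR * (R * vR * R) := by
      calc _ = L * Eν * (kR * R) + (L * bL) * vR * R := by
            simp only [Matrix.mul_add, Matrix.add_mul, Matrix.mul_assoc]
        _ = _ := by rw [h2, Matrix.mul_one, hi]; simp only [Matrix.mul_assoc]
    have e2 : L * (vL * bR + kL * Eω) * R = L * vL * L * bL + Eω * R := by
      calc _ = L * vL * (bR * R) + (L * kL) * Eω * R := by
            simp only [Matrix.mul_add, Matrix.add_mul, Matrix.mul_assoc]
        _ = _ := by rw [h1, Matrix.one_mul, ← hi]; simp only [Matrix.mul_assoc]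
    rw [e1, e2] at e
    rw [iL, iR, Matrix.neg_mul, Matrix.mul_neg]
    linear_combination (norm := abel) e
  rw [wb, wb', lb, rb, hbL, hbR, hEν, hEω] at key
  simp only [constrainedBL, constrainedBR, Matrix.fromBlocks_multiply, Matrix.fromBlocks_inj,
    Matrix.zero_mul, Matrix.mul_zero, add_zero, zero_add, Matrix.smul_mul, Matrix.mul_smul,
    Matrix.one_mul, Matrix.mul_one, Matrix.neg_mul, smul_neg, neg_inj, Matrix.fromBlocks_add] at key
  have h3 := congrArg Matrix.conjTranspose key.2.2.1
  simp only [Matrix.conjTranspose_smul, Matrix.conjTranspose_mul,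
    Matrix.conjTranspose_conjTranspose, star_inv₀, Complex.star_def, Complex.conj_ofReal] at h3
  have hx' : (x : ℂ) ≠ 0 := by exact_mod_cast hx
  have hy' : (y : ℂ) ≠ 0 := by exact_mod_cast hy
  have h4 := congrArg (((x * y : ℝ) : ℂ) • ·) h3
  simp only [smul_smul] at h4
  rw [show ((x * y : ℝ) : ℂ) * (y : ℂ)⁻¹ = x by push_cast; field_simp,
    show ((x * y : ℝ) : ℂ) * (x : ℂ)⁻¹ = y by push_cast; field_simp] at h4
  exact h4

variable {S Γ C : RVec n} {ρ τ k l : Mat n}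

lemma dg_smul (a : ℝ) (f : RVec n) : dg (fun i => a * f i) = (a : ℂ) • dg f := by
  ext i j
  by_cases h : i = j
  · subst h; simp
  · simp [h]

lemma smul_eq_iff_div (hy : y ≠ 0) (X Y : Mat n) :
    (y : ℂ) • X = (x : ℂ) • Y ↔ X = ((x / y : ℝ) : ℂ) • Y := by
  have hy' : (y : ℂ) ≠ 0 := by exact_mod_cast hy
  constructor
  · intro h
    have := congrArg ((y : ℂ)⁻¹ • ·) h
    simp only [smul_smul, inv_mul_cancel₀ hy', one_smul] at this
    rw [this]; congr 1; push_cast; ring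
  · rintro rfl
    rw [smul_smul]; congr 1; push_cast; field_simp

/-- A constrained point with a Cartan decomposition of `k_L` has a Cartan decomposition of `k_R`. -/
lemma exists_isFrame (hx : 0 < x) (hy : 0 < y) (hS : ∀ i, S i ≠ 0) (hΓ : ∀ i, 0 < Γ i)
    (hΓ2 : ∀ i, Γ i ^ 2 = 1 + S i ^ 2) (hC : ∀ i, 0 < C i)
    (hC2 : ∀ i, C i ^ 2 = 1 + (x / y * S i) ^ 2) (hρ : ρᴴ * ρ = 1) (hτ : τᴴ * τ = 1)
    (hk : kᴴ * k = 1) (hl : lᴴ * l = 1) {kL kR : BlockMat n} (eL : kL = kak ρ τ k l Γ S)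
    (pL : kLᴴ * Inn n * kL = Inn n) (pR : kRᴴ * Inn n * kR = Inn n)
    (h : constrainedBL y σ ν * kR = kL * constrainedBR x om) :
    ∃ r m, kR = kak r τ k m C (fun i => x / y * S i) ∧
      IsFrame σ x y S Γ C ρ τ k l r m om ν := by
  obtain ⟨a', b', c', d', rfl⟩ : ∃ a' b' c' d', kR = Matrix.fromBlocks a' b' c' d' :=
    ⟨_, _, _, _, (Matrix.fromBlocks_toBlocks kR).symm⟩
  subst eL
  have hb := constraint_blocks h
  have hu := constraint_upper_right hx.ne' hy.ne' pL pR h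
  have hxy : x / y ≠ 0 := div_ne_zero hx.ne' hy.ne'
  have hs : ∀ i, x / y * S i ≠ 0 := fun i => mul_ne_zero hxy (hS i)
  have hc : c' = τ * dg (fun i => x / y * S i) * k := by
    rw [(smul_eq_iff_div hy.ne' _ _).1 hb.1, dg_smul]
    simp only [Matrix.mul_smul, Matrix.smul_mul]
  obtain ⟨r, m, hr, hm, e⟩ := exists_kak_of_lower pR hC hC2 hτ hk hc
  refine ⟨r, m, e, hx, hy, hS, hΓ, hΓ2, hC, hC2, hρ, hτ, hk, hl, hr, hm, ?_, ?_, ?_⟩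
  · rw [kak, Matrix.fromBlocks_inj] at e
    have h2 := (smul_eq_iff_div hy.ne' _ _).1 hu.symm
    rw [e.2.1, dg_smul, Matrix.mul_smul, Matrix.smul_mul] at h2
    have h3 := smul_right_injective _ (show ((x / y : ℝ) : ℂ) ≠ 0 by exact_mod_cast hxy) h2
    rw [h3]; simp only [Matrix.mul_assoc]
  · rw [kak, Matrix.fromBlocks_inj] at e
    have h2 := hb.2.1
    rw [e.2.2.2] at h2
    apply left_injective_of_unitary hτ
    rw [Matrix.mul_sub, Matrix.mul_smul, Matrix.mul_smul, ← Matrix.mul_assoc, ← Matrix.mul_assoc,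
      ← Matrix.mul_assoc, ← Matrix.mul_assoc, h2]
    simp only [Matrix.mul_assoc]
    abel
  · rw [kak, Matrix.fromBlocks_inj] at e
    have h2 := hb.2.2.1
    rw [e.1, hc] at h2
    apply right_injective_of_unitary hk
    have hy' : (y : ℂ) ≠ 0 := by exact_mod_cast hy.ne'
    have h3 := congrArg ((y : ℂ) • ·) h2
    simp only [smul_smul, mul_inv_cancel₀ hy', one_smul] at h3
    rw [Matrix.sub_mul, Matrix.smul_mul, show ((x * y : ℝ) : ℂ) = (y : ℂ) * x by push_cast; ring, ← h3]
    simp only [Matrix.mul_assoc]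
    abel

variable {r m vom vν : Mat n} {D : RVec n} {χ η : Mat n} {vkL vkR : BlockMat n}

/-- A tangent vector to the constraint surface is determined, in terms of the Cartan
decompositions, by the lower left block of `k_L'`. -/
lemma exists_isFrameVel (F : IsFrame σ x y S Γ C ρ τ k l r m om ν)
    (pL : (kak ρ τ k l Γ S)ᴴ * Inn n * (kak ρ τ k l Γ S) = Inn n)
    (pR : (kak r τ k m C (fun i => x / y * S i))ᴴ * Inn n * (kak r τ k m C (fun i => x / y * S i)) = Inn n)
    (h : constrainedBL y σ ν * (kak r τ k m C (fun i => x / y * S i)) =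
      kak ρ τ k l Γ S * constrainedBR x om)
    (t : IsTangent σ x y (kak ρ τ k l Γ S) (kak r τ k m C (fun i => x / y * S i)) om ν
      vkL vkR vom vν)
    (hχ : χᴴ = -χ) (hη : ηᴴ = -η)
    (h21 : vkL.toBlocks₂₁ = τ * (χ * dg S + dg (fun i => S i * D i) + dg S * η) * k) :
    ∃ ξ θ ζ μ : Mat n, vkL = kakVel ρ τ k l Γ S D ξ χ η θ ∧
      vkR = kakVel r τ k m C (fun i => x / y * S i) D ζ χ η μ ∧
      IsFrameVel σ x y S Γ C ρ τ k l r m om ν D ξ χ η θ ζ μ vom vν := by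
  obtain ⟨va, vb, vc, vd, rfl⟩ : ∃ a' b' c' d', vkL = Matrix.fromBlocks a' b' c' d' :=
    ⟨_, _, _, _, (Matrix.fromBlocks_toBlocks vkL).symm⟩
  obtain ⟨va', vb', vc', vd', rfl⟩ : ∃ a' b' c' d', vkR = Matrix.fromBlocks a' b' c' d' :=
    ⟨_, _, _, _, (Matrix.fromBlocks_toBlocks vkR).symm⟩
  rw [Matrix.toBlocks_fromBlocks₂₁] at h21
  -- The same argument serves k_L and k_R with the same χ, η and D, because the lower left blocks of
  -- their velocities differ only by the factor x/y.
  have gen : ∀ {ρ τ k l : Mat n} {c s : RVec n} {va vb vc vd : Mat n} (hρ : ρᴴ * ρ = 1)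
      (hτ : τᴴ * τ = 1) (hk : kᴴ * k = 1) (hl : lᴴ * l = 1) (hc : ∀ i, 0 < c i)
      (hcs : ∀ i, c i ^ 2 = 1 + s i ^ 2)
      (p : (kak ρ τ k l c s)ᴴ * Inn n * (kak ρ τ k l c s) = Inn n)
      (t : (Matrix.fromBlocks va vb vc vd)ᴴ * Inn n * (kak ρ τ k l c s)
        + (kak ρ τ k l c s)ᴴ * Inn n * Matrix.fromBlocks va vb vc vd = 0)
      (h21 : vc = τ * (χ * dg s + dg (fun i => s i * D i) + dg s * η) * k),
      ∃ ξ θ : Mat n, ξᴴ = -ξ ∧ θᴴ = -θ ∧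
        Matrix.fromBlocks va vb vc vd = kakVel ρ τ k l c s D ξ χ η θ := by
    intro ρ τ k l c s va vb vc vd hρ hτ hk hl hc hcs p t h21
    have t' := tangent_right p t
    obtain ⟨b1, b2⟩ := tangent_blocks t
    have b3 := tangent_blocks' t'
    have kk : k * kᴴ = 1 := mul_eq_one_comm.1 hk
    have ll : l * lᴴ = 1 := mul_eq_one_comm.1 hl
    have sand {u w X Y : Mat n} (h : X = Y) : u * X * w = u * Y * w := by rw [h]
    obtain ⟨ξ, θ, hξ, hθ, e1, e2, e3⟩ := exists_skew_of_tangent (Z₁₁ := ρᴴ * va * kᴴ)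
      (Z₁₂ := ρᴴ * vb * lᴴ) (Z₂₁ := τᴴ * vc * kᴴ) (Z₂₂ := τᴴ * vd * lᴴ) (D := D)
      (fun i => (hc i).ne') hcs hχ hη
      (by rw [h21]; simp only [Matrix.mul_assoc, kk, Matrix.mul_one, unitary_cancel hτ])
      (by
        have := sand (u := k) (w := kᴴ) b1
        simpa only [Matrix.conjTranspose_mul, dg_conjTranspose, Matrix.conjTranspose_conjTranspose,
          Matrix.mul_add, Matrix.add_mul, Matrix.mul_assoc, kk, Matrix.mul_one,
          unitary_cancel' hk] using this)
      (by
        have := sand (u := k) (w := lᴴ) b2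
        simpa only [Matrix.conjTranspose_mul, dg_conjTranspose, Matrix.conjTranspose_conjTranspose,
          Matrix.mul_add, Matrix.add_mul, Matrix.mul_assoc, ll, Matrix.mul_one,
          unitary_cancel' hk] using this)
      (by
        have := sand (u := τᴴ) (w := τ) b3
        simpa only [Matrix.conjTranspose_mul, dg_conjTranspose, Matrix.conjTranspose_conjTranspose,
          Matrix.mul_add, Matrix.add_mul, Matrix.mul_assoc, hτ, Matrix.mul_one,
          unitary_cancel hτ] using this)
    refine ⟨ξ, θ, hξ, hθ, ?_⟩
    rw [kakVel, Matrix.fromBlocks_inj]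
    refine ⟨?_, ?_, h21, ?_⟩
    · rw [← e1]; simp only [Matrix.mul_assoc, hk, Matrix.mul_one, unitary_cancel' hρ]
    · rw [← e2]; simp only [Matrix.mul_assoc, hl, Matrix.mul_one, unitary_cancel' hρ]
    · rw [← e3]; simp only [Matrix.mul_assoc, hl, Matrix.mul_one, unitary_cancel' hτ]
  have hx := F.x_pos
  have hy := F.y_pos
  have hxy : x / y ≠ 0 := div_ne_zero hx.ne' hy.ne'
  have hy' : (y : ℂ) ≠ 0 := by exact_mod_cast hy.ne'
  obtain ⟨m1, m2, m3⟩ := tangent_main_blocks t.main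
  have hu := tangent_upper_right hx.ne' hy.ne' pL pR h t
  have h21' : vc' = τ * (χ * dg (fun i => x / y * S i) + dg (fun i => x / y * S i * D i)
      + dg (fun i => x / y * S i) * η) * k := by
    rw [(smul_eq_iff_div hy.ne' _ _).1 m1, h21, dg_smul,
      show (fun i => x / y * S i * D i) = (fun i => x / y * (S i * D i)) by funext i; ring, dg_smul]
    simp only [Matrix.mul_smul, Matrix.smul_mul, ← smul_add]
  obtain ⟨ξ, θ, hξ, hθ, e⟩ := gen F.ρ_u F.τ_u F.k_u F.l_u F.Γ_pos F.Γ_sq pL t.tL h21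
  obtain ⟨ζ, μ, hζ, hμ, e'⟩ := gen F.r_u F.τ_u F.k_u F.m_u F.C_pos F.C_sq pR t.tR h21'
  refine ⟨ξ, θ, ζ, μ, e, e', hξ, hχ, hη, hθ, hζ, hμ, ?_, ?_, ?_⟩
  · rw [kakVel, Matrix.fromBlocks_inj] at e e'
    have h2 := (smul_eq_iff_div hy.ne' _ _).1 hu.symm
    rw [e.2.1, e'.2.1, dg_smul,
      show (fun i => x / y * S i * D i) = (fun i => x / y * (S i * D i)) by funext i; ring,
      dg_smul] at h2
    simp only [Matrix.mul_smul, Matrix.smul_mul, ← smul_add] at h2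
    have h3 := smul_right_injective _ (show ((x / y : ℝ) : ℂ) ≠ 0 by exact_mod_cast hxy) h2
    beta_reduce at h3
    rw [h3]; simp only [Matrix.mul_assoc]
  · rw [kakVel, Matrix.fromBlocks_inj] at e e'
    rw [e.2.2.2, e'.2.2.2, h21] at m2
    apply left_injective_of_unitary F.τ_u
    have : τ * (dg S * k * vom) = τ * dg S * k * vom := by simp only [Matrix.mul_assoc]
    rw [this, ← sub_eq_iff_eq_add'.2 m2]
    simp only [Matrix.mul_sub, Matrix.mul_smul, Matrix.mul_assoc]
    abel
  · rw [kakVel, Matrix.fromBlocks_inj] at e e'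
    rw [e.1, e'.1, h21'] at m3
    have h3 := congrArg ((y : ℂ) • ·) m3
    simp only [smul_smul, mul_inv_cancel₀ hy', one_smul] at h3
    apply right_injective_of_unitary F.k_u
    rw [Matrix.sub_mul, Matrix.sub_mul, Matrix.smul_mul,
      show ((x * y : ℝ) : ℂ) = (y : ℂ) * x by push_cast; ring, ← h3]
    simp only [Matrix.mul_assoc]
    abel

end ConstraintRelations
end HeisenbergDouble

namespace HeisenbergDouble
-- Points of the constraint surface, their frames and the leaf form on them.
section PointStructure

variable {n : ℕ} {σ om ν : Mat n} {x y : ℝ} {S Γ C : RVec n} {ρ τ k l r m vom vν : Mat n}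

lemma kak_eq_mul (ρ τ k l : Mat n) (c s : RVec n) :
    kak ρ τ k l c s = Matrix.fromBlocks ρ 0 0 τ * Matrix.fromBlocks (dg c) (dg s) (dg s) (dg c) *
      Matrix.fromBlocks k 0 0 l := by
  simp [kak, Matrix.fromBlocks_multiply]

lemma kak_preserves {c s : RVec n} (hcs : ∀ i, c i ^ 2 = 1 + s i ^ 2) (hρ : ρᴴ * ρ = 1)
    (hτ : τᴴ * τ = 1) (hk : kᴴ * k = 1) (hl : lᴴ * l = 1) :
    (kak ρ τ k l c s)ᴴ * Inn n * kak ρ τ k l c s = Inn n := by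
  have e1 : dg c * dg c = 1 + dg s * dg s := by
    rw [dg_mul_dg, dg_mul_dg, ← dg_one]
    ext i j
    by_cases h : i = j
    · subst h
      have : (c i : ℂ) ^ 2 = 1 + (s i : ℂ) ^ 2 := by exact_mod_cast hcs i
      simp only [Matrix.add_apply, Matrix.diagonal_apply_eq, Complex.ofReal_mul, Complex.ofReal_one]
      linear_combination this
    · simp [h]
  have e2 : dg c * dg s = dg s * dg c := by rw [dg_mul_dg, dg_mul_dg]; simp only [mul_comm]
  have e1' (X : Mat n) : dg c * (dg c * X) = X + dg s * (dg s * X) := by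
    rw [← Matrix.mul_assoc, e1, Matrix.add_mul, Matrix.one_mul, Matrix.mul_assoc]
  have e2' (X : Mat n) : dg c * (dg s * X) = dg s * (dg c * X) := by
    rw [← Matrix.mul_assoc, e2, Matrix.mul_assoc]
  simp only [Inn, kak, Matrix.fromBlocks_conjTranspose, Matrix.fromBlocks_multiply, Matrix.mul_one,
    Matrix.mul_zero, add_zero, zero_add, Matrix.mul_neg, Matrix.neg_mul,
    Matrix.conjTranspose_mul, dg_conjTranspose, Matrix.mul_assoc, unitary_cancel hρ,
    unitary_cancel hτ, e1', e2', Matrix.mul_add, hk, hl]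
  congr 1 <;> abel

lemma kak_inv {c s : RVec n} (hcs : ∀ i, c i ^ 2 = 1 + s i ^ 2) (hρ : ρᴴ * ρ = 1)
    (hτ : τᴴ * τ = 1) (hk : kᴴ * k = 1) (hl : lᴴ * l = 1) :
    (kak ρ τ k l c s)⁻¹ = Matrix.fromBlocks (kᴴ * dg c * ρᴴ) (-(kᴴ * dg s * τᴴ))
      (-(lᴴ * dg s * ρᴴ)) (lᴴ * dg c * τᴴ) := by
  rw [inv_of_preserves (kak_preserves hcs hρ hτ hk hl), kak, Inn_conj_fromBlocks]
  simp only [Matrix.conjTranspose_mul, dg_conjTranspose, Matrix.mul_assoc]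

lemma velκ_eq {c s D : RVec n} (hc : ∀ i, 0 < c i) (hcs : ∀ i, c i ^ 2 = 1 + s i ^ 2)
    (χ η θ : Mat n) :
    (χ * dg s + dg (fun i => s i * D i) + dg s * η) * dg c
      - (χ * dg c + dg (fun i => s i ^ 2 * D i / c i) + dg c * θ) * dg s = velκ s c D η θ := by
  ext i j
  have h1 : (c i : ℂ) ≠ 0 := by exact_mod_cast (hc i).ne'
  have h2 : (c i : ℂ) ^ 2 = 1 + (s i : ℂ) ^ 2 := by exact_mod_cast hcs i
  by_cases h : i = j
  · subst h
    simp [velκ, Matrix.mul_diagonal, Matrix.diagonal_mul]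
    field_simp
    linear_combination (s i * D i : ℂ) * h2
  · simp [velκ, Matrix.mul_diagonal, Matrix.diagonal_mul, h]
    ring

/-- The counterpart of `velκ_eq` for k⁻¹k' in place of k'k⁻¹. Left and right factors change places,
hence the arguments -ζ, -χ. -/
lemma velκ_eq' {c s D : RVec n} (hc : ∀ i, 0 < c i) (hcs : ∀ i, c i ^ 2 = 1 + s i ^ 2)
    (χ η ζ : Mat n) :
    dg c * (χ * dg s + dg (fun i => s i * D i) + dg s * η)
      - dg s * (ζ * dg c + dg (fun i => s i ^ 2 * D i / c i) + dg c * η)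
        = velκ s c D (-ζ) (-χ) := by
  ext i j
  have h1 : (c i : ℂ) ≠ 0 := by exact_mod_cast (hc i).ne'
  have h2 : (c i : ℂ) ^ 2 = 1 + (s i : ℂ) ^ 2 := by exact_mod_cast hcs i
  by_cases h : i = j
  · subst h
    simp [velκ, Matrix.mul_diagonal, Matrix.diagonal_mul]
    field_simp
    linear_combination (s i * D i : ℂ) * h2
  · simp [velκ, Matrix.mul_diagonal, Matrix.diagonal_mul, h]
    ring

lemma constrainedBL_inv (hy : y ≠ 0) (hσ : σ.det = 1) (X : Mat n) :
    Matrix.fromBlocks 0 ((y : ℂ)⁻¹ • X) 0 0 * (constrainedBL y σ ν)⁻¹ =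
      Matrix.fromBlocks 0 ((((y ^ 2 : ℝ) : ℂ)⁻¹) • X) 0 0 := by
  have hy' : (y : ℂ) ≠ 0 := by exact_mod_cast hy
  have hu : IsUnit (constrainedBL y σ ν).det := by
    rw [constrainedBL, Matrix.det_fromBlocks_zero₂₁, Matrix.det_smul, Matrix.det_smul, hσ,
      Matrix.det_one, isUnit_iff_ne_zero]
    simp [hy']
  have : Matrix.fromBlocks 0 ((y : ℂ)⁻¹ • X) 0 0 =
      Matrix.fromBlocks 0 ((((y ^ 2 : ℝ) : ℂ)⁻¹) • X) 0 0 * constrainedBL y σ ν := by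
    rw [constrainedBL, Matrix.fromBlocks_multiply]
    have e : (y : ℂ) * (((y ^ 2 : ℝ) : ℂ)⁻¹) = (y : ℂ)⁻¹ := by push_cast; field_simp
    simp only [Matrix.zero_mul, Matrix.mul_zero, add_zero, zero_add, Matrix.mul_smul,
      Matrix.mul_one, smul_smul, e, smul_zero]
  rw [this, Matrix.mul_nonsing_inv_cancel_right _ _ hu]

lemma constrainedBR_det (hx : x ≠ 0) : IsUnit (constrainedBR x om).det := by
  have hx' : (x : ℂ) ≠ 0 := by exact_mod_cast hx
  rw [constrainedBR, Matrix.det_fromBlocks_zero₂₁, Matrix.det_smul, Matrix.det_smul,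
    Matrix.det_one, isUnit_iff_ne_zero]
  simp [hx']

lemma constrainedBR_inv (hx : x ≠ 0) (X : Mat n) :
    (constrainedBR x om)⁻¹ * Matrix.fromBlocks 0 X 0 0 = Matrix.fromBlocks 0 ((x : ℂ)⁻¹ • X) 0 0 := by
  have hx' : (x : ℂ) ≠ 0 := by exact_mod_cast hx
  have : Matrix.fromBlocks 0 X 0 0 =
      constrainedBR x om * Matrix.fromBlocks 0 ((x : ℂ)⁻¹ • X) 0 0 := by
    rw [constrainedBR, Matrix.fromBlocks_multiply]
    simp only [Matrix.zero_mul, Matrix.mul_zero, add_zero, Matrix.mul_smul,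
      Matrix.smul_mul, Matrix.one_mul, smul_smul, inv_mul_cancel₀ hx', one_smul, smul_zero]
  rw [this, Matrix.nonsing_inv_mul_cancel_left _ _ (constrainedBR_det hx)]

lemma trace_fromBlocks_mul (X a b c d : Mat n) :
    (Matrix.fromBlocks 0 X 0 0 * Matrix.fromBlocks a b c d).trace = (X * c).trace := by
  rw [Matrix.fromBlocks_multiply]
  simp [Matrix.trace, Fintype.sum_sum_type]

/-- One half of the form on the leaf, for a tangent vector `(vbL, vbR)` and a tangent vector
`(vkL, vkR)`. -/
noncomputable def leafPairing (bL kL bR kR vbL vbR vkL vkR : BlockMat n) : ℝ :=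
  pairing (vbL * bL⁻¹) (vkL * kL⁻¹) + pairing (bR⁻¹ * vbR) (kR⁻¹ * vkR)

/-- The velocities of b_L and b_R have only an upper right block, and this remains so after
multiplication by b_L⁻¹ and b_R⁻¹. The trace pairing therefore sees only the lower left blocks of
k_L'k_L⁻¹ and k_R⁻¹k_R'. -/
lemma leafPairing_eq {D : RVec n} {ξ χ η θ ζ μ : Mat n}
    (F : IsFrame σ x y S Γ C ρ τ k l r m om ν) (hσ : σ.det = 1) :
    leafPairing (constrainedBL y σ ν) (kak ρ τ k l Γ S) (constrainedBR x om)
      (kak r τ k m C (fun i => x / y * S i)) (Matrix.fromBlocks 0 ((y : ℂ)⁻¹ • vν) 0 0)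
      (Matrix.fromBlocks 0 vom 0 0) (kakVel ρ τ k l Γ S D ξ χ η θ)
      (kakVel r τ k m C (fun i => x / y * S i) D ζ χ η μ) =
      (leafHalf x y S Γ C ρ τ k m vom vν D χ η θ ζ).im := by
  rw [leafPairing, constrainedBL_inv F.y_pos.ne' hσ, constrainedBR_inv F.x_pos.ne',
    kak_inv F.Γ_sq F.ρ_u F.τ_u F.k_u F.l_u, kak_inv F.C_sq F.r_u F.τ_u F.k_u F.m_u, kakVel, kakVel,
    Matrix.fromBlocks_multiply, Matrix.fromBlocks_multiply, pairing, pairing,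
    trace_fromBlocks_mul, trace_fromBlocks_mul, ← Complex.add_im, leafHalf,
    ← velκ_eq F.Γ_pos F.Γ_sq χ, ← velκ_eq' F.C_pos F.C_sq χ η]
  have kk : k * kᴴ = 1 := mul_eq_one_comm.1 F.k_u
  have e1 (X Y : Mat n) : τ * X * k * (kᴴ * dg Γ * ρᴴ) + τ * Y * l * -(lᴴ * dg S * ρᴴ) =
      τ * (X * dg Γ - Y * dg S) * ρᴴ := by
    simp only [Matrix.mul_assoc, Matrix.mul_sub, Matrix.sub_mul, unitary_cancel' F.k_u,
      unitary_cancel' F.l_u, Matrix.mul_neg]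
    abel
  have e2 (s : RVec n) (X Y : Mat n) : -(mᴴ * dg s * rᴴ) * (r * Y * k) + mᴴ * dg C * τᴴ * (τ * X * k) =
      mᴴ * (dg C * X - dg s * Y) * k := by
    simp only [Matrix.mul_assoc, Matrix.mul_sub, Matrix.sub_mul, unitary_cancel F.r_u,
      unitary_cancel F.τ_u, Matrix.neg_mul]
    abel
  rw [e1, e2, Matrix.smul_mul, Matrix.smul_mul, Matrix.trace_smul, Matrix.trace_smul]
  simp only [smul_eq_mul]

/-- The `K`-factor and the `B`-factor of a constrained point are unique. -/
lemma constrainedBR_unique (hx : x ≠ 0) {k₁ k₂ : BlockMat n} {om₁ om₂ : Mat n}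
    (h₁ : k₁ᴴ * Inn n * k₁ = Inn n) (h₂ : k₂ᴴ * Inn n * k₂ = Inn n)
    (h : k₁ * constrainedBR x om₁ = k₂ * constrainedBR x om₂) : k₁ = k₂ ∧ om₁ = om₂ := by
  have hx' : (x : ℂ) ≠ 0 := by exact_mod_cast hx
  have e : (k₁ * constrainedBR x om₁)ᴴ * Inn n * (k₁ * constrainedBR x om₁) =
      (k₂ * constrainedBR x om₂)ᴴ * Inn n * (k₂ * constrainedBR x om₂) := by rw [h]
  have e' {k b : BlockMat n} (hk : kᴴ * Inn n * k = Inn n) :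
      (k * b)ᴴ * Inn n * (k * b) = bᴴ * Inn n * b := by
    calc _ = bᴴ * (kᴴ * Inn n * k) * b := by
          rw [Matrix.conjTranspose_mul]; simp only [Matrix.mul_assoc]
      _ = _ := by rw [hk]
  rw [e' h₁, e' h₂] at e
  have ho : om₁ = om₂ := by
    simp only [constrainedBR, Inn, Matrix.fromBlocks_conjTranspose, Matrix.fromBlocks_multiply,
      Matrix.fromBlocks_inj, Matrix.conjTranspose_smul, Matrix.conjTranspose_one,
      Matrix.mul_one, Matrix.mul_zero, add_zero, zero_add, Matrix.smul_mul, Matrix.one_mul,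
      Matrix.conjTranspose_zero, Matrix.zero_mul, neg_zero, Matrix.mul_neg] at e
    exact smul_right_injective _ (show star (x : ℂ) ≠ 0 by simpa using hx) e.2.1
  subst ho
  refine ⟨?_, rfl⟩
  have := congrArg (· * (constrainedBR x om₁)⁻¹) h
  simpa only [Matrix.mul_nonsing_inv_cancel_right _ _ (constrainedBR_det hx)] using this

/-- The relation between `Σ²` and its image under the unitary matrix `T = m l†`. -/
lemma IsFrame.rank (F : IsFrame σ x y S Γ C ρ τ k l r m om ν) :
    (m * lᴴ)ᴴ * dg (fun i => S i ^ 2) * (m * lᴴ) = dg S * (ρᴴ * (σ * σᴴ) * ρ) * dg S := by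
  have h : σᴴ * ρ * dg S = r * dg S * (m * lᴴ) := by
    rw [← Matrix.mul_assoc, ← F.rel, Matrix.mul_assoc _ l, mul_eq_one_comm.1 F.l_u, Matrix.mul_one]
  have e : (σᴴ * ρ * dg S)ᴴ * (σᴴ * ρ * dg S) = dg S * (ρᴴ * (σ * σᴴ) * ρ) * dg S := by
    simp only [Matrix.conjTranspose_mul, dg_conjTranspose, Matrix.conjTranspose_conjTranspose,
      Matrix.mul_assoc]
  have e2 : dg (fun i => S i ^ 2) = dg S * dg S := by rw [dg_mul_dg]; congr 1; funext i; rw [sq]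
  rw [← e, h, e2]
  simp only [Matrix.conjTranspose_mul, dg_conjTranspose, Matrix.conjTranspose_conjTranspose,
      Matrix.mul_assoc, unitary_cancel F.r_u]

lemma IsFrame.T_u (F : IsFrame σ x y S Γ C ρ τ k l r m om ν) : (m * lᴴ)ᴴ * (m * lᴴ) = 1 := by
  simp only [Matrix.conjTranspose_mul, Matrix.conjTranspose_conjTranspose, Matrix.mul_assoc,
    unitary_cancel F.m_u, mul_eq_one_comm.1 F.l_u]

lemma cartan_eq (Δ : RVec n) : cartan Δ = Matrix.fromBlocks (dg fun i => Real.cosh (Δ i))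
    (dg fun i => Real.sinh (Δ i)) (dg fun i => Real.sinh (Δ i)) (dg fun i => Real.cosh (Δ i)) := rfl

/-- The hyperbolic cosines that belong to `k_R`. -/
noncomputable def coshR (x y : ℝ) (S : RVec n) : RVec n :=
  fun i => Real.sqrt (y ^ 2 + x ^ 2 * S i ^ 2) / y

lemma coshR_pos (hy : 0 < y) (S : RVec n) (i : Fin n) : 0 < coshR x y S i := by
  unfold coshR; positivity

lemma coshR_sq (hy : 0 < y) (S : RVec n) (i : Fin n) :
    coshR x y S i ^ 2 = 1 + (x / y * S i) ^ 2 := by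
  unfold coshR
  rw [div_pow, Real.sq_sqrt (by positivity)]
  field_simp

lemma lower_right_block (hy : y ≠ 0) (X : Mat n) (S : RVec n) :
    (dg (fun i => Real.sqrt (y ^ 2 + x ^ 2 * S i ^ 2))) * X = (y : ℂ) • (dg (coshR x y S) * X) := by
  have : (fun i => Real.sqrt (y ^ 2 + x ^ 2 * S i ^ 2)) = fun i => y * coshR x y S i := by
    funext i; unfold coshR; field_simp
  rw [this, dg_smul, Matrix.smul_mul]

lemma point_toBlocks₂₂ {kR : BlockMat n} :
    (constrainedBL y σ ν * kR).toBlocks₂₂ = (y : ℂ) • kR.toBlocks₂₂ := by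
  obtain ⟨a', b', c', d', rfl⟩ : ∃ a' b' c' d', kR = Matrix.fromBlocks a' b' c' d' :=
    ⟨_, _, _, _, (Matrix.fromBlocks_toBlocks kR).symm⟩
  simp [constrainedBL, Matrix.fromBlocks_multiply]

/-- The Cartan decompositions of a point with coordinates `(Δ, p)`. -/
lemma exists_frame_of_hasCoordinates (hx : 0 < x) (hy : 0 < y) {bL kL bR kR : BlockMat n}
    (hc : IsConstrained σ x y bL kL bR kR) {Δ p : RVec n} (hΔ : ∀ i, Real.sinh (Δ i) ≠ 0)
    (h : HasCoordinates x y (kL * bR) Δ p) :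
    ∃ ρ τ k l r m om ν : Mat n,
      IsFrame σ x y (fun i => Real.sinh (Δ i)) (fun i => Real.cosh (Δ i))
        (coshR x y fun i => Real.sinh (Δ i)) ρ τ k l r m om ν ∧
      kL = kak ρ τ k l (fun i => Real.cosh (Δ i)) (fun i => Real.sinh (Δ i)) ∧
      kR = kak r τ k m (coshR x y fun i => Real.sinh (Δ i)) (fun i => x / y * Real.sinh (Δ i)) ∧
      bL = constrainedBL y σ ν ∧ bR = constrainedBR x om ∧
      ∀ i, (m * lᴴ) i i = (‖(m * lᴴ) i i‖ : ℂ) * Complex.exp (Complex.I * (p i : ℂ)) := by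
  obtain ⟨hL, hR, ⟨ν, rfl⟩, ⟨om, rfl⟩, e⟩ := hc
  obtain ⟨ρ, hρ, τ, hτ, k, hk, l, hl, om', T, e1, e2, e3⟩ := h
  have hcs (i : Fin n) : Real.cosh (Δ i) ^ 2 = 1 + Real.sinh (Δ i) ^ 2 := by
    rw [Real.cosh_sq]; ring
  replace hρ : ρᴴ * ρ = 1 := Matrix.mem_unitaryGroup_iff'.1 hρ
  replace hτ : τᴴ * τ = 1 := Matrix.mem_unitaryGroup_iff'.1 hτ
  replace hk : kᴴ * k = 1 := Matrix.mem_unitaryGroup_iff'.1 hk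
  replace hl : lᴴ * l = 1 := Matrix.mem_unitaryGroup_iff'.1 hl
  rw [cartan_eq, ← kak_eq_mul] at e1
  obtain ⟨eL, eo⟩ := constrainedBR_unique hx.ne' hL.2 (kak_preserves hcs hρ hτ hk hl) e1
  subst eo
  obtain ⟨r, m, eR, F⟩ := exists_isFrame (C := coshR x y fun i => Real.sinh (Δ i)) hx hy hΔ
    (fun i => Real.cosh_pos _) hcs
    (fun i => coshR_pos hy _ i) (fun i => coshR_sq hy _ i) hρ hτ hk hl eL hL.2 hR.2 e
  -- The lower right block of g = b_L k_R is y times that of k_R, namely yτCm, and yC is the square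
  -- root in the definition of the coordinates.
  have hT : T = m * lᴴ := by
    rw [← e, point_toBlocks₂₂, eR, kak, Matrix.toBlocks_fromBlocks₂₂] at e2
    have hd : (Matrix.diagonal fun i => (Real.sqrt (y ^ 2 + x ^ 2 * Real.sinh (Δ i) ^ 2) : ℂ)) * T =
      (y : ℂ) • (dg (coshR x y fun i => Real.sinh (Δ i)) * T) := lower_right_block hy.ne' T _
    rw [hd] at e2
    simp only [Matrix.mul_smul, Matrix.smul_mul, Matrix.mul_assoc, unitary_cancel hτ] at e2
    have hy' : (y : ℂ) ≠ 0 := by exact_mod_cast hy.ne'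
    exact (dg_left_injective (fun i => (coshR_pos hy _ i).ne')
      (smul_right_injective _ hy' e2)).symm
  rw [hT] at e3
  exact ⟨ρ, τ, k, l, r, m, om, ν, F, eL, eR, rfl, rfl, e3⟩

/-- A point given by Cartan decompositions has coordinates. -/
lemma IsFrame.hasCoordinates {Δ p : RVec n}
    (F : IsFrame σ x y (fun i => Real.sinh (Δ i)) (fun i => Real.cosh (Δ i))
        (coshR x y fun i => Real.sinh (Δ i)) ρ τ k l r m om ν)
    (hT : ∀ i, (m * lᴴ) i i = (‖(m * lᴴ) i i‖ : ℂ) * Complex.exp (Complex.I * (p i : ℂ))) :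
    HasCoordinates x y (kak ρ τ k l (fun i => Real.cosh (Δ i)) (fun i => Real.sinh (Δ i)) *
      constrainedBR x om) Δ p := by
  have mem {u : Mat n} (h : uᴴ * u = 1) : u ∈ Matrix.unitaryGroup (Fin n) ℂ :=
    Matrix.mem_unitaryGroup_iff'.2 h
  refine ⟨ρ, mem F.ρ_u, τ, mem F.τ_u, k, mem F.k_u, l, mem F.l_u, om, m * lᴴ, ?_, ?_, hT⟩
  · rw [cartan_eq, ← kak_eq_mul]
  · have hd : (Matrix.diagonal fun i => (Real.sqrt (y ^ 2 + x ^ 2 * Real.sinh (Δ i) ^ 2) : ℂ)) *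
      (m * lᴴ) = (y : ℂ) • (dg (coshR x y fun i => Real.sinh (Δ i)) * (m * lᴴ)) :=
        lower_right_block F.y_pos.ne' _ _
    have h := F.om_eq
    rw [hd, kak, constrainedBR, Matrix.fromBlocks_multiply, Matrix.toBlocks_fromBlocks₂₂,
      Matrix.mul_smul, Matrix.mul_one]
    have e : τ * dg (fun i => Real.sinh (Δ i)) * k * om =
        τ * (dg (fun i => Real.sinh (Δ i)) * k * om) := by simp only [Matrix.mul_assoc]
    rw [e, h]
    simp only [Matrix.mul_sub, Matrix.mul_smul, Matrix.mul_assoc, sub_add_cancel,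
      unitary_cancel F.τ_u, Matrix.smul_mul]

end PointStructure
end HeisenbergDouble

namespace HeisenbergDouble
-- Rank one perturbations: determinants, eigenvectors, interlacing.
section RankOne

/-- The determinant of a rank one perturbation of a diagonal matrix with a vanishing entry. -/
lemma det_diagonal_add_vecMulVec {n : ℕ} {R : Type*} [CommRing R] (d u v : Fin n → R) (i : Fin n)
    (hd : d i = 0) :
    (Matrix.diagonal d + Matrix.vecMulVec u v).det = u i * v i * ∏ j ∈ Finset.univ.erase i, d j := by
  -- Since d_i = 0, row i of the diagonal matrix is free to carry v, and column i of the identity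
  -- carries u. The two factors have determinants u_i and v_i times the product of the other d_j.
  have e : Matrix.diagonal d + Matrix.vecMulVec u v =
      Matrix.updateCol 1 i u * Matrix.updateRow (Matrix.diagonal d) i v := by
    ext a b
    rw [Matrix.mul_apply, ← Finset.add_sum_erase _ _ (Finset.mem_univ i)]
    simp only [Matrix.updateCol_self, Matrix.updateRow_self]
    rw [Matrix.add_apply, Matrix.vecMulVec_apply, add_comm]
    congr 1
    rw [Finset.sum_congr rfl (g := fun c => (1 : Matrix (Fin n) (Fin n) R) a c * Matrix.diagonal d c b)
      (fun c hc => by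
        rw [Matrix.updateCol_ne (Finset.ne_of_mem_erase hc),
          Matrix.updateRow_ne (Finset.ne_of_mem_erase hc)])]
    rw [Finset.sum_erase _ (by
      by_cases h : i = b
      · subst h; simp [hd]
      · simp [h])]
    rw [← Matrix.mul_apply, Matrix.one_mul]
  rw [e, Matrix.det_mul, ← Matrix.cramer_apply, ← Matrix.cramer_transpose_apply, Matrix.cramer_one,
    Matrix.cramer_eq_adjugate_mulVec, Matrix.diagonal_transpose, Matrix.adjugate_diagonal,
    Matrix.mulVec_diagonal]
  simp; ring

variable {n : ℕ} {T : Mat n} {w : Fin n → ℂ} {a b : RVec n} {ε : ℝ}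

/-- If `T† a T = b + ε w w†`, then the products of the `b_i - a_j` are determined by `w`. -/
lemma prod_sub_eq_of_rank_one (hT : Tᴴ * T = 1)
    (h : Tᴴ * dg a * T = dg b + (ε : ℂ) • Matrix.vecMulVec w (star w)) (i : Fin n) :
    ∏ j, (b i - a j) = -ε * ‖w i‖ ^ 2 * ∏ j ∈ Finset.univ.erase i, (b i - b j) := by
  -- The characteristic polynomial of a is evaluated at b_i, where the unperturbed diagonal matrix
  -- has a vanishing entry.
  have h1 : Tᴴ * dg (fun j => b i - a j) * T =
      dg (fun j => b i - b j) + Matrix.vecMulVec ((-(ε : ℂ)) • w) (star w) := by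
    have e (c : RVec n) : dg (fun j => b i - c j) = (b i : ℂ) • (1 : Mat n) - dg c := by
      ext j k; by_cases hjk : j = k
      · subst hjk; simp
      · simp [hjk]
    rw [e, e, Matrix.mul_sub, Matrix.sub_mul, h, Matrix.mul_smul, Matrix.smul_mul, Matrix.mul_one,
      hT, Matrix.smul_vecMulVec, neg_smul]
    abel
  have h2 := congrArg Matrix.det h1
  rw [Matrix.det_mul, Matrix.det_mul, mul_comm, ← mul_assoc, ← Matrix.det_mul,
    mul_eq_one_comm.1 hT, Matrix.det_one, one_mul, det_diagonal_add_vecMulVec _ _ _ i (by simp),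
    Matrix.det_diagonal] at h2
  have h3 : w i * star (w i) = ((‖w i‖ ^ 2 : ℝ) : ℂ) := by
    rw [Complex.star_def, Complex.mul_conj, Complex.normSq_eq_norm_sq]
  have h4 : (-(ε : ℂ)) * w i * star (w i) = ((-ε * ‖w i‖ ^ 2 : ℝ) : ℂ) := by
    rw [mul_assoc, h3]; push_cast; ring
  rw [Pi.smul_apply, smul_eq_mul, Pi.star_apply, h4] at h2
  exact_mod_cast h2

/-- The vector `u = T w` satisfies the relation with the roles of `a` and `b` exchanged. -/
lemma rank_one_symm (hT : Tᴴ * T = 1)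
    (h : Tᴴ * dg a * T = dg b + (ε : ℂ) • Matrix.vecMulVec w (star w)) :
    (Tᴴ)ᴴ * dg b * Tᴴ = dg a + ((-ε : ℝ) : ℂ) • Matrix.vecMulVec (T *ᵥ w) (star (T *ᵥ w)) := by
  have e : Matrix.vecMulVec (T *ᵥ w) (star (T *ᵥ w)) = T * Matrix.vecMulVec w (star w) * Tᴴ := by
    rw [Matrix.mul_vecMulVec, Matrix.vecMulVec_mul, Matrix.star_mulVec]
  have e2 : dg b = Tᴴ * dg a * T - (ε : ℂ) • Matrix.vecMulVec w (star w) := by rw [h]; abel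
  have e3 : T * (Tᴴ * dg a * T) * Tᴴ = dg a := by
    simp only [Matrix.mul_assoc, mul_eq_one_comm.1 hT, Matrix.mul_one]
    rw [← Matrix.mul_assoc, mul_eq_one_comm.1 hT, Matrix.one_mul]
  rw [Matrix.conjTranspose_conjTranspose, e, e2, Matrix.mul_sub, Matrix.sub_mul, e3,
    Matrix.mul_smul, Matrix.smul_mul]
  push_cast
  rw [neg_smul]; abel

/-- The (k, i) entry of aT = T(T†aT). Where a_k ≠ b_i it determines T from the vectors w and Tw as a
matrix of Cauchy type. -/
lemma rank_one_apply (hT : Tᴴ * T = 1)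
    (h : Tᴴ * dg a * T = dg b + (ε : ℂ) • Matrix.vecMulVec w (star w)) (k i : Fin n) :
    T k i * ((a k - b i : ℝ) : ℂ) = ε * ((T *ᵥ w) k * star (w i)) := by
  have h1 : dg a * T = T * dg b + (ε : ℂ) • Matrix.vecMulVec (T *ᵥ w) (star w) := by
    rw [← Matrix.mul_vecMulVec, ← Matrix.mul_smul, ← Matrix.mul_add, ← h, ← Matrix.mul_assoc,
      ← Matrix.mul_assoc, mul_eq_one_comm.1 hT, Matrix.one_mul]
  have h2 := congrFun (congrFun h1 k) i
  simp only [Matrix.diagonal_mul, Matrix.mul_diagonal, Matrix.add_apply, Matrix.smul_apply,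
    Matrix.vecMulVec_apply, smul_eq_mul, Pi.star_apply] at h2
  push_cast
  linear_combination h2

/-- Interlacing of the eigenvalues of a positive rank one perturbation, in the case where the
unperturbed eigenvalues are `c a_i`. -/
lemma le_of_rank_one {c : ℝ} (hc : 0 < c) (hT : Tᴴ * T = 1)
    (h : Tᴴ * dg a * T = dg (fun i => c * a i) + Matrix.vecMulVec w (star w)) {i j : Fin n}
    (hij : a j < a i) : a j ≤ c * a i := by
  classical
  by_contra! hlt
  -- Dimension count in the style of Courant and Fischer. One looks for e = T†ζ, with ζ supported on
  -- J, that vanishes on I and is orthogonal to w. These are |I| + 1 conditions on |J| unknowns, and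
  -- J contains I together with the two further indices i and j, so a nonzero e exists. Its
  -- quadratic form is at most c a_i times, but at least a_j times, the squared norm.
  set J := Finset.univ.filter fun k => a j ≤ a k
  set I := Finset.univ.filter fun k => a i < a k
  let f : (J → ℂ) →ₗ[ℂ] (Fin n → ℂ) :=
    (Matrix.toLin' Tᴴ).comp (LinearMap.pi fun k => if hk : k ∈ J then LinearMap.proj ⟨k, hk⟩ else 0)
  let g : (J → ℂ) →ₗ[ℂ] (I → ℂ) × ℂ :=
    (LinearMap.prod (LinearMap.funLeft ℂ ℂ ((↑) : I → Fin n))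
      (∑ k, (star (w k)) • (LinearMap.proj k : (Fin n → ℂ) →ₗ[ℂ] ℂ))).comp f
  have hcard : Module.finrank ℂ ((I → ℂ) × ℂ) < Module.finrank ℂ (J → ℂ) := by
    rw [Module.finrank_prod, Module.finrank_fintype_fun_eq_card, Module.finrank_fintype_fun_eq_card,
      Module.finrank_self, Fintype.card_coe, Fintype.card_coe]
    have hi : i ∉ insert j I := by
      have hne : i ≠ j := fun e => by subst e; exact lt_irrefl _ hij
      simp [I, hne]
    have hj : j ∉ I := by simp [I, hij.le]
    have hsub : insert i (insert j I) ⊆ J := by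
      intro k hk
      rcases Finset.mem_insert.1 hk with rfl | hk
      · simp [J, hij.le]
      rcases Finset.mem_insert.1 hk with rfl | hk
      · simp [J]
      · simp only [I, Finset.mem_filter] at hk
        simp [J, (hij.trans hk.2).le]
    have := Finset.card_le_card hsub
    rw [Finset.card_insert_of_notMem hi, Finset.card_insert_of_notMem hj] at this
    omega
  obtain ⟨z, hz, hz0⟩ := (Submodule.ne_bot_iff _).1 (LinearMap.ker_ne_bot_of_finrank_lt (f := g) hcard)
  set e := f z with he
  have hg : g z = 0 := hz
  have hI (k : Fin n) (hk : a i < a k) : e k = 0 :=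
    congrFun (congrArg Prod.fst hg) ⟨k, by simp [I, hk]⟩
  have hw : star w ⬝ᵥ e = 0 := by
    have := congrArg Prod.snd hg
    simpa [g, dotProduct] using this
  set ζ : Fin n → ℂ := fun k => if hk : k ∈ J then z ⟨k, hk⟩ else 0 with hζ
  have heζ : e = Tᴴ *ᵥ ζ := by
    simp only [he, f, LinearMap.comp_apply, Matrix.toLin'_apply]
    congr 1
    funext k
    simp only [LinearMap.pi_apply, hζ]
    split <;> simp
  have hTe : T *ᵥ e = ζ := by
    rw [heζ, Matrix.mulVec_mulVec, mul_eq_one_comm.1 hT, Matrix.one_mulVec]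
  have q (d : RVec n) (f : Fin n → ℂ) : star f ⬝ᵥ (dg d *ᵥ f) = ((∑ k, d k * ‖f k‖ ^ 2 : ℝ) : ℂ) := by
    simp only [dotProduct, Matrix.mulVec_diagonal, Pi.star_apply]
    push_cast
    refine Finset.sum_congr rfl fun k _ => ?_
    have h3 : f k * star (f k) = ((‖f k‖ ^ 2 : ℝ) : ℂ) := by
      rw [Complex.star_def, Complex.mul_conj, Complex.normSq_eq_norm_sq]
    push_cast at h3
    rw [← h3]; ring
  have h1 : star e ⬝ᵥ ((Tᴴ * dg a * T) *ᵥ e) = star ζ ⬝ᵥ (dg a *ᵥ ζ) := by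
    rw [← Matrix.mulVec_mulVec, hTe, ← Matrix.mulVec_mulVec, Matrix.dotProduct_mulVec,
      ← Matrix.star_mulVec, hTe]
  rw [h, Matrix.add_mulVec, dotProduct_add, Matrix.vecMulVec_mulVec, hw, q, q] at h1
  simp only [MulOpposite.op_zero, zero_smul, dotProduct_zero, add_zero] at h1
  have h2 : ∑ k, c * a k * ‖e k‖ ^ 2 = ∑ k, a k * ‖ζ k‖ ^ 2 := by exact_mod_cast h1
  have nrm : ∑ k, ‖e k‖ ^ 2 = ∑ k, ‖ζ k‖ ^ 2 := by
    have h4 : star ζ ⬝ᵥ ζ = star e ⬝ᵥ e := by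
      rw [← hTe, Matrix.star_mulVec, ← Matrix.dotProduct_mulVec, Matrix.mulVec_mulVec, hT,
        Matrix.one_mulVec]
    have q1 (f : Fin n → ℂ) : star f ⬝ᵥ f = ((∑ k, ‖f k‖ ^ 2 : ℝ) : ℂ) := by
      have := q (fun _ => 1) f
      rw [dg_one, Matrix.one_mulVec] at this
      simpa using this
    rw [q1, q1] at h4
    exact_mod_cast h4.symm
  have hpos : 0 < ∑ k, ‖ζ k‖ ^ 2 := by
    obtain ⟨k, hk⟩ := Function.ne_iff.1 hz0
    refine Finset.sum_pos' (fun _ _ => by positivity) ⟨k, Finset.mem_univ _, ?_⟩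
    have : ζ k = z k := by simp [hζ]
    rw [this]
    have : z k ≠ 0 := hk
    positivity
  have h5 : ∑ k, c * a k * ‖e k‖ ^ 2 ≤ c * a i * ∑ k, ‖e k‖ ^ 2 := by
    rw [Finset.mul_sum]
    refine Finset.sum_le_sum fun k _ => ?_
    by_cases hk : a i < a k
    · simp [hI k hk]
    · push Not at hk
      gcongr
  have h6 : a j * ∑ k, ‖ζ k‖ ^ 2 ≤ ∑ k, a k * ‖ζ k‖ ^ 2 := by
    rw [Finset.mul_sum]
    refine Finset.sum_le_sum fun k _ => ?_
    by_cases hk : a j ≤ a k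
    · gcongr
    · have : ζ k = 0 := by simp [hζ, J, hk]
      simp [this]
  rw [nrm] at h5
  nlinarith

end RankOne

/-! ### Interpolation identities for Cauchy matrices. -/

section Cauchy

variable {n : ℕ} {a b : RVec n}

/-- The monic polynomial with roots b_j, j ≠ i, has degree n - 1. Lagrange interpolation at the n
nodes a_k reproduces it, and the sum is its leading coefficient. -/
lemma sum_cauchy_eq_one (ha : Function.Injective a) (i : Fin n) :
    ∑ k, (∏ j ∈ Finset.univ.erase i, (a k - b j)) / ∏ j ∈ Finset.univ.erase k, (a k - a j) = 1 := by
  have hn : 0 < n := i.pos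
  have hc : (Finset.univ.erase i).card = n - 1 := by simp
  have hmon : (Lagrange.nodal (Finset.univ.erase i) b).Monic := Lagrange.nodal_monic
  have hdeg : (Lagrange.nodal (Finset.univ.erase i) b).natDegree = n - 1 := by
    rw [Lagrange.natDegree_nodal, hc]
  have h := Lagrange.coeff_eq_sum (s := Finset.univ) (v := a) ha.injOn
    (P := Lagrange.nodal (Finset.univ.erase i) b) (by
      rw [Lagrange.degree_nodal, hc, Finset.card_univ, Fintype.card_fin]
      exact_mod_cast Nat.sub_lt hn one_pos)
  rw [Finset.card_univ, Fintype.card_fin, ← hdeg, hmon.coeff_natDegree] at h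
  rw [h]
  refine Finset.sum_congr rfl fun k _ => ?_
  rw [Lagrange.eval_nodal]

/-- The same interpolation as in `sum_cauchy_eq_one`, evaluated at the point b_i, which is not a
node. -/
lemma sum_cauchy_sq (ha : Function.Injective a) (hab : ∀ i j, a i ≠ b j) (i : Fin n) :
    (∏ j, (b i - a j)) * ∑ k, (∏ j ∈ Finset.univ.erase i, (a k - b j)) /
      ((a k - b i) * ∏ j ∈ Finset.univ.erase k, (a k - a j)) =
      - ∏ j ∈ Finset.univ.erase i, (b i - b j) := by
  have hn : 0 < n := i.pos
  have hc : (Finset.univ.erase i).card = n - 1 := by simp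
  have h := Lagrange.eq_interpolate (s := Finset.univ) (v := a) ha.injOn
    (f := Lagrange.nodal (Finset.univ.erase i) b) (by
      rw [Lagrange.degree_nodal, hc, Finset.card_univ, Fintype.card_fin]
      exact_mod_cast Nat.sub_lt hn one_pos)
  have h2 := congrArg (Polynomial.eval (b i)) h
  rw [Lagrange.eval_interpolate_not_at_node _ (fun k _ => (hab k i).symm), Lagrange.eval_nodal,
    Lagrange.eval_nodal] at h2
  rw [h2, ← mul_neg, ← Finset.sum_neg_distrib]
  congr 1
  refine Finset.sum_congr rfl fun k _ => ?_
  rw [Lagrange.eval_nodal, Lagrange.nodalWeight, Finset.prod_inv_distrib,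
    show b i - a k = -(a k - b i) by ring, inv_neg]
  rw [div_eq_mul_inv, mul_inv]
  ring

end Cauchy
end HeisenbergDouble

namespace HeisenbergDouble
-- The explicit orthogonal matrix R of Cauchy type.
section RealCauchy

variable {n : ℕ} {α : ℝ} {S : RVec n}

lemma log_sq (t : ℝ) : Real.log (t ^ 2) = 2 * Real.log t := by rw [Real.log_pow]; norm_num

/-- On the logarithmic scale S_i² and S_j² are further apart than |log α²|. Multiplying one of them
by α² therefore does not change their order, and numerator and denominator have the same sign. -/
lemma allChambers_ratio_pos (hα : α ≠ 0) (hS : S ∈ allChambers n α) {i j : Fin n} (h : i ≠ j) :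
    0 < (α ^ 2 * S i ^ 2 - S j ^ 2) / (S i ^ 2 - S j ^ 2) ∧
      0 < (S i ^ 2 - α ^ 2 * S j ^ 2) / (S i ^ 2 - S j ^ 2) := by
  obtain ⟨h0, h1⟩ := hS
  have hi : 0 < S i ^ 2 := by have := h0 i; positivity
  have hj : 0 < S j ^ 2 := by have := h0 j; positivity
  have ha : 0 < α ^ 2 := by positivity
  have h2 := h1 i j h
  have li := log_sq (S i)
  have lj := log_sq (S j)
  have la := log_sq α
  have lai : Real.log (α ^ 2 * S i ^ 2) = 2 * Real.log α + 2 * Real.log (S i) := by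
    rw [Real.log_mul ha.ne' hi.ne', la, li]
  have laj : Real.log (α ^ 2 * S j ^ 2) = 2 * Real.log α + 2 * Real.log (S j) := by
    rw [Real.log_mul ha.ne' hj.ne', la, lj]
  have b1 := neg_abs_le (Real.log α)
  have b2 := le_abs_self (Real.log α)
  rcases lt_or_ge (Real.log (S i) - Real.log (S j)) 0 with hlt | hge
  · rw [abs_of_neg hlt] at h2
    have c1 : S i ^ 2 < S j ^ 2 := (Real.log_lt_log_iff hi hj).1 (by rw [li, lj]; linarith)
    have c2 : α ^ 2 * S i ^ 2 < S j ^ 2 :=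
      (Real.log_lt_log_iff (by positivity) hj).1 (by rw [lai, lj]; linarith)
    have c3 : S i ^ 2 < α ^ 2 * S j ^ 2 :=
      (Real.log_lt_log_iff hi (by positivity)).1 (by rw [laj, li]; linarith)
    exact ⟨div_pos_of_neg_of_neg (by linarith) (by linarith),
      div_pos_of_neg_of_neg (by linarith) (by linarith)⟩
  · rw [abs_of_nonneg hge] at h2
    have c1 : S j ^ 2 < S i ^ 2 := (Real.log_lt_log_iff hj hi).1 (by
      rw [li, lj]; have := abs_nonneg (Real.log α); linarith)
    have c2 : S j ^ 2 < α ^ 2 * S i ^ 2 :=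
      (Real.log_lt_log_iff hj (by positivity)).1 (by rw [lai, lj]; linarith)
    have c3 : α ^ 2 * S j ^ 2 < S i ^ 2 :=
      (Real.log_lt_log_iff (by positivity) hi).1 (by rw [laj, li]; linarith)
    exact ⟨div_pos (by linarith) (by linarith), div_pos (by linarith) (by linarith)⟩

lemma allChambers_sq_ne (hα : α ≠ 0) (hS : S ∈ allChambers n α) {i j : Fin n} (h : i ≠ j) :
    S i ^ 2 ≠ S j ^ 2 := by
  have h1 := (allChambers_ratio_pos hα hS h).1
  intro e
  rw [e, sub_self, div_zero] at h1
  exact lt_irrefl _ h1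

lemma allChambers_cross_ne (hα : α ≠ 0) (hα1 : α ^ 2 ≠ 1) (hS : S ∈ allChambers n α)
    (i j : Fin n) : S i ^ 2 ≠ α ^ 2 * S j ^ 2 := by
  by_cases h : i = j
  · subst h
    intro e
    have : S i ^ 2 ≠ 0 := pow_ne_zero _ (hS.1 i)
    exact hα1 (mul_right_cancel₀ this (by linarith))
  · have h1 := (allChambers_ratio_pos hα hS h).2
    intro e
    rw [e, sub_self, zero_div] at h1
    exact lt_irrefl _ h1

/-- The sign `ε = - sgn log α²`. -/
noncomputable def epsSign (α : ℝ) : ℝ := -Real.sign (Real.log (α ^ 2))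

lemma epsSign_eq (hα : α ≠ 0) (hα1 : α ^ 2 ≠ 1) :
    (epsSign α = -1 ∧ 1 < α ^ 2) ∨ (epsSign α = 1 ∧ α ^ 2 < 1) := by
  have ha : 0 < α ^ 2 := by positivity
  rcases lt_or_gt_of_ne hα1 with h | h
  · right
    exact ⟨by rw [epsSign, Real.sign_of_neg (Real.log_neg ha h), neg_neg], h⟩
  · left
    exact ⟨by rw [epsSign, Real.sign_of_pos (Real.log_pos h)], h⟩

lemma epsSign_sq (hα : α ≠ 0) (hα1 : α ^ 2 ≠ 1) : epsSign α * epsSign α = 1 := by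
  rcases epsSign_eq hα hα1 with h | h <;> rw [h.1] <;> norm_num

lemma epsSign_mul_abs (hα : α ≠ 0) (hα1 : α ^ 2 ≠ 1) : epsSign α * |1 - α ^ 2| = 1 - α ^ 2 := by
  rcases epsSign_eq hα hα1 with h | h <;> rw [h.1]
  · rw [abs_of_neg (by linarith)]; ring
  · rw [abs_of_pos (by linarith)]; ring

/-- The squares of the components of the vector `Σ ρ† v`. -/
noncomputable def wSq (α : ℝ) (S : RVec n) (i : Fin n) : ℝ :=
  |1 - α ^ 2| * S i ^ 2 * ∏ j ∈ Finset.univ.erase i,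
    ((α ^ 2 * S i ^ 2 - S j ^ 2) / (α ^ 2 * S i ^ 2 - α ^ 2 * S j ^ 2))

/-- The squares of the components of the vector `T Σ ρ† v`. -/
noncomputable def uSq (α : ℝ) (S : RVec n) (i : Fin n) : ℝ :=
  |1 - α ^ 2| * S i ^ 2 * ∏ j ∈ Finset.univ.erase i,
    ((S i ^ 2 - α ^ 2 * S j ^ 2) / (S i ^ 2 - S j ^ 2))

/-- The real orthogonal matrix `exp(-ip) T`, in the gauge in which `ρ† v` is positive. -/
noncomputable def cauchyT (α : ℝ) (S : RVec n) : RMat n := Matrix.of fun k i =>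
  epsSign α * (Real.sqrt (uSq α S k) * Real.sqrt (wSq α S i)) / (S k ^ 2 - α ^ 2 * S i ^ 2)

lemma wSq_pos (hα : α ≠ 0) (hα1 : α ^ 2 ≠ 1) (hS : S ∈ allChambers n α) (i : Fin n) :
    0 < wSq α S i := by
  have h1 : 0 < |1 - α ^ 2| := abs_pos.2 (sub_ne_zero.2 hα1.symm)
  have h2 : 0 < S i ^ 2 := by have := hS.1 i; positivity
  have ha : 0 < α ^ 2 := by positivity
  refine mul_pos (mul_pos h1 h2) (Finset.prod_pos fun j hj => ?_)
  have h3 := (allChambers_ratio_pos hα hS (Finset.ne_of_mem_erase hj).symm).1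
  rw [← mul_sub, mul_comm (α ^ 2) (S i ^ 2 - S j ^ 2), ← div_div]
  exact div_pos h3 ha

lemma uSq_pos (hα : α ≠ 0) (hα1 : α ^ 2 ≠ 1) (hS : S ∈ allChambers n α) (i : Fin n) :
    0 < uSq α S i := by
  have h1 : 0 < |1 - α ^ 2| := abs_pos.2 (sub_ne_zero.2 hα1.symm)
  have h2 : 0 < S i ^ 2 := by have := hS.1 i; positivity
  exact mul_pos (mul_pos h1 h2) (Finset.prod_pos fun j hj =>
    (allChambers_ratio_pos hα hS (Finset.ne_of_mem_erase hj).symm).2)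

/-- Up to the sign ε, the prefactor |1 - α²| S_i² is the factor j = i that is missing in the
product. In `wSq_eq` that factor has the opposite sign. -/
lemma uSq_eq (hα : α ≠ 0) (hα1 : α ^ 2 ≠ 1) (i : Fin n) :
    uSq α S i = epsSign α * ((∏ j, (S i ^ 2 - α ^ 2 * S j ^ 2)) /
      ∏ j ∈ Finset.univ.erase i, (S i ^ 2 - S j ^ 2)) := by
  rw [← Finset.mul_prod_erase _ _ (Finset.mem_univ i), uSq, Finset.prod_div_distrib]
  have h := epsSign_mul_abs hα hα1
  have h2 := epsSign_sq hα hα1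
  have h3 : |1 - α ^ 2| = epsSign α * (1 - α ^ 2) := by
    linear_combination epsSign α * h - |1 - α ^ 2| * h2
  rw [h3]; ring

lemma wSq_eq (hα : α ≠ 0) (hα1 : α ^ 2 ≠ 1) (i : Fin n) :
    wSq α S i = -epsSign α * ((∏ j, (α ^ 2 * S i ^ 2 - S j ^ 2)) /
      ∏ j ∈ Finset.univ.erase i, (α ^ 2 * S i ^ 2 - α ^ 2 * S j ^ 2)) := by
  rw [← Finset.mul_prod_erase _ _ (Finset.mem_univ i), wSq, Finset.prod_div_distrib]
  have h := epsSign_mul_abs hα hα1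
  have h2 := epsSign_sq hα hα1
  have h3 : |1 - α ^ 2| = epsSign α * (1 - α ^ 2) := by
    linear_combination epsSign α * h - |1 - α ^ 2| * h2
  rw [h3]; ring

/-- The denominator cancels the factor j = i in the numerator of `uSq_eq`, which leaves the Lagrange
sum with nodes S_k² and roots α²S_j². -/
lemma sum_uSq_div (hα : α ≠ 0) (hα1 : α ^ 2 ≠ 1) (hS : S ∈ allChambers n α) (i : Fin n) :
    ∑ k, uSq α S k / (S k ^ 2 - α ^ 2 * S i ^ 2) = epsSign α := by
  have hinj : Function.Injective fun i => S i ^ 2 := fun i j h => by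
    by_contra hne; exact allChambers_sq_ne hα hS hne h
  have h := sum_cauchy_eq_one (b := fun j => α ^ 2 * S j ^ 2) hinj i
  rw [← mul_one (epsSign α), ← h, Finset.mul_sum]
  refine Finset.sum_congr rfl fun k _ => ?_
  rw [uSq_eq hα hα1, ← Finset.mul_prod_erase _ _ (Finset.mem_univ i)]
  have := sub_ne_zero.2 (allChambers_cross_ne hα hα1 hS k i)
  field_simp

lemma sum_uSq_div_sq (hα : α ≠ 0) (hα1 : α ^ 2 ≠ 1) (hS : S ∈ allChambers n α) (i : Fin n) :
    wSq α S i * ∑ k, uSq α S k / (S k ^ 2 - α ^ 2 * S i ^ 2) ^ 2 = 1 := by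
  have hinj : Function.Injective fun i => S i ^ 2 := fun i j h => by
    by_contra hne; exact allChambers_sq_ne hα hS hne h
  have h := sum_cauchy_sq (b := fun j => α ^ 2 * S j ^ 2) hinj
    (fun k i => allChambers_cross_ne hα hα1 hS k i) i
  have e : ∑ k, uSq α S k / (S k ^ 2 - α ^ 2 * S i ^ 2) ^ 2 = epsSign α *
      ∑ k, (∏ j ∈ Finset.univ.erase i, (S k ^ 2 - α ^ 2 * S j ^ 2)) /
      ((S k ^ 2 - α ^ 2 * S i ^ 2) * ∏ j ∈ Finset.univ.erase k, (S k ^ 2 - S j ^ 2)) := by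
    rw [Finset.mul_sum]
    refine Finset.sum_congr rfl fun k _ => ?_
    rw [uSq_eq hα hα1, ← Finset.mul_prod_erase _ _ (Finset.mem_univ i)]
    have := sub_ne_zero.2 (allChambers_cross_ne hα hα1 hS k i)
    field_simp
  have hne : ∏ j ∈ Finset.univ.erase i, (α ^ 2 * S i ^ 2 - α ^ 2 * S j ^ 2) ≠ 0 :=
    Finset.prod_ne_zero_iff.2 fun j hj => by
      rw [← mul_sub]
      exact mul_ne_zero (pow_ne_zero _ hα)
        (sub_ne_zero.2 (allChambers_sq_ne hα hS (Finset.ne_of_mem_erase hj).symm))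
  have h2 := epsSign_sq hα hα1
  rw [e, wSq_eq hα hα1]
  calc _ = -(epsSign α * epsSign α) * (((∏ j, (α ^ 2 * S i ^ 2 - S j ^ 2)) * ∑ k, (∏ j ∈ Finset.univ.erase i, (S k ^ 2 - α ^ 2 * S j ^ 2)) /
      ((S k ^ 2 - α ^ 2 * S i ^ 2) * ∏ j ∈ Finset.univ.erase k, (S k ^ 2 - S j ^ 2))) /
      ∏ j ∈ Finset.univ.erase i, (α ^ 2 * S i ^ 2 - α ^ 2 * S j ^ 2)) := by ring
    _ = 1 := by rw [h, h2, neg_div, div_self hne]; ring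

/-- The diagonal entries are `sum_uSq_div_sq`. Off the diagonal, partial fractions turn the sum over
k into a divided difference of the sums in `sum_uSq_div`, which do not depend on i. -/
lemma cauchyT_orthogonal (hα : α ≠ 0) (hα1 : α ^ 2 ≠ 1) (hS : S ∈ allChambers n α) :
    (cauchyT α S)ᵀ * cauchyT α S = 1 := by
  have h2 := epsSign_sq hα hα1
  have hw := fun i => Real.mul_self_sqrt (wSq_pos hα hα1 hS i).le
  have hu := fun i => Real.mul_self_sqrt (uSq_pos hα hα1 hS i).le
  ext i j
  have e : ((cauchyT α S)ᵀ * cauchyT α S) i j = Real.sqrt (wSq α S i) * Real.sqrt (wSq α S j) *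
      ∑ k, uSq α S k / ((S k ^ 2 - α ^ 2 * S i ^ 2) * (S k ^ 2 - α ^ 2 * S j ^ 2)) := by
    rw [Matrix.mul_apply, Finset.mul_sum]
    refine Finset.sum_congr rfl fun k _ => ?_
    have h3 := sub_ne_zero.2 (allChambers_cross_ne hα hα1 hS k i)
    have h4 := sub_ne_zero.2 (allChambers_cross_ne hα hα1 hS k j)
    simp only [cauchyT, Matrix.transpose_apply, Matrix.of_apply]
    field_simp
    linear_combination (Real.sqrt (wSq α S i) * Real.sqrt (wSq α S j) *
      (Real.sqrt (uSq α S k) * Real.sqrt (uSq α S k))) * h2 +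
      (Real.sqrt (wSq α S i) * Real.sqrt (wSq α S j)) * hu k
  rw [e]
  by_cases h : i = j
  · subst h
    rw [Matrix.one_apply_eq, hw, ← sum_uSq_div_sq hα hα1 hS i]
    simp only [sq]
  · rw [Matrix.one_apply_ne h]
    refine mul_eq_zero_of_right _ ?_
    have hne : α ^ 2 * S i ^ 2 - α ^ 2 * S j ^ 2 ≠ 0 := by
      rw [← mul_sub]
      exact mul_ne_zero (pow_ne_zero _ hα) (sub_ne_zero.2 (allChambers_sq_ne hα hS h))
    have : ∑ k, uSq α S k / ((S k ^ 2 - α ^ 2 * S i ^ 2) * (S k ^ 2 - α ^ 2 * S j ^ 2)) =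
        (∑ k, uSq α S k / (S k ^ 2 - α ^ 2 * S i ^ 2) - ∑ k, uSq α S k / (S k ^ 2 - α ^ 2 * S j ^ 2)) /
          (α ^ 2 * S i ^ 2 - α ^ 2 * S j ^ 2) := by
      rw [← Finset.sum_sub_distrib, Finset.sum_div]
      refine Finset.sum_congr rfl fun k _ => ?_
      have h3 := sub_ne_zero.2 (allChambers_cross_ne hα hα1 hS k i)
      have h4 := sub_ne_zero.2 (allChambers_cross_ne hα hα1 hS k j)
      rw [div_sub_div _ _ h3 h4, div_div, eq_div_iff (mul_ne_zero (mul_ne_zero h3 h4) hne),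
        div_mul_eq_mul_div, div_eq_iff (mul_ne_zero h3 h4)]
      ring
    rw [this, sum_uSq_div hα hα1 hS, sum_uSq_div hα hα1 hS, sub_self, zero_div]

/-- The positive vector `ρ† v`. -/
noncomputable def vHat (α : ℝ) (S : RVec n) : RVec n := fun i => Real.sqrt (wSq α S i) / S i

/-- By construction R solves S²R = α²RS² + ε u wᵀ, where u and w are the positive square roots of
`uSq` and `wSq`. It remains to see Rᵀu = w, which is again `sum_uSq_div`. -/
lemma cauchyT_rank (hα : α ≠ 0) (hα1 : α ^ 2 ≠ 1) (hS : S ∈ allChambers n α) :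
    (cauchyT α S)ᵀ * Matrix.diagonal (fun i => S i ^ 2) * cauchyT α S = Matrix.diagonal S *
      (α ^ 2 • (1 : RMat n) + epsSign α • Matrix.vecMulVec (vHat α S) (vHat α S)) *
        Matrix.diagonal S := by
  have h2 := epsSign_sq hα hα1
  have hw := fun i => Real.mul_self_sqrt (wSq_pos hα hα1 hS i).le
  have hu := fun i => Real.mul_self_sqrt (uSq_pos hα hα1 hS i).le
  have e1 : Matrix.diagonal (fun i => S i ^ 2) * cauchyT α S =
      cauchyT α S * Matrix.diagonal (fun i => α ^ 2 * S i ^ 2) +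
        epsSign α • Matrix.vecMulVec (fun k => Real.sqrt (uSq α S k)) (fun i => Real.sqrt (wSq α S i)) := by
    ext k i
    have h3 := sub_ne_zero.2 (allChambers_cross_ne hα hα1 hS k i)
    simp only [Matrix.diagonal_mul, Matrix.add_apply, Matrix.mul_diagonal, Matrix.smul_apply,
      Matrix.vecMulVec_apply, cauchyT, Matrix.of_apply, smul_eq_mul]
    field_simp
    ring
  have e2 : Matrix.mulVec (cauchyT α S)ᵀ (fun k => Real.sqrt (uSq α S k)) = fun i => Real.sqrt (wSq α S i) := by
    funext i
    have : Real.sqrt (wSq α S i) = epsSign α * Real.sqrt (wSq α S i) *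
        ∑ k, uSq α S k / (S k ^ 2 - α ^ 2 * S i ^ 2) := by
      rw [sum_uSq_div hα hα1 hS]; linear_combination -Real.sqrt (wSq α S i) * h2
    rw [this, Finset.mul_sum, Matrix.mulVec, dotProduct]
    refine Finset.sum_congr rfl fun k _ => ?_
    simp only [cauchyT, Matrix.transpose_apply, Matrix.of_apply]
    linear_combination (epsSign α * Real.sqrt (wSq α S i) / (S k ^ 2 - α ^ 2 * S i ^ 2)) * hu k
  rw [Matrix.mul_assoc, e1, Matrix.mul_add, ← Matrix.mul_assoc, cauchyT_orthogonal hα hα1 hS,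
    Matrix.one_mul, Matrix.mul_smul, Matrix.mul_vecMulVec, e2]
  ext i j
  have hi := hS.1 i
  have hj := hS.1 j
  simp only [Matrix.add_apply, Matrix.mul_diagonal, Matrix.diagonal_mul, Matrix.smul_apply,
    Matrix.vecMulVec_apply, smul_eq_mul, vHat]
  by_cases h : i = j
  · subst h
    simp only [Matrix.diagonal_apply_eq, Matrix.one_apply_eq]
    field_simp
  · simp only [Matrix.diagonal_apply_ne _ h, Matrix.one_apply_ne h]
    field_simp
    ring

/-- On the diagonal the denominator is (1 - α²)S_i², whose sign is ε. Hence the phases of the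
diagonal of exp(ip)R are exactly the p_i. -/
lemma cauchyT_diag_pos (hα : α ≠ 0) (hα1 : α ^ 2 ≠ 1) (hS : S ∈ allChambers n α) (i : Fin n) :
    0 < cauchyT α S i i := by
  have hw := Real.sqrt_pos.2 (wSq_pos hα hα1 hS i)
  have hu := Real.sqrt_pos.2 (uSq_pos hα hα1 hS i)
  have h2 : 0 < S i ^ 2 := by have := hS.1 i; positivity
  have h3 : S i ^ 2 - α ^ 2 * S i ^ 2 = epsSign α * (|1 - α ^ 2| * S i ^ 2) := by
    rw [← mul_assoc, epsSign_mul_abs hα hα1]; ring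
  have h1 : 0 < |1 - α ^ 2| := abs_pos.2 (sub_ne_zero.2 hα1.symm)
  have h4 : epsSign α ≠ 0 := fun h => by have := epsSign_sq hα hα1; rw [h] at this; norm_num at this
  simp only [cauchyT, Matrix.of_apply]
  rw [h3, mul_div_mul_left _ _ h4]
  positivity

end RealCauchy
end HeisenbergDouble

namespace HeisenbergDouble
-- The gauge in which ρ†v is a prescribed real vector.
section NormalForm

variable {n : ℕ} {σ om ν : Mat n} {α x y : ℝ} {S Γ C : RVec n} {ρ τ k l r m d : Mat n}
  {v : Fin n → ℂ}

/-- A diagonal unitary change of the Cartan decompositions. -/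
lemma IsFrame.gauge (F : IsFrame σ x y S Γ C ρ τ k l r m om ν) (hd : dᴴ * d = 1)
    (hc : ∀ f : RVec n, d * dg f = dg f * d) :
    IsFrame σ x y S Γ C (ρ * dᴴ) (τ * dᴴ) (d * k) (d * l) (r * dᴴ) (d * m) om ν := by
  have hd' : d * dᴴ = 1 := mul_eq_one_comm.1 hd
  have hc' (f : RVec n) : dᴴ * dg f = dg f * dᴴ := by
    have := congrArg Matrix.conjTranspose (hc f)
    simpa only [Matrix.conjTranspose_mul, dg_conjTranspose] using this.symm
  have uR {X : Mat n} (h : Xᴴ * X = 1) : (X * dᴴ)ᴴ * (X * dᴴ) = 1 := by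
    simp only [Matrix.conjTranspose_mul, Matrix.conjTranspose_conjTranspose, Matrix.mul_assoc,
      unitary_cancel h, hd']
  have uL {X : Mat n} (h : Xᴴ * X = 1) : (d * X)ᴴ * (d * X) = 1 := by
    simp only [Matrix.conjTranspose_mul, Matrix.mul_assoc, unitary_cancel hd, h]
  have mid (X Y : Mat n) (f : RVec n) : X * dᴴ * dg f * (d * Y) = X * dg f * Y := by
    calc _ = X * (dᴴ * dg f) * d * Y := by simp only [Matrix.mul_assoc]
      _ = X * dg f * (dᴴ * d) * Y := by rw [hc']; simp only [Matrix.mul_assoc]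
      _ = _ := by rw [hd, Matrix.mul_one]
  have front (X : Mat n) (f : RVec n) : dg f * (d * X) = d * (dg f * X) := by
    rw [← Matrix.mul_assoc, ← hc, Matrix.mul_assoc]
  have back (X : Mat n) (f : RVec n) : X * dᴴ * dg f = X * dg f * dᴴ := by
    rw [Matrix.mul_assoc, hc', ← Matrix.mul_assoc]
  exact { F with
    ρ_u := uR F.ρ_u
    τ_u := uR F.τ_u
    k_u := uL F.k_u
    l_u := uL F.l_u
    r_u := uR F.r_u
    m_u := uL F.m_u
    rel := by rw [← Matrix.mul_assoc σᴴ, mid, mid, F.rel]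
    om_eq := by
      rw [front, front, front, Matrix.mul_assoc d, F.om_eq, Matrix.mul_sub, Matrix.mul_smul,
        Matrix.mul_smul]
    ν_eq := by
      rw [← Matrix.mul_assoc ν, back, back, ← Matrix.mul_assoc σ, back, F.ν_eq, Matrix.sub_mul,
        Matrix.smul_mul] }

lemma kak_gauge (hd : dᴴ * d = 1) (hc : ∀ f : RVec n, d * dg f = dg f * d) (c s : RVec n) :
    kak (ρ * dᴴ) (τ * dᴴ) (d * k) (d * l) c s = kak ρ τ k l c s := by
  have hc' (f : RVec n) : dᴴ * dg f = dg f * dᴴ := by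
    have := congrArg Matrix.conjTranspose (hc f)
    simpa only [Matrix.conjTranspose_mul, dg_conjTranspose] using this.symm
  have mid (X Y : Mat n) (f : RVec n) : X * dᴴ * dg f * (d * Y) = X * dg f * Y := by
    calc _ = X * (dᴴ * dg f) * d * Y := by simp only [Matrix.mul_assoc]
      _ = X * dg f * (dᴴ * d) * Y := by rw [hc']; simp only [Matrix.mul_assoc]
      _ = _ := by rw [hd, Matrix.mul_one]
  simp only [kak, mid]

/-- The rank one perturbation relation satisfied by `T = m l†`. -/
lemma IsFrame.rank_one (F : IsFrame σ x y S Γ C ρ τ k l r m om ν) (hσ : IsKKS α v σ) :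
    (m * lᴴ)ᴴ * dg (fun i => S i ^ 2) * (m * lᴴ) = dg (fun i => α ^ 2 * S i ^ 2) +
      (epsSign α : ℂ) • Matrix.vecMulVec (dg S *ᵥ (ρᴴ *ᵥ v)) (star (dg S *ᵥ (ρᴴ *ᵥ v))) := by
  have e : Matrix.vecMulVec (dg S *ᵥ (ρᴴ *ᵥ v)) (star (dg S *ᵥ (ρᴴ *ᵥ v))) =
      dg S * (ρᴴ * Matrix.vecMulVec v (star v) * ρ) * dg S := by
    rw [Matrix.mul_vecMulVec, Matrix.vecMulVec_mul, Matrix.mul_vecMulVec, Matrix.vecMulVec_mul,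
      Matrix.star_mulVec, Matrix.star_mulVec, dg_conjTranspose, Matrix.conjTranspose_conjTranspose]
  have e2 : dg (fun i => α ^ 2 * S i ^ 2) = ((α ^ 2 : ℝ) : ℂ) • (dg S * dg S) := by
    rw [dg_smul, dg_mul_dg]; simp only [sq]
  rw [F.rank, hσ.2.2, e, e2, epsSign]
  simp only [Matrix.mul_add, Matrix.add_mul, Matrix.mul_smul, Matrix.smul_mul, Matrix.mul_one,
    F.ρ_u]

/-- The product formula `prod_sub_eq_of_rank_one` is solved for |w_i|²; the remaining product is
nonzero because the S_j² are distinct. -/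
lemma norm_sq_w (hα : α ≠ 0) (hα1 : α ^ 2 ≠ 1) (hS : S ∈ allChambers n α) {T : Mat n}
    {w : Fin n → ℂ} (hT : Tᴴ * T = 1) (h : Tᴴ * dg (fun i => S i ^ 2) * T =
      dg (fun i => α ^ 2 * S i ^ 2) + (epsSign α : ℂ) • Matrix.vecMulVec w (star w)) (i : Fin n) :
    ‖w i‖ ^ 2 = wSq α S i := by
  have h1 := prod_sub_eq_of_rank_one hT h i
  have h2 := epsSign_sq hα hα1
  have hne : ∏ j ∈ Finset.univ.erase i, (α ^ 2 * S i ^ 2 - α ^ 2 * S j ^ 2) ≠ 0 :=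
    Finset.prod_ne_zero_iff.2 fun j hj => by
      rw [← mul_sub]
      exact mul_ne_zero (pow_ne_zero _ hα)
        (sub_ne_zero.2 (allChambers_sq_ne hα hS (Finset.ne_of_mem_erase hj).symm))
  rw [wSq_eq hα hα1, h1, mul_div_cancel_right₀ _ hne]
  linear_combination (-‖w i‖ ^ 2) * h2

lemma norm_sq_u (hα : α ≠ 0) (hα1 : α ^ 2 ≠ 1) (hS : S ∈ allChambers n α) {T : Mat n}
    {w : Fin n → ℂ} (hT : Tᴴ * T = 1) (h : Tᴴ * dg (fun i => S i ^ 2) * T =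
      dg (fun i => α ^ 2 * S i ^ 2) + (epsSign α : ℂ) • Matrix.vecMulVec w (star w)) (i : Fin n) :
    ‖(T *ᵥ w) i‖ ^ 2 = uSq α S i := by
  have h1 := prod_sub_eq_of_rank_one (T := Tᴴ)
    (by rw [Matrix.conjTranspose_conjTranspose]; exact mul_eq_one_comm.1 hT) (rank_one_symm hT h) i
  have h2 := epsSign_sq hα hα1
  have hne : ∏ j ∈ Finset.univ.erase i, (S i ^ 2 - S j ^ 2) ≠ 0 :=
    Finset.prod_ne_zero_iff.2 fun j hj =>
      sub_ne_zero.2 (allChambers_sq_ne hα hS (Finset.ne_of_mem_erase hj).symm)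
  rw [uSq_eq hα hα1, h1, mul_div_cancel_right₀ _ hne]
  linear_combination (-‖(T *ᵥ w) i‖ ^ 2) * h2

/-- In the gauge in which `w` is positive, `T` is the product of its phases and a real matrix. -/
lemma eq_phase_mul_cauchyT (hα : α ≠ 0) (hα1 : α ^ 2 ≠ 1) (hS : S ∈ allChambers n α) {T : Mat n}
    (hT : Tᴴ * T = 1) {w : Fin n → ℂ} (h : Tᴴ * dg (fun i => S i ^ 2) * T =
      dg (fun i => α ^ 2 * S i ^ 2) + (epsSign α : ℂ) • Matrix.vecMulVec w (star w))
    (hw : ∀ i, w i = (Real.sqrt (wSq α S i) : ℂ)) {p : RVec n}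
    (hp : ∀ i, T i i = (‖T i i‖ : ℂ) * Complex.exp (Complex.I * (p i : ℂ))) :
    T = phase p * ofRealM (cauchyT α S) := by
  have hap := rank_one_apply hT h
  have ha1 : 0 < |1 - α ^ 2| := abs_pos.2 (sub_ne_zero.2 hα1.symm)
  have h2 := epsSign_sq hα hα1
  have hu (i : Fin n) : (T *ᵥ w) i = (Real.sqrt (uSq α S i) : ℂ) *
      Complex.exp (Complex.I * (p i : ℂ)) := by
    have hws := Real.sqrt_pos.2 (wSq_pos hα hα1 hS i)
    have hi : 0 < S i ^ 2 := by have := hS.1 i; positivity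
    -- The diagonal entry of `rank_one_apply`, with 1 - α² = ε|1 - α²|, gives (Tw)_i = c exp(ip_i).
    -- So (Tw)_i has the phase of T_ii, and its modulus is known from `norm_sq_u`.
    set c : ℝ := ‖T i i‖ * (|1 - α ^ 2| * S i ^ 2) / Real.sqrt (wSq α S i) with hc
    have hc0 : 0 ≤ c := by positivity
    have e : (T *ᵥ w) i = (c : ℂ) * Complex.exp (Complex.I * (p i : ℂ)) := by
      have h3 := hap i i
      have h4 : S i ^ 2 - α ^ 2 * S i ^ 2 = epsSign α * (|1 - α ^ 2| * S i ^ 2) := by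
        rw [← mul_assoc, epsSign_mul_abs hα hα1]; ring
      have hws' : (Real.sqrt (wSq α S i) : ℂ) ≠ 0 := by exact_mod_cast hws.ne'
      have h2' : (epsSign α : ℂ) * epsSign α = 1 := by exact_mod_cast h2
      rw [h4, hp i, hw i, Complex.star_def, Complex.conj_ofReal] at h3
      rw [hc]
      push_cast at h3 ⊢
      rw [div_mul_eq_mul_div, eq_div_iff hws']
      linear_combination (-(epsSign α : ℂ)) * h3 + ((‖T i i‖ : ℂ) * Complex.exp (Complex.I * (p i : ℂ)) *
        ((|1 - α ^ 2| : ℝ) * (S i : ℂ) ^ 2) - (T *ᵥ w) i * (Real.sqrt (wSq α S i) : ℂ)) * h2'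
    have hn := norm_sq_u hα hα1 hS hT h i
    have hexp : ‖Complex.exp (Complex.I * (p i : ℂ))‖ = 1 := by
      rw [mul_comm]; exact Complex.norm_exp_ofReal_mul_I _
    rw [e, norm_mul, hexp, mul_one, Complex.norm_real, Real.norm_of_nonneg hc0] at hn
    rw [e, ← hn, Real.sqrt_sq hc0]
  ext k i
  have h3 := hap k i
  have hne : S k ^ 2 - α ^ 2 * S i ^ 2 ≠ 0 := sub_ne_zero.2 (allChambers_cross_ne hα hα1 hS k i)
  have hne' : ((S k ^ 2 - α ^ 2 * S i ^ 2 : ℝ) : ℂ) ≠ 0 := by exact_mod_cast hne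
  rw [hu, hw i, Complex.star_def, Complex.conj_ofReal, ← eq_div_iff hne'] at h3
  rw [h3, phase, Matrix.diagonal_mul]
  simp only [ofRealM, cauchyT, Matrix.map_apply, Matrix.of_apply]
  push_cast
  ring

/-- The normal form of a point of the constraint surface. -/
lemma IsFrame.exists_normal (hα : α ≠ 0) (hα1 : α ^ 2 ≠ 1) (hS : S ∈ allChambers n α)
    (F : IsFrame σ x y S Γ C ρ τ k l r m om ν) (hσ : IsKKS α v σ) {p : RVec n}
    (hp : ∀ i, (m * lᴴ) i i = (‖(m * lᴴ) i i‖ : ℂ) * Complex.exp (Complex.I * (p i : ℂ))) :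
    ∃ d : Mat n, dᴴ * d = 1 ∧ (∀ f : RVec n, d * dg f = dg f * d) ∧
      IsFrame σ x y S Γ C (ρ * dᴴ) (τ * dᴴ) (d * k) (d * l) (r * dᴴ) (d * m) om ν ∧
      (d * m) * (d * l)ᴴ = phase p * ofRealM (cauchyT α S) ∧
      (ρ * dᴴ)ᴴ *ᵥ v = fun i => (vHat α S i : ℂ) := by
  set w := dg S *ᵥ (ρᴴ *ᵥ v) with hwd
  have hwn := norm_sq_w hα hα1 hS F.T_u (F.rank_one hσ)
  rw [← hwd] at hwn
  have hwp (i : Fin n) : 0 < ‖w i‖ := by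
    have := wSq_pos hα hα1 hS i
    rw [← hwn] at this
    exact (norm_nonneg _).lt_of_ne fun h => by rw [← h] at this; norm_num at this
  have hws (i : Fin n) : Real.sqrt (wSq α S i) = ‖w i‖ := by
    rw [← hwn, Real.sqrt_sq (norm_nonneg _)]
  -- The phases of w are removed by the diagonal freedom of the Cartan decomposition; none of the
  -- w_i vanishes.
  set d : Mat n := Matrix.diagonal fun i => star (w i) / (‖w i‖ : ℂ) with hdd
  have hww (i : Fin n) : star (w i) * w i = (‖w i‖ : ℂ) * ‖w i‖ := by
    rw [Complex.star_def, Complex.conj_mul']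
    ring
  have hwne (i : Fin n) : (‖w i‖ : ℂ) ≠ 0 := by exact_mod_cast (hwp i).ne'
  have hdu : dᴴ * d = 1 := by
    rw [hdd, Matrix.diagonal_conjTranspose, Matrix.diagonal_mul_diagonal, ← Matrix.diagonal_one]
    congr 1; funext i
    have := hwne i
    have hns : star (‖w i‖ : ℂ) = ‖w i‖ := Complex.conj_ofReal _
    rw [Pi.star_apply, star_div₀, star_star, hns, div_mul_div_comm, mul_comm (w i), hww,
      div_self (mul_ne_zero this this)]
  have hdc (f : RVec n) : d * dg f = dg f * d := by
    rw [hdd, Matrix.diagonal_mul_diagonal, Matrix.diagonal_mul_diagonal]; simp only [mul_comm]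
  have F' := F.gauge hdu hdc
  have hρ : (ρ * dᴴ)ᴴ *ᵥ v = fun i => (vHat α S i : ℂ) := by
    funext i
    rw [Matrix.conjTranspose_mul, Matrix.conjTranspose_conjTranspose, ← Matrix.mulVec_mulVec, hdd,
      Matrix.mulVec_diagonal]
    have h1 : w i = S i * (ρᴴ *ᵥ v) i := by rw [hwd, Matrix.mulVec_diagonal]
    have hSi : (S i : ℂ) ≠ 0 := by exact_mod_cast hS.1 i
    rw [vHat, hws]
    push_cast
    have h2 := hww i
    have := hwne i
    rw [eq_div_iff hSi, div_mul_eq_mul_div, div_mul_eq_mul_div, div_eq_iff this, ← h2, h1]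
    ring
  refine ⟨d, hdu, hdc, F', ?_, hρ⟩
  refine eq_phase_mul_cauchyT hα hα1 hS F'.T_u (F'.rank_one hσ) (fun i => ?_) (fun i => ?_)
  · rw [hρ, Matrix.mulVec_diagonal, vHat]
    have hSi : (S i : ℂ) ≠ 0 := by exact_mod_cast hS.1 i
    push_cast
    field_simp
  · have : ((d * m) * (d * l)ᴴ) i i = (m * lᴴ) i i := by
      have e : (d * m) * (d * l)ᴴ = d * (m * lᴴ) * dᴴ := by
        simp only [Matrix.conjTranspose_mul, Matrix.mul_assoc]
      have h3 := congrFun (congrFun hdu i) i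
      rw [Matrix.one_apply_eq, hdd, Matrix.diagonal_conjTranspose, Matrix.diagonal_mul_diagonal,
        Matrix.diagonal_apply_eq] at h3
      rw [e, hdd, Matrix.diagonal_conjTranspose, Matrix.mul_diagonal, Matrix.diagonal_mul]
      linear_combination ((m * lᴴ) i i) * h3
    rw [this]; exact hp i

end NormalForm
end HeisenbergDouble

namespace HeisenbergDouble
-- The reduced Hamiltonian.
section Hamiltonian

variable {n : ℕ} {σ om ν : Mat n} {α x y : ℝ} {S Γ C : RVec n} {ρ τ k l r m : Mat n}
  {v : Fin n → ℂ}

/-- The factors in the reduced Hamiltonian. -/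
noncomputable def hamRatio (α : ℝ) (S : RVec n) (i k : Fin n) : ℝ :=
  (α⁻¹ * S k ^ 2 - α * S i ^ 2) * (α * S k ^ 2 - α⁻¹ * S i ^ 2) / (S k ^ 2 - S i ^ 2) ^ 2

lemma hamRatio_eq (hα : α ≠ 0) {i k : Fin n} (h : S i ^ 2 ≠ S k ^ 2) :
    hamRatio α S i k = (α ^ 2 * S i ^ 2 - S k ^ 2) * (S i ^ 2 - α ^ 2 * S k ^ 2) /
      ((α ^ 2 * S i ^ 2 - α ^ 2 * S k ^ 2) * (S i ^ 2 - S k ^ 2)) := by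
  have h1 := sub_ne_zero.2 h
  have h2 := sub_ne_zero.2 h.symm
  rw [hamRatio, ← mul_sub]
  field_simp
  ring

variable {T : Mat n} {w : Fin n → ℂ}

/-- Nonnegativity is forced by the existence of T, through the interlacing inequality
`le_of_rank_one`, and not by an assumption on the chamber. If α² > 1 the perturbation is negative,
and the inequality is applied to the inverse relation `rank_one_symm`. -/
lemma hamRatio_nonneg (hα : α ≠ 0) (hα1 : α ^ 2 ≠ 1) (hd : ∀ i j, i ≠ j → S i ^ 2 ≠ S j ^ 2)
    (hT : Tᴴ * T = 1) (h : Tᴴ * dg (fun i => S i ^ 2) * T =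
      dg (fun i => α ^ 2 * S i ^ 2) + (epsSign α : ℂ) • Matrix.vecMulVec w (star w))
    {i k : Fin n} (hik : i ≠ k) : 0 ≤ hamRatio α S i k := by
  have ha : 0 < α ^ 2 := by positivity
  have hT' : (Tᴴ)ᴴ * Tᴴ = 1 := by
    rw [Matrix.conjTranspose_conjTranspose]; exact mul_eq_one_comm.1 hT
  have key : ∀ i j, S j ^ 2 < S i ^ 2 →
      (S j ^ 2 ≤ α ^ 2 * S i ^ 2) ∧ (α ^ 2 * S j ^ 2 ≤ S i ^ 2) := by
    intro i j hij
    have hj := sq_nonneg (S j)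
    rcases epsSign_eq hα hα1 with ⟨he, h1⟩ | ⟨he, h1⟩
    · have h2 := rank_one_symm hT h
      have h3 : (fun i => S i ^ 2) = fun i => (α ^ 2)⁻¹ * (α ^ 2 * S i ^ 2) := by
        funext i; field_simp
      rw [he, neg_neg, Complex.ofReal_one, one_smul, h3] at h2
      have h4 := le_of_rank_one (inv_pos.2 ha) hT' h2 (i := i) (j := j) (by nlinarith)
      rw [inv_mul_cancel_left₀ ha.ne'] at h4
      exact ⟨by nlinarith, h4⟩
    · rw [he, Complex.ofReal_one, one_smul] at h
      have h4 := le_of_rank_one ha hT h hij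
      exact ⟨h4, by nlinarith⟩
  rw [hamRatio_eq hα (hd i k hik), ← mul_sub]
  rcases lt_or_gt_of_ne (hd i k hik) with hlt | hlt
  · obtain ⟨h1, h2⟩ := key k i hlt
    refine div_nonneg (mul_nonneg_of_nonpos_of_nonpos (by linarith) (by linarith)) ?_
    rw [mul_assoc]; exact mul_nonneg ha.le (mul_self_nonneg _)
  · obtain ⟨h1, h2⟩ := key i k hlt
    refine div_nonneg (mul_nonneg (by linarith) (by linarith)) ?_
    rw [mul_assoc]; exact mul_nonneg ha.le (mul_self_nonneg _)

/-- The diagonal case of `rank_one_apply` expresses |T_ii|² by |w_i|² and |(Tw)_i|². Both are given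
by `prod_sub_eq_of_rank_one`, for T and for T†. -/
lemma norm_T_diag (hα : α ≠ 0) (hα1 : α ^ 2 ≠ 1) (hS : ∀ i, S i ≠ 0)
    (hd : ∀ i j, i ≠ j → S i ^ 2 ≠ S j ^ 2)
    (hT : Tᴴ * T = 1) (h : Tᴴ * dg (fun i => S i ^ 2) * T =
      dg (fun i => α ^ 2 * S i ^ 2) + (epsSign α : ℂ) • Matrix.vecMulVec w (star w)) (i : Fin n) :
    ‖T i i‖ = ∏ k ∈ Finset.univ.erase i, Real.sqrt (hamRatio α S i k) := by
  have ha : 0 < α ^ 2 := by positivity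
  have hT' : (Tᴴ)ᴴ * Tᴴ = 1 := by
    rw [Matrix.conjTranspose_conjTranspose]; exact mul_eq_one_comm.1 hT
  have he2 := epsSign_sq hα hα1
  refine (pow_left_inj₀ (norm_nonneg _) (Finset.prod_nonneg fun _ _ => Real.sqrt_nonneg _)
    two_ne_zero).1 ?_
  rw [← Finset.prod_pow, Finset.prod_congr rfl fun k hk => Real.sq_sqrt
    (hamRatio_nonneg hα hα1 hd hT h (Finset.ne_of_mem_erase hk).symm),
    Finset.prod_congr rfl fun k hk => hamRatio_eq hα (hd i k (Finset.ne_of_mem_erase hk).symm),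
    Finset.prod_div_distrib, Finset.prod_mul_distrib, Finset.prod_mul_distrib]
  have p1 := prod_sub_eq_of_rank_one hT h i
  have p2 := prod_sub_eq_of_rank_one hT' (rank_one_symm hT h) i
  have p3 := congrArg (fun z => ‖z‖ ^ 2) (rank_one_apply hT h i i)
  simp only [norm_mul, Complex.norm_real, norm_star, mul_pow, Real.norm_eq_abs, sq_abs] at p3
  rw [← Finset.mul_prod_erase _ _ (Finset.mem_univ i)] at p1 p2
  have n1 : ∏ k ∈ Finset.univ.erase i, (α ^ 2 * S i ^ 2 - α ^ 2 * S k ^ 2) ≠ 0 :=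
    Finset.prod_ne_zero_iff.2 fun j hj => by
      rw [← mul_sub]
      exact mul_ne_zero ha.ne' (sub_ne_zero.2 (hd _ _ (Finset.ne_of_mem_erase hj).symm))
  have n2 : ∏ k ∈ Finset.univ.erase i, (S i ^ 2 - S k ^ 2) ≠ 0 :=
    Finset.prod_ne_zero_iff.2 fun j hj =>
      sub_ne_zero.2 (hd _ _ (Finset.ne_of_mem_erase hj).symm)
  have n3 : (S i ^ 2 - α ^ 2 * S i ^ 2) ^ 2 ≠ 0 := by
    refine pow_ne_zero _ ?_
    have : S i ^ 2 - α ^ 2 * S i ^ 2 = (1 - α ^ 2) * S i ^ 2 := by ring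
    rw [this]
    exact mul_ne_zero (sub_ne_zero.2 hα1.symm) (pow_ne_zero _ (hS i))
  rw [eq_div_iff (mul_ne_zero n1 n2)]
  refine mul_right_cancel₀ n3 ?_
  set A := ∏ k ∈ Finset.univ.erase i, (α ^ 2 * S i ^ 2 - S k ^ 2)
  set B := ∏ k ∈ Finset.univ.erase i, (S i ^ 2 - α ^ 2 * S k ^ 2)
  set E := ∏ k ∈ Finset.univ.erase i, (α ^ 2 * S i ^ 2 - α ^ 2 * S k ^ 2)
  set G := ∏ k ∈ Finset.univ.erase i, (S i ^ 2 - S k ^ 2)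
  set U := ‖(T *ᵥ w) i‖ ^ 2
  set W := ‖w i‖ ^ 2
  calc _ = ‖T i i‖ ^ 2 * (S i ^ 2 - α ^ 2 * S i ^ 2) ^ 2 * E * G := by ring
    _ = (epsSign α * epsSign α) * U * W * E * G := by rw [p3]; ring
    _ = -((-epsSign α * W * E) * (-(-epsSign α) * U * G)) := by ring
    _ = A * B * (S i ^ 2 - α ^ 2 * S i ^ 2) ^ 2 := by rw [← p1, ← p2]; ring

/-- The factor k_L disappears by cyclicity of the trace, and b_R I b_R† I is computed in blocks. -/
lemma phi_one_eq {kL : BlockMat n} (h : kLᴴ * Inn n * kL = Inn n) :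
    Phi 1 (kL * constrainedBR x om) =
      (1 / 2) * ((om * omᴴ).trace.re - n * x ^ 2 - n * (x ^ 2)⁻¹) := by
  have e : (kL * constrainedBR x om * Inn n * (kL * constrainedBR x om)ᴴ * Inn n).trace =
      (constrainedBR x om * Inn n * (constrainedBR x om)ᴴ * Inn n).trace := by
    rw [Matrix.conjTranspose_mul]
    calc _ = (kL * (constrainedBR x om * Inn n * (constrainedBR x om)ᴴ * (kLᴴ * Inn n))).trace := by
          simp only [Matrix.mul_assoc]
      _ = _ := by rw [Matrix.trace_mul_comm, Matrix.mul_assoc, h]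
  have e2 : (constrainedBR x om * Inn n * (constrainedBR x om)ᴴ * Inn n).trace =
      n * (x : ℂ) ^ 2 + n * ((x : ℂ) ^ 2)⁻¹ - (om * omᴴ).trace := by
    simp only [constrainedBR, Inn, Matrix.fromBlocks_conjTranspose, Matrix.fromBlocks_multiply,
      Matrix.mul_one, Matrix.mul_zero, add_zero, zero_add, Matrix.smul_mul, Matrix.mul_smul,
      Matrix.one_mul, Matrix.zero_mul, Matrix.mul_neg, Matrix.neg_mul, Matrix.conjTranspose_smul,
      Matrix.conjTranspose_one, smul_smul, star_inv₀, Complex.star_def, Complex.conj_ofReal]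
    simp only [Matrix.trace, Matrix.diag, Fintype.sum_sum_type, Matrix.fromBlocks_apply₁₁,
      Matrix.fromBlocks_apply₂₂, Matrix.add_apply, Matrix.smul_apply, Matrix.neg_apply,
      Matrix.one_apply_eq, smul_eq_mul, mul_one, Finset.sum_add_distrib, Finset.sum_const,
      Finset.card_univ, Fintype.card_fin, nsmul_eq_mul, Finset.sum_neg_distrib]
    ring
  rw [Phi, PhiC, pow_one, e, e2]
  have e3 : -(1 / (2 * ((1 : ℕ) : ℂ))) * (n * (x : ℂ) ^ 2 + n * ((x : ℂ) ^ 2)⁻¹ - (om * omᴴ).trace) =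
      (((1 / 2 : ℝ) : ℂ)) * ((om * omᴴ).trace - ((n * x ^ 2 + n * (x ^ 2)⁻¹ : ℝ) : ℂ)) := by
    push_cast; ring
  rw [e3, Complex.re_ofReal_mul, Complex.sub_re, Complex.ofReal_re]
  ring

/-- Up to unitary factors ω equals S⁻¹(yCT - x⁻¹Γ). The squares of the two terms are diagonal
because T is unitary, and the cross term sees only the real part of the diagonal of T. -/
lemma IsFrame.trace_om (F : IsFrame σ x y S Γ C ρ τ k l r m om ν) :
    (om * omᴴ).trace.re = ∑ i, (S i ^ 2)⁻¹ * ((y * C i) ^ 2 + (x⁻¹ * Γ i) ^ 2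
      - 2 * (y * C i) * (x⁻¹ * Γ i) * ((m * lᴴ) i i).re) := by
  set T := m * lᴴ with hT
  have Tu : T * Tᴴ = 1 := mul_eq_one_comm.1 F.T_u
  have ll : l * lᴴ = 1 := mul_eq_one_comm.1 F.l_u
  set X : Mat n := (y : ℂ) • (dg C * T) - (x : ℂ)⁻¹ • dg Γ with hX
  have h1 : dg S * (k * om * lᴴ) = X := by
    have := congrArg (· * lᴴ) F.om_eq
    simp only [Matrix.sub_mul, Matrix.smul_mul, Matrix.mul_assoc, ll, Matrix.mul_one] at this
    simp only [Matrix.mul_assoc]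
    exact this
  have h2 : k * om * lᴴ = dg (fun i => (S i)⁻¹) * X := by
    rw [← h1, ← Matrix.mul_assoc, dg_inv_mul F.S_ne, Matrix.one_mul]
  have h3 : (om * omᴴ).trace = ((k * om * lᴴ) * (k * om * lᴴ)ᴴ).trace := by
    have e : (k * om * lᴴ) * (k * om * lᴴ)ᴴ = k * (om * omᴴ * kᴴ) := by
      simp only [Matrix.conjTranspose_mul, Matrix.conjTranspose_conjTranspose, Matrix.mul_assoc,
        unitary_cancel F.l_u]
    rw [e, Matrix.trace_mul_comm k, Matrix.mul_assoc, F.k_u, Matrix.mul_one]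
  have h4 (i : Fin n) : (X * Xᴴ) i i = (((y * C i) ^ 2 + (x⁻¹ * Γ i) ^ 2 : ℝ) : ℂ)
      - ((y * C i * (x⁻¹ * Γ i) : ℝ) : ℂ) * (T i i + star (T i i)) := by
    have e : X * Xᴴ = ((y : ℂ) * y) • (dg C * dg C) + ((x : ℂ)⁻¹ * (x : ℂ)⁻¹) • (dg Γ * dg Γ)
        - ((y : ℂ) * (x : ℂ)⁻¹) • (dg C * T * dg Γ) - ((y : ℂ) * (x : ℂ)⁻¹) • (dg Γ * Tᴴ * dg C) := by
      have e1 : dg C * T * (dg C * T)ᴴ = dg C * dg C := by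
        rw [Matrix.conjTranspose_mul, dg_conjTranspose, Matrix.mul_assoc, ← Matrix.mul_assoc T, Tu,
          Matrix.one_mul]
      rw [hX]
      simp only [Matrix.conjTranspose_sub, Matrix.conjTranspose_smul, star_inv₀, Complex.star_def,
        Complex.conj_ofReal, Matrix.sub_mul, Matrix.mul_sub, Matrix.smul_mul, Matrix.mul_smul, e1,
        dg_conjTranspose]
      rw [Matrix.conjTranspose_mul, dg_conjTranspose, ← Matrix.mul_assoc (dg Γ)]
      simp only [smul_sub, smul_smul, mul_comm (x : ℂ)⁻¹ (y : ℂ)]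
      abel
    rw [e]
    simp only [Matrix.sub_apply, Matrix.add_apply, Matrix.smul_apply, Matrix.diagonal_mul,
      Matrix.mul_diagonal, Matrix.diagonal_apply_eq, Matrix.conjTranspose_apply, smul_eq_mul]
    push_cast
    ring
  rw [h3, h2, Matrix.conjTranspose_mul, dg_conjTranspose, Matrix.trace, Complex.re_sum]
  refine Finset.sum_congr rfl fun i _ => ?_
  have e : dg (fun i => (S i)⁻¹) * X * (Xᴴ * dg (fun i => (S i)⁻¹)) =
      dg (fun i => (S i)⁻¹) * (X * Xᴴ) * dg (fun i => (S i)⁻¹) := by simp only [Matrix.mul_assoc]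
  rw [e, Matrix.diag_apply, Matrix.mul_diagonal, Matrix.diagonal_mul, h4]
  have e5 : T i i + star (T i i) = ((2 * (T i i).re : ℝ) : ℂ) := by
    rw [Complex.star_def, Complex.add_conj]
  rw [e5]
  have e6 (a b c d : ℝ) : ((a : ℂ) * ((b : ℂ) - (c : ℂ) * (d : ℂ)) * (a : ℂ)) =
      ((a * (b - c * d) * a : ℝ) : ℂ) := by push_cast; ring
  rw [e6, Complex.ofReal_re]
  ring

/-- The formula for the Hamiltonian. -/
theorem IsFrame.phi_one (hα : α ≠ 0) (hα1 : α ^ 2 ≠ 1) (hd : ∀ i j, i ≠ j → S i ^ 2 ≠ S j ^ 2)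
    (F : IsFrame σ x y S Γ C ρ τ k l r m om ν) (hσ : IsKKS α v σ) {p : RVec n}
    (hp : ∀ i, (m * lᴴ) i i = (‖(m * lᴴ) i i‖ : ℂ) * Complex.exp (Complex.I * (p i : ℂ))) :
    Phi 1 (kak ρ τ k l Γ S * constrainedBR x om) = hamS α x y S p := by
  have hx := F.x_pos
  have hy := F.y_pos
  have hre (i : Fin n) : ((m * lᴴ) i i).re =
      Real.cos (p i) * ∏ k ∈ Finset.univ.erase i, Real.sqrt (hamRatio α S i k) := by
    rw [← norm_T_diag hα hα1 F.S_ne hd F.T_u (F.rank_one hσ) i]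
    conv_lhs => rw [hp i]
    rw [mul_comm Complex.I, Complex.exp_ofReal_mul_I]
    simp [Complex.mul_re]
    rw [← Complex.ofReal_cos, Complex.ofReal_re]; ring
  -- S_i may be negative, so the roots contain |S_i|; the product of the two roots involves only
  -- S_i².
  have hsq (i : Fin n) : Real.sqrt (1 + (S i ^ 2)⁻¹) = Γ i / |S i| := by
    have := F.S_ne i
    rw [Real.sqrt_eq_iff_mul_self_eq_of_pos (div_pos (F.Γ_pos i) (abs_pos.2 this)), ← sq, div_pow, sq_abs,
      F.Γ_sq i]
    field_simp
    ring
  have hsq' (i : Fin n) : Real.sqrt (x ^ 2 + y ^ 2 * (S i ^ 2)⁻¹) = y * C i / |S i| := by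
    have := F.S_ne i
    rw [Real.sqrt_eq_iff_mul_self_eq_of_pos (div_pos (mul_pos hy (F.C_pos i)) (abs_pos.2 this)), ← sq, div_pow,
      sq_abs, mul_pow, F.C_sq i]
    field_simp
    ring
  rw [phi_one_eq (kak_preserves F.Γ_sq F.ρ_u F.τ_u F.k_u F.l_u), F.trace_om, hamS]
  simp only [hsq, hsq', hre]
  -- The constants n x² and n x⁻² are distributed over the particles: they cancel the parts x² of
  -- (yC_i)²/S_i² and x⁻² of (x⁻¹Γ_i)²/S_i² that do not depend on S_i.
  have hn (c : ℝ) : (n : ℝ) * c = ∑ _i : Fin n, c := by simp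
  rw [hn, hn, ← Finset.sum_sub_distrib, ← Finset.sum_sub_distrib, Finset.mul_sum, Finset.mul_sum,
    Finset.mul_sum, ← Finset.sum_sub_distrib]
  refine Finset.sum_congr rfl fun i _ => ?_
  have := F.S_ne i
  have h1 : |S i| * |S i| = S i ^ 2 := by rw [← sq, sq_abs]
  have e1 : Real.cos (p i) * (Γ i / |S i|) * (y * C i / |S i|) = Real.cos (p i) * (Γ i * (y * C i)) / S i ^ 2 := by
    rw [← h1]; ring
  change _ = _ - x⁻¹ * (Real.cos (p i) * (Γ i / |S i|) * (y * C i / |S i|) *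
    ∏ k ∈ Finset.univ.erase i, Real.sqrt (hamRatio α S i k))
  rw [e1, mul_pow y, F.C_sq, mul_pow _ (Γ i), F.Γ_sq]
  field_simp
  ring

end Hamiltonian
end HeisenbergDouble

namespace HeisenbergDouble
-- The Weyl group and the passage to the variables q.
section WeylGroup

variable {n : ℕ} {α x y : ℝ}

lemma units_cases (s : Fin n → ℤˣ) (i : Fin n) :
    ((s i : ℤ) : ℝ) = 1 ∨ ((s i : ℤ) : ℝ) = -1 := by
  rcases Int.units_eq_one_or (s i) with h | h <;> simp [h]

lemma units_mul_self (s : Fin n → ℤˣ) (i : Fin n) : ((s i : ℤ) : ℝ) * ((s i : ℤ) : ℝ) = 1 := by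
  rcases units_cases s i with h | h <;> rw [h] <;> norm_num

lemma sinh_weylAct (s : Fin n → ℤˣ) (π : Equiv.Perm (Fin n)) (Δ : RVec n) (i : Fin n) :
    Real.sinh (weylAct s π Δ i) = ((s i : ℤ) : ℝ) * Real.sinh (Δ (π i)) := by
  rcases units_cases s i with h | h <;> simp [weylAct, h]

lemma cosh_weylAct (s : Fin n → ℤˣ) (π : Equiv.Perm (Fin n)) (Δ : RVec n) (i : Fin n) :
    Real.cosh (weylAct s π Δ i) = Real.cosh (Δ (π i)) := by
  rcases units_cases s i with h | h <;> simp [weylAct, h]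

lemma weylAct_sq (s : Fin n → ℤˣ) (π : Equiv.Perm (Fin n)) (S : RVec n) (i : Fin n) :
    weylAct s π S i ^ 2 = S (π i) ^ 2 := by
  rw [weylAct, mul_pow, sq ((s i : ℤ) : ℝ), units_mul_self, one_mul]

lemma submatrix_mul_diagonal_mul (π : Equiv.Perm (Fin n)) (X Y : Mat n) (f : RVec n) :
    X.submatrix id π * dg (fun i => f (π i)) * Y.submatrix π id = X * dg f * Y := by
  ext i j
  rw [Matrix.mul_apply, Matrix.mul_apply]
  simp only [Matrix.mul_diagonal, Matrix.submatrix_apply, id]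
  exact Equiv.sum_comp π fun k => X i k * (f k : ℂ) * Y k j

/-- The lift of the action of the Weyl group. -/
lemma HasCoordinates.weylAct {g : BlockMat n} {Δ p : RVec n} (h : HasCoordinates x y g Δ p)
    (s : Fin n → ℤˣ) (π : Equiv.Perm (Fin n)) :
    HasCoordinates x y g (weylAct s π Δ) (p ∘ π) := by
  obtain ⟨ρ, hρ, τ, hτ, k, hk, l, hl, om, T, e1, e2, e3⟩ := h
  set e : RVec n := fun i => ((s i : ℤ) : ℝ) with he
  have hee (i : Fin n) : (e i : ℂ) * (e i : ℂ) = 1 := by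
    rw [← Complex.ofReal_mul, he, units_mul_self s i, Complex.ofReal_one]
  have dee : dg e * dg e = 1 := by
    rw [dg_mul_dg, ← dg_one]; congr 1; funext i; rw [units_mul_self s i]
  have mem {u : Mat n} (h : u * uᴴ = 1) : u ∈ Matrix.unitaryGroup (Fin n) ℂ :=
    Matrix.mem_unitaryGroup_iff.2 h
  have du : dg e ∈ Matrix.unitaryGroup (Fin n) ℂ := mem (by rw [dg_conjTranspose, dee])
  have hP {u : Mat n} (h : u ∈ Matrix.unitaryGroup (Fin n) ℂ) :
      u.submatrix π id ∈ Matrix.unitaryGroup (Fin n) ℂ := by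
    refine mem ?_
    ext i j
    have h1 := congrFun (congrFun (Matrix.mem_unitaryGroup_iff.1 h) (π i)) (π j)
    rw [Matrix.mul_apply] at h1 ⊢
    simp only [Matrix.conjTranspose_apply, Matrix.submatrix_apply, id]
    simp only [Matrix.star_eq_conjTranspose, Matrix.conjTranspose_apply] at h1
    rw [h1, Matrix.one_apply, Matrix.one_apply]
    simp
  have hQ {u : Mat n} (h : u ∈ Matrix.unitaryGroup (Fin n) ℂ) :
      u.submatrix id π ∈ Matrix.unitaryGroup (Fin n) ℂ := by
    have h1 := Unitary.star_mem (hP (Unitary.star_mem h))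
    convert h1 using 1
    ext i j
    simp [Matrix.star_eq_conjTranspose]
  -- The permutation is absorbed in all four unitary factors, the signs only in τ and l. They
  -- compensate the signs of sinh in the off-diagonal blocks and cancel each other in the block τΓl.
  -- T becomes a sign conjugate of a permuted matrix, so the phases of its diagonal are only
  -- permuted.
  refine ⟨ρ.submatrix id π, hQ hρ, τ.submatrix id π * dg e, mul_mem (hQ hτ) du,
    k.submatrix π id, hP hk, dg e * l.submatrix π id, mul_mem du (hP hl), om,
    dg e * T.submatrix π π * dg e, ?_, ?_, fun i => ?_⟩
  · rw [e1]
    congr 1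
    rw [cartan_eq, cartan_eq, ← kak_eq_mul, ← kak_eq_mul]
    have c1 : (fun i => Real.cosh (HeisenbergDouble.weylAct s π Δ i)) =
      fun i => Real.cosh (Δ (π i)) := funext (cosh_weylAct s π Δ)
    have c2 : (fun i => Real.sinh (HeisenbergDouble.weylAct s π Δ i)) =
      fun i => e i * Real.sinh (Δ (π i)) := funext (sinh_weylAct s π Δ)
    have d1 (f : RVec n) (Y : Mat n) : dg (fun i => e i * f i) * (dg e * Y) = dg f * Y := by
      rw [← Matrix.mul_assoc, dg_mul_dg]; congr 2; funext i
      linear_combination f i * units_mul_self s i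
    have d2 (f : RVec n) (X : Mat n) : X * dg e * dg (fun i => e i * f i) = X * dg f := by
      rw [Matrix.mul_assoc, dg_mul_dg]; congr 2; funext i
      linear_combination f i * units_mul_self s i
    have d3 (f : RVec n) (X Y : Mat n) : X * dg e * dg f * (dg e * Y) = X * dg f * Y := by
      calc _ = X * (dg e * dg f * dg e) * Y := by simp only [Matrix.mul_assoc]
        _ = _ := by
          rw [dg_mul_dg, dg_mul_dg]; congr 3; funext i; linear_combination f i * units_mul_self s i
    simp only [kak]
    rw [c1, c2, Matrix.mul_assoc (ρ.submatrix id π) _ (dg e * _), d1, d2, d3,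
      ← Matrix.mul_assoc (ρ.submatrix id π)]
    rw [submatrix_mul_diagonal_mul π ρ k fun i => Real.cosh (Δ i),
      submatrix_mul_diagonal_mul π ρ l fun i => Real.sinh (Δ i),
      submatrix_mul_diagonal_mul π τ k fun i => Real.sinh (Δ i),
      submatrix_mul_diagonal_mul π τ l fun i => Real.cosh (Δ i)]
  · have h1 : (τ.submatrix id π * dg e)ᴴ * g.toBlocks₂₂ * (dg e * l.submatrix π id)ᴴ =
        dg e * (τᴴ * g.toBlocks₂₂ * lᴴ).submatrix π π * dg e := by
      rw [Matrix.conjTranspose_mul, Matrix.conjTranspose_mul, dg_conjTranspose]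
      have : (τ.submatrix id π)ᴴ * g.toBlocks₂₂ * (l.submatrix π id)ᴴ =
          (τᴴ * g.toBlocks₂₂ * lᴴ).submatrix π π := by
        ext i j; simp [Matrix.mul_apply]
      rw [← this]
      simp only [Matrix.mul_assoc]
    rw [h1, e2]
    ext i j
    simp only [Matrix.mul_diagonal, Matrix.diagonal_mul, Matrix.submatrix_apply]
    have : Real.sinh (HeisenbergDouble.weylAct s π Δ i) ^ 2 = Real.sinh (Δ (π i)) ^ 2 := by
      rw [sinh_weylAct, mul_pow, sq ((s i : ℤ) : ℝ), units_mul_self, one_mul]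
    rw [this]
    ring
  · have : (dg e * T.submatrix π π * dg e) i i = T (π i) (π i) := by
      simp only [Matrix.mul_diagonal, Matrix.diagonal_mul, Matrix.submatrix_apply]
      linear_combination T (π i) (π i) * hee i
    rw [this]
    exact e3 (π i)

lemma log_weylAct (s : Fin n → ℤˣ) (π : Equiv.Perm (Fin n)) (S : RVec n) (i : Fin n) :
    Real.log (weylAct s π S i) = Real.log (S (π i)) := by
  rcases units_cases s i with h | h <;> simp [weylAct, h]

lemma weylAct_mem_allChambers {S : RVec n} (s : Fin n → ℤˣ) (π : Equiv.Perm (Fin n))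
    (hS : S ∈ allChambers n α) : weylAct s π S ∈ allChambers n α := by
  refine ⟨fun i => ?_, fun i j h => ?_⟩
  · have := hS.1 (π i)
    rcases units_cases s i with h | h <;> simp [weylAct, h, this]
  · rw [log_weylAct, log_weylAct]
    exact hS.2 _ _ (fun e => h (π.injective e))

lemma reducedForm_weylAct (s : Fin n → ℤˣ) (π : Equiv.Perm (Fin n)) (S : RVec n)
    (u w : RVec n × RVec n) :
    reducedForm (weylAct s π S) (weylAct s π u.1, u.2 ∘ π) (weylAct s π w.1, w.2 ∘ π) =
      reducedForm S u w := by
  have e (S w : RVec n) (i : Fin n) : (weylAct s π S i)⁻¹ * weylAct s π w i =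
      (S (π i))⁻¹ * w (π i) := by
    rcases units_cases s i with h | h <;> simp [weylAct, h, inv_neg]
  simp only [reducedForm, e, Function.comp]
  congr 1
  exact Equiv.sum_comp π fun i => u.2 i * ((S i)⁻¹ * w.1 i) - w.2 i * ((S i)⁻¹ * u.1 i)

lemma prod_erase_perm (π : Equiv.Perm (Fin n)) (f : Fin n → ℝ) (i : Fin n) :
    ∏ k ∈ Finset.univ.erase i, f (π k) = ∏ k ∈ Finset.univ.erase (π i), f k :=
  Finset.prod_equiv π (by simp) (by simp)

lemma hamS_weylAct (s : Fin n → ℤˣ) (π : Equiv.Perm (Fin n)) (S p : RVec n) :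
    hamS α x y (weylAct s π S) (p ∘ π) = hamS α x y S p := by
  simp only [hamS, weylAct_sq, Function.comp]
  congr 2
  · exact Equiv.sum_comp π fun i => (S i ^ 2)⁻¹
  · conv_rhs => rw [← Equiv.sum_comp π]
    refine Finset.sum_congr rfl fun i _ => ?_
    rw [prod_erase_perm π (fun k => Real.sqrt ((α⁻¹ * S k ^ 2 - α * S (π i) ^ 2) *
      (α * S k ^ 2 - α⁻¹ * S (π i) ^ 2) / (S k ^ 2 - S (π i) ^ 2) ^ 2))]

lemma chamber_ne {q : RVec n} (hq : q ∈ chamber n α) {i j : Fin n} (h : i ≠ j) :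
    |Real.log α| < |q i - q j| := by
  rcases lt_or_gt_of_ne h with h | h
  · exact (hq i j h).trans_le (le_abs_self _)
  · rw [abs_sub_comm]; exact (hq j i h).trans_le (le_abs_self _)

lemma exp_mem_allChambers {q : RVec n} (hq : q ∈ chamber n α) :
    (fun i => Real.exp (q i)) ∈ allChambers n α :=
  ⟨fun i => (Real.exp_pos _).ne', fun i j h => by
    simpa only [Real.log_exp] using chamber_ne hq h⟩

/-- The factor is homogeneous of degree zero in the pair (S_i, S_k), so it depends only on q_i -
q_k. -/
lemma hamRatio_exp (hα : α ≠ 0) {q : RVec n} {i k : Fin n} (h : q i ≠ q k) :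
    hamRatio α (fun i => Real.exp (q i)) i k =
      1 - (α - α⁻¹) ^ 2 / (4 * Real.sinh (q i - q k) ^ 2) := by
  have h1 : Real.sinh (q i - q k) = (Real.exp (q i) ^ 2 - Real.exp (q k) ^ 2) /
      (2 * Real.exp (q i) * Real.exp (q k)) := by
    rw [Real.sinh_eq, neg_sub, Real.exp_sub, Real.exp_sub]
    field_simp
  have h2 : Real.exp (q i) ^ 2 - Real.exp (q k) ^ 2 ≠ 0 := by
    intro e
    have h3 := (pow_left_inj₀ (Real.exp_pos _).le (Real.exp_pos _).le two_ne_zero).1 (sub_eq_zero.1 e)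
    exact h (Real.exp_injective h3)
  have h3 : Real.exp (q k) ^ 2 - Real.exp (q i) ^ 2 ≠ 0 := fun e => h2 (by linarith)
  have h4 : (Real.exp (q k) ^ 2 - Real.exp (q i) ^ 2) ^ 2 =
    (Real.exp (q i) ^ 2 - Real.exp (q k) ^ 2) ^ 2 := by ring
  rw [hamRatio, h1, h4]
  field_simp
  ring

/-- With E = exp(-2q_i), the quadratic polynomial under the root factors as (1 + E)(1 + (y²/x²)E),
which accounts for the two roots and the prefactor x⁻¹. -/
lemma hamS_exp (hα : α ≠ 0) (hx : 0 < x) {q : RVec n} (hq : q ∈ chamber n α) (p : RVec n) :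
    hamS α x y (fun i => Real.exp (q i)) p = hamQ α x y q p := by
  have hE (i : Fin n) : (Real.exp (q i) ^ 2)⁻¹ = Real.exp (-2 * q i) := by
    rw [← Real.exp_nat_mul, ← Real.exp_neg]; congr 1; push_cast; ring
  have hE4 (i : Fin n) : Real.exp (-4 * q i) = Real.exp (-2 * q i) ^ 2 := by
    rw [← Real.exp_nat_mul]; congr 1; push_cast; ring
  simp only [hamS, hamQ, hE, hE4]
  rw [Finset.mul_sum (Finset.univ) _ x⁻¹]
  congr 1
  refine Finset.sum_congr rfl fun i _ => ?_
  have e1 : ∏ k ∈ Finset.univ.erase i, Real.sqrt ((α⁻¹ * Real.exp (q k) ^ 2 - α * Real.exp (q i) ^ 2) *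
      (α * Real.exp (q k) ^ 2 - α⁻¹ * Real.exp (q i) ^ 2) / (Real.exp (q k) ^ 2 - Real.exp (q i) ^ 2) ^ 2)
      = ∏ k ∈ Finset.univ.erase i, Real.sqrt (1 - (α - α⁻¹) ^ 2 / (4 * Real.sinh (q i - q k) ^ 2)) := by
    refine Finset.prod_congr rfl fun k hk => ?_
    have hne : q i ≠ q k := fun e => by
      have := chamber_ne hq (Finset.ne_of_mem_erase hk).symm
      rw [e, sub_self, abs_zero] at this
      exact (abs_nonneg _).not_gt this
    rw [← hamRatio_exp hα hne]
    rfl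
  rw [e1]
  set E := Real.exp (-2 * q i)
  have hEp : 0 < E := Real.exp_pos _
  have e2 : Real.sqrt (1 + (1 + y ^ 2 / x ^ 2) * E + y ^ 2 / x ^ 2 * E ^ 2) =
      x⁻¹ * (Real.sqrt (1 + E) * Real.sqrt (x ^ 2 + y ^ 2 * E)) := by
    rw [← Real.sqrt_mul (by positivity)]
    conv_rhs => rw [← Real.sqrt_sq (inv_pos.2 hx).le, ← Real.sqrt_mul (by positivity)]
    congr 1
    field_simp
    ring
  rw [e2]
  ring

end WeylGroup

/-! ### Which parameters the Hamiltonian determines. -/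

section Parameters

variable {n : ℕ} {α x y α' x' y' : ℝ}

/-- The parameters enter only through (α - α⁻¹)², x⁻² + y² and y²/x², which are unchanged by the
listed substitutions. -/
lemma hamQ_congr (hα : α ≠ 0) (hα' : α' ≠ 0) (hx : 0 < x) (hy : 0 < y)
    (h1 : α' ^ 2 = α ^ 2 ∨ α' ^ 2 = (α ^ 2)⁻¹)
    (h2 : (x' = x ∧ y' = y) ∨ (x' = y⁻¹ ∧ y' = x⁻¹)) (q p : RVec n) :
    hamQ α' x' y' q p = hamQ α x y q p := by
  have e (a : ℝ) (ha : a ≠ 0) : (a - a⁻¹) ^ 2 = a ^ 2 + (a ^ 2)⁻¹ - 2 := by field_simp; ring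
  have e1 : (α' - α'⁻¹) ^ 2 = (α - α⁻¹) ^ 2 := by
    rw [e α hα, e α' hα']
    rcases h1 with h | h
    · rw [h]
    · rw [h, inv_inv]; ring
  have e2 : (x' ^ 2)⁻¹ + y' ^ 2 = (x ^ 2)⁻¹ + y ^ 2 := by
    rcases h2 with ⟨rfl, rfl⟩ | ⟨rfl, rfl⟩
    · rfl
    · rw [inv_pow, inv_pow, inv_inv]; ring
  have e3 : y' ^ 2 / x' ^ 2 = y ^ 2 / x ^ 2 := by
    rcases h2 with ⟨rfl, rfl⟩ | ⟨rfl, rfl⟩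
    · rfl
    · field_simp
  simp only [hamQ, e1, e2, e3]

/-- The product over the other particles in the Hamiltonian. -/
noncomputable def hamProd (c : ℝ) (q : RVec n) (i : Fin n) : ℝ :=
  ∏ k ∈ Finset.univ.erase i, Real.sqrt (1 - c / (4 * Real.sinh (q i - q k) ^ 2))

lemma chamber_factor_pos (hα : α ≠ 0) {q : RVec n} (hq : q ∈ chamber n α) {i k : Fin n}
    (h : i ≠ k) : 0 < 1 - (α - α⁻¹) ^ 2 / (4 * Real.sinh (q i - q k) ^ 2) := by
  have hS := exp_mem_allChambers hq
  have hne : q i ≠ q k := fun e => by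
    have := chamber_ne hq h
    rw [e, sub_self, abs_zero] at this
    exact (abs_nonneg _).not_gt this
  rw [← hamRatio_exp hα hne, hamRatio_eq hα (allChambers_sq_ne hα hS h)]
  obtain ⟨h1, h2⟩ := allChambers_ratio_pos hα hS h
  have ha : 0 < α ^ 2 := by positivity
  refine (mul_pos (mul_pos h1 h2) (inv_pos.2 ha)).trans_eq ?_
  have := sub_ne_zero.2 (allChambers_sq_ne hα hS h)
  rw [← mul_sub]
  field_simp

/-- Every factor is strictly decreasing in c. For n ≥ 2 there is at least one factor, which makes
the inequality strict. -/
lemma hamProd_lt (hn : 2 ≤ n) {c c' : ℝ} (hc : c < c') {q : RVec n}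
    (hq : ∀ i k, i ≠ k → 0 < 1 - c' / (4 * Real.sinh (q i - q k) ^ 2))
    (hne : ∀ i k, i ≠ k → q i ≠ q k) (i : Fin n) : hamProd c' q i < hamProd c q i := by
  have key (k : Fin n) (hk : i ≠ k) : 1 - c' / (4 * Real.sinh (q i - q k) ^ 2) <
      1 - c / (4 * Real.sinh (q i - q k) ^ 2) := by
    have hs : Real.sinh (q i - q k) ≠ 0 := by
      rw [Ne, Real.sinh_eq_zero]; exact sub_ne_zero.2 (hne i k hk)
    have : 0 < 4 * Real.sinh (q i - q k) ^ 2 := by positivity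
    have := div_lt_div_of_pos_right hc this
    linarith
  have hnt : Nontrivial (Fin n) := Fin.nontrivial_iff_two_le.2 hn
  obtain ⟨j, hj⟩ := exists_ne i
  refine Finset.prod_lt_prod (fun k hk => Real.sqrt_pos.2 (hq i k (Finset.ne_of_mem_erase hk).symm))
    (fun k hk => Real.sqrt_le_sqrt (key k (Finset.ne_of_mem_erase hk).symm).le)
    ⟨j, Finset.mem_erase.2 ⟨hj, Finset.mem_univ _⟩,
      Real.sqrt_lt_sqrt (hq i j hj.symm).le (key j hj.symm)⟩

/-- A common translation keeps the differences q_i - q_k and multiplies all exp(-2q_i) by the same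
number, which can then be varied freely. -/
lemma hamQ_shift (q : RVec n) (t : ℝ) (p : RVec n) :
    hamQ α x y (fun i => q i + t) p = (1 / 2) * ((x ^ 2)⁻¹ + y ^ 2) *
      ∑ i, Real.exp (-2 * t) * Real.exp (-2 * q i) - ∑ i, Real.cos (p i) *
        Real.sqrt (1 + (1 + y ^ 2 / x ^ 2) * (Real.exp (-2 * t) * Real.exp (-2 * q i))
          + y ^ 2 / x ^ 2 * (Real.exp (-2 * t) * Real.exp (-2 * q i)) ^ 2)
        * hamProd ((α - α⁻¹) ^ 2) q i := by
  have h2 (i : Fin n) : Real.exp (-2 * (q i + t)) = Real.exp (-2 * t) * Real.exp (-2 * q i) := by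
    rw [← Real.exp_add]; congr 1; ring
  have h4 (i : Fin n) : Real.exp (-4 * (q i + t)) = (Real.exp (-2 * t) * Real.exp (-2 * q i)) ^ 2 := by
    rw [← h2, ← Real.exp_nat_mul]; congr 1; push_cast; ring
  simp only [hamQ, h2, h4, add_sub_add_right_eq_sub]
  rfl

lemma shift_mem_chamber {q : RVec n} (hq : q ∈ chamber n α) (t : ℝ) :
    (fun i => q i + t) ∈ chamber n α := fun i j h => by
  rw [add_sub_add_right_eq_sub]; exact hq i j h

lemma exists_mem_chamber (n : ℕ) (α α' : ℝ) : ∃ q, q ∈ chamber n α ∩ chamber n α' := by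
  refine ⟨fun i => -(|Real.log α| + |Real.log α'| + 1) * ((i : ℕ) : ℝ), fun i j h => ?_, fun i j h => ?_⟩
  all_goals
    have h1 : ((i : ℕ) : ℝ) + 1 ≤ ((j : ℕ) : ℝ) := by exact_mod_cast h
    have h2 := abs_nonneg (Real.log α)
    have h3 := abs_nonneg (Real.log α')
    nlinarith

/-- The reduced Hamiltonian determines its parameters. -/
lemma params_of_hamQ_eq (hn : 2 ≤ n) (hα : α ≠ 0) (hx : 0 < x) (hy : 0 < y) (hα' : α' ≠ 0)
    (hx' : 0 < x') (hy' : 0 < y')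
    (h : ∀ q ∈ chamber n α ∩ chamber n α', ∀ p : RVec n, hamQ α' x' y' q p = hamQ α x y q p) :
    (α' ^ 2 = α ^ 2 ∨ α' ^ 2 = (α ^ 2)⁻¹) ∧ ((x' = x ∧ y' = y) ∨ (x' = y⁻¹ ∧ y' = x⁻¹)) := by
  obtain ⟨q, hq⟩ := exists_mem_chamber n α α'
  have hsh (t : ℝ) := h _ ⟨shift_mem_chamber hq.1 t, shift_mem_chamber hq.2 t⟩
  simp only [hamQ_shift] at hsh
  have hne (i k : Fin n) (hik : i ≠ k) : q i ≠ q k := fun e => by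
    have := chamber_ne hq.1 hik
    rw [e, sub_self, abs_zero] at this
    exact (abs_nonneg _).not_gt this
  have hn0 : (Finset.univ : Finset (Fin n)).Nonempty := ⟨⟨0, by omega⟩, Finset.mem_univ _⟩
  -- At momenta π/2 all cosines vanish and only the potential term with x⁻² + y² is left.
  have hA : (x' ^ 2)⁻¹ + y' ^ 2 = (x ^ 2)⁻¹ + y ^ 2 := by
    have h1 := hsh 0 fun _ => Real.pi / 2
    simp only [Real.cos_pi_div_two, zero_mul, Finset.sum_const_zero, sub_zero, mul_zero,
      Real.exp_zero, one_mul] at h1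
    have h2 : 0 < ∑ i, Real.exp (-2 * q i) := Finset.sum_pos (fun _ _ => Real.exp_pos _) hn0
    have := mul_right_cancel₀ h2.ne' h1
    linarith
  set B := y ^ 2 / x ^ 2 with hB
  set B' := y' ^ 2 / x' ^ 2 with hB'
  set F : ℝ → ℝ → ℝ → ℝ := fun B c e => ∑ i, Real.sqrt (1 + (1 + B) * (e * Real.exp (-2 * q i))
      + B * (e * Real.exp (-2 * q i)) ^ 2) * hamProd c q i with hF
  have hFe (e : ℝ) (he : 0 < e) : F B' ((α' - α'⁻¹) ^ 2) e = F B ((α - α⁻¹) ^ 2) e := by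
    have h1 := hsh (-(Real.log e) / 2) fun _ => 0
    have h2 : Real.exp (-2 * (-(Real.log e) / 2)) = e := by
      rw [show -2 * (-(Real.log e) / 2) = Real.log e by ring, Real.exp_log he]
    rw [h2, hA] at h1
    simp only [Real.cos_zero, one_mul] at h1
    linarith
  have hcont (B c : ℝ) : Continuous (F B c) := by
    rw [hF]
    refine continuous_finsetSum _ fun i _ => ?_
    exact (Real.continuous_sqrt.comp (by fun_prop)).mul continuous_const
  -- The value e = 0 is not attained by translations, which give e > 0, but F is continuous up to
  -- it. There the one-particle roots equal 1 and only the coupling (α - α⁻¹)² remains.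
  have hF0 : F B' ((α' - α'⁻¹) ^ 2) 0 = F B ((α - α⁻¹) ^ 2) 0 := by
    have t1 := ((hcont B' ((α' - α'⁻¹) ^ 2)).tendsto 0).mono_left (nhdsWithin_le_nhds (s := Set.Ioi 0))
    have t2 := ((hcont B ((α - α⁻¹) ^ 2)).tendsto 0).mono_left (nhdsWithin_le_nhds (s := Set.Ioi 0))
    refine tendsto_nhds_unique (t1.congr' ?_) t2
    filter_upwards [self_mem_nhdsWithin] with e he using hFe e he
  have hc : (α' - α'⁻¹) ^ 2 = (α - α⁻¹) ^ 2 := by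
    simp only [hF, zero_mul, mul_zero, add_zero, Real.sqrt_one, one_mul, ne_eq, OfNat.ofNat_ne_zero,
      not_false_eq_true, zero_pow] at hF0
    rcases lt_trichotomy ((α' - α'⁻¹) ^ 2) ((α - α⁻¹) ^ 2) with hlt | heq | hlt
    · have := Finset.sum_lt_sum_of_nonempty hn0 fun i _ => hamProd_lt hn hlt
        (fun i k hik => chamber_factor_pos hα hq.1 hik) hne i
      linarith
    · exact heq
    · have := Finset.sum_lt_sum_of_nonempty hn0 fun i _ => hamProd_lt hn hlt
        (fun i k hik => chamber_factor_pos hα' hq.2 hik) hne i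
      linarith
  have hmono {B B' : ℝ} (h0 : 0 ≤ B) (hlt : B < B') :
      F B ((α - α⁻¹) ^ 2) 1 < F B' ((α - α⁻¹) ^ 2) 1 := by
    refine Finset.sum_lt_sum_of_nonempty hn0 fun i _ => ?_
    have hP : 0 < hamProd ((α - α⁻¹) ^ 2) q i := Finset.prod_pos fun k hk =>
      Real.sqrt_pos.2 (chamber_factor_pos hα hq.1 (Finset.ne_of_mem_erase hk).symm)
    have hE := Real.exp_pos (-2 * q i)
    refine mul_lt_mul_of_pos_right (Real.sqrt_lt_sqrt (by positivity) ?_) hP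
    rw [one_mul]
    have := mul_lt_mul_of_pos_right hlt hE
    have := mul_lt_mul_of_pos_right hlt (pow_pos hE 2)
    nlinarith
  have hBB : B' = B := by
    have h1 := hFe 1 one_pos
    rw [hc] at h1
    rcases lt_trichotomy B' B with hlt | heq | hlt
    · have := hmono (by positivity) hlt; linarith
    · exact heq
    · have := hmono (by positivity) hlt; linarith
  constructor
  · have e (a : ℝ) (ha : a ≠ 0) : (a - a⁻¹) ^ 2 = a ^ 2 + (a ^ 2)⁻¹ - 2 := by field_simp; ring
    rw [e α hα, e α' hα'] at hc
    have ha : 0 < α ^ 2 := by positivity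
    have ha' : 0 < α' ^ 2 := by positivity
    have : (α' ^ 2 - α ^ 2) * (α' ^ 2 * α ^ 2 - 1) = 0 := by
      have h1 : α' ^ 2 + (α' ^ 2)⁻¹ = α ^ 2 + (α ^ 2)⁻¹ := by linarith
      have e1 := mul_inv_cancel₀ ha.ne'
      have e2 := mul_inv_cancel₀ ha'.ne'
      linear_combination (α ^ 2 * α' ^ 2) * h1 - α ^ 2 * e2 + α' ^ 2 * e1
    rcases mul_eq_zero.1 this with h1 | h1
    · left; linarith
    · right; exact eq_inv_of_mul_eq_one_left (by linarith)
  · have hX : 0 < (x ^ 2)⁻¹ := by positivity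
    have hX' : 0 < (x' ^ 2)⁻¹ := by positivity
    rw [hB, hB', div_eq_mul_inv, div_eq_mul_inv] at hBB
    -- The numbers x⁻² and y² are known through their sum and product, hence up to order; the
    -- exchange of the two roots is the ambiguity (x, y) ↦ (y⁻¹, x⁻¹).
    have h0 : ((x' ^ 2)⁻¹ - (x ^ 2)⁻¹) * ((x' ^ 2)⁻¹ - y ^ 2) = 0 := by
      linear_combination (x' ^ 2)⁻¹ * hA - hBB
    have sqi {a b : ℝ} (ha : 0 < a) (hb : 0 < b) (h : a ^ 2 = b ^ 2) : a = b :=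
      (pow_left_inj₀ ha.le hb.le two_ne_zero).1 h
    rcases mul_eq_zero.1 h0 with h1 | h1
    · left
      have h2 : x' ^ 2 = x ^ 2 := inv_injective (by linarith)
      exact ⟨sqi hx' hx h2, sqi hy' hy (by linarith)⟩
    · right
      refine ⟨sqi hx' (inv_pos.2 hy) ?_, sqi hy' (inv_pos.2 hx) ?_⟩
      · rw [inv_pow, ← sub_eq_zero.1 h1, inv_inv]
      · rw [inv_pow]; linarith

end Parameters
end HeisenbergDouble

namespace HeisenbergDouble
-- Points built from frames, and unitary matrices with a prescribed action on a vector.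
section Section

variable {n : ℕ} {σ om ν : Mat n} {α x y : ℝ} {S Γ C : RVec n} {ρ τ k l r m : Mat n}
  {v : Fin n → ℂ}

/-- The Cartan decompositions define a point of the constraint surface. -/
lemma IsFrame.constraint (F : IsFrame σ x y S Γ C ρ τ k l r m om ν) :
    constrainedBL y σ ν * kak r τ k m C (fun i => x / y * S i) =
      kak ρ τ k l Γ S * constrainedBR x om := by
  have hx := F.x_pos
  have hy := F.y_pos
  have hx' : (x : ℂ) ≠ 0 := by exact_mod_cast hx.ne'
  have hy' : (y : ℂ) ≠ 0 := by exact_mod_cast hy.ne'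
  have e22 : (y : ℂ) • (τ * dg C * m) = τ * dg S * k * om + (x : ℂ)⁻¹ • (τ * dg Γ * l) := by
    have : τ * dg S * k * om = τ * (dg S * k * om) := by simp only [Matrix.mul_assoc]
    rw [this, F.om_eq]
    simp only [Matrix.mul_sub, Matrix.mul_smul, Matrix.mul_assoc]
    abel
  have e11 : (y : ℂ)⁻¹ • (σ * (r * dg C * k) + ν * (τ * dg (fun i => x / y * S i) * k)) =
      (x : ℂ) • (ρ * dg Γ * k) := by
    have : ν * (τ * dg (fun i => x / y * S i) * k) = (ν * τ * dg (fun i => x / y * S i)) * k := by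
      simp only [Matrix.mul_assoc]
    rw [this, F.ν_eq]
    simp only [Matrix.sub_mul, Matrix.smul_mul, Matrix.mul_assoc, add_sub_cancel, smul_smul]
    congr 1; push_cast; field_simp
  -- This block is not among the defining equations of a frame. It follows from the formulas for ω
  -- and ν, the relation for σr, and the identities s - C²/s = -1/s and Γ²/S = 1/S + S.
  have e12 : (y : ℂ)⁻¹ • (σ * (r * dg (fun i => x / y * S i) * m) + ν * (τ * dg C * m)) =
      ρ * dg Γ * k * om + (x : ℂ)⁻¹ • (ρ * dg S * l) := by
    have k_om : k * om = dg (fun i => (S i)⁻¹) * ((y : ℂ) • (dg C * m) - ((x : ℂ)⁻¹) • (dg Γ * l)) := by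
      rw [← F.om_eq, Matrix.mul_assoc, ← Matrix.mul_assoc, dg_inv_mul F.S_ne, Matrix.one_mul]
    have ντ : ν * τ = (((x * y : ℝ) : ℂ) • (ρ * dg Γ) - σ * r * dg C) *
        dg (fun i => (x / y * S i)⁻¹) := by
      rw [← F.ν_eq, Matrix.mul_assoc, dg_mul_inv F.s_ne, Matrix.mul_one]
    have hrel : σ * r * dg (fun i => (S i)⁻¹) * m = ρ * dg (fun i => (S i)⁻¹) * l := by
      have h := F.rel'
      have h1 : σ * r = ρ * (dg (fun i => (S i)⁻¹) * (l * mᴴ) * dg S) := by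
        rw [← h, Matrix.mul_assoc, unitary_cancel' F.ρ_u]
      rw [h1]
      calc _ = ρ * dg (fun i => (S i)⁻¹) * l * mᴴ * (dg S * dg (fun i => (S i)⁻¹)) * m := by
            simp only [Matrix.mul_assoc]
        _ = _ := by
          rw [dg_mul_inv F.S_ne, Matrix.mul_one, Matrix.mul_assoc, F.m_u, Matrix.mul_one]
    have a1 : σ * (r * dg (fun i => x / y * S i) * m) + ν * (τ * dg C * m) =
        σ * r * (dg (fun i => x / y * S i) - dg C * dg (fun i => (x / y * S i)⁻¹) * dg C) * m
          + ((x * y : ℝ) : ℂ) • (ρ * (dg Γ * dg (fun i => (x / y * S i)⁻¹) * dg C) * m) := by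
      have : ν * (τ * dg C * m) = ν * τ * dg C * m := by simp only [Matrix.mul_assoc]
      rw [this, ντ]
      simp only [Matrix.mul_sub, Matrix.sub_mul, Matrix.smul_mul, Matrix.mul_assoc]
      abel
    have a2 : dg (fun i => x / y * S i) - dg C * dg (fun i => (x / y * S i)⁻¹) * dg C =
        (-((y / x : ℝ) : ℂ)) • dg (fun i => (S i)⁻¹) := by
      rw [dg_mul_dg, dg_mul_dg]
      ext i j
      by_cases h : i = j
      · subst h
        have h1 := F.C_sq i
        have h2 := F.S_ne i
        simp only [Matrix.sub_apply, Matrix.smul_apply, Matrix.diagonal_apply_eq, smul_eq_mul]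
        norm_cast
        have h3 : C i * (x / y * S i)⁻¹ * C i = (1 + (x / y * S i) ^ 2) * (x / y * S i)⁻¹ := by
          rw [← h1]; ring
        rw [h3]
        field_simp
        ring
      · simp [h]
    have a3 : dg Γ * dg (fun i => (x / y * S i)⁻¹) * dg C =
        ((y / x : ℝ) : ℂ) • (dg Γ * dg (fun i => (S i)⁻¹) * dg C) := by
      have : (fun i => (x / y * S i)⁻¹) = fun i => y / x * (S i)⁻¹ := by
        funext i; rw [mul_inv, inv_div]
      rw [this, dg_smul, Matrix.mul_smul, Matrix.smul_mul]
    have a4 : dg Γ * dg (fun i => (S i)⁻¹) * dg Γ = dg (fun i => (S i)⁻¹) + dg S := by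
      rw [dg_mul_dg, dg_mul_dg]
      ext i j
      by_cases h : i = j
      · subst h
        have h1 := F.Γ_sq i
        have h2 := F.S_ne i
        simp only [Matrix.add_apply, Matrix.diagonal_apply_eq]
        norm_cast
        have h3 : Γ i * (S i)⁻¹ * Γ i = (1 + S i ^ 2) * (S i)⁻¹ := by rw [← h1]; ring
        rw [h3]
        field_simp
      · simp [h]
    rw [a1, a2, a3]
    have a5 : σ * r * ((-((y / x : ℝ) : ℂ)) • dg (fun i => (S i)⁻¹)) * m =
        (-((y / x : ℝ) : ℂ)) • (ρ * dg (fun i => (S i)⁻¹) * l) := by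
      rw [← hrel]; simp only [Matrix.mul_smul, Matrix.smul_mul]
    have a6 : ρ * dg Γ * k * om = (y : ℂ) • (ρ * (dg Γ * dg (fun i => (S i)⁻¹) * dg C) * m)
        - (x : ℂ)⁻¹ • (ρ * (dg (fun i => (S i)⁻¹) + dg S) * l) := by
      rw [Matrix.mul_assoc _ k, k_om, ← a4]
      simp only [Matrix.mul_sub, Matrix.mul_smul, Matrix.mul_assoc]
    rw [a5, a6]
    simp only [Matrix.mul_smul, Matrix.smul_mul, smul_add, smul_smul, Matrix.mul_add,
      Matrix.add_mul]
    have b1 : (y : ℂ)⁻¹ * -((y / x : ℝ) : ℂ) = -(x : ℂ)⁻¹ := by push_cast; field_simp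
    have b2 : (y : ℂ)⁻¹ * (((x * y : ℝ) : ℂ) * ((y / x : ℝ) : ℂ)) = y := by push_cast; field_simp
    rw [b1, b2, neg_smul]
    abel
  have e21 : (y : ℂ) • (τ * dg (fun i => x / y * S i) * k) = (x : ℂ) • (τ * dg S * k) := by
    rw [smul_eq_iff_div hy.ne', dg_smul]
    simp only [Matrix.mul_smul, Matrix.smul_mul]
  simp only [constrainedBL, constrainedBR, kak, Matrix.fromBlocks_multiply, Matrix.fromBlocks_inj,
    Matrix.zero_mul, Matrix.mul_zero, add_zero, zero_add, Matrix.smul_mul, Matrix.mul_smul,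
    Matrix.one_mul, Matrix.mul_one]
  refine ⟨?_, ?_, e21, e22⟩
  · rw [← smul_add, ← e11]
  · rw [← smul_add, ← e12]

lemma det_cartan_block {c s : RVec n} (hc : ∀ i, 0 < c i) (hcs : ∀ i, c i ^ 2 = 1 + s i ^ 2) :
    (Matrix.fromBlocks (dg c) (dg s) (dg s) (dg c)).det = 1 := by
  have hc' : ∀ i, c i ≠ 0 := fun i => (hc i).ne'
  have e : Matrix.fromBlocks (dg c) (dg s) (dg s) (dg c) =
      Matrix.fromBlocks (dg fun i => (c i)⁻¹) (dg s) 0 (dg c) *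
        Matrix.fromBlocks 1 0 (dg (fun i => (c i)⁻¹) * dg s) 1 := by
    rw [Matrix.fromBlocks_multiply]
    simp only [Matrix.mul_zero, zero_add, Matrix.mul_one]
    rw [← Matrix.mul_assoc (dg c), dg_mul_inv hc', Matrix.one_mul]
    congr 1
    rw [dg_mul_dg, dg_mul_dg]
    ext i j
    by_cases h : i = j
    · subst h
      have := hc' i
      simp only [Matrix.add_apply, Matrix.diagonal_apply_eq]
      norm_cast
      field_simp
      linarith [hcs i]
    · simp [h]
  rw [e, Matrix.det_mul, Matrix.det_fromBlocks_zero₂₁, Matrix.det_fromBlocks_zero₁₂,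
    ← Matrix.det_mul, dg_inv_mul hc']
  simp

lemma det_kak {c s : RVec n} (hc : ∀ i, 0 < c i) (hcs : ∀ i, c i ^ 2 = 1 + s i ^ 2) :
    (kak ρ τ k l c s).det = ρ.det * τ.det * (k.det * l.det) := by
  rw [kak_eq_mul, Matrix.det_mul, Matrix.det_mul, det_cartan_block hc hcs,
    Matrix.det_fromBlocks_zero₂₁, Matrix.det_fromBlocks_zero₂₁, mul_one]

lemma det_constrainedBL (hy : y ≠ 0) (hσ : σ.det = 1) : (constrainedBL y σ ν).det = 1 := by
  have hy' : (y : ℂ) ≠ 0 := by exact_mod_cast hy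
  rw [constrainedBL, Matrix.det_fromBlocks_zero₂₁, Matrix.det_smul, Matrix.det_smul, hσ,
    Matrix.det_one, mul_one, mul_one, ← mul_pow, inv_mul_cancel₀ hy', one_pow]

lemma det_constrainedBR (hx : x ≠ 0) : (constrainedBR x om).det = 1 := by
  have hx' : (x : ℂ) ≠ 0 := by exact_mod_cast hx
  rw [constrainedBR, Matrix.det_fromBlocks_zero₂₁, Matrix.det_smul, Matrix.det_smul,
    Matrix.det_one, mul_one, mul_one, ← mul_pow, mul_inv_cancel₀ hx', one_pow]

/-- Only the determinant of k_L has to be prescribed. That of k_R follows from the constraint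
equation, since b_L and b_R have determinant 1. -/
lemma IsFrame.isConstrained (F : IsFrame σ x y S Γ C ρ τ k l r m om ν) (hσ : σ.det = 1)
    (hdet : ρ.det * τ.det * (k.det * l.det) = 1) :
    IsConstrained σ x y (constrainedBL y σ ν) (kak ρ τ k l Γ S) (constrainedBR x om)
      (kak r τ k m C (fun i => x / y * S i)) where
  kL_mem := ⟨by rw [det_kak F.Γ_pos F.Γ_sq, hdet], kak_preserves F.Γ_sq F.ρ_u F.τ_u F.k_u F.l_u⟩
  kR_mem := ⟨by
    have h := congrArg Matrix.det F.constraint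
    rwa [Matrix.det_mul, Matrix.det_mul, det_constrainedBL F.y_pos.ne' hσ,
      det_constrainedBR F.x_pos.ne', mul_one, one_mul, det_kak F.Γ_pos F.Γ_sq, hdet] at h,
    kak_preserves F.C_sq F.r_u F.τ_u F.k_u F.m_u⟩
  bL_form := ⟨ν, rfl⟩
  bR_form := ⟨om, rfl⟩
  eq := F.constraint

/-- The unitary matrix which exchanges two vectors of the same length with real scalar product,
in terms of their sum. -/
noncomputable def refl (u : Fin n → ℂ) : Mat n :=
  (2 / (star u ⬝ᵥ u)) • Matrix.vecMulVec u (star u) - 1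

lemma star_dotProduct_self (u : Fin n → ℂ) : star (star u ⬝ᵥ u) = star u ⬝ᵥ u := by
  exact (Matrix.star_dotProduct u u).symm

lemma refl_conjTranspose (u : Fin n → ℂ) : (refl u)ᴴ = refl u := by
  have h : star (2 : ℂ) = 2 := by simp
  rw [refl, Matrix.conjTranspose_sub, Matrix.conjTranspose_one, Matrix.conjTranspose_smul,
    Matrix.conjTranspose_vecMulVec, star_star, star_div₀, star_dotProduct_self, h]

lemma refl_unitary {u : Fin n → ℂ} (hu : star u ⬝ᵥ u ≠ 0) : (refl u)ᴴ * refl u = 1 := by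
  rw [refl_conjTranspose, refl, Matrix.sub_mul, Matrix.mul_sub, Matrix.one_mul, Matrix.mul_one,
    Matrix.smul_mul, Matrix.mul_smul, Matrix.vecMulVec_mul_vecMulVec, smul_smul,
    Matrix.vecMulVec_smul, smul_smul, mul_assoc, div_mul_cancel₀ _ hu, mul_two, add_smul]
  abel

/-- For equal lengths and real scalar product, the projection of a on a + b is (a + b)/2, so twice
the projection minus the identity sends a to b. -/
lemma refl_mulVec {a b : Fin n → ℂ} (hab : star (a + b) ⬝ᵥ (a + b) ≠ 0)
    (h1 : star a ⬝ᵥ a = star b ⬝ᵥ b) (h2 : star a ⬝ᵥ b = star b ⬝ᵥ a) :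
    refl (a + b) *ᵥ a = b := by
  have h3 : star (a + b) ⬝ᵥ (a + b) = 2 * (star (a + b) ⬝ᵥ a) := by
    rw [star_add, add_dotProduct, add_dotProduct, dotProduct_add, dotProduct_add, h1, h2]; ring
  have h4 : star (a + b) ⬝ᵥ a ≠ 0 := fun h => hab (by rw [h3, h, mul_zero])
  rw [refl, Matrix.sub_mulVec, Matrix.one_mulVec, Matrix.smul_mulVec, Matrix.vecMulVec_mulVec, h3]
  funext i
  simp only [Pi.sub_apply, Pi.smul_apply, smul_eq_mul, MulOpposite.smul_eq_mul_unop,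
    MulOpposite.unop_op, Pi.add_apply]
  field_simp
  ring

lemma sum_normSq_eq (u : Fin n → ℂ) : star u ⬝ᵥ u = ((∑ i, ‖u i‖ ^ 2 : ℝ) : ℂ) := by
  rw [dotProduct]
  push_cast
  refine Finset.sum_congr rfl fun i _ => ?_
  rw [Pi.star_apply, Complex.star_def, Complex.conj_mul']

/-- The vector of the given length in a fixed direction. -/
noncomputable def baseVec (i₀ : Fin n) (N : ℝ) : Fin n → ℂ := Pi.single i₀ (Real.sqrt N : ℂ)

lemma baseVec_normSq (i₀ : Fin n) {N : ℝ} (hN : 0 ≤ N) :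
    star (baseVec i₀ N) ⬝ᵥ baseVec i₀ N = (N : ℂ) := by
  have : star (baseVec i₀ N) ⬝ᵥ baseVec i₀ N = ((Real.sqrt N * Real.sqrt N : ℝ) : ℂ) := by
    rw [baseVec, dotProduct_single]; simp
  rw [this, Real.mul_self_sqrt hN]

/-- The reflection in the sum of two vectors needs a real scalar product and a nonzero sum. A
preliminary phase c makes the scalar product real and nonnegative, which ensures both. -/
lemma exists_unitary_baseVec (i₀ : Fin n) {N : ℝ} (hN : 0 < N) {v : Fin n → ℂ}
    (hv : star v ⬝ᵥ v = (N : ℂ)) : ∃ U : Mat n, Uᴴ * U = 1 ∧ U *ᵥ baseVec i₀ N = v := by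
  obtain ⟨c, hc, hcv⟩ : ∃ c : ℂ, star c * c = 1 ∧ star c * v i₀ = (‖v i₀‖ : ℂ) := by
    by_cases h : v i₀ = 0
    · exact ⟨1, by simp, by simp [h]⟩
    · have hn : (‖v i₀‖ : ℂ) ≠ 0 := by simpa using h
      have hns : star (‖v i₀‖ : ℂ) = ‖v i₀‖ := Complex.conj_ofReal _
      have h2 : star (v i₀) * v i₀ = (‖v i₀‖ : ℂ) * ‖v i₀‖ := by
        rw [Complex.star_def, Complex.conj_mul']; ring
      refine ⟨v i₀ / ‖v i₀‖, ?_, ?_⟩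
      · rw [star_div₀, hns, div_mul_div_comm, h2, div_self (mul_ne_zero hn hn)]
      · rw [star_div₀, hns, div_mul_eq_mul_div, h2, mul_div_assoc, div_self hn, mul_one]
  set a := c • baseVec i₀ N with ha
  have haa : star a ⬝ᵥ a = (N : ℂ) := by
    rw [ha, star_smul, smul_dotProduct, dotProduct_smul, baseVec_normSq i₀ hN.le, smul_eq_mul,
      smul_eq_mul, ← mul_assoc, hc, one_mul]
  have hav : star a ⬝ᵥ v = ((Real.sqrt N * ‖v i₀‖ : ℝ) : ℂ) := by
    have : star a ⬝ᵥ v = star c * (Real.sqrt N * v i₀) := by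
      rw [ha, star_smul, smul_dotProduct, smul_eq_mul, baseVec, dotProduct]
      rw [Finset.sum_eq_single i₀ (fun j _ hj => by simp [Pi.single_eq_of_ne hj]) (by simp)]
      simp
    rw [this]; push_cast; rw [← hcv]; ring
  have hva : star a ⬝ᵥ v = star v ⬝ᵥ a := by
    have : star v ⬝ᵥ a = star (star a ⬝ᵥ v) := Matrix.star_dotProduct v a
    rw [this, hav, Complex.star_def, Complex.conj_ofReal]
  have hne : star (a + v) ⬝ᵥ (a + v) ≠ 0 := by
    have : star (a + v) ⬝ᵥ (a + v) = ((2 * N + 2 * (Real.sqrt N * ‖v i₀‖) : ℝ) : ℂ) := by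
      rw [star_add, add_dotProduct, dotProduct_add, dotProduct_add, haa, hv, ← hva, hav]
      push_cast; ring
    rw [this]
    have : 0 < 2 * N + 2 * (Real.sqrt N * ‖v i₀‖) := by positivity
    exact_mod_cast this.ne'
  refine ⟨c • refl (a + v), ?_, ?_⟩
  · rw [Matrix.conjTranspose_smul, Matrix.smul_mul, Matrix.mul_smul, smul_smul, hc, one_smul,
      refl_unitary hne]
  · rw [Matrix.smul_mulVec, ← Matrix.mulVec_smul, ← ha, refl_mulVec hne (by rw [haa, hv]) hva]

lemma det_smul_one_add_vecMulVec {c ε : ℂ} (hc : c ≠ 0) (v w : Fin n → ℂ) :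
    (c • (1 : Mat n) + ε • Matrix.vecMulVec v w).det = c ^ n * (1 + ε / c * (w ⬝ᵥ v)) := by
  have : c • (1 : Mat n) + ε • Matrix.vecMulVec v w =
      c • (1 + Matrix.replicateCol Unit ((ε / c) • v) * Matrix.replicateRow Unit w) := by
    rw [smul_add, ← Matrix.vecMulVec_eq, Matrix.smul_vecMulVec, smul_smul, mul_div_cancel₀ _ hc]
  rw [this, Matrix.det_smul, Fintype.card_fin, Matrix.det_one_add_replicateCol_mul_replicateRow,
    dotProduct_smul, smul_eq_mul]

end Section
end HeisenbergDouble

namespace HeisenbergDouble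
-- A smooth section over the chamber.
section SmoothSection

variable {n : ℕ} {σ : Mat n} {α x y : ℝ} {S Γ C : RVec n} {ρ : Mat n} {v : Fin n → ℂ}

/-- The matrix `T` in normal form. -/
noncomputable def normalT (α : ℝ) (S p : RVec n) : Mat n := phase p * ofRealM (cauchyT α S)

/-- The vector `ρ† v` in normal form. -/
noncomputable def vHatC (α : ℝ) (S : RVec n) : Fin n → ℂ := fun i => (vHat α S i : ℂ)

lemma ofRealM_mul (A B : RMat n) : ofRealM (A * B) = ofRealM A * ofRealM B := by
  ext i j; simp [ofRealM, Matrix.mul_apply]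

lemma ofRealM_conjTranspose (A : RMat n) : (ofRealM A)ᴴ = ofRealM Aᵀ := by
  ext i j; simp [ofRealM]

lemma ofRealM_diagonal (f : RVec n) : ofRealM (Matrix.diagonal f) = dg f := by
  ext i j
  by_cases h : i = j
  · subst h; simp [ofRealM]
  · simp [ofRealM, h]

lemma normalT_unitary (hα : α ≠ 0) (hα1 : α ^ 2 ≠ 1) (hS : S ∈ allChambers n α) (p : RVec n) :
    (normalT α S p)ᴴ * normalT α S p = 1 := by
  rw [normalT, Matrix.conjTranspose_mul, Matrix.mul_assoc, unitary_cancel (phase_conjTranspose_mul p),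
    ofRealM_conjTranspose, ← ofRealM_mul, cauchyT_orthogonal hα hα1 hS]
  ext i j; simp [ofRealM, Matrix.one_apply, apply_ite]

lemma normalT_rank (hα : α ≠ 0) (hα1 : α ^ 2 ≠ 1) (hS : S ∈ allChambers n α) (p : RVec n) :
    (normalT α S p)ᴴ * dg (fun i => S i ^ 2) * normalT α S p =
      dg S * (((α ^ 2 : ℝ) : ℂ) • (1 : Mat n) + (epsSign α : ℂ) •
        Matrix.vecMulVec (vHatC α S) (star (vHatC α S))) * dg S := by
  have h := congrArg ofRealM (cauchyT_rank hα hα1 hS)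
  simp only [ofRealM_mul, ofRealM_diagonal] at h
  have e : ofRealM (α ^ 2 • (1 : RMat n) + epsSign α • Matrix.vecMulVec (vHat α S) (vHat α S)) =
      ((α ^ 2 : ℝ) : ℂ) • (1 : Mat n) + (epsSign α : ℂ) •
        Matrix.vecMulVec (vHatC α S) (star (vHatC α S)) := by
    ext i j
    simp [ofRealM, vHatC, Matrix.one_apply, apply_ite, Matrix.vecMulVec_apply]
  rw [← e, ← h, normalT, Matrix.conjTranspose_mul, ofRealM_conjTranspose, Matrix.mul_assoc,
    Matrix.mul_assoc, ← Matrix.mul_assoc (dg _), ← phase_comm_dg, Matrix.mul_assoc (phase p),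
    unitary_cancel (phase_conjTranspose_mul p), Matrix.mul_assoc]

lemma normalT_diag (hα : α ≠ 0) (hα1 : α ^ 2 ≠ 1) (hS : S ∈ allChambers n α) (p : RVec n)
    (i : Fin n) : normalT α S p i i =
      (‖normalT α S p i i‖ : ℂ) * Complex.exp (Complex.I * (p i : ℂ)) := by
  have h : normalT α S p i i = Complex.exp (Complex.I * (p i : ℂ)) * (cauchyT α S i i : ℂ) := by
    rw [normalT, phase, Matrix.diagonal_mul]; rfl
  have hexp : ‖Complex.exp (Complex.I * (p i : ℂ))‖ = 1 := by
    rw [mul_comm]; exact Complex.norm_exp_ofReal_mul_I _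
  rw [h, norm_mul, hexp, one_mul, Complex.norm_real,
    Real.norm_of_nonneg (cauchyT_diag_pos hα hα1 hS i).le, mul_comm]

/-- A point in normal form is determined by `ρ` and the coordinates. -/
lemma isFrame_of_rho (hα : α ≠ 0) (hα1 : α ^ 2 ≠ 1) (hS : S ∈ allChambers n α) (hx : 0 < x)
    (hy : 0 < y) (hΓ : ∀ i, 0 < Γ i) (hΓ2 : ∀ i, Γ i ^ 2 = 1 + S i ^ 2) (hσ : IsKKS α v σ)
    (hρ : ρᴴ * ρ = 1) (hρv : ρᴴ *ᵥ v = vHatC α S) (p : RVec n) :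
    IsFrame σ x y S Γ (coshR x y S) ρ 1 ρᴴ 1
      (σᴴ * ρ * dg S * (normalT α S p)ᴴ * dg (fun i => (S i)⁻¹)) (normalT α S p)
      (ρ * dg (fun i => (S i)⁻¹) * ((y : ℂ) • (dg (coshR x y S) * normalT α S p)
        - (x : ℂ)⁻¹ • dg Γ))
      ((((x * y : ℝ) : ℂ) • (ρ * dg Γ) - σ * (σᴴ * ρ * dg S * (normalT α S p)ᴴ *
        dg (fun i => (S i)⁻¹)) * dg (coshR x y S)) * dg (fun i => (x / y * S i)⁻¹)) := by
  set T := normalT α S p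
  have hT : Tᴴ * T = 1 := normalT_unitary hα hα1 hS p
  have hT' : T * Tᴴ = 1 := mul_eq_one_comm.1 hT
  have hS0 := hS.1
  have hs : ∀ i, x / y * S i ≠ 0 := fun i => mul_ne_zero (div_ne_zero hx.ne' hy.ne') (hS0 i)
  have hρ' : ρ * ρᴴ = 1 := mul_eq_one_comm.1 hρ
  have hM : dg S * (ρᴴ * (σ * σᴴ) * ρ) * dg S = Tᴴ * dg (fun i => S i ^ 2) * T := by
    rw [normalT_rank hα hα1 hS p, hσ.2.2, ← hρv, epsSign, Matrix.star_mulVec,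
      Matrix.conjTranspose_conjTranspose]
    simp only [Matrix.mul_add, Matrix.add_mul, Matrix.mul_smul, Matrix.smul_mul, Matrix.mul_one, hρ,
      Matrix.mul_vecMulVec, Matrix.vecMulVec_mul]
  have hsq : dg (fun i => S i ^ 2) = dg S * dg S := by rw [dg_mul_dg]; simp only [sq]
  exact {
    x_pos := hx
    y_pos := hy
    S_ne := hS0
    Γ_pos := hΓ
    Γ_sq := hΓ2
    C_pos := coshR_pos hy S
    C_sq := coshR_sq hy S
    ρ_u := hρ
    τ_u := by simp
    k_u := by rw [Matrix.conjTranspose_conjTranspose, hρ']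
    l_u := by simp
    r_u := by
      have : (σᴴ * ρ * dg S * Tᴴ * dg (fun i => (S i)⁻¹))ᴴ *
          (σᴴ * ρ * dg S * Tᴴ * dg (fun i => (S i)⁻¹)) = dg (fun i => (S i)⁻¹) * (T *
            (dg S * (ρᴴ * (σ * σᴴ) * ρ) * dg S) * Tᴴ) * dg (fun i => (S i)⁻¹) := by
        simp only [Matrix.conjTranspose_mul, Matrix.conjTranspose_conjTranspose, dg_conjTranspose,
          Matrix.mul_assoc]
      rw [this, hM, hsq]
      calc _ = dg (fun i => (S i)⁻¹) * ((T * Tᴴ) * (dg S * dg S) * (T * Tᴴ)) *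
            dg (fun i => (S i)⁻¹) := by simp only [Matrix.mul_assoc]
        _ = (dg (fun i => (S i)⁻¹) * dg S) * (dg S * dg (fun i => (S i)⁻¹)) := by
            rw [hT', Matrix.one_mul, Matrix.mul_one]; simp only [Matrix.mul_assoc]
        _ = 1 := by rw [dg_inv_mul hS0, dg_mul_inv hS0, Matrix.one_mul]
    m_u := hT
    rel := by
      rw [Matrix.mul_one, Matrix.mul_assoc (_ * Tᴴ) _ (dg S), dg_inv_mul hS0, Matrix.mul_one,
        Matrix.mul_assoc _ Tᴴ, hT, Matrix.mul_one]
    om_eq := by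
      calc _ = dg S * (ρᴴ * ρ) * dg (fun i => (S i)⁻¹) *
            ((y : ℂ) • (dg (coshR x y S) * T) - (x : ℂ)⁻¹ • dg Γ) := by
            simp only [Matrix.mul_assoc]
        _ = _ := by rw [hρ, Matrix.mul_one, dg_mul_inv hS0, Matrix.one_mul, Matrix.mul_one]
    ν_eq := by rw [Matrix.mul_one, Matrix.mul_assoc _ _ (dg fun i => x / y * S i), dg_inv_mul hs,
      Matrix.mul_one] }

/-- The determinant is α²ⁿ(1 + ε|w|²/α²), so the condition that it be 1 fixes the norm. In
particular v and the normal form of ρ†v have the same length, as is needed for a unitary ρ. -/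
lemma normSq_of_kks (hα : α ≠ 0) (hα1 : α ^ 2 ≠ 1) {w : Fin n → ℂ}
    (h : (((α ^ 2 : ℝ) : ℂ) • (1 : Mat n) + (epsSign α : ℂ) • Matrix.vecMulVec w (star w)).det = 1) :
    star w ⬝ᵥ w = (((α ^ 2) ^ n : ℝ)⁻¹ - 1 : ℝ) * (α ^ 2 * epsSign α : ℝ) := by
  have ha : ((α ^ 2 : ℝ) : ℂ) ≠ 0 := by exact_mod_cast pow_ne_zero 2 hα
  have h2 : (epsSign α : ℂ) * epsSign α = 1 := by exact_mod_cast epsSign_sq hα hα1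
  rw [det_smul_one_add_vecMulVec ha] at h
  have h3 := eq_inv_of_mul_eq_one_right h
  have hα' : (α : ℂ) ≠ 0 := by exact_mod_cast hα
  push_cast at h3 ⊢
  rw [← h3]
  field_simp
  linear_combination (-(star w ⬝ᵥ w)) * h2

lemma det_kks (hσ : IsKKS α v σ) :
    (((α ^ 2 : ℝ) : ℂ) • (1 : Mat n) + (epsSign α : ℂ) • Matrix.vecMulVec v (star v)).det = 1 := by
  have := congrArg Matrix.det hσ.2.2
  rw [Matrix.det_mul, Matrix.det_conjTranspose, hσ.2.1] at this
  rw [epsSign, ← this]; simp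

/-- Compare determinants in `normalT_rank`: T is unitary and the determinants of S cancel. -/
lemma det_vHatC (hα : α ≠ 0) (hα1 : α ^ 2 ≠ 1) (hS : S ∈ allChambers n α) :
    (((α ^ 2 : ℝ) : ℂ) • (1 : Mat n) + (epsSign α : ℂ) •
      Matrix.vecMulVec (vHatC α S) (star (vHatC α S))).det = 1 := by
  have h := congrArg Matrix.det (normalT_rank hα hα1 hS 0)
  have hT := congrArg Matrix.det (normalT_unitary hα hα1 hS 0)
  have e : dg (fun i => S i ^ 2) = dg S * dg S := by rw [dg_mul_dg]; simp only [sq]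
  have hne : (dg S).det ≠ 0 := by
    rw [Matrix.det_diagonal]
    exact Finset.prod_ne_zero_iff.2 fun i _ => by exact_mod_cast hS.1 i
  rw [Matrix.det_mul, Matrix.det_one] at hT
  rw [e] at h
  simp only [Matrix.det_mul] at h
  refine mul_right_cancel₀ (mul_ne_zero hne hne) ?_
  linear_combination -h + ((dg S).det * (dg S).det) * hT

/-- If v vanished, the determinant condition would give α²ⁿ = 1. -/
lemma normSq_pos (hn : 0 < n) (hα : α ≠ 0) (hα1 : α ^ 2 ≠ 1) (hσ : IsKKS α v σ) :
    0 < ∑ i, ‖v i‖ ^ 2 := by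
  refine (Finset.sum_nonneg fun i _ => by positivity).lt_of_ne fun h => ?_
  have h1 := normSq_of_kks hα hα1 (det_kks hσ)
  rw [sum_normSq_eq, ← h] at h1
  have h2 : (((α ^ 2) ^ n : ℝ)⁻¹ - 1) * (α ^ 2 * epsSign α) = 0 := by exact_mod_cast h1.symm
  have he := epsSign_sq hα hα1
  rcases mul_eq_zero.1 h2 with h3 | h3
  · have h4 : (α ^ 2) ^ n = 1 := by rw [← inv_inv ((α ^ 2) ^ n), sub_eq_zero.1 h3, inv_one]
    exact hα1 ((pow_eq_one_iff_of_nonneg (sq_nonneg α) hn.ne').1 h4)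
  · rcases mul_eq_zero.1 h3 with h4 | h4
    · exact pow_ne_zero 2 hα h4
    · rw [h4, mul_zero] at he; exact zero_ne_one he

/-- A smooth choice of `ρ`. -/
noncomputable def secRho (U : Mat n) (i₀ : Fin n) (N α : ℝ) (S : RVec n) : Mat n :=
  U * refl (vHatC α S + baseVec i₀ N)

/-- The normal form of ρ†v has positive components for positive S, so its scalar product with the
base vector is positive. The sum of the two then never vanishes, and the reflection is smooth over
the whole chamber. -/
lemma secRho_denom (i₀ : Fin n) {N : ℝ} (hN : 0 < N) (hα : α ≠ 0) (hα1 : α ^ 2 ≠ 1) (hS : S ∈ allChambers n α)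
    (hpos : ∀ i, 0 < S i) (hNS : star (vHatC α S) ⬝ᵥ vHatC α S = (N : ℂ)) :
    star (vHatC α S) ⬝ᵥ baseVec i₀ N = star (baseVec i₀ N) ⬝ᵥ vHatC α S ∧
    star (vHatC α S + baseVec i₀ N) ⬝ᵥ (vHatC α S + baseVec i₀ N) ≠ 0 := by
  have h1 : star (vHatC α S) ⬝ᵥ baseVec i₀ N = ((vHat α S i₀ * Real.sqrt N : ℝ) : ℂ) := by
    rw [baseVec, dotProduct_single]; simp [vHatC]
  have h2 : star (baseVec i₀ N) ⬝ᵥ vHatC α S = star (star (vHatC α S) ⬝ᵥ baseVec i₀ N) :=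
    Matrix.star_dotProduct _ _
  have h3 : star (vHatC α S) ⬝ᵥ baseVec i₀ N = star (baseVec i₀ N) ⬝ᵥ vHatC α S := by
    rw [h2, h1, Complex.star_def, Complex.conj_ofReal]
  refine ⟨h3, ?_⟩
  have : star (vHatC α S + baseVec i₀ N) ⬝ᵥ (vHatC α S + baseVec i₀ N) =
      ((2 * N + 2 * (vHat α S i₀ * Real.sqrt N) : ℝ) : ℂ) := by
    rw [star_add, add_dotProduct, dotProduct_add, dotProduct_add, hNS, ← h3, h1,
      baseVec_normSq i₀ hN.le]
    push_cast; ring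
  rw [this]
  have hv : 0 < vHat α S i₀ := div_pos (Real.sqrt_pos.2 (wSq_pos hα hα1 hS i₀)) (hpos i₀)
  have : 0 < 2 * N + 2 * (vHat α S i₀ * Real.sqrt N) := by positivity
  exact_mod_cast this.ne'

/-- A family of matrices with smooth entries. -/
def SmoothM {E : Type*} [NormedAddCommGroup E] [NormedSpace ℝ E] (M : E → Mat n) (s : Set E) :
    Prop := ∀ i j, ContDiffOn ℝ ∞ (fun z => M z i j) s

section Smooth

variable {E : Type*} [NormedAddCommGroup E] [NormedSpace ℝ E] {s : Set E} {M N : E → Mat n}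

lemma contDiffOn_ofReal {f : E → ℝ} (hf : ContDiffOn ℝ ∞ f s) :
    ContDiffOn ℝ ∞ (fun z => (f z : ℂ)) s := Complex.ofRealCLM.contDiff.comp_contDiffOn hf

lemma contDiffOn_star {f : E → ℂ} (hf : ContDiffOn ℝ ∞ f s) :
    ContDiffOn ℝ ∞ (fun z => star (f z)) s := Complex.conjCLE.contDiff.comp_contDiffOn hf

lemma SmoothM.mul (hM : SmoothM M s) (hN : SmoothM N s) : SmoothM (fun z => M z * N z) s :=
  fun i j => by
    simp only [Matrix.mul_apply]
    exact ContDiffOn.sum fun k _ => (hM i k).mul (hN k j)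

lemma SmoothM.sub (hM : SmoothM M s) (hN : SmoothM N s) : SmoothM (fun z => M z - N z) s :=
  fun i j => (hM i j).sub (hN i j)

lemma SmoothM.smul (hM : SmoothM M s) {f : E → ℂ} (hf : ContDiffOn ℝ ∞ f s) :
    SmoothM (fun z => f z • M z) s := fun i j => hf.mul (hM i j)

lemma SmoothM.conjTranspose (hM : SmoothM M s) : SmoothM (fun z => (M z)ᴴ) s :=
  fun i j => contDiffOn_star (hM j i)

lemma SmoothM.const (A : Mat n) : SmoothM (fun _ : E => A) s := fun _ _ => contDiffOn_const

lemma SmoothM.diagonal {f : E → Fin n → ℂ} (hf : ∀ i, ContDiffOn ℝ ∞ (fun z => f z i) s) :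
    SmoothM (fun z => Matrix.diagonal (f z)) s := fun i j => by
  by_cases h : i = j
  · subst h; simpa using hf i
  · simpa [h] using contDiffOn_const

lemma SmoothM.dg {f : E → RVec n} (hf : ∀ i, ContDiffOn ℝ ∞ (fun z => f z i) s) :
    SmoothM (fun z => dg (f z)) s := SmoothM.diagonal fun i => contDiffOn_ofReal (hf i)

lemma SmoothM.refl {u : E → Fin n → ℂ} (hu : ∀ i, ContDiffOn ℝ ∞ (fun z => u z i) s)
    (h0 : ∀ z ∈ s, star (u z) ⬝ᵥ u z ≠ 0) : SmoothM (fun z => refl (u z)) s := by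
  have hd : ContDiffOn ℝ ∞ (fun z => star (u z) ⬝ᵥ u z) s := by
    simp only [dotProduct]
    exact ContDiffOn.sum fun k _ => (contDiffOn_star (hu k)).mul (hu k)
  exact (SmoothM.smul (M := fun z => Matrix.vecMulVec (u z) (star (u z)))
    (fun i j => (hu i).mul (contDiffOn_star (hu j))) (by
      simp only [div_eq_mul_inv]
      exact contDiffOn_const.mul (hd.inv h0))).sub (SmoothM.const 1)

lemma SmoothM.fromBlocks {a b c d : E → Mat n} (ha : SmoothM a s) (hb : SmoothM b s)
    (hc : SmoothM c s) (hd : SmoothM d s) :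
    SmoothMatOn (fun z => Matrix.fromBlocks (a z) (b z) (c z) (d z)) s := by
  rintro (i | i) (j | j)
  exacts [ha i j, hb i j, hc i j, hd i j]

lemma SmoothM.kak {ρ τ k l : E → Mat n} {c f : E → RVec n} (hρ : SmoothM ρ s) (hτ : SmoothM τ s)
    (hk : SmoothM k s) (hl : SmoothM l s) (hc : ∀ i, ContDiffOn ℝ ∞ (fun z => c z i) s)
    (hf : ∀ i, ContDiffOn ℝ ∞ (fun z => f z i) s) :
    SmoothMatOn (fun z => kak (ρ z) (τ z) (k z) (l z) (c z) (f z)) s :=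
  SmoothM.fromBlocks ((hρ.mul (SmoothM.dg hc)).mul hk) ((hρ.mul (SmoothM.dg hf)).mul hl)
    ((hτ.mul (SmoothM.dg hf)).mul hk) ((hτ.mul (SmoothM.dg hc)).mul hl)

end Smooth

lemma contDiffOn_prod_erase {E : Type*} [NormedAddCommGroup E] [NormedSpace ℝ E] {s : Set E}
    {f : Fin n → E → ℝ} {i : Fin n} (hf : ∀ j, i ≠ j → ContDiffOn ℝ ∞ (f j) s) :
    ContDiffOn ℝ ∞ (fun z => ∏ j ∈ Finset.univ.erase i, f j z) s :=
  contDiffOn_prod fun j hj => hf j (Finset.ne_of_mem_erase hj).symm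

/-- There is a smooth family of points of the constraint surface with given coordinates. -/
theorem exists_section (hn : 0 < n) (hα : α ≠ 0) (hα1 : α ^ 2 ≠ 1) (hx : 0 < x) (hy : 0 < y)
    (hσ : IsKKS α v σ) :
    ∃ bL kL bR kR : RVec n × RVec n → BlockMat n,
      SmoothMatOn bL (chamber n α ×ˢ Set.univ) ∧ SmoothMatOn kL (chamber n α ×ˢ Set.univ) ∧
      SmoothMatOn bR (chamber n α ×ˢ Set.univ) ∧ SmoothMatOn kR (chamber n α ×ˢ Set.univ) ∧
      ∀ q ∈ chamber n α, ∀ p : RVec n,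
        IsConstrained σ x y (bL (q, p)) (kL (q, p)) (bR (q, p)) (kR (q, p)) ∧
        HasCoordinates x y (kL (q, p) * bR (q, p)) (deltaOf q) p := by
  set N := ∑ i, ‖v i‖ ^ 2 with hNd
  have hN : 0 < N := normSq_pos hn hα hα1 hσ
  have hv : star v ⬝ᵥ v = (N : ℂ) := sum_normSq_eq v
  set i₀ : Fin n := ⟨0, hn⟩
  obtain ⟨U, hU, hUv⟩ := exists_unitary_baseVec i₀ hN hv
  set S : RVec n × RVec n → RVec n := fun z i => Real.exp (z.1 i) with hSd
  set Γ : RVec n × RVec n → RVec n := fun z i => Real.sqrt (1 + S z i ^ 2) with hΓd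
  set D : Set (RVec n × RVec n) := chamber n α ×ˢ Set.univ with hD
  have hS : ∀ z ∈ D, S z ∈ allChambers n α := fun z hz => exp_mem_allChambers hz.1
  have hSp : ∀ z i, 0 < S z i := fun z i => Real.exp_pos _
  have hNS : ∀ z ∈ D, star (vHatC α (S z)) ⬝ᵥ vHatC α (S z) = (N : ℂ) := fun z hz => by
    rw [normSq_of_kks hα hα1 (det_vHatC hα hα1 (hS z hz)), ← hv,
      normSq_of_kks hα hα1 (det_kks hσ)]
  have hden := fun z hz => secRho_denom i₀ hN hα hα1 (hS z hz) (hSp z) (hNS z hz)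
  set ρ : RVec n × RVec n → Mat n := fun z => secRho U i₀ N α (S z) with hρd
  set T : RVec n × RVec n → Mat n := fun z => normalT α (S z) z.2 with hTd
  have hρu : ∀ z ∈ D, (ρ z)ᴴ * ρ z = 1 := fun z hz => by
    simp only [hρd, secRho, Matrix.conjTranspose_mul, Matrix.mul_assoc, unitary_cancel hU,
      refl_unitary (hden z hz).2]
  have hρv : ∀ z ∈ D, (ρ z)ᴴ *ᵥ v = vHatC α (S z) := fun z hz => by
    have h1 : ρ z *ᵥ vHatC α (S z) = v := by
      simp only [hρd, secRho]
      rw [← Matrix.mulVec_mulVec, refl_mulVec (hden z hz).2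
        (by rw [hNS z hz, baseVec_normSq i₀ hN.le]) (hden z hz).1, hUv]
    rw [← h1, Matrix.mulVec_mulVec, hρu z hz, Matrix.one_mulVec]
  have F : ∀ z ∈ D, _ := fun z hz => isFrame_of_rho (Γ := Γ z) hα hα1 (hS z hz) hx hy
    (fun i => Real.sqrt_pos.2 (by positivity)) (fun i => Real.sq_sqrt (by positivity)) hσ
    (hρu z hz) (hρv z hz) z.2
  -- smoothness
  have sS (i : Fin n) : ContDiffOn ℝ ∞ (fun z => S z i) D := by
    apply ContDiff.contDiffOn
    exact Real.contDiff_exp.comp ((contDiff_apply ℝ ℝ i).comp contDiff_fst)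
  have sSi (i : Fin n) : ContDiffOn ℝ ∞ (fun z => (S z i)⁻¹) D := (sS i).inv fun z _ => (hSp z i).ne'
  have sS2 (i : Fin n) : ContDiffOn ℝ ∞ (fun z => S z i ^ 2) D := (sS i).pow 2
  have sΓ (i : Fin n) : ContDiffOn ℝ ∞ (fun z => Γ z i) D :=
    (contDiffOn_const.add (sS2 i)).sqrt fun z _ => by positivity
  have sC (i : Fin n) : ContDiffOn ℝ ∞ (fun z => coshR x y (S z) i) D :=
    ((contDiffOn_const.add (contDiffOn_const.mul (sS2 i))).sqrt fun z _ => by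
      have := sq_nonneg (S z i); positivity).div_const y
  have sW (i : Fin n) : ContDiffOn ℝ ∞ (fun z => Real.sqrt (wSq α (S z) i)) D := by
    refine ContDiffOn.sqrt ?_ fun z hz => (wSq_pos hα hα1 (hS z hz) i).ne'
    refine (contDiffOn_const.mul (sS2 i)).mul (contDiffOn_prod_erase fun j hij => ?_)
    refine ((contDiffOn_const.mul (sS2 i)).sub (sS2 j)).div
      ((contDiffOn_const.mul (sS2 i)).sub (contDiffOn_const.mul (sS2 j))) fun z hz => ?_
    rw [← mul_sub]
    exact mul_ne_zero (pow_ne_zero _ hα) (sub_ne_zero.2 (allChambers_sq_ne hα (hS z hz) hij))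
  have sU (i : Fin n) : ContDiffOn ℝ ∞ (fun z => Real.sqrt (uSq α (S z) i)) D := by
    refine ContDiffOn.sqrt ?_ fun z hz => (uSq_pos hα hα1 (hS z hz) i).ne'
    refine (contDiffOn_const.mul (sS2 i)).mul (contDiffOn_prod_erase fun j hij => ?_)
    exact ((sS2 i).sub (contDiffOn_const.mul (sS2 j))).div ((sS2 i).sub (sS2 j)) fun z hz =>
      sub_ne_zero.2 (allChambers_sq_ne hα (hS z hz) hij)
  have sV (i : Fin n) : ContDiffOn ℝ ∞ (fun z => vHatC α (S z) i) D :=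
    contDiffOn_ofReal ((sW i).div (sS i) fun z _ => (hSp z i).ne')
  have sρ : SmoothM ρ D := (SmoothM.const U).mul
    (SmoothM.refl (fun i => (sV i).add contDiffOn_const) fun z hz => (hden z hz).2)
  have sT : SmoothM T D := by
    refine SmoothM.mul (SmoothM.diagonal fun i => ?_) fun k i => contDiffOn_ofReal ?_
    · refine Complex.contDiff_exp.comp_contDiffOn (contDiffOn_const.mul (contDiffOn_ofReal ?_))
      exact ((contDiff_apply ℝ ℝ i).comp contDiff_snd).contDiffOn
    · exact (contDiffOn_const.mul ((sU k).mul (sW i))).div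
        ((sS2 k).sub (contDiffOn_const.mul (sS2 i))) fun z hz =>
        sub_ne_zero.2 (allChambers_cross_ne hα hα1 (hS z hz) k i)
  have c1 : SmoothM (fun _ : RVec n × RVec n => (1 : Mat n)) D := SmoothM.const 1
  have cs (c : ℂ) : ContDiffOn ℝ ∞ (fun _ : RVec n × RVec n => c) D := contDiffOn_const
  have ss (i : Fin n) : ContDiffOn ℝ ∞ (fun z => x / y * S z i) D := contDiffOn_const.mul (sS i)
  have sr := ((((SmoothM.const σᴴ).mul sρ).mul (SmoothM.dg sS)).mul sT.conjTranspose).mul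
    (SmoothM.dg sSi)
  have som := (sρ.mul (SmoothM.dg sSi)).mul ((((SmoothM.dg sC).mul sT).smul (cs (y : ℂ))).sub
    ((SmoothM.dg sΓ).smul (cs (x : ℂ)⁻¹)))
  have sν := ((((sρ.mul (SmoothM.dg sΓ)).smul (cs ((x * y : ℝ) : ℂ))).sub
    (((SmoothM.const σ).mul sr).mul (SmoothM.dg sC))).mul
    (SmoothM.dg fun i => (ss i).inv fun z _ =>
      mul_ne_zero (div_ne_zero hx.ne' hy.ne') (hSp z i).ne'))
  refine ⟨_, _, _, _, SmoothM.fromBlocks (SmoothM.const ((y : ℂ)⁻¹ • σ)) (sν.smul (cs (y : ℂ)⁻¹))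
      (SmoothM.const 0) (SmoothM.const ((y : ℂ) • 1)), SmoothM.kak sρ c1 sρ.conjTranspose c1 sΓ sS,
    SmoothM.fromBlocks (SmoothM.const ((x : ℂ) • 1)) som (SmoothM.const 0)
      (SmoothM.const ((x : ℂ)⁻¹ • 1)), SmoothM.kak sr c1 sρ.conjTranspose sT sC ss, ?_⟩
  intro q hq p
  have hz : (q, p) ∈ D := ⟨hq, Set.mem_univ _⟩
  have F := F (q, p) hz
  refine ⟨F.isConstrained hσ.2.1 ?_, ?_⟩
  -- With τ = l = 1 and k = ρ† the determinants of ρ and k cancel.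
  · have := congrArg Matrix.det (mul_eq_one_comm.1 (hρu _ hz))
    rw [Matrix.det_mul, Matrix.det_one] at this
    rw [Matrix.det_one, mul_one, mul_one, this]
  · have e1 : (fun i => Real.sinh (deltaOf q i)) = S (q, p) := by
      funext i; exact Real.sinh_arsinh _
    have e2 : (fun i => Real.cosh (deltaOf q i)) = Γ (q, p) := by
      funext i; exact Real.cosh_arsinh _
    rw [← e1, ← e2] at F
    have := F.hasCoordinates (p := p) fun i => by
      rw [Matrix.conjTranspose_one, Matrix.mul_one]
      exact normalT_diag hα hα1 (by rw [e1]; exact hS _ hz) p i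
    rw [e1, e2] at this
    exact this

end SmoothSection
end HeisenbergDouble

namespace HeisenbergDouble
-- Uniqueness of the normal form and the bijection with chamber times torus.
section Uniqueness

variable {n : ℕ} {σ om ν om' ν' : Mat n} {α x y : ℝ} {S p : RVec n} {kL kR : BlockMat n}
  {ρ τ k l r m ρ' τ' k' l' r' m' : Mat n} {v : Fin n → ℂ}

/-- The hyperbolic cosines that belong to `k_L`. -/
noncomputable def coshL (S : RVec n) : RVec n := fun i => Real.sqrt (1 + S i ^ 2)

lemma coshL_sinh (Δ : RVec n) : coshL (fun i => Real.sinh (Δ i)) = fun i => Real.cosh (Δ i) := by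
  funext i
  rw [coshL, add_comm, ← Real.cosh_sq, Real.sqrt_sq (Real.cosh_pos _).le]

/-- A point of the constraint surface together with Cartan decompositions in normal form. -/
structure IsNormal (σ : Mat n) (α x y : ℝ) (v : Fin n → ℂ) (S p : RVec n) (kL kR : BlockMat n)
    (om ν ρ τ k l r m : Mat n) : Prop where
  frame : IsFrame σ x y S (coshL S) (coshR x y S) ρ τ k l r m om ν
  kL_eq : kL = kak ρ τ k l (coshL S) S
  kR_eq : kR = kak r τ k m (coshR x y S) (fun i => x / y * S i)
  T_eq : m * lᴴ = normalT α S p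
  v_eq : ρᴴ *ᵥ v = vHatC α S

lemma exists_isNormal (hα : α ≠ 0) (hα1 : α ^ 2 ≠ 1) (hx : 0 < x) (hy : 0 < y)
    (hσ : IsKKS α v σ) {bL bR : BlockMat n} (hc : IsConstrained σ x y bL kL bR kR) {Δ : RVec n}
    (hS : (fun i => Real.sinh (Δ i)) ∈ allChambers n α) (h : HasCoordinates x y (kL * bR) Δ p) :
    ∃ om ν ρ τ k l r m, bL = constrainedBL y σ ν ∧ bR = constrainedBR x om ∧
      IsNormal σ α x y v (fun i => Real.sinh (Δ i)) p kL kR om ν ρ τ k l r m := by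
  obtain ⟨ρ, τ, k, l, r, m, om, ν, F, e1, e2, e3, e4, hp⟩ :=
    exists_frame_of_hasCoordinates hx hy hc hS.1 h
  rw [← coshL_sinh] at F e1
  obtain ⟨d, hd, hdc, F', hT, hv⟩ := F.exists_normal hα hα1 hS hσ hp
  exact ⟨om, ν, _, _, _, _, _, _, e3, e4, F', by rw [kak_gauge hd hdc, e1],
    by rw [kak_gauge hd hdc, e2], hT, hv⟩

/-- The matrix with columns `H^j v`. -/
noncomputable def krylov (H : Mat n) (v : Fin n → ℂ) : Mat n :=
  Matrix.of fun i j => ((H ^ (j : ℕ)) *ᵥ v) i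

/-- The matrix which represents the vectors `H^j v` in the eigenbasis of `H`. -/
noncomputable def eigenKrylov (α : ℝ) (S : RVec n) : Mat n :=
  Matrix.diagonal (vHatC α S) * Matrix.vandermonde fun i => ((1 + S i ^ 2 : ℝ) : ℂ)

lemma coshL_sq (S : RVec n) (i : Fin n) : coshL S i ^ 2 = 1 + S i ^ 2 :=
  Real.sq_sqrt (by positivity)

/-- The vector v is cyclic for k₁₁k₁₁†: in the eigenbasis it has no vanishing component, and the
eigenvalues 1 + S_i² are distinct, so the Vandermonde factor is invertible. -/
lemma isUnit_eigenKrylov (hα : α ≠ 0) (hα1 : α ^ 2 ≠ 1) (hS : S ∈ allChambers n α) :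
    IsUnit (eigenKrylov α S).det := by
  rw [isUnit_iff_ne_zero, eigenKrylov, Matrix.det_mul, Matrix.det_diagonal]
  refine mul_ne_zero (Finset.prod_ne_zero_iff.2 fun i _ => ?_)
    (Matrix.det_vandermonde_ne_zero_iff.2 fun i j h => ?_)
  · have : vHat α S i ≠ 0 := div_ne_zero (Real.sqrt_pos.2 (wSq_pos hα hα1 hS i)).ne' (hS.1 i)
    rw [vHatC]; exact_mod_cast this
  · by_contra hij
    have h' : 1 + S i ^ 2 = 1 + S j ^ 2 := by exact_mod_cast h
    exact allChambers_sq_ne hα hS hij (by linarith)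

lemma IsNormal.kL_mul (N : IsNormal σ α x y v S p kL kR om ν ρ τ k l r m) :
    kL.toBlocks₁₁ * kL.toBlocks₁₁ᴴ = ρ * dg (fun i => 1 + S i ^ 2) * ρᴴ := by
  have e : (fun i => 1 + S i ^ 2) = fun i => coshL S i * coshL S i := by
    funext i; rw [← coshL_sq, sq]
  rw [N.kL_eq, kak, Matrix.toBlocks_fromBlocks₁₁, e, ← dg_mul_dg]
  simp only [Matrix.conjTranspose_mul, dg_conjTranspose, Matrix.mul_assoc,
    unitary_cancel' N.frame.k_u]

/-- The vectors (k₁₁k₁₁†)^j v have components (1 + S_a²)^j (ρ†v)_a in the basis given by ρ. The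
right-hand side involves only the point and v, and the second factor on the left only S; so ρ is
unique, and it varies differentiably along curves. -/
lemma IsNormal.rho_mul (N : IsNormal σ α x y v S p kL kR om ν ρ τ k l r m) :
    ρ * eigenKrylov α S = krylov (kL.toBlocks₁₁ * kL.toBlocks₁₁ᴴ) v := by
  have hρ := N.frame.ρ_u
  have hv : v = ρ *ᵥ vHatC α S := by
    rw [← N.v_eq, Matrix.mulVec_mulVec, mul_eq_one_comm.1 hρ, Matrix.one_mulVec]
  have hpow (j : ℕ) : (ρ * dg (fun i => 1 + S i ^ 2) * ρᴴ) ^ j =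
      ρ * dg (fun i => (1 + S i ^ 2) ^ j) * ρᴴ := by
    induction j with
    | zero => simp only [pow_zero, dg_one, Matrix.mul_one, mul_eq_one_comm.1 hρ]
    | succ j ih =>
      rw [pow_succ, ih]
      calc _ = ρ * dg (fun i => (1 + S i ^ 2) ^ j) * (ρᴴ * ρ) * dg (fun i => 1 + S i ^ 2) * ρᴴ := by
            simp only [Matrix.mul_assoc]
        _ = ρ * (dg (fun i => (1 + S i ^ 2) ^ j) * dg (fun i => 1 + S i ^ 2)) * ρᴴ := by
            rw [hρ, Matrix.mul_one]; simp only [Matrix.mul_assoc]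
        _ = _ := by rw [dg_mul_dg]; simp only [pow_succ]
  ext i j
  rw [N.kL_mul, krylov, Matrix.of_apply, hpow, ← Matrix.mulVec_mulVec, N.v_eq,
    ← Matrix.mulVec_mulVec, Matrix.mul_apply, Matrix.mulVec]
  refine Finset.sum_congr rfl fun a _ => ?_
  rw [eigenKrylov, Matrix.diagonal_mul, Matrix.mulVec_diagonal, Matrix.vandermonde_apply]
  push_cast
  ring

/-- The formulas for the factors of the normal form. -/
lemma IsNormal.factors (N : IsNormal σ α x y v S p kL kR om ν ρ τ k l r m) :
    k = dg (fun i => (coshL S i)⁻¹) * ρᴴ * kL.toBlocks₁₁ ∧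
    l = dg (fun i => (S i)⁻¹) * ρᴴ * kL.toBlocks₁₂ ∧
    τ = kL.toBlocks₂₁ * kᴴ * dg (fun i => (S i)⁻¹) ∧
    r = kR.toBlocks₁₁ * kᴴ * dg (fun i => (coshR x y S i)⁻¹) ∧
    m = dg (fun i => (coshR x y S i)⁻¹) * τᴴ * kR.toBlocks₂₂ := by
  have F := N.frame
  have kk := mul_eq_one_comm.1 F.k_u
  have h1 := fun i => (F.Γ_pos i).ne'
  have h2 := fun i => (F.C_pos i).ne'
  have a {f : RVec n} (hf : ∀ i, f i ≠ 0) (X : Mat n) : dg (fun i => (f i)⁻¹) * (dg f * X) = X := by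
    rw [← Matrix.mul_assoc, dg_inv_mul hf, Matrix.one_mul]
  rw [N.kL_eq, N.kR_eq, kak, kak]
  simp only [Matrix.toBlocks_fromBlocks₁₁, Matrix.toBlocks_fromBlocks₁₂,
    Matrix.toBlocks_fromBlocks₂₁, Matrix.toBlocks_fromBlocks₂₂, Matrix.mul_assoc,
    unitary_cancel F.ρ_u, unitary_cancel F.τ_u, unitary_cancel' F.k_u, a h1, a h2, a F.S_ne,
    dg_mul_inv h2, dg_mul_inv F.S_ne, Matrix.mul_one, true_and]

/-- The normal form of a point with given `Σ` is unique. -/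
lemma IsNormal.unique (hα : α ≠ 0) (hα1 : α ^ 2 ≠ 1) (hS : S ∈ allChambers n α) {p' : RVec n}
    (N : IsNormal σ α x y v S p kL kR om ν ρ τ k l r m)
    (N' : IsNormal σ α x y v S p' kL kR om' ν' ρ' τ' k' l' r' m') :
    ρ = ρ' ∧ τ = τ' ∧ k = k' ∧ l = l' ∧ r = r' ∧ m = m' := by
  have hρ : ρ = ρ' := by
    have h := N.rho_mul.trans N'.rho_mul.symm
    have := congrArg (· * (eigenKrylov α S)⁻¹) h
    simpa only [Matrix.mul_nonsing_inv_cancel_right _ _ (isUnit_eigenKrylov hα hα1 hS)] using this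
  obtain ⟨a1, a2, a3, a4, a5⟩ := N.factors
  obtain ⟨b1, b2, b3, b4, b5⟩ := N'.factors
  subst hρ
  have hk : k = k' := a1.trans b1.symm
  have hl : l = l' := a2.trans b2.symm
  subst hk
  have hτ : τ = τ' := a3.trans b3.symm
  subst hτ
  exact ⟨rfl, rfl, rfl, hl, a4.trans b4.symm, a5.trans b5.symm⟩

lemma IsNormal.phase_unique (hα : α ≠ 0) (hα1 : α ^ 2 ≠ 1) (hS : S ∈ allChambers n α)
    {p' : RVec n} (N : IsNormal σ α x y v S p kL kR om ν ρ τ k l r m)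
    (N' : IsNormal σ α x y v S p' kL kR om' ν' ρ' τ' k' l' r' m') : phase p = phase p' := by
  obtain ⟨-, -, -, rfl, -, rfl⟩ := N.unique hα hα1 hS N'
  have h := N.T_eq.symm.trans N'.T_eq
  rw [phase, phase]
  congr 1; funext i
  have h := congrFun (congrFun h i) i
  rw [normalT, normalT, phase, phase, Matrix.diagonal_mul, Matrix.diagonal_mul] at h
  refine mul_right_cancel₀ (b := ofRealM (cauchyT α S) i i) ?_ h
  have := (cauchyT_diag_pos hα hα1 hS i).ne'
  simpa [ofRealM] using this

lemma angle_eq_of_phase {p p' : RVec n} (h : phase p = phase p') (i : Fin n) :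
    (p i : Real.Angle) = (p' i : Real.Angle) := by
  have h := congrFun (congrFun h i) i
  rw [phase, phase, Matrix.diagonal_apply_eq, Matrix.diagonal_apply_eq,
    Complex.exp_eq_exp_iff_exists_int] at h
  obtain ⟨z, hz⟩ := h
  rw [Real.Angle.angle_eq_iff_two_pi_dvd_sub]
  refine ⟨z, ?_⟩
  have h1 : Complex.I * ((p i : ℂ) - p' i - 2 * Real.pi * z) = 0 := by
    linear_combination hz
  have h2 := (mul_eq_zero.1 h1).resolve_left Complex.I_ne_zero
  have h3 : p i - p' i - 2 * Real.pi * z = 0 := by exact_mod_cast h2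
  linarith

lemma HasCoordinates.of_angle_eq {g : BlockMat n} {Δ p p' : RVec n}
    (h : HasCoordinates x y g Δ p) (hp : ∀ i, (p i : Real.Angle) = (p' i : Real.Angle)) :
    HasCoordinates x y g Δ p' := by
  obtain ⟨ρ, hρ, τ, hτ, k, hk, l, hl, om, T, e1, e2, e3⟩ := h
  refine ⟨ρ, hρ, τ, hτ, k, hk, l, hl, om, T, e1, e2, fun i => ?_⟩
  rw [e3 i, Complex.norm_mul]
  have hexp : ‖Complex.exp (Complex.I * (p i : ℂ))‖ = 1 := by
    rw [mul_comm]; exact Complex.norm_exp_ofReal_mul_I _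
  have : Complex.exp (Complex.I * (p i : ℂ)) = Complex.exp (Complex.I * (p' i : ℂ)) := by
    obtain ⟨z, hz⟩ := Real.Angle.angle_eq_iff_two_pi_dvd_sub.1 (hp i)
    rw [Complex.exp_eq_exp_iff_exists_int]
    refine ⟨z, ?_⟩
    have hz : (p i : ℂ) - p' i = 2 * Real.pi * z := by exact_mod_cast hz
    linear_combination Complex.I * hz
  rw [hexp, this]
  simp

lemma constrainedBR_mul_diag (hp : l * lᴴ = 1) (om k : Mat n) :
    constrainedBR x om * Matrix.fromBlocks l 0 0 k =
      Matrix.fromBlocks l 0 0 k * constrainedBR x (lᴴ * om * k) := by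
  simp only [constrainedBR, Matrix.fromBlocks_multiply, Matrix.zero_mul, Matrix.mul_zero, add_zero,
    zero_add, Matrix.smul_mul, Matrix.mul_smul, Matrix.one_mul, Matrix.mul_one, smul_zero,
    ← Matrix.mul_assoc, hp]

/-- The coordinates are invariant under left and right multiplication by block unitary matrices. -/
lemma HasCoordinates.mul {g : BlockMat n} {Δ p : RVec n} {a₁ a₂ b₁ b₂ : Mat n}
    (h : HasCoordinates x y g Δ p) (ha₁ : a₁ ∈ Matrix.unitaryGroup (Fin n) ℂ)
    (ha₂ : a₂ ∈ Matrix.unitaryGroup (Fin n) ℂ) (hb₁ : b₁ ∈ Matrix.unitaryGroup (Fin n) ℂ)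
    (hb₂ : b₂ ∈ Matrix.unitaryGroup (Fin n) ℂ) :
    HasCoordinates x y (Matrix.fromBlocks a₁ 0 0 a₂ * g * Matrix.fromBlocks b₁ 0 0 b₂) Δ p := by
  obtain ⟨ρ, hρ, τ, hτ, k, hk, l, hl, om, T, e1, e2, e3⟩ := h
  have hb : b₁ * b₁ᴴ = 1 := Matrix.mem_unitaryGroup_iff.1 hb₁
  have ha : a₂ᴴ * a₂ = 1 := Matrix.mem_unitaryGroup_iff'.1 ha₂
  have hb' : b₂ᴴ * b₂ = 1 := Matrix.mem_unitaryGroup_iff'.1 hb₂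
  refine ⟨a₁ * ρ, mul_mem ha₁ hρ, a₂ * τ, mul_mem ha₂ hτ, k * b₁, mul_mem hk hb₁, l * b₂,
    mul_mem hl hb₂, b₁ᴴ * om * b₂, T, ?_, ?_, e3⟩
  · have f1 (a b c d : Mat n) : Matrix.fromBlocks (a * b) 0 0 (c * d) =
        Matrix.fromBlocks a 0 0 c * Matrix.fromBlocks b 0 0 d := by
      simp [Matrix.fromBlocks_multiply]
    rw [f1, f1, e1]
    have h1 := constrainedBR_mul_diag (x := x) hb om b₂
    simp only [Matrix.mul_assoc] at h1 ⊢
    rw [h1]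
  · rw [← e2]
    have : (Matrix.fromBlocks a₁ 0 0 a₂ * g * Matrix.fromBlocks b₁ 0 0 b₂).toBlocks₂₂ =
        a₂ * g.toBlocks₂₂ * b₂ := by
      conv_lhs => rw [← Matrix.fromBlocks_toBlocks g]
      simp [Matrix.fromBlocks_multiply]
    rw [this]
    simp only [Matrix.conjTranspose_mul, Matrix.mul_assoc, unitary_cancel ha, unitary_cancel' hb']

lemma chamber_strictAnti {q : RVec n} (hq : q ∈ chamber n α) : StrictAnti q := fun i j h => by
  linarith [hq i j h, abs_nonneg (Real.log α)]

lemma sinh_deltaOf (q : RVec n) : (fun i => Real.sinh (deltaOf q i)) = fun i => Real.exp (q i) := by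
  funext i; exact Real.sinh_arsinh _

/-- If a_j is not among the b_i, the intertwining relation makes column j of U vanish, which is
impossible for a unitary matrix. -/
lemma range_subset_of_intertwines {U : Mat n} {a b : RVec n} (hU : Uᴴ * U = 1)
    (h : U * dg a = dg b * U) : Set.range a ⊆ Set.range b := by
  rintro _ ⟨j, rfl⟩
  by_contra hn
  have h0 (i : Fin n) : U i j = 0 := by
    have h1 := congrFun (congrFun h i) j
    rw [Matrix.mul_diagonal, Matrix.diagonal_mul] at h1
    have h2 : (a j : ℂ) - b i ≠ 0 := by
      rw [sub_ne_zero]; exact_mod_cast fun e : a j = b i => hn ⟨i, e.symm⟩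
    exact (mul_eq_zero.1 (by linear_combination h1 : ((a j : ℂ) - b i) * U i j = 0)).resolve_left h2
  have h3 := congrFun (congrFun hU j) j
  rw [Matrix.mul_apply, Matrix.one_apply_eq] at h3
  simp [h0] at h3

/-- The coordinates of a regular point are unique. -/
lemma HasCoordinates.unique (hα : α ≠ 0) (hα1 : α ^ 2 ≠ 1) (hx : 0 < x) (hy : 0 < y)
    (hσ : IsKKS α v σ) {g : BlockMat n} (hg : g ∈ constraintSurface σ x y) {q q' p p' : RVec n}
    (hq : q ∈ chamber n α) (hq' : q' ∈ chamber n α) (h : HasCoordinates x y g (deltaOf q) p)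
    (h' : HasCoordinates x y g (deltaOf q') p') :
    q = q' ∧ ∀ i, (p i : Real.Angle) = (p' i : Real.Angle) := by
  obtain ⟨bL, kL, bR, kR, hc, rfl⟩ := hg
  have hS := exp_mem_allChambers hq
  have hS' := exp_mem_allChambers hq'
  obtain ⟨om, ν, ρ, τ, k, l, r, m, -, -, N⟩ :=
    exists_isNormal hα hα1 hx hy hσ hc (by rw [sinh_deltaOf]; exact hS) h
  obtain ⟨om', ν', ρ', τ', k', l', r', m', -, -, N'⟩ :=
    exists_isNormal hα hα1 hx hy hσ hc (by rw [sinh_deltaOf]; exact hS') h'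
  rw [sinh_deltaOf] at N N'
  have key {q q' : RVec n} {ρ ρ' : Mat n} (hρ : ρᴴ * ρ = 1) (hρ' : ρ'ᴴ * ρ' = 1)
      (e : ρ * dg (fun i => 1 + Real.exp (q i) ^ 2) * ρᴴ =
        ρ' * dg (fun i => 1 + Real.exp (q' i) ^ 2) * ρ'ᴴ) : Set.range q ⊆ Set.range q' := by
    have h1 : (ρ'ᴴ * ρ) * dg (fun i => 1 + Real.exp (q i) ^ 2) =
        dg (fun i => 1 + Real.exp (q' i) ^ 2) * (ρ'ᴴ * ρ) := by
      have := congrArg (fun X => ρ'ᴴ * X * ρ) e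
      simpa only [Matrix.mul_assoc, hρ, Matrix.mul_one, unitary_cancel hρ'] using this
    have h2 := range_subset_of_intertwines (U := ρ'ᴴ * ρ) (by
      simp only [Matrix.conjTranspose_mul, Matrix.conjTranspose_conjTranspose, Matrix.mul_assoc,
        unitary_cancel' hρ', hρ]) h1
    rintro _ ⟨j, rfl⟩
    obtain ⟨i, hi⟩ := h2 ⟨j, rfl⟩
    refine ⟨i, Real.exp_injective ?_⟩
    have hi : 1 + Real.exp (q' i) ^ 2 = 1 + Real.exp (q j) ^ 2 := hi
    exact (sq_eq_sq₀ (Real.exp_pos _).le (Real.exp_pos _).le).1 (by linarith)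
  have e := N.kL_mul.symm.trans N'.kL_mul
  have hr : Set.range q = Set.range q' :=
    (key N.frame.ρ_u N'.frame.ρ_u e).antisymm (key N'.frame.ρ_u N.frame.ρ_u e.symm)
  -- In the chamber q is strictly decreasing, so it is determined by the set of its values.
  obtain rfl : q = q' := ((chamber_strictAnti hq).range_inj (chamber_strictAnti hq')).1 hr
  exact ⟨rfl, angle_eq_of_phase (N.phase_unique hα hα1 hS N')⟩

lemma exists_unit_pow_eq (hn : 0 < n) {w : ℂ} (hw : star w * w = 1) :
    ∃ z : ℂ, star z * z = 1 ∧ z ^ (n + n) = w := by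
  obtain ⟨z, hz⟩ := IsAlgClosed.exists_pow_nat_eq w (show 0 < n + n by omega)
  refine ⟨z, ?_, hz⟩
  have h1 : ‖w‖ ^ 2 = 1 := by
    have := hw
    rw [Complex.star_def, Complex.conj_mul'] at this
    exact_mod_cast this
  rw [← hz, norm_pow, ← pow_mul, pow_eq_one_iff_of_nonneg (norm_nonneg _) (by omega)] at h1
  rw [Complex.star_def, Complex.conj_mul', h1]
  norm_num

lemma smul_fromBlocks_diag (z : ℂ) (a b : Mat n) :
    Matrix.fromBlocks (z • a) 0 0 (z • b) = z • Matrix.fromBlocks a 0 0 b := by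
  rw [Matrix.fromBlocks_smul]; simp

lemma det_smul_block (z : ℂ) (A : BlockMat n) : (z • A).det = z ^ (n + n) * A.det := by
  rw [Matrix.det_smul]; simp

/-- Two regular points with the same coordinates are gauge equivalent. -/
lemma gauge_of_hasCoordinates (hn : 0 < n) (hα : α ≠ 0) (hα1 : α ^ 2 ≠ 1) (hx : 0 < x)
    (hy : 0 < y) (hσ : IsKKS α v σ) {g g' : BlockMat n} (hg : g ∈ constraintSurface σ x y)
    (hg' : g' ∈ constraintSurface σ x y) {Δ p : RVec n}
    (hS : (fun i => Real.sinh (Δ i)) ∈ allChambers n α) (h : HasCoordinates x y g Δ p)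
    (h' : HasCoordinates x y g' Δ p) :
    ∃ a ∈ leftGauge σ, ∃ b ∈ groupKplus n, g' = a * g * b := by
  obtain ⟨bL, kL, bR, kR, hc, rfl⟩ := hg
  obtain ⟨bL', kL', bR', kR', hc', rfl⟩ := hg'
  obtain ⟨om, ν, ρ, τ, k, l, r, m, -, rfl, N⟩ := exists_isNormal hα hα1 hx hy hσ hc hS h
  obtain ⟨om', ν', ρ', τ', k', l', r', m', -, rfl, N'⟩ := exists_isNormal hα hα1 hx hy hσ hc' hS h'
  have F := N.frame
  have F' := N'.frame
  have u {X : Mat n} (h : Xᴴ * X = 1) : X ∈ Matrix.unitaryGroup (Fin n) ℂ :=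
    Matrix.mem_unitaryGroup_iff'.2 h
  have us {X : Mat n} (h : Xᴴ * X = 1) : Xᴴ ∈ Matrix.unitaryGroup (Fin n) ℂ :=
    Unitary.star_mem (u h)
  have uz {X : Mat n} {z : ℂ} (hz : star z * z = 1) (h : X ∈ Matrix.unitaryGroup (Fin n) ℂ) :
      z • X ∈ Matrix.unitaryGroup (Fin n) ℂ := by
    rw [Matrix.mem_unitaryGroup_iff'] at h ⊢
    rw [star_smul, Matrix.smul_mul, Matrix.mul_smul, smul_smul, h, hz, one_smul]
  set a₁ := ρ' * ρᴴ
  set a₂ := τ' * τᴴ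
  set b₁ := kᴴ * k'
  set b₂ := lᴴ * l'
  have ha₁ : a₁ ∈ Matrix.unitaryGroup (Fin n) ℂ := mul_mem (u F'.ρ_u) (us F.ρ_u)
  have ha₂ : a₂ ∈ Matrix.unitaryGroup (Fin n) ℂ := mul_mem (u F'.τ_u) (us F.τ_u)
  have hb₁ : b₁ ∈ Matrix.unitaryGroup (Fin n) ℂ := mul_mem (us F.k_u) (u F'.k_u)
  have hb₂ : b₂ ∈ Matrix.unitaryGroup (Fin n) ℂ := mul_mem (us F.l_u) (u F'.l_u)
  -- In normal form kωl† depends only on S and T, hence only on the coordinates.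
  have ko : k * om * lᴴ = k' * om' * l'ᴴ := by
    refine dg_left_injective F.S_ne ?_
    have e {k om l m : Mat n} (hl : l * lᴴ = 1) (hm : m * lᴴ = normalT α (fun i => Real.sinh (Δ i)) p)
        (h : dg (fun i => Real.sinh (Δ i)) * k * om =
          (y : ℂ) • (dg (coshR x y fun i => Real.sinh (Δ i)) * m) -
            ((x : ℂ)⁻¹) • (dg (coshL fun i => Real.sinh (Δ i)) * l)) :
        dg (fun i => Real.sinh (Δ i)) * (k * om * lᴴ) = (y : ℂ) •
          (dg (coshR x y fun i => Real.sinh (Δ i)) * normalT α (fun i => Real.sinh (Δ i)) p) -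
            ((x : ℂ)⁻¹) • dg (coshL fun i => Real.sinh (Δ i)) := by
      rw [← Matrix.mul_assoc, ← Matrix.mul_assoc, h, Matrix.sub_mul, Matrix.smul_mul,
        Matrix.smul_mul, Matrix.mul_assoc, Matrix.mul_assoc, hl, hm, Matrix.mul_one]
    rw [e (mul_eq_one_comm.1 F.l_u) N.T_eq F.om_eq, e (mul_eq_one_comm.1 F'.l_u) N'.T_eq F'.om_eq]
  have key : kL' * constrainedBR x om' = Matrix.fromBlocks a₁ 0 0 a₂ * (kL * constrainedBR x om) *
      Matrix.fromBlocks b₁ 0 0 b₂ := by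
    rw [Matrix.mul_assoc, Matrix.mul_assoc, constrainedBR_mul_diag (Matrix.mem_unitaryGroup_iff.1 hb₁)]
    have e1 : b₁ᴴ * om * b₂ = om' := by
      have : b₁ᴴ * om * b₂ = k'ᴴ * (k * om * lᴴ) * l' := by
        simp only [b₁, b₂, Matrix.conjTranspose_mul, Matrix.conjTranspose_conjTranspose,
          Matrix.mul_assoc]
      rw [this, ko]
      simp only [Matrix.mul_assoc, F'.l_u, Matrix.mul_one, unitary_cancel F'.k_u]
    rw [e1, ← Matrix.mul_assoc, ← Matrix.mul_assoc]
    congr 1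
    rw [N.kL_eq, N'.kL_eq, kak, kak, Matrix.fromBlocks_multiply, Matrix.fromBlocks_multiply]
    simp only [a₁, a₂, b₁, b₂, Matrix.zero_mul, Matrix.mul_zero, add_zero, zero_add,
      Matrix.mul_assoc, unitary_cancel F.ρ_u, unitary_cancel F.τ_u, unitary_cancel' F.k_u,
      unitary_cancel' F.l_u]
  have hA : (Matrix.fromBlocks a₁ 0 0 a₂)ᴴ * Matrix.fromBlocks a₁ 0 0 a₂ = (1 : BlockMat n) := by
    have h1 : a₁ᴴ * a₁ = 1 := Matrix.mem_unitaryGroup_iff'.1 ha₁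
    have h2 : a₂ᴴ * a₂ = 1 := Matrix.mem_unitaryGroup_iff'.1 ha₂
    simp [Matrix.fromBlocks_conjTranspose, Matrix.fromBlocks_multiply, h1, h2]
  set A := (Matrix.fromBlocks a₁ 0 0 a₂ : BlockMat n)
  have hdA := congrArg Matrix.det hA
  rw [Matrix.det_mul, Matrix.det_conjTranspose, Matrix.det_one] at hdA
  -- The unitary factors need not have determinant 1. A scalar z with z²ⁿ equal to the conjugate of
  -- the determinant corrects the left factor, and its inverse is put into the right factor.
  obtain ⟨z, hz, hz2⟩ := exists_unit_pow_eq hn (w := star A.det) (by rw [star_star, mul_comm, hdA])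
  have hz' : star (star z) * star z = 1 := by rw [star_star, mul_comm, hz]
  have hzz : z * star z = 1 := by rw [mul_comm, hz]
  have hkey := congrArg Matrix.det key
  rw [Matrix.det_mul, Matrix.det_mul, Matrix.det_mul, Matrix.det_mul, hc.kL_mem.1, hc'.kL_mem.1,
    det_constrainedBR hx.ne', det_constrainedBR hx.ne', one_mul, mul_one] at hkey
  refine ⟨z • A, ⟨z • a₁, uz hz ha₁, z • a₂, uz hz ha₂, (smul_fromBlocks_diag _ _ _).symm, ?_, ?_⟩,
    star z • Matrix.fromBlocks b₁ 0 0 b₂, ⟨star z • b₁, uz hz' hb₁, star z • b₂, uz hz' hb₂,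
      (smul_fromBlocks_diag _ _ _).symm, ?_⟩, ?_⟩
  · rw [det_smul_block, hz2, hdA]
  -- Both normal forms have the same vector ρ†v, so a₁ = ρ'ρ† fixes v and commutes with σσ†.
  · have hv : a₁ *ᵥ v = v := by
      rw [← Matrix.mulVec_mulVec, N.v_eq, ← N'.v_eq, Matrix.mulVec_mulVec,
        mul_eq_one_comm.1 F'.ρ_u, Matrix.one_mulVec]
    have h1 : a₁ * a₁ᴴ = 1 := Matrix.mem_unitaryGroup_iff.1 ha₁
    rw [Matrix.conjTranspose_smul, Matrix.smul_mul, Matrix.smul_mul, Matrix.mul_smul, smul_smul, hzz,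
      one_smul, hσ.2.2, Matrix.mul_add, Matrix.add_mul, Matrix.mul_smul, Matrix.smul_mul,
      Matrix.mul_one, h1, Matrix.mul_smul, Matrix.smul_mul, Matrix.mul_vecMulVec,
      Matrix.vecMulVec_mul, hv]
    congr 3
    rw [← Matrix.star_mulVec, hv]
  · rw [det_smul_block, ← star_pow, hz2, star_star, hkey]
  · rw [key]
    simp only [Matrix.smul_mul, Matrix.mul_smul, smul_smul, hz, one_smul]

/-- The coordinates identify the reduced space with the product of the chamber and a torus. -/
theorem exists_coordinates (hn : 0 < n) (hα : α ≠ 0) (hα1 : α ^ 2 ≠ 1) (hx : 0 < x) (hy : 0 < y)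
    (hσ : IsKKS α v σ) :
    ∃ e : ReducedSpace σ α x y ≃ chamber n α × (Fin n → Real.Angle),
      ∀ (g : regularSurface σ α x y) (q : chamber n α) (p : RVec n),
        e (toReduced g) = (q, fun i => (p i : Real.Angle)) ↔
          HasCoordinates x y (g : BlockMat n) (deltaOf (q : RVec n)) p := by
  choose q hq p hp using fun g : regularSurface σ α x y => g.2.2
  have huniq (g : regularSurface σ α x y) {q' p' : RVec n} (hq' : q' ∈ chamber n α)
      (h : HasCoordinates x y (g : BlockMat n) (deltaOf q') p') :=
    HasCoordinates.unique hα hα1 hx hy hσ g.2.1 (hq g) hq' (hp g) h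
  let f : ReducedSpace σ α x y → chamber n α × (Fin n → Real.Angle) :=
    Quotient.lift (fun g => (⟨q g, hq g⟩, fun i => (p g i : Real.Angle))) (by
      rintro g g' ⟨a, ⟨a₁, ha₁, a₂, ha₂, rfl, -⟩, b, ⟨b₁, hb₁, b₂, hb₂, rfl, -⟩, e⟩
      have h := (hp g).mul ha₁ ha₂ hb₁ hb₂
      rw [← e] at h
      obtain ⟨h1, h2⟩ := huniq g' (hq g) h
      exact Prod.ext (Subtype.ext h1.symm) (funext fun i => (h2 i).symm))
  have hf (g : regularSurface σ α x y) (q' : chamber n α) (p' : RVec n) :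
      f (toReduced g) = (q', fun i => (p' i : Real.Angle)) ↔
        HasCoordinates x y (g : BlockMat n) (deltaOf (q' : RVec n)) p' := by
    constructor
    · intro h
      obtain ⟨rfl, h2⟩ := Prod.ext_iff.1 h
      exact (hp g).of_angle_eq fun i => congrFun h2 i
    · intro h
      obtain ⟨h1, h2⟩ := huniq g q'.2 h
      exact Prod.ext (Subtype.ext h1) (funext h2)
  refine ⟨Equiv.ofBijective f ⟨?_, ?_⟩, hf⟩
  · rintro ⟨g⟩ ⟨g'⟩ h
    have h : f (toReduced g) = f (toReduced g') := h
    have h1 := (hf g ⟨q g', hq g'⟩ (p g')).1 h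
    exact Quotient.sound (s := gaugeSetoid σ α x y) (gauge_of_hasCoordinates hn hα hα1 hx hy hσ
      g.2.1 g'.2.1 (by rw [sinh_deltaOf]; exact exp_mem_allChambers (hq g')) h1 (hp g'))
  · rintro ⟨q', θ⟩
    choose p' hp' using fun i => Real.Angle.induction_on (p := fun t => ∃ s : ℝ, (s : Real.Angle) = t)
      (θ i) fun s => ⟨s, rfl⟩
    obtain ⟨bL, kL, bR, kR, -, -, -, -, h⟩ := exists_section (x := x) (y := y) hn hα hα1 hx hy hσ
    obtain ⟨h1, h2⟩ := h q' q'.2 p'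
    refine ⟨toReduced ⟨_, ⟨_, _, _, _, h1, rfl⟩, q', q'.2, p', h2⟩, ?_⟩
    rw [(hf _ q' p').2 h2, funext hp']

end Uniqueness
end HeisenbergDouble

namespace HeisenbergDouble
-- Differentiable curves of matrices.
section MatrixCurves

open Filter Topology

variable {n : ℕ} {ι κ μ : Type*}

/-- The derivative at `0` of a curve of matrices, entry by entry. -/
def HasDerivM (M : ℝ → Matrix ι κ ℂ) (M' : Matrix ι κ ℂ) : Prop :=
  ∀ i j, HasDerivAt (fun t => M t i j) (M' i j) 0

lemma HasDerivM.mul [Fintype κ] {M : ℝ → Matrix ι κ ℂ} {M' : Matrix ι κ ℂ} {N : ℝ → Matrix κ μ ℂ}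
    {N' : Matrix κ μ ℂ} (hM : HasDerivM M M') (hN : HasDerivM N N') :
    HasDerivM (fun t => M t * N t) (M' * N 0 + M 0 * N') := fun i j => by
  simp only [Matrix.mul_apply, Matrix.add_apply, ← Finset.sum_add_distrib]
  exact HasDerivAt.fun_sum fun k _ => (hM i k).mul (hN k j)

lemma HasDerivM.const (A : Matrix ι κ ℂ) : HasDerivM (fun _ => A) 0 :=
  fun _ _ => hasDerivAt_const _ _

lemma HasDerivM.const_mul [Fintype κ] {N : ℝ → Matrix κ μ ℂ} {N' : Matrix κ μ ℂ} (A : Matrix ι κ ℂ)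
    (hN : HasDerivM N N') : HasDerivM (fun t => A * N t) (A * N') := by
  simpa using (HasDerivM.const A).mul hN

lemma HasDerivM.sub {M N : ℝ → Matrix ι κ ℂ} {M' N' : Matrix ι κ ℂ} (hM : HasDerivM M M')
    (hN : HasDerivM N N') : HasDerivM (fun t => M t - N t) (M' - N') :=
  fun i j => (hM i j).sub (hN i j)

lemma HasDerivM.smul {M : ℝ → Matrix ι κ ℂ} {M' : Matrix ι κ ℂ} (c : ℂ) (hM : HasDerivM M M') :
    HasDerivM (fun t => c • M t) (c • M') := fun i j => (hM i j).const_mul c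

lemma HasDerivM.conjTranspose {M : ℝ → Matrix ι κ ℂ} {M' : Matrix ι κ ℂ} (hM : HasDerivM M M') :
    HasDerivM (fun t => (M t)ᴴ) M'ᴴ := fun i j => (hM j i).star

lemma HasDerivM.unique {M : ℝ → Matrix ι κ ℂ} {M' M'' : Matrix ι κ ℂ} (h : HasDerivM M M')
    (h' : HasDerivM M M'') : M' = M'' := Matrix.ext fun i j => (h i j).unique (h' i j)

lemma HasDerivM.congr {M N : ℝ → Matrix ι κ ℂ} {M' : Matrix ι κ ℂ} (hM : HasDerivM M M')
    (h : ∀ᶠ t in 𝓝 0, N t = M t) : HasDerivM N M' := fun i j =>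
  (hM i j).congr_of_eventuallyEq (h.mono fun _ ht => congrFun (congrFun ht i) j)

lemma HasDerivM.fromBlocks {a b c d : ℝ → Mat n} {a' b' c' d' : Mat n} (ha : HasDerivM a a')
    (hb : HasDerivM b b') (hc : HasDerivM c c') (hd : HasDerivM d d') :
    HasDerivM (fun t => Matrix.fromBlocks (a t) (b t) (c t) (d t))
      (Matrix.fromBlocks a' b' c' d') := by
  rintro (i | i) (j | j)
  exacts [ha i j, hb i j, hc i j, hd i j]

lemma HasDerivM.diagonal {f : ℝ → Fin n → ℂ} {f' : Fin n → ℂ}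
    (hf : ∀ i, HasDerivAt (fun t => f t i) (f' i) 0) :
    HasDerivM (fun t => Matrix.diagonal (f t)) (Matrix.diagonal f') := fun i j => by
  by_cases h : i = j
  · subst h; simpa using hf i
  · simpa [h] using hasDerivAt_const (0 : ℝ) (0 : ℂ)

lemma HasDerivM.dg {f : ℝ → RVec n} {f' : RVec n} (hf : ∀ i, HasDerivAt (fun t => f t i) (f' i) 0) :
    HasDerivM (fun t => dg (f t)) (dg f') := HasDerivM.diagonal fun i => (hf i).ofReal_comp

lemma HasDerivM.exists_pow {M : ℝ → Mat n} {M' : Mat n} (hM : HasDerivM M M') (j : ℕ) :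
    ∃ N', HasDerivM (fun t => M t ^ j) N' := by
  induction j with
  | zero => exact ⟨0, by simpa using HasDerivM.const 1⟩
  | succ j ih =>
    obtain ⟨N', h⟩ := ih
    exact ⟨_, by simpa only [pow_succ] using h.mul hM⟩

lemma HasDerivM.differentiableAt_det {M : ℝ → Mat n} {M' : Mat n} (hM : HasDerivM M M') :
    DifferentiableAt ℝ (fun t => (M t).det) 0 := by
  simp only [Matrix.det_apply']
  exact DifferentiableAt.fun_sum fun π _ => (differentiableAt_const _).mul
    (DifferentiableAt.fun_finsetProd fun i _ => (hM (π i) i).differentiableAt)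

lemma exists_hasDerivM {M : ℝ → Matrix ι κ ℂ}
    (h : ∀ i j, DifferentiableAt ℝ (fun t => M t i j) 0) : ∃ M', HasDerivM M M' :=
  ⟨Matrix.of fun i j => deriv (fun t => M t i j) 0, fun i j => (h i j).hasDerivAt⟩

lemma HasDerivM.exists_adjugate {M : ℝ → Mat n} {M' : Mat n} (hM : HasDerivM M M') :
    ∃ N', HasDerivM (fun t => (M t).adjugate) N' := by
  refine exists_hasDerivM fun i j => ?_
  simp only [Matrix.adjugate_apply]
  refine HasDerivM.differentiableAt_det (M' := M'.updateRow j 0) fun a b => ?_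
  by_cases h : a = j
  · subst h; simpa using hasDerivAt_const (0 : ℝ) _
  · simpa [Matrix.updateRow_ne h] using hM a b

/-- A solution of a regular linear system with differentiable coefficients is differentiable. -/
lemma exists_hasDerivM_of_mul_eq {X N W : ℝ → Mat n} {N' W' : Mat n} (hN : HasDerivM N N')
    (hW : HasDerivM W W') (h0 : IsUnit (N 0).det) (h : ∀ᶠ t in 𝓝 0, X t * N t = W t) :
    ∃ X', HasDerivM X X' := by
  obtain ⟨A', hA⟩ := hN.exists_adjugate
  have hd := hN.differentiableAt_det
  have hne := hd.continuousAt.eventually_ne h0.ne_zero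
  obtain ⟨B', hB⟩ := exists_hasDerivM (M := fun t => (N t).det⁻¹ • (W t * (N t).adjugate))
    fun i j => (hd.inv h0.ne_zero).mul ((hW.mul hA) i j).differentiableAt
  refine ⟨B', hB.congr ?_⟩
  filter_upwards [h, hne] with t ht hnt
  rw [← ht, Matrix.mul_assoc, Matrix.mul_adjugate, Matrix.mul_smul, smul_smul, inv_mul_cancel₀ hnt,
    one_smul, Matrix.mul_one]

/-- Differentiate u†u = 1. -/
lemma HasDerivM.exists_left_skew {u : ℝ → Mat n} {u' : Mat n} (h : HasDerivM u u')
    (hu : ∀ᶠ t in 𝓝 0, (u t)ᴴ * u t = 1) : ∃ ξ, ξᴴ = -ξ ∧ u' = u 0 * ξ := by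
  have h1 := (h.conjTranspose.mul h).unique ((HasDerivM.const 1).congr hu)
  refine ⟨(u 0)ᴴ * u', ?_, (unitary_cancel' hu.self_of_nhds u').symm⟩
  rw [Matrix.conjTranspose_mul, Matrix.conjTranspose_conjTranspose]
  exact eq_neg_of_add_eq_zero_left h1

lemma HasDerivM.exists_right_skew {u : ℝ → Mat n} {u' : Mat n} (h : HasDerivM u u')
    (hu : ∀ᶠ t in 𝓝 0, (u t)ᴴ * u t = 1) : ∃ ξ, ξᴴ = -ξ ∧ u' = ξ * u 0 := by
  have h1 := (h.mul h.conjTranspose).unique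
    ((HasDerivM.const 1).congr (hu.mono fun t ht => mul_eq_one_comm.1 ht))
  refine ⟨u' * (u 0)ᴴ, ?_, by rw [Matrix.mul_assoc, hu.self_of_nhds, Matrix.mul_one]⟩
  rw [Matrix.conjTranspose_mul, Matrix.conjTranspose_conjTranspose]
  exact eq_neg_of_add_eq_zero_right h1

lemma HasDerivM.kak {ρ τ k l : ℝ → Mat n} {c s : ℝ → RVec n} {ξ χ η θ : Mat n} {D : RVec n}
    (hρ : HasDerivM ρ (ρ 0 * ξ)) (hτ : HasDerivM τ (τ 0 * χ)) (hk : HasDerivM k (η * k 0))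
    (hl : HasDerivM l (θ * l 0))
    (hc : ∀ i, HasDerivAt (fun t => c t i) (s 0 i ^ 2 * D i / c 0 i) 0)
    (hs : ∀ i, HasDerivAt (fun t => s t i) (s 0 i * D i) 0) :
    HasDerivM (fun t => kak (ρ t) (τ t) (k t) (l t) (c t) (s t))
      (kakVel (ρ 0) (τ 0) (k 0) (l 0) (c 0) (s 0) D ξ χ η θ) := by
  have e (X Y Z A B C : Mat n) : (X * A * Y + X * B) * Z + X * Y * (C * Z) =
      X * (A * Y + B + Y * C) * Z := by
    simp only [Matrix.mul_add, Matrix.add_mul, Matrix.mul_assoc]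
  have := HasDerivM.fromBlocks ((hρ.mul (HasDerivM.dg hc)).mul hk)
    ((hρ.mul (HasDerivM.dg hs)).mul hl) ((hτ.mul (HasDerivM.dg hs)).mul hk)
    ((hτ.mul (HasDerivM.dg hc)).mul hl)
  simp only [e] at this
  exact this

lemma differentiableAt_vHat {α : ℝ} {S : ℝ → RVec n} (hα : α ≠ 0) (hα1 : α ^ 2 ≠ 1)
    (hS0 : S 0 ∈ allChambers n α) (hS : ∀ i, DifferentiableAt ℝ (fun t => S t i) 0) (i : Fin n) :
    DifferentiableAt ℝ (fun t => vHat α (S t) i) 0 := by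
  have h2 (i : Fin n) : DifferentiableAt ℝ (fun t => S t i ^ 2) 0 := (hS i).pow 2
  refine DifferentiableAt.div (DifferentiableAt.sqrt ?_ (wSq_pos hα hα1 hS0 i).ne') (hS i) (hS0.1 i)
  refine ((differentiableAt_const _).mul (h2 i)).mul
    (DifferentiableAt.fun_finsetProd fun j hj => ?_)
  refine ((h2 i).const_mul _ |>.sub (h2 j)).div (((h2 i).const_mul _).sub ((h2 j).const_mul _)) ?_
  rw [← mul_sub]
  exact mul_ne_zero (pow_ne_zero _ hα)
    (sub_ne_zero.2 (allChambers_sq_ne hα hS0 (Finset.ne_of_mem_erase hj).symm))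

lemma hasDerivAt_coshL {S : ℝ → RVec n} {D : RVec n} {i : Fin n}
    (hS : HasDerivAt (fun t => S t i) (S 0 i * D i) 0) :
    HasDerivAt (fun t => coshL (S t) i) (S 0 i ^ 2 * D i / coshL (S 0) i) 0 := by
  have hpos : 0 < 1 + S 0 i ^ 2 := by positivity
  refine HasDerivAt.congr_deriv (((hS.pow 2).const_add 1).sqrt hpos.ne') ?_
  rw [coshL]
  have := (Real.sqrt_pos.2 hpos).ne'
  push_cast
  simp only [Pi.pow_apply]
  field_simp

lemma hasDerivAt_coshR {x y : ℝ} (hy : 0 < y) {S : ℝ → RVec n} {D : RVec n} {i : Fin n}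
    (hS : HasDerivAt (fun t => S t i) (S 0 i * D i) 0) :
    HasDerivAt (fun t => coshR x y (S t) i) ((x / y * S 0 i) ^ 2 * D i / coshR x y (S 0) i) 0 := by
  have hpos : 0 < y ^ 2 + x ^ 2 * S 0 i ^ 2 := by positivity
  refine HasDerivAt.congr_deriv
    (((((hS.pow 2).const_mul (x ^ 2)).const_add (y ^ 2)).sqrt hpos.ne').div_const y) ?_
  rw [coshR]
  have := (Real.sqrt_pos.2 hpos).ne'
  push_cast
  simp only [Pi.pow_apply]
  field_simp

end MatrixCurves

/-! ### Velocities of curves in normal form. -/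

section NormalCurves

open Filter Topology

variable {n : ℕ} {σ : Mat n} {α x y : ℝ} {v : Fin n → ℂ} {S p : ℝ → RVec n}
  {kL kR : ℝ → BlockMat n} {om ν : ℝ → Mat n} {ρ τ k l r m : ℝ → Mat n} {D Y : RVec n}
  {vkL vkR : BlockMat n} {vom vν : Mat n}

/-- The factors of the normal form depend differentiably on the point. -/
lemma exists_hasDerivM_factors (hα : α ≠ 0) (hα1 : α ^ 2 ≠ 1) (hy : 0 < y)
    (hS0 : S 0 ∈ allChambers n α)
    (hN : ∀ᶠ t in 𝓝 0, IsNormal σ α x y v (S t) (p t) (kL t) (kR t) (om t) (ν t) (ρ t) (τ t) (k t)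
      (l t) (r t) (m t))
    (hS : ∀ i, HasDerivAt (fun t => S t i) (S 0 i * D i) 0) (hkL : HasDerivM kL vkL)
    (hkR : HasDerivM kR vkR) :
    ∃ ρ' τ' k' l' r' m', HasDerivM ρ ρ' ∧ HasDerivM τ τ' ∧ HasDerivM k k' ∧ HasDerivM l l' ∧
      HasDerivM r r' ∧ HasDerivM m m' := by
  have F := hN.self_of_nhds.frame
  have h11 : HasDerivM (fun t => (kL t).toBlocks₁₁) vkL.toBlocks₁₁ := fun i j => hkL _ _
  have h12 : HasDerivM (fun t => (kL t).toBlocks₁₂) vkL.toBlocks₁₂ := fun i j => hkL _ _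
  have h21 : HasDerivM (fun t => (kL t).toBlocks₂₁) vkL.toBlocks₂₁ := fun i j => hkL _ _
  have g11 : HasDerivM (fun t => (kR t).toBlocks₁₁) vkR.toBlocks₁₁ := fun i j => hkR _ _
  have g22 : HasDerivM (fun t => (kR t).toBlocks₂₂) vkR.toBlocks₂₂ := fun i j => hkR _ _
  have hSi := HasDerivM.dg (f := fun t i => (S t i)⁻¹) fun i => (hS i).inv (F.S_ne i)
  have hLi := HasDerivM.dg (f := fun t i => (coshL (S t) i)⁻¹) fun i =>
    (hasDerivAt_coshL (hS i)).inv (F.Γ_pos i).ne'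
  have hRi := HasDerivM.dg (f := fun t i => (coshR x y (S t) i)⁻¹) fun i =>
    (hasDerivAt_coshR hy (hS i)).inv (F.C_pos i).ne'
  obtain ⟨K', hK⟩ : ∃ K', HasDerivM (fun t => krylov ((kL t).toBlocks₁₁ * (kL t).toBlocks₁₁ᴴ) v) K' := by
    refine exists_hasDerivM fun i j => ?_
    obtain ⟨P', hP⟩ := (h11.mul h11.conjTranspose).exists_pow (j : ℕ)
    change DifferentiableAt ℝ
      (fun t => ∑ a, (((kL t).toBlocks₁₁ * (kL t).toBlocks₁₁ᴴ) ^ (j : ℕ)) i a * v a) 0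
    exact DifferentiableAt.fun_sum fun a _ => (hP i a).differentiableAt.mul (differentiableAt_const _)
  obtain ⟨V', hV⟩ : ∃ V', HasDerivM (fun t => eigenKrylov α (S t)) V' := by
    refine exists_hasDerivM fun i j => ?_
    simp only [eigenKrylov, Matrix.diagonal_mul, Matrix.vandermonde_apply]
    refine DifferentiableAt.mul (HasDerivAt.ofReal_comp (differentiableAt_vHat hα hα1 hS0
      (fun i => (hS i).differentiableAt) i).hasDerivAt).differentiableAt ?_
    exact (HasDerivAt.ofReal_comp (((hS i).pow 2).const_add 1)).differentiableAt.pow _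
  -- No regularity of the frame is assumed. ρ solves a regular linear system with differentiable
  -- coefficients, and the other factors are explicit in terms of ρ and the point.
  obtain ⟨ρ', hρ⟩ := exists_hasDerivM_of_mul_eq hV hK (isUnit_eigenKrylov hα hα1 hS0)
    (hN.mono fun t h => h.rho_mul)
  have hk := ((hLi.mul hρ.conjTranspose).mul h11).congr (hN.mono fun t h => h.factors.1)
  have hl := ((hSi.mul hρ.conjTranspose).mul h12).congr (hN.mono fun t h => h.factors.2.1)
  have hτ := ((h21.mul hk.conjTranspose).mul hSi).congr (hN.mono fun t h => h.factors.2.2.1)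
  have hr := ((g11.mul hk.conjTranspose).mul hRi).congr (hN.mono fun t h => h.factors.2.2.2.1)
  have hm := ((hRi.mul hτ.conjTranspose).mul g22).congr (hN.mono fun t h => h.factors.2.2.2.2)
  exact ⟨_, _, _, _, _, _, hρ, hτ, hk, hl, hr, hm⟩

/-- The velocity of a curve of points in normal form. -/
lemma exists_vel_of_normal (hα : α ≠ 0) (hα1 : α ^ 2 ≠ 1) (hS0 : S 0 ∈ allChambers n α)
    (hN : ∀ᶠ t in 𝓝 0, IsNormal σ α x y v (S t) (p t) (kL t) (kR t) (om t) (ν t) (ρ t) (τ t) (k t)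
      (l t) (r t) (m t))
    (hS : ∀ i, HasDerivAt (fun t => S t i) (S 0 i * D i) 0)
    (hp : ∀ i, HasDerivAt (fun t => p t i) (Y i) 0) (hkL : HasDerivM kL vkL)
    (hkR : HasDerivM kR vkR) (hom : HasDerivM om vom) (hν : HasDerivM ν vν) :
    ∃ ξ χ η θ ζ μ : Mat n,
      vkL = kakVel (ρ 0) (τ 0) (k 0) (l 0) (coshL (S 0)) (S 0) D ξ χ η θ ∧
      vkR = kakVel (r 0) (τ 0) (k 0) (m 0) (coshR x y (S 0)) (fun i => x / y * S 0 i) D ζ χ η μ ∧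
      IsFrameVel σ x y (S 0) (coshL (S 0)) (coshR x y (S 0)) (ρ 0) (τ 0) (k 0) (l 0) (r 0) (m 0)
        (om 0) (ν 0) D ξ χ η θ ζ μ vom vν ∧
      HasPhaseVel (p 0) (cauchyT α (S 0)) θ μ Y := by
  have N := hN.self_of_nhds
  have F := N.frame
  have hy := F.y_pos
  obtain ⟨ρ', τ', k', l', r', m', hρ, hτ, hk, hl, hr, hm⟩ :=
    exists_hasDerivM_factors hα hα1 hy hS0 hN hS hkL hkR
  obtain ⟨ξ, hξ, rfl⟩ := hρ.exists_left_skew (hN.mono fun t h => h.frame.ρ_u)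
  obtain ⟨χ, hχ, rfl⟩ := hτ.exists_left_skew (hN.mono fun t h => h.frame.τ_u)
  obtain ⟨η, hη, rfl⟩ := hk.exists_right_skew (hN.mono fun t h => h.frame.k_u)
  obtain ⟨θ, hθ, rfl⟩ := hl.exists_right_skew (hN.mono fun t h => h.frame.l_u)
  obtain ⟨ζ, hζ, rfl⟩ := hr.exists_left_skew (hN.mono fun t h => h.frame.r_u)
  obtain ⟨μ, hμ, rfl⟩ := hm.exists_right_skew (hN.mono fun t h => h.frame.m_u)
  have hΓ := fun i => hasDerivAt_coshL (hS i)
  have hC := fun i => hasDerivAt_coshR (x := x) hy (hS i)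
  have hs (i : Fin n) : HasDerivAt (fun t => x / y * S t i) (x / y * S 0 i * D i) 0 := by
    simpa only [mul_assoc] using (hS i).const_mul (x / y)
  refine ⟨ξ, χ, η, θ, ζ, μ, hkL.unique ((HasDerivM.kak hρ hτ hk hl hΓ hS).congr
      (hN.mono fun t h => h.kL_eq)), hkR.unique ((HasDerivM.kak (s := fun t i => x / y * S t i)
      hr hτ hk hm hC hs).congr (hN.mono fun t h => h.kR_eq)),
    ⟨hξ, hχ, hη, hθ, hζ, hμ, ?_, ?_, ?_⟩, ?_⟩
  · have h := (((hρ.const_mul σᴴ).mul (HasDerivM.dg hS)).mul hl).unique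
      (((hr.mul (HasDerivM.dg hS)).mul hm).congr (hN.mono fun t h => h.frame.rel))
    simp only [Matrix.mul_add, Matrix.add_mul, Matrix.mul_assoc] at h ⊢
    exact h
  · have h := (((HasDerivM.dg hS).mul hk).mul hom).unique
      (((((HasDerivM.dg hC).mul hm).smul (y : ℂ)).sub (((HasDerivM.dg hΓ).mul hl).smul (x : ℂ)⁻¹)).congr
        (hN.mono fun t h => h.frame.om_eq))
    have h0 := congrArg (χ * ·) F.om_eq
    simp only [Matrix.add_mul, Matrix.mul_sub, Matrix.mul_smul, smul_add,
      Matrix.mul_assoc] at h h0 ⊢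
    rw [h0, eq_sub_of_add_eq' h]
    abel
  · have h := ((hν.mul hτ).mul (HasDerivM.dg hs)).unique
      (((((hρ.mul (HasDerivM.dg hΓ)).smul ((x * y : ℝ) : ℂ))).sub
        ((hr.const_mul σ).mul (HasDerivM.dg hC))).congr (hN.mono fun t h => by
          rw [h.frame.ν_eq]))
    have h0 := congrArg (· * η) F.ν_eq
    simp only [Matrix.mul_add, Matrix.add_mul, Matrix.sub_mul, Matrix.smul_mul, smul_add,
      Matrix.mul_assoc] at h h0 ⊢
    rw [h0, ← sub_eq_zero, ← sub_eq_zero.2 h]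
    abel
  · have hTu := cauchyT_orthogonal hα hα1 hS0
    have hph : HasDerivM (fun t => phase (p t))
        (Matrix.diagonal fun i => Complex.exp (Complex.I * (p 0 i : ℂ)) * (Complex.I * (Y i : ℂ))) :=
      HasDerivM.diagonal fun i => ((hp i).ofReal_comp.const_mul Complex.I).cexp
    -- Near 0 the matrix exp(-ip)T is the real matrix R, so its derivative has vanishing imaginary
    -- part. This is exactly the statement that the phases have velocity Y.
    have hR := ((hph.conjTranspose.mul (hm.mul hl.conjTranspose)).congr
      (hN.mono fun t h => by
        change (fun t => ofRealM (cauchyT α (S t))) t = _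
        simp only [h.T_eq, normalT, unitary_cancel (phase_conjTranspose_mul (p t))]))
    have e1 : (Matrix.diagonal fun i =>
        Complex.exp (Complex.I * (p 0 i : ℂ)) * (Complex.I * (Y i : ℂ)))ᴴ =
        (-Complex.I) • (dg Y * (phase (p 0))ᴴ) := by
      ext i j
      by_cases h : i = j
      · subst h
        simp [phase, Matrix.diagonal_conjTranspose]
        ring
      · simp [phase, Matrix.diagonal_conjTranspose, h, Ne.symm h]
    have e2 : μ * m 0 * (l 0)ᴴ + m 0 * (θ * l 0)ᴴ =
        μ * (m 0 * (l 0)ᴴ) - m 0 * (l 0)ᴴ * θ := by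
      rw [Matrix.conjTranspose_mul, hθ]
      simp only [Matrix.mul_neg, Matrix.mul_assoc, sub_eq_add_neg]
    rw [e1, e2, N.T_eq, normalT] at hR
    have e3 : (-Complex.I) • (dg Y * (phase (p 0))ᴴ) * (phase (p 0) * ofRealM (cauchyT α (S 0))) +
        (phase (p 0))ᴴ * (μ * (phase (p 0) * ofRealM (cauchyT α (S 0))) -
          phase (p 0) * ofRealM (cauchyT α (S 0)) * θ) =
        unphase (p 0) μ * ofRealM (cauchyT α (S 0)) - ofRealM (cauchyT α (S 0)) * θ -
          Complex.I • (dg Y * ofRealM (cauchyT α (S 0))) := by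
      simp only [unphase, Matrix.mul_sub, neg_smul, Matrix.neg_mul, Matrix.smul_mul, Matrix.mul_assoc,
        unitary_cancel (phase_conjTranspose_mul (p 0))]
      abel
    rw [e3] at hR
    set R := cauchyT α (S 0)
    have him : imM (unphase (p 0) μ * ofRealM R - ofRealM R * θ - Complex.I • (dg Y * ofRealM R)) = 0 := by
      ext i j
      have h1 := hR i j
      have h2 := Complex.imCLM.hasFDerivAt.comp_hasDerivAt (0 : ℝ) h1
      exact h2.unique (by simpa [ofRealM, Function.comp_def] using hasDerivAt_const (0 : ℝ) (0 : ℝ))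
    have reR : reM (ofRealM R) = R := by ext i j; simp [reM, ofRealM]
    have imR : imM (ofRealM R) = 0 := by ext i j; simp [imM, ofRealM]
    have imI : imM (Complex.I • (dg Y * ofRealM R)) = Matrix.diagonal Y * R := by
      ext i j; simp [imM, ofRealM, Matrix.diagonal_mul]
    rw [imM_sub, imM_sub, imM_mul, imM_mul, reR, imR, imI, Matrix.mul_zero, Matrix.zero_mul, zero_add,
      add_zero, sub_sub, sub_eq_zero] at him
    have h5 := congrArg (· * Rᵀ) him
    simp only [Matrix.add_mul, Matrix.mul_assoc, mul_eq_one_comm.1 hTu, Matrix.mul_one] at h5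
    rw [HasPhaseVel, h5, Matrix.mul_assoc]

end NormalCurves
end HeisenbergDouble

namespace HeisenbergDouble
-- The leaf form on curves in the constraint surface.
section CanonicalForm

open Filter Topology

variable {n : ℕ} {σ : Mat n} {α x y : ℝ} {v : Fin n → ℂ}

/-- The off-diagonal block of `b_L` is determined by the point. -/
lemma constrainedBL_unique (hy : y ≠ 0) (hσ : σ.det = 1) {k₁ k₂ : BlockMat n} {ν₁ ν₂ : Mat n}
    (h₁ : k₁ᴴ * Inn n * k₁ = Inn n) (h₂ : k₂ᴴ * Inn n * k₂ = Inn n)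
    (h : constrainedBL y σ ν₁ * k₁ = constrainedBL y σ ν₂ * k₂) : k₁ = k₂ ∧ ν₁ = ν₂ := by
  have hy' : (y : ℂ) ≠ 0 := by exact_mod_cast hy
  have e : (constrainedBL y σ ν₁ * k₁) * Inn n * (constrainedBL y σ ν₁ * k₁)ᴴ =
      (constrainedBL y σ ν₂ * k₂) * Inn n * (constrainedBL y σ ν₂ * k₂)ᴴ := by rw [h]
  have e' {k b : BlockMat n} (hk : kᴴ * Inn n * k = Inn n) :
      (b * k) * Inn n * (b * k)ᴴ = b * Inn n * bᴴ := by
    calc _ = b * (k * Inn n * kᴴ) * bᴴ := by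
          rw [Matrix.conjTranspose_mul]; simp only [Matrix.mul_assoc]
      _ = _ := by rw [mul_Inn_of_preserves hk]
  rw [e' h₁, e' h₂] at e
  have ho : ν₁ = ν₂ := by
    simp only [constrainedBL, Inn, Matrix.fromBlocks_conjTranspose, Matrix.fromBlocks_multiply,
      Matrix.fromBlocks_inj, Matrix.conjTranspose_smul, Matrix.conjTranspose_one,
      Matrix.mul_one, Matrix.mul_zero, add_zero, zero_add, Matrix.smul_mul, Matrix.mul_smul,
      Matrix.conjTranspose_zero, Matrix.mul_neg, smul_neg, neg_inj,
      smul_smul] at e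
    have hs : star (y : ℂ) = y := Complex.conj_ofReal y
    have := e.2.1
    rw [hs] at this
    exact smul_right_injective _ (mul_ne_zero hy' (inv_ne_zero hy')) this
  subst ho
  refine ⟨?_, rfl⟩
  have hu : IsUnit (constrainedBL y σ ν₁).det := by rw [det_constrainedBL hy hσ]; exact isUnit_one
  have := congrArg ((constrainedBL y σ ν₁)⁻¹ * ·) h
  simpa only [Matrix.nonsing_inv_mul_cancel_left _ _ hu] using this

/-- The velocity of a curve in the constraint surface in terms of the velocity of its
coordinates. -/
theorem exists_vel_of_constrained (hα : α ≠ 0) (hα1 : α ^ 2 ≠ 1) (hx : 0 < x) (hy : 0 < y)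
    (hσ : IsKKS α v σ) {bL kL bR kR : ℝ → BlockMat n} {vbL vkL vbR vkR : BlockMat n}
    {Δ p : ℝ → RVec n} {D Y : RVec n} {om ν ρ τ k l r m : Mat n}
    (hbL : HasDerivM bL vbL) (hkL : HasDerivM kL vkL) (hbR : HasDerivM bR vbR)
    (hkR : HasDerivM kR vkR)
    (h : ∀ᶠ t in 𝓝 0, IsConstrained σ x y (bL t) (kL t) (bR t) (kR t) ∧
      (fun i => Real.sinh (Δ t i)) ∈ allChambers n α ∧
      HasCoordinates x y (kL t * bR t) (Δ t) (p t))
    (hΔ : ∀ i, HasDerivAt (fun t => Real.sinh (Δ t i)) (Real.sinh (Δ 0 i) * D i) 0)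
    (hp : ∀ i, HasDerivAt (fun t => p t i) (Y i) 0)
    (hL0 : bL 0 = constrainedBL y σ ν) (hR0 : bR 0 = constrainedBR x om)
    (N : IsNormal σ α x y v (fun i => Real.sinh (Δ 0 i)) (p 0) (kL 0) (kR 0) om ν ρ τ k l r m) :
    ∃ ξ χ η θ ζ μ vom vν : Mat n,
      vbL = Matrix.fromBlocks 0 ((y : ℂ)⁻¹ • vν) 0 0 ∧ vbR = Matrix.fromBlocks 0 vom 0 0 ∧
      vkL = kakVel ρ τ k l (coshL fun i => Real.sinh (Δ 0 i)) (fun i => Real.sinh (Δ 0 i)) D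
        ξ χ η θ ∧
      vkR = kakVel r τ k m (coshR x y fun i => Real.sinh (Δ 0 i))
        (fun i => x / y * Real.sinh (Δ 0 i)) D ζ χ η μ ∧
      IsFrameVel σ x y (fun i => Real.sinh (Δ 0 i)) (coshL fun i => Real.sinh (Δ 0 i))
        (coshR x y fun i => Real.sinh (Δ 0 i)) ρ τ k l r m om ν D ξ χ η θ ζ μ vom vν ∧
      HasPhaseVel (p 0) (cauchyT α fun i => Real.sinh (Δ 0 i)) θ μ Y := by
  have hx' : (x : ℂ) ≠ 0 := by exact_mod_cast hx.ne'
  have hy' : (y : ℂ) ≠ 0 := by exact_mod_cast hy.ne'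
  have hex : ∀ᶠ t in 𝓝 0, ∃ X : (Mat n × Mat n) × (Mat n × Mat n × Mat n) × (Mat n × Mat n × Mat n),
      bL t = constrainedBL y σ X.1.2 ∧ bR t = constrainedBR x X.1.1 ∧
      IsNormal σ α x y v (fun i => Real.sinh (Δ t i)) (p t) (kL t) (kR t) X.1.1 X.1.2
        X.2.1.1 X.2.1.2.1 X.2.1.2.2 X.2.2.1 X.2.2.2.1 X.2.2.2.2 := by
    filter_upwards [h] with t ht
    obtain ⟨om, ν, ρ, τ, k, l, r, m, e1, e2, N⟩ := exists_isNormal hα hα1 hx hy hσ ht.1 ht.2.1 ht.2.2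
    exact ⟨⟨⟨om, ν⟩, ⟨ρ, τ, k⟩, l, r, m⟩, e1, e2, N⟩
  -- The normal forms are chosen independently at each time; at time 0 the choice is compared with
  -- the given one by uniqueness.
  obtain ⟨X, hX⟩ := hex.choice
  have hbL' := hX.mono fun t h => h.1
  have hbR' := hX.mono fun t h => h.2.1
  have hS0 := h.self_of_nhds.2.1
  have hν : HasDerivM (fun t => (X t).1.2) ((y : ℂ) • vbL.toBlocks₁₂) := by
    have h1 : HasDerivM (fun t => (bL t).toBlocks₁₂) vbL.toBlocks₁₂ := fun i j => hbL _ _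
    refine (h1.smul (y : ℂ)).congr (hbL'.mono fun t ht => ?_)
    rw [ht, constrainedBL, Matrix.toBlocks_fromBlocks₁₂, smul_smul, mul_inv_cancel₀ hy', one_smul]
  have hom : HasDerivM (fun t => (X t).1.1) vbR.toBlocks₁₂ := by
    have h1 : HasDerivM (fun t => (bR t).toBlocks₁₂) vbR.toBlocks₁₂ := fun i j => hbR _ _
    refine h1.congr (hbR'.mono fun t ht => ?_)
    rw [ht, constrainedBR, Matrix.toBlocks_fromBlocks₁₂]
  obtain ⟨ξ, χ, η, θ, ζ, μ, e1, e2, V, P⟩ := exists_vel_of_normal hα hα1 hS0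
    (hX.mono fun t h => h.2.2) hΔ hp hkL hkR hom hν
  obtain ⟨e3, e4, N'⟩ := hX.self_of_nhds
  have u := N'.unique hα hα1 hS0 N
  have hom0 : (X 0).1.1 = om := by
    have := e4.symm.trans hR0
    rw [constrainedBR, constrainedBR, Matrix.fromBlocks_inj] at this
    exact this.2.1
  have hν0 : (X 0).1.2 = ν := by
    have := e3.symm.trans hL0
    rw [constrainedBL, constrainedBL, Matrix.fromBlocks_inj] at this
    exact smul_right_injective _ (inv_ne_zero hy') this.2.1
  obtain ⟨u1, u2, u3, u4, u5, u6⟩ := u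
  simp only [u1, u2, u3, u4, u5, u6, hom0, hν0] at e1 e2 V
  refine ⟨ξ, χ, η, θ, ζ, μ, _, _, ?_, ?_, e1, e2, V, P⟩
  · have := hbL.unique ((HasDerivM.fromBlocks (HasDerivM.const ((y : ℂ)⁻¹ • σ)) (hν.smul (y : ℂ)⁻¹)
      (HasDerivM.const 0) (HasDerivM.const ((y : ℂ) • 1))).congr hbL')
    exact this
  · exact hbR.unique ((HasDerivM.fromBlocks (HasDerivM.const ((x : ℂ) • 1)) hom
      (HasDerivM.const 0) (HasDerivM.const ((x : ℂ)⁻¹ • 1))).congr hbR')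

lemma hasDerivM_velocity {M : ℝ → BlockMat n} (h : SmoothMatOn M Set.univ) :
    HasDerivM M (velocity M) := fun i j =>
  (((contDiffOn_univ.1 (h i j)).differentiable (by simp)) 0).hasDerivAt

/-- The coordinates are canonical. -/
theorem leafForm_eq_reducedForm (hα : α ≠ 0) (hα1 : α ^ 2 ≠ 1) (hx : 0 < x) (hy : 0 < y)
    (hσ : IsKKS α v σ) (c d : ConstraintCurve σ x y) {Δ p Δ' p' : ℝ → RVec n}
    (hΔ : ContDiff ℝ ∞ Δ) (hp : ContDiff ℝ ∞ p) (hΔ' : ContDiff ℝ ∞ Δ') (hp' : ContDiff ℝ ∞ p')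
    (hc : ∀ t, (fun i => Real.sinh (Δ t i)) ∈ allChambers n α ∧
      HasCoordinates x y (c.point t) (Δ t) (p t))
    (hd : ∀ t, (fun i => Real.sinh (Δ' t i)) ∈ allChambers n α ∧
      HasCoordinates x y (d.point t) (Δ' t) (p' t))
    (h0 : c.point 0 = d.point 0) (hΔ0 : Δ 0 = Δ' 0) :
    leafForm c d = reducedForm (fun i => Real.sinh (Δ 0 i)) (coordVelocity Δ p)
      (coordVelocity Δ' p') := by
  obtain ⟨om, ν, ρ, τ, k, l, r, m, eL, eR, N⟩ :=
    exists_isNormal hα hα1 hx hy hσ (c.constrained 0) (hc 0).1 (hc 0).2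
  obtain ⟨om', ν', ρ', τ', k', l', r', m', eL', eR', N'⟩ :=
    exists_isNormal hα hα1 hx hy hσ (d.constrained 0) (hd 0).1 (hd 0).2
  have hL := constrainedBR_unique hx.ne' (c.constrained 0).kL_mem.2 (d.constrained 0).kL_mem.2
    (om₁ := om) (om₂ := om') (by rw [← eR, ← eR']; exact h0)
  have hR := constrainedBL_unique hy.ne' hσ.2.1 (c.constrained 0).kR_mem.2 (d.constrained 0).kR_mem.2
    (ν₁ := ν) (ν₂ := ν') (by
      rw [← eL, ← eL', (c.constrained 0).eq, (d.constrained 0).eq]; exact h0)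
  obtain ⟨hkL, rfl⟩ := hL
  obtain ⟨hkR, rfl⟩ := hR
  have hbL0 := eL.trans eL'.symm
  have hbR0 := eR.trans eR'.symm
  have hN'' := N'
  rw [← hΔ0, ← hkL, ← hkR] at hN''
  obtain ⟨rfl, rfl, rfl, rfl, rfl, rfl⟩ := N.unique hα hα1 (hc 0).1 hN''
  -- The momenta of the two curves need not agree at 0, only modulo 2π; the phases, through which
  -- alone the momenta enter, do agree.
  have hph := N.phase_unique hα hα1 (hc 0).1 hN''
  have dS {Δ : ℝ → RVec n} (hΔ : ContDiff ℝ ∞ Δ) (hS : ∀ i, Real.sinh (Δ 0 i) ≠ 0) (i : Fin n) :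
      HasDerivAt (fun t => Real.sinh (Δ t i)) (Real.sinh (Δ 0 i) * ((Real.sinh (Δ 0 i))⁻¹ *
        deriv (fun t => Real.sinh (Δ t i)) 0)) 0 := by
    rw [mul_inv_cancel_left₀ (hS i)]
    exact ((Real.contDiff_sinh.comp (contDiff_pi.1 hΔ i)).differentiable (by simp) 0).hasDerivAt
  have dp {p : ℝ → RVec n} (hp : ContDiff ℝ ∞ p) (i : Fin n) :
      HasDerivAt (fun t => p t i) (deriv (fun t => p t i) 0) 0 :=
    ((contDiff_pi.1 hp i).differentiable (by simp) 0).hasDerivAt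
  obtain ⟨ξ, χ, η, θ, ζ, μ, vom, vν, c1, c2, c3, c4, V, P⟩ := exists_vel_of_constrained hα hα1 hx hy hσ
    (hasDerivM_velocity c.bL_smooth) (hasDerivM_velocity c.kL_smooth)
    (hasDerivM_velocity c.bR_smooth) (hasDerivM_velocity c.kR_smooth)
    (Eventually.of_forall fun t => ⟨c.constrained t, hc t⟩) (dS hΔ (hc 0).1.1) (dp hp) eL eR N
  obtain ⟨ξ', χ', η', θ', ζ', μ', vom', vν', d1, d2, d3, d4, V', P'⟩ :=
    exists_vel_of_constrained hα hα1 hx hy hσ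
    (hasDerivM_velocity d.bL_smooth) (hasDerivM_velocity d.kL_smooth)
    (hasDerivM_velocity d.bR_smooth) (hasDerivM_velocity d.kR_smooth)
    (Eventually.of_forall fun t => ⟨d.constrained t, hd t⟩) (dS hΔ' (hd 0).1.1) (dp hp') eL' eR' N'
  rw [← hΔ0] at d3 d4 V' P'
  have hform : leafForm c d = leafPairing (c.bL 0) (c.kL 0) (c.bR 0) (c.kR 0) (velocity c.bL)
      (velocity c.bR) (velocity d.kL) (velocity d.kR) -
      leafPairing (c.bL 0) (c.kL 0) (c.bR 0) (c.kR 0) (velocity d.bL)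
      (velocity d.bR) (velocity c.kL) (velocity c.kR) := by
    rw [leafForm, leafPairing, leafPairing, velR, velR, velR, velR, velL, velL, velL, velL, ← hkL,
      ← hkR, ← hbL0, ← hbR0]
    ring
  rw [hform, c1, c2, c3, c4, d1, d2, d3, d4, eL, eR, N.kL_eq, N.kR_eq,
    leafPairing_eq N.frame hσ.2.1, leafPairing_eq N.frame hσ.2.1]
  have P'' : HasPhaseVel (p 0) (cauchyT α fun i => Real.sinh (Δ 0 i)) θ' μ'
      (fun i => deriv (fun t => p' t i) 0) := by
    rw [HasPhaseVel, unphase, hph]; exact P'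
  rw [leafHalf_canonical N.frame V V' (cauchyT_orthogonal hα hα1 (hc 0).1) N.T_eq P P'']
  simp only [reducedForm, coordVelocity, hΔ0]

end CanonicalForm
end HeisenbergDouble

namespace HeisenbergDouble
-- Invariance and involution of the Φ_ν on G.
section InvolutionOnG

open Filter Topology

variable {n : ℕ} {L g : BlockMat n}

/-- Matrices which are Hermitian for the indefinite form. -/
def IsInnHermitian (L : BlockMat n) : Prop := Lᴴ = Inn n * L * Inn n

lemma isInnHermitian_left (g : BlockMat n) : IsInnHermitian (g * Inn n * gᴴ * Inn n) := by
  have e : Inn n * (g * Inn n * gᴴ * Inn n) * Inn n = Inn n * g * Inn n * gᴴ * (Inn n * Inn n) := by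
    simp only [Matrix.mul_assoc]
  rw [IsInnHermitian, e, Inn_mul_Inn, Matrix.mul_one]
  simp only [Matrix.conjTranspose_mul, Matrix.conjTranspose_conjTranspose, Inn_conjTranspose,
    Matrix.mul_assoc]

lemma isInnHermitian_right (g : BlockMat n) : IsInnHermitian (Inn n * gᴴ * Inn n * g) := by
  have e : Inn n * (Inn n * gᴴ * Inn n * g) * Inn n = (Inn n * Inn n) * gᴴ * Inn n * g * Inn n := by
    simp only [Matrix.mul_assoc]
  rw [IsInnHermitian, e, Inn_mul_Inn, Matrix.one_mul]
  simp only [Matrix.conjTranspose_mul, Matrix.conjTranspose_conjTranspose, Inn_conjTranspose,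
    Matrix.mul_assoc]

lemma IsInnHermitian.pow (h : IsInnHermitian L) (ν : ℕ) : IsInnHermitian (L ^ ν) := by
  rw [IsInnHermitian, Matrix.conjTranspose_pow, h]
  induction ν with
  | zero => simp [Inn_mul_Inn]
  | succ ν ih =>
    rw [pow_succ, ih, pow_succ]
    calc _ = Inn n * L ^ ν * (Inn n * Inn n) * L * Inn n := by simp only [Matrix.mul_assoc]
      _ = _ := by rw [Inn_mul_Inn, Matrix.mul_one]; simp only [Matrix.mul_assoc]

/-- L† is conjugate to L by I, so the trace of L equals its complex conjugate. -/
lemma IsInnHermitian.trace_im (h : IsInnHermitian L) : L.trace.im = 0 := by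
  refine Complex.conj_eq_iff_im.1 ?_
  change star L.trace = _
  rw [← Matrix.trace_conjTranspose, h, Matrix.trace_mul_comm, ← Matrix.mul_assoc, Inn_mul_Inn,
    Matrix.one_mul]

lemma PhiC_im (ν : ℕ) (g : BlockMat n) : (PhiC ν g).im = 0 := by
  have h := ((isInnHermitian_left g).pow ν).trace_im
  have e : (-(1 / (2 * (ν : ℂ)))) = ((-(1 / (2 * (ν : ℝ))) : ℝ) : ℂ) := by push_cast; ring
  rw [PhiC, e, Complex.im_ofReal_mul, h, mul_zero]

lemma trace_pow_mul_comm (A B : BlockMat n) (ν : ℕ) : ((A * B) ^ ν).trace = ((B * A) ^ ν).trace := by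
  cases ν with
  | zero => simp
  | succ ν =>
    have h (ν : ℕ) : (A * B) ^ ν * A = A * (B * A) ^ ν := by
      induction ν with
      | zero => simp
      | succ ν ih =>
        rw [pow_succ, pow_succ]
        calc _ = ((A * B) ^ ν * A) * (B * A) := by simp only [Matrix.mul_assoc]
          _ = _ := by rw [ih]; simp only [Matrix.mul_assoc]
    calc ((A * B) ^ (ν + 1)).trace = (((A * B) ^ ν * A) * B).trace := by
          rw [pow_succ, Matrix.mul_assoc]
      _ = (B * A * (B * A) ^ ν).trace := by
          rw [h, Matrix.trace_mul_comm, Matrix.mul_assoc]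
      _ = _ := by rw [pow_succ']

/-- `Φ_ν` is invariant under left and right multiplication by `U(n, n)`. -/
lemma Phi_mul_left {a : BlockMat n} (ha : aᴴ * Inn n * a = Inn n) (ν : ℕ) (g : BlockMat n) :
    Phi ν (a * g) = Phi ν g := by
  have e1 : a * g * Inn n * (a * g)ᴴ * Inn n = a * (g * Inn n * gᴴ * aᴴ * Inn n) := by
    simp only [Matrix.conjTranspose_mul, Matrix.mul_assoc]
  have e2 : g * Inn n * gᴴ * aᴴ * Inn n * a = g * Inn n * gᴴ * Inn n := by
    rw [Matrix.mul_assoc _ (Inn n) a, Matrix.mul_assoc _ aᴴ, ← Matrix.mul_assoc aᴴ, ha]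
  rw [Phi, PhiC, e1, trace_pow_mul_comm, e2, Phi, PhiC]

lemma Phi_mul_right {b : BlockMat n} (hb : bᴴ * Inn n * b = Inn n) (ν : ℕ) (g : BlockMat n) :
    Phi ν (g * b) = Phi ν g := by
  have e : g * b * Inn n * (g * b)ᴴ * Inn n = g * (b * Inn n * bᴴ) * gᴴ * Inn n := by
    simp only [Matrix.conjTranspose_mul, Matrix.mul_assoc]
  rw [Phi, PhiC, e, mul_Inn_of_preserves hb, Phi, PhiC]

lemma preserves_of_mem_groupKplus {a : BlockMat n} (ha : a ∈ groupKplus n) :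
    aᴴ * Inn n * a = Inn n := by
  obtain ⟨p, hp, q, hq, rfl, -⟩ := ha
  have hp : pᴴ * p = 1 := Matrix.mem_unitaryGroup_iff'.1 hp
  have hq : qᴴ * q = 1 := Matrix.mem_unitaryGroup_iff'.1 hq
  simp [Inn, Matrix.fromBlocks_conjTranspose, Matrix.fromBlocks_multiply, hp, hq]

/-- The traceless part of `-i L^ν`. -/
noncomputable def lieGrad (ν : ℕ) (L : BlockMat n) : BlockMat n :=
  (-Complex.I) • (L ^ ν - ((L ^ ν).trace / (n + n : ℂ)) • (1 : BlockMat n))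

lemma trace_one_block : (1 : BlockMat n).trace = n + n := by simp

/-- For the indefinite form L^ν is Hermitian, so -iL^ν is skew. Hence the derivatives of Φ_ν have no
component in Lie B, and R acts on them as the identity. -/
lemma lieGrad_mem_lieK (hn : 0 < n) (h : IsInnHermitian L) (ν : ℕ) : lieGrad ν L ∈ lieK n := by
  have hn' : (n + n : ℂ) ≠ 0 := by exact_mod_cast (by omega : n + n ≠ 0)
  refine ⟨?_, ?_⟩
  · rw [lieGrad, Matrix.trace_smul, Matrix.trace_sub, Matrix.trace_smul, trace_one_block, smul_eq_mul,
      smul_eq_mul, div_mul_cancel₀ _ hn', sub_self, mul_zero]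
  · have hp := h.pow ν
    have ht : star ((L ^ ν).trace / (n + n : ℂ)) = (L ^ ν).trace / (n + n : ℂ) := by
      rw [star_div₀, show star (L ^ ν).trace = (L ^ ν).trace from
        Complex.conj_eq_iff_im.2 hp.trace_im]
      simp
    have hI : star (-Complex.I) = Complex.I := by simp
    rw [lieGrad, Matrix.conjTranspose_smul, Matrix.conjTranspose_sub, Matrix.conjTranspose_smul, ht, hp,
      hI, Matrix.conjTranspose_one, Matrix.smul_mul, Matrix.mul_smul, neg_smul,
      ← sub_eq_add_neg, ← smul_sub, Matrix.sub_mul, Matrix.mul_sub, Matrix.mul_assoc _ (Inn n),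
      Inn_mul_Inn, Matrix.mul_one]
    simp

lemma pairing_lieGrad {X : BlockMat n} (hX : X.trace = 0) (ν : ℕ) (L : BlockMat n) :
    pairing (lieGrad ν L) X = -(L ^ ν * X).trace.re := by
  rw [pairing, lieGrad, Matrix.smul_mul, Matrix.sub_mul, Matrix.smul_mul, Matrix.one_mul,
    Matrix.trace_smul, Matrix.trace_sub, Matrix.trace_smul, hX]
  simp

/-- The product of the two factors -i is -1, and the traces of all powers of L are real, so the
imaginary part vanishes; the scalar corrections are real as well. -/
lemma pairing_lieGrad_lieGrad (hn : 0 < n) (h : IsInnHermitian L) (ν μ : ℕ) :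
    pairing (lieGrad ν L) (lieGrad μ L) = 0 := by
  rw [pairing_lieGrad (lieGrad_mem_lieK hn h μ).1]
  have h1 := ((h.pow (ν + μ)).trace_im)
  have h2 := (h.pow ν).trace_im
  have h3 := (h.pow μ).trace_im
  have h4 : (((L ^ μ).trace / (n + n : ℂ)) * (L ^ ν).trace).im = 0 := by
    have e : (n + n : ℂ) = ((n + n : ℝ) : ℂ) := by push_cast; rfl
    rw [Complex.mul_im, h2, e, Complex.div_ofReal_im, h3]; simp
  rw [lieGrad, Matrix.mul_smul, Matrix.mul_sub, Matrix.mul_smul, Matrix.mul_one, Matrix.trace_smul,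
    Matrix.trace_sub, Matrix.trace_smul, ← pow_add, smul_eq_mul, smul_eq_mul]
  simp only [Complex.mul_re, Complex.neg_re, Complex.neg_im, Complex.I_re, Complex.I_im,
    Complex.sub_im, h1, h4]
  simp

/-- The derivative of the trace of a power. -/
lemma HasDerivM.trace_pow {M : ℝ → BlockMat n} {M' : BlockMat n} (hM : HasDerivM M M') (ν : ℕ) :
    ∃ N', HasDerivM (fun t => M t ^ ν) N' ∧ ∀ A, A * M 0 = M 0 * A →
      (A * N').trace = ν * (A * M 0 ^ (ν - 1) * M').trace := by
  induction ν with
  | zero => exact ⟨0, by simpa using HasDerivM.const 1, fun A _ => by simp⟩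
  | succ ν ih =>
    obtain ⟨N', h1, h2⟩ := ih
    refine ⟨_, by simpa only [pow_succ] using h1.mul hM, fun A hA => ?_⟩
    -- The commuting matrix A carries the induction: by cyclicity one factor M(0) is moved into A,
    -- which still commutes with M(0).
    have e1 : (A * (N' * M 0)).trace = (M 0 * A * N').trace := by
      rw [← Matrix.mul_assoc, Matrix.trace_mul_comm, Matrix.mul_assoc]
    rw [Matrix.mul_add, Matrix.trace_add, e1, h2 (M 0 * A) (by rw [Matrix.mul_assoc, hA])]
    cases ν with
    | zero => simp
    | succ ν =>
      have e2 : M 0 * A * M 0 ^ (ν + 1 - 1) = A * M 0 ^ (ν + 1) := by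
        rw [← hA, Nat.add_sub_cancel, Matrix.mul_assoc, ← pow_succ']
      rw [e2, Nat.add_sub_cancel, ← Matrix.mul_assoc]
      push_cast
      ring

/-- The derivative of `Φ_ν`. -/
lemma HasDerivM.phi {γ : ℝ → BlockMat n} {γ' : BlockMat n} (h : HasDerivM γ γ') {ν : ℕ} (hν : 1 ≤ ν) :
    HasDerivAt (fun t => Phi ν (γ t)) (-((γ 0 * Inn n * (γ 0)ᴴ * Inn n) ^ (ν - 1) *
      (γ' * Inn n * (γ 0)ᴴ * Inn n)).trace.re) 0 := by
  set L := γ 0 * Inn n * (γ 0)ᴴ * Inn n with hL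
  have h1 := ((h.mul (HasDerivM.const (Inn n))).mul h.conjTranspose).mul (HasDerivM.const (Inn n))
  obtain ⟨N', h2, h3⟩ := h1.trace_pow ν
  have h3 := h3 1 (by simp)
  have h4 : HasDerivAt (fun t => ((γ t * Inn n * (γ t)ᴴ * Inn n) ^ ν).trace) N'.trace 0 := by
    simp only [Matrix.trace, Matrix.diag_apply]
    exact HasDerivAt.fun_sum fun i _ => h2 i i
  have h5 := Complex.reCLM.hasFDerivAt.comp_hasDerivAt (0 : ℝ)
    (h4.const_mul (-(1 / (2 * (ν : ℂ)))))
  refine HasDerivAt.congr_deriv h5 ?_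
  rw [Matrix.one_mul, Matrix.one_mul] at h3
  have hν' : (ν : ℂ) ≠ 0 := by exact_mod_cast (by omega : ν ≠ 0)
  set B := L ^ (ν - 1) * (γ' * Inn n * (γ 0)ᴴ * Inn n) with hB
  -- The derivative of gIg†I has two summands, from g and from g†, whose traces against L^(ν-1) are
  -- complex conjugates. Together they give twice a real part, which cancels the factor 1/2 in Φ_ν.
  have h6 : (L ^ (ν - 1) * (γ 0 * Inn n * γ'ᴴ * Inn n)).trace = star B.trace := by
    have h7 : (L ^ (ν - 1))ᴴ = Inn n * L ^ (ν - 1) * Inn n := (isInnHermitian_left (γ 0)).pow (ν - 1)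
    rw [← Matrix.trace_conjTranspose, hB, Matrix.conjTranspose_mul, h7]
    simp only [Matrix.conjTranspose_mul, Matrix.conjTranspose_conjTranspose, Inn_conjTranspose]
    rw [Matrix.trace_mul_comm (L ^ (ν - 1)), Matrix.trace_mul_comm (_ * _) (_ * _ * _)]
    rw [Matrix.trace_mul_comm (_ * _) (L ^ (ν - 1))]
    have e : Inn n * L ^ (ν - 1) * Inn n * (Inn n * (γ 0 * (Inn n * γ'ᴴ))) =
        Inn n * (L ^ (ν - 1) * (γ 0 * Inn n * γ'ᴴ)) := by
      calc _ = Inn n * L ^ (ν - 1) * (Inn n * Inn n) * (γ 0 * (Inn n * γ'ᴴ)) := by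
            simp only [Matrix.mul_assoc]
        _ = _ := by rw [Inn_mul_Inn, Matrix.mul_one]; simp only [Matrix.mul_assoc]
    rw [e, Matrix.trace_mul_comm (Inn n)]
    simp only [Matrix.mul_assoc]
  have h8 : N'.trace = ν * (B.trace + star B.trace) := by
    rw [h3, ← h6, hB, ← Matrix.trace_add, ← Matrix.mul_add, ← Matrix.add_mul]
    simp only [Matrix.mul_zero, add_zero, hL]
  change (-(1 / (2 * (ν : ℂ))) * N'.trace).re = _
  rw [h8]
  have e : -(1 / (2 * (ν : ℂ))) * (ν * (B.trace + star B.trace)) = -(1 / 2) * (B.trace + star B.trace) := by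
    field_simp
  rw [e, Complex.star_def, Complex.add_conj]
  simp

/-- The derivative of `Φ_ν` for a velocity `X g`. -/
lemma HasDerivM.phi_left {γ : ℝ → BlockMat n} {X : BlockMat n} (h : HasDerivM γ (X * γ 0)) {ν : ℕ}
    (hν : 1 ≤ ν) (hX : X.trace = 0) : HasDerivAt (fun t => Phi ν (γ t))
      (pairing (lieGrad ν (γ 0 * Inn n * (γ 0)ᴴ * Inn n)) X) 0 := by
  refine (h.phi hν).congr_deriv ?_
  rw [pairing_lieGrad hX]
  set L := γ 0 * Inn n * (γ 0)ᴴ * Inn n with hL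
  have e : X * γ 0 * Inn n * (γ 0)ᴴ * Inn n = X * L := by rw [hL]; simp only [Matrix.mul_assoc]
  have e2 : L ^ ν = L * L ^ (ν - 1) := by rw [← pow_succ', Nat.sub_add_cancel hν]
  rw [e, ← Matrix.mul_assoc, Matrix.trace_mul_comm, ← Matrix.mul_assoc, ← e2]

/-- The derivative of `Φ_ν` for a velocity `g X`. -/
lemma HasDerivM.phi_right {γ : ℝ → BlockMat n} {X : BlockMat n} (h : HasDerivM γ (γ 0 * X)) {ν : ℕ}
    (hν : 1 ≤ ν) (hX : X.trace = 0) : HasDerivAt (fun t => Phi ν (γ t))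
      (pairing (lieGrad ν (Inn n * (γ 0)ᴴ * Inn n * γ 0)) X) 0 := by
  refine (h.phi hν).congr_deriv ?_
  rw [pairing_lieGrad hX]
  set g := γ 0
  have e1 (j : ℕ) : (Inn n * gᴴ * Inn n) * (g * Inn n * gᴴ * Inn n) ^ j * g =
      (Inn n * gᴴ * Inn n * g) ^ (j + 1) := by
    induction j with
    | zero => simp
    | succ j ih =>
      rw [pow_succ (n := j + 1), ← ih, pow_succ]
      simp only [Matrix.mul_assoc]
  rw [show ν = ν - 1 + 1 by omega, ← e1, Nat.add_sub_cancel]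
  congr 2
  rw [Matrix.trace_mul_comm]
  have e2 : g * X * Inn n * gᴴ * Inn n * (g * Inn n * gᴴ * Inn n) ^ (ν - 1) =
      (g * X) * ((Inn n * gᴴ * Inn n) * (g * Inn n * gᴴ * Inn n) ^ (ν - 1)) := by
    simp only [Matrix.mul_assoc]
  rw [e2, Matrix.trace_mul_comm, ← Matrix.mul_assoc]

section Exponential

open NormedSpace

attribute [local instance] Matrix.linftyOpNormedRing Matrix.linftyOpNormedAlgebra

lemma hasDerivM_exp (X : BlockMat n) : HasDerivM (fun t : ℝ => exp (t • X)) X := fun i j => by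
  have h := hasDerivAt_exp_smul_const (𝕂 := ℝ) X (0 : ℝ)
  rw [zero_smul, exp_zero, one_mul] at h
  exact (LinearMap.toContinuousLinearMap
    (Matrix.entryLinearMap ℝ ℂ i j)).hasFDerivAt.comp_hasDerivAt (0 : ℝ) h

end Exponential

/-- The functions `Φ_ν` are in involution on `G`. -/
theorem hasPoissonBracket_Phi (hn : 0 < n) {ν μ : ℕ} (hν : 1 ≤ ν) (hμ : 1 ≤ μ) (g : BlockMat n) :
    HasPoissonBracket (Phi ν) (Phi μ) g 0 := by
  have hl (ν : ℕ) := lieGrad_mem_lieK hn (isInnHermitian_left g) ν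
  have hr (ν : ℕ) := lieGrad_mem_lieK hn (isInnHermitian_right g) ν
  have hzero : (0 : BlockMat n) ∈ lieB n := ⟨by simp, fun i j _ => rfl, fun i => by simp⟩
  have R {κ : BlockMat n} (h : κ ∈ lieK n) : IsRImage κ κ := ⟨κ, h, 0, hzero, by simp, by simp⟩
  have dl {ν : ℕ} (hν : 1 ≤ ν) :
      IsLeftDerivative (Phi ν) g (lieGrad ν (g * Inn n * gᴴ * Inn n)) := by
    refine ⟨(hl ν).1, fun X hX => ?_⟩
    have h := (hasDerivM_exp X).mul (HasDerivM.const g)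
    rw [Matrix.mul_zero, add_zero] at h
    have h' := HasDerivM.phi_left (γ := fun t : ℝ => NormedSpace.exp (t • X) * g) (X := X)
      (by simpa using h) hν hX
    simpa using h'
  have dr {ν : ℕ} (hν : 1 ≤ ν) :
      IsRightDerivative (Phi ν) g (lieGrad ν (Inn n * gᴴ * Inn n * g)) := by
    refine ⟨(hr ν).1, fun X hX => ?_⟩
    have h := (hasDerivM_exp X).const_mul g
    have h' := HasDerivM.phi_right (γ := fun t : ℝ => g * NormedSpace.exp (t • X)) (X := X)
      (by simpa using h) hν hX
    simpa using h'
  exact ⟨_, _, _, _, _, _, dl hν, dr hν, dl hμ, dr hμ, R (hl μ), R (hr μ), by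
    rw [pairing_lieGrad_lieGrad hn (isInnHermitian_left g),
      pairing_lieGrad_lieGrad hn (isInnHermitian_right g), add_zero]⟩

end InvolutionOnG
end HeisenbergDouble

namespace HeisenbergDouble
-- The flows of the Φ_a as tangent vectors to the constraint surface.
section Flows

open Filter Topology

variable {n : ℕ} {σ om ν : Mat n} {α x y : ℝ} {v : Fin n → ℂ} {S p : RVec n}
  {kL kR : BlockMat n} {ρ τ k l r m : Mat n}

lemma isOpen_chamber : IsOpen (chamber n α) := by
  simp only [chamber, Set.ofPred_forall]
  refine isOpen_iInter_of_finite fun i => isOpen_iInter_of_finite fun j =>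
    isOpen_iInter_of_finite fun _ => ?_
  exact isOpen_lt continuous_const ((continuous_apply i).sub (continuous_apply j))

/-- Powers of hM and of Mh are conjugate by h. This relates left and right derivatives, and the
derivatives at g, b_L and b_R. -/
lemma lieGrad_conj {h : BlockMat n} (hh : IsUnit h.det) (M : BlockMat n) (a : ℕ) :
    h⁻¹ * lieGrad a (h * M) * h = lieGrad a (M * h) := by
  have e (j : ℕ) : h⁻¹ * (h * M) ^ j * h = (M * h) ^ j := by
    induction j with
    | zero => simp [Matrix.nonsing_inv_mul _ hh]
    | succ j ih =>
      rw [pow_succ, pow_succ, ← ih]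
      simp only [Matrix.mul_assoc]
  rw [lieGrad, lieGrad, trace_pow_mul_comm h M, Matrix.mul_smul, Matrix.smul_mul, Matrix.mul_sub,
    Matrix.sub_mul, e, Matrix.mul_smul, Matrix.smul_mul, Matrix.mul_one, Matrix.nonsing_inv_mul _ hh]

/-- The flow of `Φ_a` is tangent to the constraint surface, with constant `b_L` and `b_R`. -/
lemma isTangent_flow (hn : 0 < n) (hy : y ≠ 0) (hσ : σ.det = 1) {a : ℕ}
    (h : constrainedBL y σ ν * kR = kL * constrainedBR x om)
    (hR : kRᴴ * Inn n * kR = Inn n) {κ : BlockMat n}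
    (hκ : κ = lieGrad a (kL * constrainedBR x om * Inn n * (kL * constrainedBR x om)ᴴ * Inn n)) :
    IsTangent σ x y kL kR om ν (κ * kL)
      ((constrainedBL y σ ν)⁻¹ * κ * constrainedBL y σ ν * kR) 0 0 := by
  have hu : IsUnit (constrainedBL y σ ν).det := by rw [det_constrainedBL hy hσ]; exact isUnit_one
  have tan {κ k : BlockMat n} (hκ : κ ∈ lieK n) :
      (κ * k)ᴴ * Inn n * k + kᴴ * Inn n * (κ * k) = 0 := by
    have : (κ * k)ᴴ * Inn n * k + kᴴ * Inn n * (κ * k) = kᴴ * (κᴴ * Inn n + Inn n * κ) * k := by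
      simp only [Matrix.conjTranspose_mul, Matrix.mul_add, Matrix.add_mul, Matrix.mul_assoc]
    rw [this, hκ.2, Matrix.mul_zero, Matrix.zero_mul]
  have hκ' : (constrainedBL y σ ν)⁻¹ * κ * constrainedBL y σ ν =
      lieGrad a (Inn n * (constrainedBL y σ ν)ᴴ * Inn n * constrainedBL y σ ν) := by
    rw [← lieGrad_conj hu, hκ, ← h]
    congr 3
    have : constrainedBL y σ ν * kR * Inn n * (constrainedBL y σ ν * kR)ᴴ * Inn n =
        constrainedBL y σ ν * (kR * Inn n * kRᴴ) * (constrainedBL y σ ν)ᴴ * Inn n := by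
      simp only [Matrix.conjTranspose_mul, Matrix.mul_assoc]
    rw [this, mul_Inn_of_preserves hR]
    simp only [Matrix.mul_assoc]
  refine ⟨tan ?_, ?_, ?_⟩
  · rw [hκ]; exact lieGrad_mem_lieK hn (isInnHermitian_left _) a
  · rw [hκ']
    exact tan (lieGrad_mem_lieK hn (isInnHermitian_right _) a)
  · have e : (Matrix.fromBlocks 0 0 0 0 : BlockMat n) = 0 := Matrix.fromBlocks_zero
    rw [smul_zero, e, Matrix.zero_mul, Matrix.mul_zero, zero_add, add_zero, Matrix.mul_assoc,
      Matrix.mul_assoc, ← Matrix.mul_assoc, Matrix.mul_nonsing_inv _ hu, Matrix.one_mul, h,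
      Matrix.mul_assoc]

/-- A tangent vector decomposed in the gauge in which `ρ† v` stays real. -/
lemma exists_gauged_vel (hα : α ≠ 0) (hα1 : α ^ 2 ≠ 1) (hS : S ∈ allChambers n α)
    (N : IsNormal σ α x y v S p kL kR om ν ρ τ k l r m) {vkL vkR : BlockMat n} {vom vν : Mat n}
    (t : IsTangent σ x y kL kR om ν vkL vkR vom vν) :
    ∃ (ξ χ η θ ζ μ : Mat n) (D Y : RVec n), vkL = kakVel ρ τ k l (coshL S) S D ξ χ η θ ∧
      vkR = kakVel r τ k m (coshR x y S) (fun i => x / y * S i) D ζ χ η μ ∧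
      IsFrameVel σ x y S (coshL S) (coshR x y S) ρ τ k l r m om ν D ξ χ η θ ζ μ vom vν ∧
      HasPhaseVel p (cauchyT α S) θ μ Y := by
  have F := N.frame
  have hsq : ∀ i j, i ≠ j → S i ^ 2 ≠ S j ^ 2 := fun i j h => allChambers_sq_ne hα hS h
  obtain ⟨χ₀, η₀, D, hχ₀, hη₀, hZ⟩ :=
    exists_skew_decomposition F.S_ne hsq (τᴴ * vkL.toBlocks₂₁ * kᴴ)
  have h21 : vkL.toBlocks₂₁ = τ * (χ₀ * dg S + dg (fun i => S i * D i) + dg S * η₀) * k := by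
    rw [← hZ]
    simp only [Matrix.mul_assoc, unitary_cancel' F.τ_u, F.k_u, Matrix.mul_one]
  rw [N.kL_eq, N.kR_eq] at t
  have pL := kak_preserves F.Γ_sq F.ρ_u F.τ_u F.k_u F.l_u
  have pR := kak_preserves F.C_sq F.r_u F.τ_u F.k_u F.m_u
  obtain ⟨ξ₀, θ₀, ζ₀, μ₀, e₀, -, -⟩ := exists_isFrameVel F pL pR F.constraint t hχ₀ hη₀ h21
  have hv (i : Fin n) : vHat α S i ≠ 0 :=
    div_ne_zero (Real.sqrt_pos.2 (wSq_pos hα hα1 hS i)).ne' (hS.1 i)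
  -- The velocities of τ and k can be changed by ±i times a real diagonal matrix without changing
  -- the tangent vector; this adds i f to ξ. The choice of f makes the imaginary part of ξ
  -- annihilate the vector ρ†v.
  set f : RVec n := fun i => -(imM ξ₀ *ᵥ vHat α S) i / vHat α S i with hf
  have hif : (Complex.I • dg f)ᴴ = -(Complex.I • dg f) := by
    rw [Matrix.conjTranspose_smul, dg_conjTranspose]; simp
  have comm (g : RVec n) : (Complex.I • dg f) * dg g = dg g * (Complex.I • dg f) := by
    rw [Matrix.smul_mul, Matrix.mul_smul, dg_mul_dg, dg_mul_dg]
    simp only [mul_comm]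
  obtain ⟨ξ, θ, ζ, μ, e1, e2, V⟩ := exists_isFrameVel (χ := χ₀ + Complex.I • dg f)
    (η := η₀ - Complex.I • dg f) F pL pR F.constraint t
    (by rw [Matrix.conjTranspose_add, hχ₀, hif, neg_add])
    (by rw [Matrix.conjTranspose_sub, hη₀, hif, neg_sub_neg, neg_sub])
    (by rw [h21, Matrix.add_mul, Matrix.mul_sub, comm]; congr 2; abel)
  have hξ : ξ = ξ₀ + Complex.I • dg f := by
    have h := e1.symm.trans e₀
    rw [kakVel, kakVel, Matrix.fromBlocks_inj] at h
    have h1 := left_injective_of_unitary F.ρ_u (right_injective_of_unitary F.k_u h.1)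
    refine dg_right_injective (fun i => (F.Γ_pos i).ne') ?_
    rw [Matrix.mul_sub, ← comm] at h1
    rw [Matrix.add_mul, ← sub_eq_zero]
    rw [← sub_eq_zero] at h1
    rw [← h1]
    abel
  have hnull : imM ξ *ᵥ vHat α S = 0 := by
    have e : imM (Complex.I • dg f) = Matrix.diagonal f := by
      ext i j
      by_cases h : i = j
      · subst h; simp [imM]
      · simp [imM, h]
    rw [hξ, imM_add, e, Matrix.add_mulVec]
    funext i
    rw [Pi.add_apply, Matrix.mulVec_diagonal, hf, Pi.zero_apply]
    have := hv i
    field_simp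
    ring
  obtain ⟨Y, P⟩ := V.exists_phaseVel F (cauchyT_orthogonal hα hα1 hS) N.T_eq hsq
    (cauchyT_rank hα hα1 hS) hnull
  exact ⟨_, _, _, _, _, _, D, Y, e1, e2, V, P⟩

end Flows
end HeisenbergDouble

namespace HeisenbergDouble
-- The reduced functions and their Poisson brackets.
section ReducedHamiltonians

open Filter Topology

variable {n : ℕ} {σ : Mat n} {α x y : ℝ} {v : Fin n → ℂ}

/-- The formula for `Φ_1` in the coordinates. -/
theorem phi_one_of_hasCoordinates (hα : α ≠ 0) (hα1 : α ^ 2 ≠ 1) (hx : 0 < x) (hy : 0 < y)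
    (hσ : IsKKS α v σ) {g : BlockMat n} (hg : g ∈ constraintSurface σ x y) {Δ p : RVec n}
    (h : HasCoordinates x y g Δ p) (h0 : ∀ i, Δ i ≠ 0) (hd : ∀ i j, i ≠ j → |Δ i| ≠ |Δ j|) :
    Phi 1 g = hamS α x y (fun i => Real.sinh (Δ i)) p := by
  obtain ⟨bL, kL, bR, kR, hc, rfl⟩ := hg
  obtain ⟨ρ, τ, k, l, r, m, om, ν, F, rfl, -, -, rfl, hp⟩ := exists_frame_of_hasCoordinates hx hy hc
    (fun i => by rw [Ne, Real.sinh_eq_zero]; exact h0 i) h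
  refine F.phi_one hα hα1 (fun i j hij e => hd i j hij ?_) hσ hp
  rw [sq_eq_sq_iff_abs_eq_abs, Real.abs_sinh, Real.abs_sinh] at e
  exact Real.sinh_injective e

section Smooth

variable {E : Type*} [NormedAddCommGroup E] [NormedSpace ℝ E] {s : Set E} {M N : E → BlockMat n}

lemma SmoothMatOn.mul (hM : SmoothMatOn M s) (hN : SmoothMatOn N s) :
    SmoothMatOn (fun z => M z * N z) s := fun i j => by
  simp only [Matrix.mul_apply]
  exact ContDiffOn.sum fun k _ => (hM i k).mul (hN k j)

lemma SmoothMatOn.const (A : BlockMat n) : SmoothMatOn (fun _ : E => A) s :=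
  fun _ _ => contDiffOn_const

lemma SmoothMatOn.pow (hM : SmoothMatOn M s) (a : ℕ) : SmoothMatOn (fun z => M z ^ a) s := by
  induction a with
  | zero => simpa only [pow_zero] using SmoothMatOn.const 1
  | succ a ih => simpa only [pow_succ] using ih.mul hM

lemma SmoothMatOn.phi (hM : SmoothMatOn M s) (a : ℕ) : ContDiffOn ℝ ∞ (fun z => Phi a (M z)) s := by
  have h := (((hM.mul (SmoothMatOn.const (Inn n))).mul
    (N := fun z => (M z)ᴴ) fun i j => contDiffOn_star (hM j i)).mul (SmoothMatOn.const (Inn n))).pow a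
  refine Complex.reCLM.contDiff.comp_contDiffOn (contDiffOn_const.mul ?_)
  simp only [Matrix.trace, Matrix.diag_apply]
  exact ContDiffOn.sum fun i _ => h i i

lemma SmoothMatOn.exists_hasDerivM (hM : SmoothMatOn M s) {z : E} (hs : s ∈ 𝓝 z) (e : E) :
    ∃ M', HasDerivM (fun t : ℝ => M (z + t • e)) M' := by
  refine HeisenbergDouble.exists_hasDerivM fun i j => ?_
  have h1 : DifferentiableAt ℝ (fun w => M w i j) (z + (0 : ℝ) • e) := by
    rw [zero_smul, add_zero]
    exact ((hM i j).contDiffAt hs).differentiableAt (by simp)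
  have h2 : DifferentiableAt ℝ (fun t : ℝ => z + t • e) 0 := by fun_prop
  exact DifferentiableAt.comp (0 : ℝ) h1 h2

end Smooth

lemma pairing_comm (X Y : BlockMat n) : pairing X Y = pairing Y X := by
  rw [pairing, pairing, Matrix.trace_mul_comm]

lemma leafHalf_zero {S Γ C : RVec n} {ρ τ k m : Mat n} {D' : RVec n} {χ' η' θ' ζ' : Mat n} :
    leafHalf x y S Γ C ρ τ k m 0 0 D' χ' η' θ' ζ' = 0 := by
  simp [leafHalf]

/-- Invariance under K on both sides, applied to the two factorizations of g. That b_R and b_L both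
give Φ_a is essential for the factor 2 in the contraction with the form. -/
lemma phi_constrained {bL kL bR kR : BlockMat n} (h : IsConstrained σ x y bL kL bR kR) (a : ℕ) :
    Phi a (kL * bR) = Phi a bR ∧ Phi a bR = Phi a bL := by
  have h1 := Phi_mul_left h.kL_mem.2 a bR
  exact ⟨h1, by rw [← h1, ← h.eq, Phi_mul_right h.kR_mem.2]⟩

/-- The derivative of `Φ_a` is the contraction of the reduced form with the flow of `Φ_a`. -/
lemma hasDerivAt_phi_section (hα : α ≠ 0) (hα1 : α ^ 2 ≠ 1) (hx : 0 < x) (hy : 0 < y)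
    (hσ : IsKKS α v σ) {bL kL bR kR : RVec n × RVec n → BlockMat n}
    (sbL : SmoothMatOn bL (chamber n α ×ˢ Set.univ)) (skL : SmoothMatOn kL (chamber n α ×ˢ Set.univ))
    (sbR : SmoothMatOn bR (chamber n α ×ˢ Set.univ)) (skR : SmoothMatOn kR (chamber n α ×ˢ Set.univ))
    (hsec : ∀ q ∈ chamber n α, ∀ p : RVec n,
      IsConstrained σ x y (bL (q, p)) (kL (q, p)) (bR (q, p)) (kR (q, p)) ∧
      HasCoordinates x y (kL (q, p) * bR (q, p)) (deltaOf q) p)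
    {z : RVec n × RVec n} (hz : z.1 ∈ chamber n α) {om ν ρ τ k l r m : Mat n}
    (hL0 : bL z = constrainedBL y σ ν) (hR0 : bR z = constrainedBR x om)
    (N : IsNormal σ α x y v (fun i => Real.sinh (deltaOf z.1 i)) z.2 (kL z) (kR z) om ν ρ τ k l r m)
    {a : ℕ} (ha : 1 ≤ a) {ξ χ η θ ζ μ : Mat n} {D Y : RVec n}
    (e1 : lieGrad a (kL z * constrainedBR x om * Inn n * (kL z * constrainedBR x om)ᴴ * Inn n) * kL z =
      kakVel ρ τ k l (coshL fun i => Real.sinh (deltaOf z.1 i)) (fun i => Real.sinh (deltaOf z.1 i)) D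
        ξ χ η θ)
    (e2 : (constrainedBL y σ ν)⁻¹ *
      lieGrad a (kL z * constrainedBR x om * Inn n * (kL z * constrainedBR x om)ᴴ * Inn n) *
        constrainedBL y σ ν * kR z =
      kakVel r τ k m (coshR x y fun i => Real.sinh (deltaOf z.1 i))
        (fun i => x / y * Real.sinh (deltaOf z.1 i)) D ζ χ η μ)
    (V : IsFrameVel σ x y (fun i => Real.sinh (deltaOf z.1 i))
      (coshL fun i => Real.sinh (deltaOf z.1 i)) (coshR x y fun i => Real.sinh (deltaOf z.1 i))
      ρ τ k l r m om ν D ξ χ η θ ζ μ 0 0)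
    (P : HasPhaseVel z.2 (cauchyT α fun i => Real.sinh (deltaOf z.1 i)) θ μ Y)
    (w : RVec n × RVec n) :
    HasDerivAt (fun t : ℝ => Phi a (bR (z + t • w))) (∑ i, (w.2 i * D i - Y i * w.1 i)) 0 := by
  have hD : chamber n α ×ˢ Set.univ ∈ 𝓝 z :=
    (isOpen_chamber.prod isOpen_univ).mem_nhds ⟨hz, Set.mem_univ _⟩
  have hline : Tendsto (fun t : ℝ => z + t • w) (𝓝 0) (𝓝 z) := by
    have : ContinuousAt (fun t : ℝ => z + t • w) 0 := by fun_prop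
    simpa [ContinuousAt] using this
  have hev := hline.eventually hD
  obtain ⟨vbL, dbL⟩ := sbL.exists_hasDerivM hD w
  obtain ⟨vkL, dkL⟩ := skL.exists_hasDerivM hD w
  obtain ⟨vbR, dbR⟩ := sbR.exists_hasDerivM hD w
  obtain ⟨vkR, dkR⟩ := skR.exists_hasDerivM hD w
  have z0 : z + (0 : ℝ) • w = z := by rw [zero_smul, add_zero]
  have hS (i : Fin n) : HasDerivAt (fun t : ℝ => Real.sinh (deltaOf (z + t • w).1 i))
      (Real.sinh (deltaOf (z + (0 : ℝ) • w).1 i) * w.1 i) 0 := by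
    simp only [deltaOf, Real.sinh_arsinh]
    have h : HasDerivAt (fun t : ℝ => (z + t • w).1 i) (w.1 i) 0 := by
      simpa using ((hasDerivAt_id (0 : ℝ)).mul_const (w.1 i)).const_add (z.1 i)
    exact h.exp
  have hp (i : Fin n) : HasDerivAt (fun t : ℝ => (z + t • w).2 i) (w.2 i) 0 := by
    simpa using ((hasDerivAt_id (0 : ℝ)).mul_const (w.2 i)).const_add (z.2 i)
  have hcon : ∀ᶠ t : ℝ in 𝓝 0, IsConstrained σ x y (bL (z + t • w)) (kL (z + t • w))
      (bR (z + t • w)) (kR (z + t • w)) := hev.mono fun t ht => (hsec _ ht.1 (z + t • w).2).1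
  obtain ⟨ξ', χ', η', θ', ζ', μ', vom, vν, d1, d2, d3, d4, V', P'⟩ :=
    exists_vel_of_constrained (Δ := fun t => deltaOf (z + t • w).1) (p := fun t => (z + t • w).2)
      hα hα1 hx hy hσ dbL dkL dbR dkR (hev.mono fun t ht => ⟨(hsec _ ht.1 (z + t • w).2).1, by
        rw [sinh_deltaOf]; exact exp_mem_allChambers ht.1, (hsec _ ht.1 (z + t • w).2).2⟩) hS hp
      (by rw [z0]; exact hL0) (by rw [z0]; exact hR0) (by simp only [z0]; exact N)
  simp only [z0] at V' P'
  have hc := (hsec _ hz z.2).1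
  simp only [Prod.mk.eta] at hc
  have hbL : IsUnit (bL z).det := by
    rw [hL0, det_constrainedBL hy.ne' hσ.2.1]; exact isUnit_one
  have hbR : IsUnit (bR z).det := by rw [hR0]; exact constrainedBR_det hx.ne'
  have tX (X : Mat n) : (Matrix.fromBlocks 0 X 0 0 : BlockMat n).trace = 0 := by
    simp [Matrix.trace, Fintype.sum_sum_type]
  have dR : HasDerivAt (fun t : ℝ => Phi a (bR (z + t • w)))
      (pairing (lieGrad a (Inn n * (bR z)ᴴ * Inn n * bR z)) ((bR z)⁻¹ * vbR)) 0 := by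
    have := HasDerivM.phi_right (γ := fun t : ℝ => bR (z + t • w)) (X := (bR z)⁻¹ * vbR)
      (by rw [z0, Matrix.mul_nonsing_inv_cancel_left _ _ hbR]; exact dbR) ha
      (by rw [d2, hR0, constrainedBR_inv hx.ne', tX])
    simpa only [z0] using this
  -- The two halves of the leaf form, evaluated on the flow, are the derivatives of Φ_a through b_L
  -- and through b_R. They agree, and their sum cancels the factor 2 of the canonical form.
  have dL : HasDerivAt (fun t : ℝ => Phi a (bR (z + t • w)))
      (pairing (lieGrad a (bL z * Inn n * (bL z)ᴴ * Inn n)) (vbL * (bL z)⁻¹)) 0 := by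
    have := HasDerivM.phi_left (γ := fun t : ℝ => bL (z + t • w)) (X := vbL * (bL z)⁻¹)
      (by rw [z0, Matrix.nonsing_inv_mul_cancel_right _ _ hbL]; exact dbL) ha
      (by rw [d1, hL0, constrainedBL_inv hy.ne' hσ.2.1, tX])
    refine HasDerivAt.congr_of_eventuallyEq ?_ (hcon.mono fun t ht => (phi_constrained ht a).2)
    simpa only [z0] using this
  refine dR.congr_deriv ?_
  have hform := leafHalf_canonical N.frame V V' (cauchyT_orthogonal hα hα1
    (by rw [sinh_deltaOf]; exact exp_mem_allChambers hz)) N.T_eq P P'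
  rw [leafHalf_zero, ← leafPairing_eq N.frame hσ.2.1, ← e1, ← e2, ← d1, ← d2, ← N.kL_eq, ← N.kR_eq,
    ← hL0, ← hR0, leafPairing] at hform
  have hkL : IsUnit (kL z).det := by rw [hc.kL_mem.1]; exact isUnit_one
  have hkR : IsUnit (kR z).det := by rw [hc.kR_mem.1]; exact isUnit_one
  have c1 : kL z * bR z * Inn n * (kL z * bR z)ᴴ * Inn n = bL z * Inn n * (bL z)ᴴ * Inn n := by
    have : bL z * kR z * Inn n * (bL z * kR z)ᴴ * Inn n =
        bL z * (kR z * Inn n * (kR z)ᴴ) * (bL z)ᴴ * Inn n := by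
      simp only [Matrix.conjTranspose_mul, Matrix.mul_assoc]
    rw [← hc.eq, this, mul_Inn_of_preserves hc.kR_mem.2]
  have c2 : (kR z)⁻¹ * ((bL z)⁻¹ * lieGrad a (kL z * bR z * Inn n * (kL z * bR z)ᴴ * Inn n) * bL z *
      kR z) = lieGrad a (Inn n * (bR z)ᴴ * Inn n * bR z) := by
    have hu : IsUnit (kL z * bR z).det := by rw [Matrix.det_mul]; exact hkL.mul hbR
    have h1 := lieGrad_conj hu (Inn n * (kL z * bR z)ᴴ * Inn n) a
    have h2 : Inn n * (kL z * bR z)ᴴ * Inn n * (kL z * bR z) =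
        Inn n * (bR z)ᴴ * ((kL z)ᴴ * Inn n * kL z) * bR z := by
      simp only [Matrix.conjTranspose_mul, Matrix.mul_assoc]
    rw [h2, hc.kL_mem.2] at h1
    rw [← h1, ← hc.eq, Matrix.mul_inv_rev]
    simp only [Matrix.mul_assoc]
  rw [c2, c1, Matrix.mul_nonsing_inv_cancel_right _ _ hkL,
    pairing_comm ((bR z)⁻¹ * vbR), pairing_comm (vbL * (bL z)⁻¹), dL.unique dR] at hform
  have : ∑ i, (w.2 i * D i - Y i * w.1 i) = -∑ i, (Y i * w.1 i - w.2 i * D i) := by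
    rw [← Finset.sum_neg_distrib]; simp only [neg_sub]
  rw [this]
  simp only [Complex.zero_im] at hform
  linarith

/-- The functions `Φ_a` commute for the reduced Poisson bracket. -/
theorem reducedBracket_phi_section (hn : 0 < n) (hα : α ≠ 0) (hα1 : α ^ 2 ≠ 1) (hx : 0 < x) (hy : 0 < y)
    (hσ : IsKKS α v σ) {bL kL bR kR : RVec n × RVec n → BlockMat n}
    (sbL : SmoothMatOn bL (chamber n α ×ˢ Set.univ)) (skL : SmoothMatOn kL (chamber n α ×ˢ Set.univ))
    (sbR : SmoothMatOn bR (chamber n α ×ˢ Set.univ)) (skR : SmoothMatOn kR (chamber n α ×ˢ Set.univ))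
    (hsec : ∀ q ∈ chamber n α, ∀ p : RVec n,
      IsConstrained σ x y (bL (q, p)) (kL (q, p)) (bR (q, p)) (kR (q, p)) ∧
      HasCoordinates x y (kL (q, p) * bR (q, p)) (deltaOf q) p)
    {a b : ℕ} (ha : 1 ≤ a) (hb : 1 ≤ b) {z : RVec n × RVec n} (hz : z.1 ∈ chamber n α) :
    reducedBracket (fun w => Phi a (bR w)) (fun w => Phi b (bR w)) z = 0 := by
  have hD : chamber n α ×ˢ Set.univ ∈ 𝓝 z :=
    (isOpen_chamber.prod isOpen_univ).mem_nhds ⟨hz, Set.mem_univ _⟩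
  have hS : (fun i => Real.sinh (deltaOf z.1 i)) ∈ allChambers n α := by
    rw [sinh_deltaOf]; exact exp_mem_allChambers hz
  have hc := hsec _ hz z.2
  simp only [Prod.mk.eta] at hc
  obtain ⟨om, ν, ρ, τ, k, l, r, m, hL0, hR0, N⟩ := exists_isNormal hα hα1 hx hy hσ hc.1 hS hc.2
  have hcon := hc.1.eq
  rw [hL0, hR0] at hcon
  have t (a : ℕ) := isTangent_flow (a := a) hn hy.ne' hσ.2.1 hcon hc.1.kR_mem.2 rfl
  obtain ⟨ξ, χ, η, θ, ζ, μ, D, Y, e1, e2, V, P⟩ := exists_gauged_vel hα hα1 hS N (t a)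
  obtain ⟨ξ', χ', η', θ', ζ', μ', D', Y', e1', e2', V', P'⟩ := exists_gauged_vel hα hα1 hS N (t b)
  -- Both flows leave b_L and b_R constant, so the leaf form vanishes on them. In coordinates this
  -- value is the Poisson bracket, up to a constant factor.
  have hform := leafHalf_canonical N.frame V V' (cauchyT_orthogonal hα hα1 hS) N.T_eq P P'
  rw [leafHalf_zero, leafHalf_zero, sub_self] at hform
  have fd {a : ℕ} {D Y : RVec n} (h : ∀ w : RVec n × RVec n, HasDerivAt
      (fun t : ℝ => Phi a (bR (z + t • w))) (∑ i, (w.2 i * D i - Y i * w.1 i)) 0)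
      (w : RVec n × RVec n) :
      fderiv ℝ (fun w => Phi a (bR w)) z w = ∑ i, (w.2 i * D i - Y i * w.1 i) := by
    rw [← (((sbR.phi a).contDiffAt hD).differentiableAt (by simp)).lineDeriv_eq_fderiv, lineDeriv]
    exact (h w).deriv
  have fa := fd (hasDerivAt_phi_section hα hα1 hx hy hσ sbL skL sbR skR hsec hz hL0 hR0 N ha e1 e2 V P)
  have fb := fd
    (hasDerivAt_phi_section hα hα1 hx hy hσ sbL skL sbR skR hsec hz hL0 hR0 N hb e1' e2' V' P')
  have q1 (Y : RVec n) (i : Fin n) : ∑ j, Y j * (Pi.single i (1 : ℝ) : RVec n) j = Y i := by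
    simp [Pi.single_apply]
  have q2 (Y : RVec n) (i : Fin n) : ∑ j, (Pi.single i (1 : ℝ) : RVec n) j * Y j = Y i := by
    simp [Pi.single_apply]
  simp only [reducedBracket, fa, fb, Pi.zero_apply, zero_mul, mul_zero, zero_sub, sub_zero,
    Finset.sum_neg_distrib, q1, q2]
  have : ∑ i, (-Y i * D' i - D i * -Y' i) = -∑ i, (Y i * D' i - Y' i * D i) := by
    rw [← Finset.sum_neg_distrib]
    exact Finset.sum_congr rfl fun i _ => by ring
  rw [this]
  linarith

/-- The functions `Φ_a` descend to smooth commuting functions on the reduced space. -/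
theorem exists_reduced_hamiltonians (hn : 0 < n) (hα : α ≠ 0) (hα1 : α ^ 2 ≠ 1) (hx : 0 < x)
    (hy : 0 < y) (hσ : IsKKS α v σ)
    (e : ReducedSpace σ α x y ≃ chamber n α × (Fin n → Real.Angle))
    (he : ∀ (g : regularSurface σ α x y) (q : chamber n α) (p : RVec n),
      e (toReduced g) = (q, fun i => (p i : Real.Angle)) ↔
        HasCoordinates x y (g : BlockMat n) (deltaOf (q : RVec n)) p) :
    ∃ φ : ℕ → ReducedSpace σ α x y → ℝ,
      (∀ ν : ℕ, 1 ≤ ν → ∀ g : regularSurface σ α x y,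
        φ ν (toReduced g) = Phi ν (g : BlockMat n)) ∧
      (∀ ν : ℕ, 1 ≤ ν →
        ContDiffOn ℝ ∞ (inCoordinates e (φ ν)) (chamber n α ×ˢ Set.univ)) ∧
      (∀ ν μ : ℕ, 1 ≤ ν → 1 ≤ μ → ∀ z ∈ chamber n α ×ˢ Set.univ,
        reducedBracket (inCoordinates e (φ ν)) (inCoordinates e (φ μ)) z = 0) ∧
      ∀ q ∈ chamber n α, ∀ p : RVec n,
        inCoordinates e (φ 1) (q, p) = hamQ α x y q p ∧
        hamS α x y (fun i => Real.exp (q i)) p = hamQ α x y q p := by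
  obtain ⟨bL, kL, bR, kR, sbL, skL, sbR, skR, hsec⟩ :=
    exists_section (x := x) (y := y) hn hα hα1 hx hy hσ
  let φ : ℕ → ReducedSpace σ α x y → ℝ := fun ν =>
    Quotient.lift (fun g => Phi ν (g : BlockMat n)) (by
      rintro g g' ⟨a, ⟨a₁, h₁, a₂, h₂, h₃, h₄, -⟩, b, hb, h⟩
      rw [h, Phi_mul_right (preserves_of_mem_groupKplus hb),
        Phi_mul_left (preserves_of_mem_groupKplus ⟨a₁, h₁, a₂, h₂, h₃, h₄⟩)])
  have hφ (ν : ℕ) (g : regularSurface σ α x y) : φ ν (toReduced g) = Phi ν (g : BlockMat n) := rfl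
  have hco (ν : ℕ) : ∀ z ∈ chamber n α ×ˢ Set.univ, inCoordinates e (φ ν) z = Phi ν (bR z) := by
    rintro ⟨q, p⟩ ⟨hq, -⟩
    obtain ⟨h1, h2⟩ := hsec q hq p
    have h3 := (he ⟨_, ⟨_, _, _, _, h1, rfl⟩, q, hq, p, h2⟩ ⟨q, hq⟩ p).2 h2
    have hq' : (q, p).1 ∈ chamber n α := hq
    rw [inCoordinates, dif_pos hq', ← h3, Equiv.symm_apply_apply, hφ]
    exact (phi_constrained h1 ν).1
  refine ⟨φ, fun ν _ g => hφ ν g, fun ν _ => (sbR.phi ν).congr (hco ν), fun ν μ hν hμ z hz => ?_,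
    fun q hq p => ⟨?_, hamS_exp hα hx hq p⟩⟩
  · have hD : chamber n α ×ˢ Set.univ ∈ 𝓝 z := (isOpen_chamber.prod isOpen_univ).mem_nhds hz
    -- The function in coordinates is given by the section only over the chamber, and by a default
    -- value elsewhere; the chamber is open, so derivatives are not affected.
    have hev (ν : ℕ) : fderiv ℝ (inCoordinates e (φ ν)) z = fderiv ℝ (fun w => Phi ν (bR w)) z :=
      Filter.EventuallyEq.fderiv_eq (Filter.eventually_of_mem hD (hco ν))
    rw [← reducedBracket_phi_section hn hα hα1 hx hy hσ sbL skL sbR skR hsec hν hμ hz.1]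
    simp only [reducedBracket, hev]
  · obtain ⟨h1, h2⟩ := hsec q hq p
    have hpos (i : Fin n) : 0 < deltaOf q i := Real.arsinh_pos_iff.2 (Real.exp_pos _)
    rw [hco 1 (q, p) ⟨hq, Set.mem_univ _⟩, ← (phi_constrained h1 1).1,
      phi_one_of_hasCoordinates hα hα1 hx hy hσ ⟨_, _, _, _, h1, rfl⟩ h2 (fun i => (hpos i).ne')
        fun i j hij h => ?_, sinh_deltaOf, ← hamS_exp hα hx hq p]
    rw [abs_of_pos (hpos i), abs_of_pos (hpos j)] at h
    exact hij ((chamber_strictAnti hq).injective (Real.exp_injective (Real.arsinh_injective h)))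

end ReducedHamiltonians
end HeisenbergDouble


/-! ### Assembly of the statements. -/

theorem mainTheorem2 (n : ℕ) (hn : 0 < n) (α x y : ℝ) (hα : α ≠ 0) (hα1 : α ^ 2 ≠ 1)
    (hx : 0 < x) (hy : 0 < y) (v : Fin n → ℂ) (σ : Mat n) (hσ : IsKKS α v σ) :
    -- the functions `Φ_ν` on `G` are real, `K₊`-invariant on both sides, and in involution
    (∀ ν : ℕ, 1 ≤ ν → ∀ g ∈ groupG n, (PhiC ν g).im = 0 ∧
      ∀ a ∈ groupKplus n, ∀ b ∈ groupKplus n, Phi ν (a * g * b) = Phi ν g) ∧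
    (∀ ν μ : ℕ, 1 ≤ ν → 1 ≤ μ → ∀ g ∈ groupG n, HasPoissonBracket (Phi ν) (Phi μ) g 0) ∧
    -- `(q, p)` are global coordinates on the reduced space
    (∃ e : ReducedSpace σ α x y ≃ chamber n α × (Fin n → Real.Angle),
      (∀ (g : regularSurface σ α x y) (q : chamber n α) (p : RVec n),
        e (toReduced g) = (q, fun i => (p i : Real.Angle)) ↔
          HasCoordinates x y (g : BlockMat n) (deltaOf (q : RVec n)) p) ∧
      (∃ bL kL bR kR : RVec n × RVec n → BlockMat n,
        SmoothMatOn bL (chamber n α ×ˢ Set.univ) ∧ SmoothMatOn kL (chamber n α ×ˢ Set.univ) ∧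
        SmoothMatOn bR (chamber n α ×ˢ Set.univ) ∧ SmoothMatOn kR (chamber n α ×ˢ Set.univ) ∧
        ∀ q ∈ chamber n α, ∀ p : RVec n,
          IsConstrained σ x y (bL (q, p)) (kL (q, p)) (bR (q, p)) (kR (q, p)) ∧
          HasCoordinates x y (kL (q, p) * bR (q, p)) (deltaOf q) p) ∧
      -- the `Φ_ν` descend to smooth commuting functions, and the first one is the Hamiltonian
      ∃ φ : ℕ → ReducedSpace σ α x y → ℝ,
        (∀ ν : ℕ, 1 ≤ ν → ∀ g : regularSurface σ α x y,
          φ ν (toReduced g) = Phi ν (g : BlockMat n)) ∧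
        (∀ ν : ℕ, 1 ≤ ν →
          ContDiffOn ℝ ∞ (inCoordinates e (φ ν)) (chamber n α ×ˢ Set.univ)) ∧
        (∀ ν μ : ℕ, 1 ≤ ν → 1 ≤ μ → ∀ z ∈ chamber n α ×ˢ Set.univ,
          reducedBracket (inCoordinates e (φ ν)) (inCoordinates e (φ μ)) z = 0) ∧
        ∀ q ∈ chamber n α, ∀ p : RVec n,
          inCoordinates e (φ 1) (q, p) = hamQ α x y q p ∧
          hamS α x y (fun i => Real.exp (q i)) p = hamQ α x y q p) ∧
    -- the coordinates are canonical: the symplectic form restricted to the constraint surface is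
    -- the pull-back of `2 ∑ dp_i ∧ S_i⁻¹ dS_i`, with `S = sinh Δ`, in each Weyl chamber
    (∀ (c d : ConstraintCurve σ x y) (Δ p Δ' p' : ℝ → RVec n),
      ContDiff ℝ ∞ Δ → ContDiff ℝ ∞ p → ContDiff ℝ ∞ Δ' → ContDiff ℝ ∞ p' →
      (∀ t, (fun i => Real.sinh (Δ t i)) ∈ allChambers n α ∧
        HasCoordinates x y (c.point t) (Δ t) (p t)) →
      (∀ t, (fun i => Real.sinh (Δ' t i)) ∈ allChambers n α ∧
        HasCoordinates x y (d.point t) (Δ' t) (p' t)) →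
      c.point 0 = d.point 0 → Δ 0 = Δ' 0 →
      leafForm c d = reducedForm (fun i => Real.sinh (Δ 0 i))
        (coordVelocity Δ p) (coordVelocity Δ' p')) ∧
    -- the formula for `Φ_1` in each Weyl chamber
    (∀ g ∈ constraintSurface σ x y, ∀ Δ p : RVec n, HasCoordinates x y g Δ p →
      (∀ i, Δ i ≠ 0) → (∀ i j, i ≠ j → |Δ i| ≠ |Δ j|) →
      Phi 1 g = hamS α x y (fun i => Real.sinh (Δ i)) p) ∧
    -- the action of the Weyl group of type `BC_n`: it lifts the action on `Δ`, it permutes the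
    -- Weyl chambers, it is symplectic, and it leaves the Hamiltonian invariant
    (∀ (s : Fin n → ℤˣ) (π : Equiv.Perm (Fin n)),
      (∀ (g : BlockMat n) (Δ p : RVec n), HasCoordinates x y g Δ p →
        HasCoordinates x y g (weylAct s π Δ) (p ∘ π)) ∧
      (∀ Δ : RVec n, (fun i => Real.sinh (weylAct s π Δ i)) =
        weylAct s π (fun i => Real.sinh (Δ i))) ∧
      (∀ S : RVec n, S ∈ allChambers n α → weylAct s π S ∈ allChambers n α) ∧
      (∀ S ∈ allChambers n α, ∀ u w : RVec n × RVec n,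
        reducedForm (weylAct s π S) (weylAct s π u.1, u.2 ∘ π) (weylAct s π w.1, w.2 ∘ π) =
          reducedForm S u w) ∧
      (∀ S ∈ allChambers n α, ∀ p : RVec n,
        hamS α x y (weylAct s π S) (p ∘ π) = hamS α x y S p)) ∧
    -- the three parameters are independent: for `n ≥ 2` the Hamiltonian determines them, up to
    -- the finite ambiguity `α ↦ ± α^(±1)`, `(x, y) ↦ (y⁻¹, x⁻¹)`
    (2 ≤ n → ∀ α' x' y' : ℝ, α' ≠ 0 → α' ^ 2 ≠ 1 → 0 < x' → 0 < y' →
      ((∀ q ∈ chamber n α ∩ chamber n α', ∀ p : RVec n,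
          hamQ α' x' y' q p = hamQ α x y q p) ↔
        (α' ^ 2 = α ^ 2 ∨ α' ^ 2 = (α ^ 2)⁻¹) ∧
        ((x' = x ∧ y' = y) ∨ (x' = y⁻¹ ∧ y' = x⁻¹)))) := by
  refine ⟨fun ν _ g _ => ⟨PhiC_im ν g, fun a ha b hb => ?_⟩,
    fun ν μ hν hμ g _ => hasPoissonBracket_Phi hn hν hμ g, ?_,
    fun c d Δ p Δ' p' hΔ hp hΔ' hp' hc hd h0 hΔ0 =>
      leafForm_eq_reducedForm hα hα1 hx hy hσ c d hΔ hp hΔ' hp' hc hd h0 hΔ0,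
    fun g hg Δ p h h0 hd => phi_one_of_hasCoordinates hα hα1 hx hy hσ hg h h0 hd,
    fun s π => ⟨fun g Δ p h => h.weylAct s π, fun Δ => funext fun i => sinh_weylAct s π Δ i,
      fun S hS => weylAct_mem_allChambers s π hS, fun S _ u w => reducedForm_weylAct s π S u w,
      fun S _ p => hamS_weylAct s π S p⟩,
    fun hn2 α' x' y' hα' _ hx' hy' => ⟨fun h => params_of_hamQ_eq hn2 hα hx hy hα' hx' hy' h,
      fun h q _ p => hamQ_congr hα hα' hx hy h.1 h.2 q p⟩⟩
  · rw [Phi_mul_right (preserves_of_mem_groupKplus hb),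
      Phi_mul_left (preserves_of_mem_groupKplus ha)]
  · obtain ⟨e, he⟩ := exists_coordinates (x := x) (y := y) hn hα hα1 hx hy hσ
    exact ⟨e, he, exists_section hn hα hα1 hx hy hσ,
      exists_reduced_hamiltonians hn hα hα1 hx hy hσ e he⟩
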